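/- Let $\mathcal S$ be a compact smooth manifold (without boundary) of dimension $d=n-1\ge 1$, let $R\in\mathbb R$, and let $(R,\infty)\times\mathcal S$ carry a smooth Riemannian metric of the form $$\mathbf G=\mathbf a\,dx^2+\frac{2\,\mathbf b_i\,dx\,d\theta_i}{w(x)}+\frac{\mathbf g_{ij}\,d\theta_i\,d\theta_j}{w(x)^2},$$ where $w:(R,\infty)\to(0,\infty)$ is smooth and, for each $x>R$, $\mathbf a(x,\cdot)$, $\mathbf b(x,\cdot)=(\mathbf b_i)$ and $\mathbf g(x,\cdot)=(\mathbf g_{ij})$ are a function, a $1$-form and a symmetric $2$-tensor on $\mathcal S$. Let $\overline{\mathbf g}$ be a smooth Riemannian metric on $\mathcal S$. For $m,M\in\mathbb R$ write $f\in S^m$ on $(M,\infty)$ (resp. on $(M,\infty)\times V$, $V\subset\mathbb R^{d}$ open) if $f$ is smooth and $\partial_x^j f=O(\langle x\rangle^{m-j})$ on $(M,\infty)$ for all $j$ (resp. $\partial_x^j\partial_\theta^\alpha f=O(\langle x\rangle^{m-j})$ on $(M,\infty)\times K$ for all $j,\alpha$ and all compact $K\subset V$), where $\langle x\rangle=(1+x^2)^{1/2}$.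 A function or tensor on $(M,\infty)\times\mathcal S$ is in $S^m$ if its components in every chart of an atlas of $\mathcal S$ are. Assume that for some $\lambda,\varepsilon,\tau>0$ and real $\mu,\nu$, $$w\in S^{-\lambda},\quad (w'/w)'\in S^{-1-\varepsilon}\quad\text{on }(R,\infty),\qquad \mathbf a-1\in S^{-\mu},\quad \mathbf b\in S^{-\nu},\quad \mathbf g-\overline{\mathbf g}\in S^{-\tau}\quad\text{on }(R,\infty)\times\mathcal S,$$ $$\mu\ge 1+\tau,\qquad \nu\ge\tfrac{1+\tau}{2},\qquad \lambda\ge\tfrac{1+\tau}{2}.$$ Then the limit $\kappa=\lim_{x\to\infty}w'(x)/w(x)$ exists and $\kappa\le 0$. For $r>R$ let $\nu_r$ be the unit normal vector field to $\{r\}\times\mathcal S$ with $\langle dx,\nu_r\rangle>0$, and let $N_r(t,\omega)=\exp_{(r,\omega)}(t\nu_r)$, $t\ge 0$, be the outgoing normal geodesic flow. There is $r_0>R$ such that for all $r\ge r_0$: 1. $N_r(t,\omega)$ is defined for all $t\ge 0$ and $\omega\in\mathcal S$. 2. $N_r$ is a homeomorphism from $[0,\infty)\times\mathcal S$ onto $[r,\infty)\times\mathcal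 S$ and a smooth diffeomorphism from $(0,\infty)\times\mathcal S$ onto $(r,\infty)\times\mathcal S$. 3. There are a smooth diffeomorphism $\Omega_r:\mathcal S\to\mathcal S$ and a smooth function $\phi_r:\mathcal S\to\mathbb R$ such that, with $\overline{\mathbf h}:=e^{-2\kappa\phi_r}\,\Omega_r^*\overline{\mathbf g}$: on $(0,\infty)\times\mathcal S$ one has $N_r^*\mathbf G=dt^2+\mathbf k(t)$ with $(\mathbf k(t))_{t>0}$ a smooth family of Riemannian metrics on $\mathcal S$; and for $t>\max(R,0)$ (where $w(t)$ is defined) $\mathbf k(t)=w(t)^{-2}\,\mathbf h(t)$, i.e. $N_r^*\mathbf G=dt^2+w(t)^{-2}\mathbf h(t)$, with $(\mathbf h(t))$ a smooth family of Riemannian metrics on $\mathcal S$ satisfying $$\mathbf h(t)-\overline{\mathbf h}\in S^{-\min(\tau,\varepsilon)}\quad\text{on }(\max(R,0),\infty)\times\mathcal S.$$ -/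

import Mathlib

open Set Filter Topology
open scoped Manifold ContDiff

noncomputable section

namespace RadialEnd

/-! ### Symbol classes -/

/-- The Japanese bracket `⟨x⟩ = (1 + x²)^{1/2}`. -/
def bracket (x : ℝ) : ℝ := Real.sqrt (1 + x ^ 2)

/-- `f ∈ S^m(M, ∞)`: `f` is smooth on `(M, ∞)` and `∂ₓʲ f = O(⟨x⟩^{m-j})` there, for all `j`. -/
def IsSymbolOnLine (m M : ℝ) (f : ℝ → ℝ) : Prop :=
  ContDiffOn ℝ ∞ f (Ioi M) ∧
    ∀ j : ℕ, ∃ C : ℝ, ∀ x, M < x → |iteratedDeriv j f x| ≤ C * bracket x ^ (m - j)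

/-- `f ∈ S^m((M, ∞) × V)` for an open set `V` of a Euclidean space: `f` is smooth and, for all
compact `K ⊆ V` and all `j, k`, the derivatives of order `j` in `x` and order `k` in `θ` are
`O(⟨x⟩^{m-j})` on `(M, ∞) × K`.  The partial derivatives of order `k` in `θ` are collected in the
`k`-linear map `iteratedFDeriv ℝ k (f x) θ`. -/
def IsSymbolOn {E F : Type*} [NormedAddCommGroup E] [NormedSpace ℝ E]
    [NormedAddCommGroup F] [NormedSpace ℝ F] (m M : ℝ) (V : Set E) (f : ℝ → E → F) : Prop :=
  ContDiffOn ℝ ∞ (fun p : ℝ × E => f p.1 p.2) (Ioi M ×ˢ V) ∧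
    ∀ K : Set E, IsCompact K → K ⊆ V → ∀ j k : ℕ, ∃ C : ℝ, ∀ x, M < x → ∀ θ ∈ K,
      ‖iteratedDeriv j (fun s => iteratedFDeriv ℝ k (f s) θ) x‖ ≤ C * bracket x ^ (m - j)

/-! ### Homeomorphisms and diffeomorphisms between subsets -/

/-- `f` restricts to a homeomorphism from `s` onto `t`. -/
def IsHomeoBetween {X Y : Type*} [TopologicalSpace X] [TopologicalSpace Y]
    (f : X → Y) (s : Set X) (t : Set Y) : Prop :=
  ∃ f' : Y → X, MapsTo f s t ∧ MapsTo f' t s ∧ InvOn f' f s t ∧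
    ContinuousOn f s ∧ ContinuousOn f' t

variable {d : ℕ} {S : Type*} [TopologicalSpace S] [ChartedSpace (EuclideanSpace ℝ (Fin d)) S]

/-- For open sets `s`, `t` of `ℝ × S`: `f` restricts to a smooth diffeomorphism from `s`
onto `t`. -/
def IsDiffeoBetween (d : ℕ) {S : Type*} [TopologicalSpace S]
    [ChartedSpace (EuclideanSpace ℝ (Fin d)) S] (f : ℝ × S → ℝ × S) (s t : Set (ℝ × S)) : Prop :=
  ∃ f' : ℝ × S → ℝ × S, MapsTo f s t ∧ MapsTo f' t s ∧ InvOn f' f s t ∧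
    ContMDiffOn (𝓘(ℝ, ℝ).prod (𝓡 d)) (𝓘(ℝ, ℝ).prod (𝓡 d)) ∞ f s ∧
    ContMDiffOn (𝓘(ℝ, ℝ).prod (𝓡 d)) (𝓘(ℝ, ℝ).prod (𝓡 d)) ∞ f' t

/-! ### Families of covariant tensors on `S` and their expressions in charts -/

/-- A chart of `S` (with values in a Euclidean space). -/
abbrev Chart (d : ℕ) (S : Type*) [TopologicalSpace S] :=
  OpenPartialHomeomorph S (EuclideanSpace ℝ (Fin d))

/-- The differential at `u` of the inverse of a chart `e`; it maps the `i`-th basis vector to the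
coordinate vector field `∂/∂θᵢ` at `e.symm u`. -/
def dInv (e : Chart d S) (u : EuclideanSpace ℝ (Fin d)) :
    EuclideanSpace ℝ (Fin d) →L[ℝ] TangentSpace (𝓡 d) (e.symm u) :=
  mfderiv 𝓘(ℝ, EuclideanSpace ℝ (Fin d)) (𝓡 d) e.symm u

/-- A family, indexed by a real parameter, of functions on `S`. -/
abbrev FunFamily (S : Type*) := ℝ → S → ℝ

/-- A family, indexed by a real parameter, of covectors at the points of `S`. -/
abbrev FormFamily (d : ℕ) (S : Type*) [TopologicalSpace S]
    [ChartedSpace (EuclideanSpace ℝ (Fin d)) S] :=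
  ℝ → ∀ y : S, TangentSpace (𝓡 d) y →L[ℝ] ℝ

/-- A family, indexed by a real parameter, of bilinear forms on the tangent spaces of `S`. -/
abbrev BilinFamily (d : ℕ) (S : Type*) [TopologicalSpace S]
    [ChartedSpace (EuclideanSpace ℝ (Fin d)) S] :=
  ℝ → ∀ y : S, TangentSpace (𝓡 d) y →L[ℝ] TangentSpace (𝓡 d) y →L[ℝ] ℝ

/-- The bilinear form `(u, v) ↦ B (L u) (L v)`.  It is used with tangent spaces of `S`, each of
which is by definition a copy of the model Euclidean space. -/
def pullBilin (B : EuclideanSpace ℝ (Fin d) →L[ℝ] EuclideanSpace ℝ (Fin d) →L[ℝ] ℝ)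
    (L : EuclideanSpace ℝ (Fin d) →L[ℝ] EuclideanSpace ℝ (Fin d)) :
    EuclideanSpace ℝ (Fin d) →L[ℝ] EuclideanSpace ℝ (Fin d) →L[ℝ] ℝ :=
  B.bilinearComp L L

/-- Expression in the chart `e` of a family of functions. -/
def funInChart (e : Chart d S) (f : FunFamily S) : ℝ → EuclideanSpace ℝ (Fin d) → ℝ :=
  fun x u => f x (e.symm u)

/-- Expression in the chart `e` of a family of 1-forms (its components are the `bᵢ(x, θ)`). -/
def formInChart (e : Chart d S) (b : FormFamily d S) :
    ℝ → EuclideanSpace ℝ (Fin d) → (EuclideanSpace ℝ (Fin d) →L[ℝ] ℝ) :=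
  fun x u => (b x (e.symm u)).comp (dInv e u)

/-- Expression in the chart `e` of a family of bilinear forms (its components are
the `gᵢⱼ(x, θ)`). -/
def bilinInChart (e : Chart d S) (g : BilinFamily d S) :
    ℝ → EuclideanSpace ℝ (Fin d) →
      (EuclideanSpace ℝ (Fin d) →L[ℝ] EuclideanSpace ℝ (Fin d) →L[ℝ] ℝ) :=
  fun x u => pullBilin (g x (e.symm u)) (dInv e u)

/-- `f ∈ S^m` on `(M, ∞) × S`, in every chart of the atlas of `S`. -/
def FunIsSymbol (m M : ℝ) (f : ℝ → S → ℝ) : Prop :=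
  ∀ e ∈ atlas (EuclideanSpace ℝ (Fin d)) S, IsSymbolOn m M e.target (funInChart e f)

/-- `b ∈ S^m` on `(M, ∞) × S`, in every chart of the atlas of `S`. -/
def FormIsSymbol (m M : ℝ) (b : FormFamily d S) : Prop :=
  ∀ e ∈ atlas (EuclideanSpace ℝ (Fin d)) S, IsSymbolOn m M e.target (formInChart e b)

/-- `g ∈ S^m` on `(M, ∞) × S`, in every chart of the atlas of `S`. -/
def BilinIsSymbol (m M : ℝ) (g : BilinFamily d S) : Prop :=
  ∀ e ∈ atlas (EuclideanSpace ℝ (Fin d)) S, IsSymbolOn m M e.target (bilinInChart e g)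

/-- `(h(t))_{t > M}` is a smooth family of Riemannian metrics on `S`. -/
structure IsSmoothMetricFamily (M : ℝ) (h : BilinFamily d S) : Prop where
  smooth : ∀ e ∈ atlas (EuclideanSpace ℝ (Fin d)) S,
    ContDiffOn ℝ ∞ (fun p : ℝ × EuclideanSpace ℝ (Fin d) => bilinInChart e h p.1 p.2)
      (Ioi M ×ˢ e.target)
  symm : ∀ t, M < t → ∀ (y : S) (u v : TangentSpace (𝓡 d) y), h t y u v = h t y v u
  pos : ∀ t, M < t → ∀ (y : S) (u : TangentSpace (𝓡 d) y), u ≠ 0 → 0 < h t y u u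

/-! ### The metric of the end -/

/-- The bilinear form `G = a dx² + 2 bᵢ dx dθᵢ / w(x) + gᵢⱼ dθᵢ dθⱼ / w(x)²` on the tangent space
`ℝ × T_y S` of `(R, ∞) × S` at the point `(x, y)`. -/
def endMetric (w : ℝ → ℝ) (a : FunFamily S) (b : FormFamily d S) (g : BilinFamily d S)
    (x : ℝ) (y : S) (X Y : ℝ × TangentSpace (𝓡 d) y) : ℝ :=
  a x y * (X.1 * Y.1) + (X.1 * b x y Y.2 + Y.1 * b x y X.2) / w x + g x y X.2 Y.2 / w x ^ 2

/-- `endMetric w a b g` is a (smooth) Riemannian metric on `(R, ∞) × S`. -/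
structure IsEndMetric (R : ℝ) (w : ℝ → ℝ) (a : FunFamily S) (b : FormFamily d S)
    (g : BilinFamily d S) : Prop where
  w_smooth : ContDiffOn ℝ ∞ w (Ioi R)
  w_pos : ∀ x, R < x → 0 < w x
  a_smooth : ∀ e ∈ atlas (EuclideanSpace ℝ (Fin d)) S,
    ContDiffOn ℝ ∞ (fun p : ℝ × EuclideanSpace ℝ (Fin d) => funInChart e a p.1 p.2)
      (Ioi R ×ˢ e.target)
  b_smooth : ∀ e ∈ atlas (EuclideanSpace ℝ (Fin d)) S,
    ContDiffOn ℝ ∞ (fun p : ℝ × EuclideanSpace ℝ (Fin d) => formInChart e b p.1 p.2)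
      (Ioi R ×ˢ e.target)
  g_smooth : ∀ e ∈ atlas (EuclideanSpace ℝ (Fin d)) S,
    ContDiffOn ℝ ∞ (fun p : ℝ × EuclideanSpace ℝ (Fin d) => bilinInChart e g p.1 p.2)
      (Ioi R ×ˢ e.target)
  g_symm : ∀ x, R < x → ∀ (y : S) (u v : TangentSpace (𝓡 d) y), g x y u v = g x y v u
  pos : ∀ x, R < x → ∀ (y : S) (X : ℝ × TangentSpace (𝓡 d) y), X ≠ 0 →
    0 < endMetric w a b g x y X X

/-- The metric of the end in the coordinates `(x, θ)` given by a chart `e` of `S`. -/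
def metricInChart (w : ℝ → ℝ) (a : FunFamily S) (b : FormFamily d S) (g : BilinFamily d S)
    (e : Chart d S) (p X Y : ℝ × EuclideanSpace ℝ (Fin d)) : ℝ :=
  endMetric w a b g p.1 (e.symm p.2) (X.1, dInv e p.2 X.2) (Y.1, dInv e p.2 Y.2)

/-- The Christoffel symbols of the first kind in the coordinates `(x, θ)`:
`Γ(X, Y; Z) = (X·G(Y, Z) + Y·G(X, Z) - Z·G(X, Y)) / 2` for constant vectors `X, Y, Z`. -/
def christoffel (w : ℝ → ℝ) (a : FunFamily S) (b : FormFamily d S) (g : BilinFamily d S)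
    (e : Chart d S) (p X Y Z : ℝ × EuclideanSpace ℝ (Fin d)) : ℝ :=
  (fderiv ℝ (fun q => metricInChart w a b g e q Y Z) p X
    + fderiv ℝ (fun q => metricInChart w a b g e q X Z) p Y
    - fderiv ℝ (fun q => metricInChart w a b g e q X Y) p Z) / 2

/-! ### Geodesics and the outgoing normal geodesic flow -/

/-- The expression of a curve of `ℝ × S` in the coordinates `(x, θ)`. -/
def curveInChart (e : Chart d S) (γ : ℝ → ℝ × S) : ℝ → ℝ × EuclideanSpace ℝ (Fin d) :=
  fun s => ((γ s).1, e (γ s).2)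

/-- `γ` is a geodesic of `((R, ∞) × S, G)` on the interval `J`: it stays in `(R, ∞) × S` and in
every chart of the atlas it is a `C²` solution of the geodesic equation
`G(c'', Z) + Γ(c', c'; Z) = 0` for all `Z`. -/
def IsGeodesicOn (R : ℝ) (w : ℝ → ℝ) (a : FunFamily S) (b : FormFamily d S) (g : BilinFamily d S)
    (J : Set ℝ) (γ : ℝ → ℝ × S) : Prop :=
  (∀ t ∈ J, R < (γ t).1) ∧ ContinuousOn γ J ∧
    ∀ e ∈ atlas (EuclideanSpace ℝ (Fin d)) S, ∀ t ∈ J, (γ t).2 ∈ e.source →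
      ContDiffWithinAt ℝ 2 (curveInChart e γ) J t ∧
      ∀ Z : ℝ × EuclideanSpace ℝ (Fin d),
        metricInChart w a b g e (curveInChart e γ t)
            (derivWithin (derivWithin (curveInChart e γ) J) J t) Z
          + christoffel w a b g e (curveInChart e γ t)
            (derivWithin (curveInChart e γ) J t) (derivWithin (curveInChart e γ) J t) Z = 0

/-- In the coordinates `(x, θ)`, `ν` is the outgoing unit normal vector at `p = (r, θ)` to the
hypersurface `{r} × S`. -/
def IsOutgoingUnitNormal (w : ℝ → ℝ) (a : FunFamily S) (b : FormFamily d S) (g : BilinFamily d S)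
    (e : Chart d S) (p ν : ℝ × EuclideanSpace ℝ (Fin d)) : Prop :=
  metricInChart w a b g e p ν ν = 1 ∧
    (∀ z : EuclideanSpace ℝ (Fin d), metricInChart w a b g e p ν (0, z) = 0) ∧ 0 < ν.1

/-- `N` is, on `[0, ∞) × S`, the outgoing normal geodesic flow from `{r} × S`: for every `y`, the
curve `t ↦ N(t, y)` is a geodesic defined for all `t ≥ 0`, starts at `(r, y)` and has the outgoing
unit normal to `{r} × S` as initial velocity. -/
def IsOutgoingNormalFlow (R : ℝ) (w : ℝ → ℝ) (a : FunFamily S) (b : FormFamily d S)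
    (g : BilinFamily d S) (r : ℝ) (N : ℝ × S → ℝ × S) : Prop :=
  ∀ y : S, IsGeodesicOn R w a b g (Ici 0) (fun t => N (t, y)) ∧ N (0, y) = (r, y) ∧
    ∀ e ∈ atlas (EuclideanSpace ℝ (Fin d)) S, y ∈ e.source →
      IsOutgoingUnitNormal w a b g e (r, e y)
        (derivWithin (curveInChart e (fun t => N (t, y))) (Ici 0) 0)

/-! ### Pull-backs -/

/-- The pulled back form `N^* G` at `(t, y)`, evaluated on two tangent vectors. -/
def pullbackEndMetric (w : ℝ → ℝ) (a : FunFamily S) (b : FormFamily d S) (g : BilinFamily d S)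
    (N : ℝ × S → ℝ × S) (t : ℝ) (y : S) (X Y : ℝ × TangentSpace (𝓡 d) y) : ℝ :=
  let D : ℝ × TangentSpace (𝓡 d) y →L[ℝ] ℝ × TangentSpace (𝓡 d) (N (t, y)).2 :=
    mfderiv (𝓘(ℝ, ℝ).prod (𝓡 d)) (𝓘(ℝ, ℝ).prod (𝓡 d)) N (t, y)
  endMetric w a b g (N (t, y)).1 (N (t, y)).2 (D X) (D Y)

/-- The bilinear form `e^{-2 κ φ} Ω^* ḡ` on `T_y S`. -/
def conformalPullback (κ : ℝ) (φ : S → ℝ) (Ω : S → S)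
    (gbar : ∀ y : S, TangentSpace (𝓡 d) y →L[ℝ] TangentSpace (𝓡 d) y →L[ℝ] ℝ) (y : S) :
    TangentSpace (𝓡 d) y →L[ℝ] TangentSpace (𝓡 d) y →L[ℝ] ℝ :=
  Real.exp (-2 * κ * φ y) •
    pullBilin (gbar (Ω y)) (mfderiv (𝓡 d) (𝓡 d) Ω y)

end RadialEnd

end

open RadialEnd

/-!
The normal geodesic flow is obtained from the Hamiltonian form of the geodesic equation, in which
the radial coordinate is almost the arc length. In a chart, write the flow as
`N(t, u) = (r + t + ψ, θ)` and let `η` be the momentum dual to `θ`. Eliminating the radial velocity by the unit speed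
condition turns the geodesic equation into a system for `(ψ, θ, η)` whose right hand side is a
symbol of order `-1 - τ` in `s = r + t` (`IsChartEnd.exists_hamiltonian`): this is exactly what the
decay rates `μ ≥ 1 + τ`, `ν ≥ (1 + τ) / 2` and `λ ≥ (1 + τ) / 2` provide. As `-1 - τ < -1`, the
right hand side is integrable up to `s = ∞`: the solutions with initial value `u` are the bounded
curves `y` with `y - A(y) = u`, where `A` is a smooth contraction of the Banach space of bounded
curves, and `id - A` is a diffeomorphism of that space (`exists_homeomorph_id_add`,
`exists_solution_map`). This gives the smooth dependence on the initial data up to `s = ∞`. For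
large `r` the flow is as close to a translation as one likes, together with its first derivatives,
and its difference with its limit is a symbol of order `-τ`, in all the variables
(`exists_symbol_flow`, `IsChartEnd.exists_chartFlow`).

To pass from charts to the manifold, the geodesic equation is transported by transition maps, and
geodesics are determined by their initial velocity (`IsGeodesicOn.eqOn`), so every outgoing normal
flow is given in charts by the flows above (`IsOutgoingNormalFlow.eq_chartFlow`). These are small
Lipschitz perturbations of the identity, hence diffeomorphisms of `ℝ × ℝᵈ`; a finite cover of the
compact cross-section by coordinate balls, with a uniform bound on the displacements, allows gluing
the inverses (`IsChartCover.exists_inverse`). The same lemma shows that the limit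
`Ω = lim θ(N(t, ·))` is a diffeomorphism, and `φ = lim (x(N(t, ·)) - t)`.

By the unit speed condition and Gauss's lemma (`IsChartFlow.gauss`), `N^* G = dt² + k(t)`. In a
chart `w(t)² k(t)` is `(w(t) / w(x))²` times the form `g(∂θ, ∂θ) + 2 w b(∂θ) ∂x + w² a (∂x)²`, with
`(x, θ) = N(t, u)`. The form converges to `θ_∞^* gbar` at rate `τ`. Writing `log w(x) = κ x + L(x)`,
where `L'` is a symbol of order `-ε` because `(w'/w)'` is one of order `-1 - ε`, the factor
converges to `e^{-2κφ}` at rate `min τ ε` (`IsChartFlow.sym_inducedForm`). Throughout, the symbol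
classes are used in an inductive form (`Sym`) in which `∂ₓ` lowers the order and which is stable
under products, composition and translation in `x`; it is equivalent to the given one
(`isSymbolOn_iff`).
-/


namespace RadialEnd

/-! ### Calculus of symbols -/

theorem two_le_infty : (2 : ℕ∞ω) ≤ ∞ := by
  exact WithTop.coe_le_coe.2 (le_top : (2 : ℕ∞) ≤ ⊤)

theorem one_le_bracket (x : ℝ) : 1 ≤ bracket x := by
  unfold bracket
  rw [Real.one_le_sqrt]
  nlinarith [sq_nonneg x]

theorem bracket_pos (x : ℝ) : 0 < bracket x := one_pos.trans_le (one_le_bracket x)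

theorem abs_le_bracket (x : ℝ) : |x| ≤ bracket x := by
  unfold bracket
  apply Real.abs_le_sqrt
  linarith

theorem bracket_rpow_mono {m m' : ℝ} (h : m ≤ m') (x : ℝ) : bracket x ^ m ≤ bracket x ^ m' :=
  Real.rpow_le_rpow_of_exponent_le (one_le_bracket x) h

theorem bracket_add_le (x y : ℝ) : bracket (x + y) ≤ (1 + |y|) * bracket x := by
  have hx := one_le_bracket x
  have hx2 : bracket x ^ 2 = 1 + x ^ 2 := Real.sq_sqrt (by positivity)
  have h1 := abs_le_bracket x
  unfold bracket at *
  apply Real.sqrt_le_iff.2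
  refine ⟨by positivity, ?_⟩
  rw [mul_pow, hx2]
  have hxy : x * y ≤ |x| * |y| := by rw [← abs_mul]; exact le_abs_self _
  have h2 : x ^ 2 = |x| ^ 2 := (sq_abs x).symm
  have h3 : y ^ 2 = |y| ^ 2 := (sq_abs y).symm
  have h4 : 2 * |x| ≤ 1 + |x| ^ 2 := by nlinarith [sq_nonneg (|x| - 1)]
  have h5 := abs_nonneg x
  have h6 := abs_nonneg y
  rw [h2]
  nlinarith [mul_nonneg h6 (sub_nonneg.2 h4), mul_nonneg (sq_nonneg |x|) (sq_nonneg |y|),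
    mul_nonneg (sq_nonneg |x|) h6]

/-- Peetre's inequality. -/
theorem bracket_add_rpow_le (m B : ℝ) :
    ∃ C, 0 < C ∧ ∀ x y : ℝ, |y| ≤ B → bracket (x + y) ^ m ≤ C * bracket x ^ m := by
  rcases le_or_gt 0 B with hB | hB
  swap
  · exact ⟨1, one_pos, fun x y hy => absurd ((abs_nonneg y).trans hy) (not_le.2 hB)⟩
  refine ⟨(1 + B) ^ |m|, by positivity, fun x y hy => ?_⟩
  have h1 : bracket (x + y) ≤ (1 + B) * bracket x :=
    (bracket_add_le x y).trans (by have := bracket_pos x; gcongr)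
  have h2 : bracket x ≤ (1 + B) * bracket (x + y) := by
    have := bracket_add_le (x + y) (-y)
    rw [add_neg_cancel_right, abs_neg] at this
    exact this.trans (by have := bracket_pos (x + y); gcongr)
  have p1 := bracket_pos x
  have p2 := bracket_pos (x + y)
  rcases le_or_gt 0 m with hm | hm
  · rw [abs_of_nonneg hm, ← Real.mul_rpow (by positivity) p1.le]
    exact Real.rpow_le_rpow p2.le h1 hm
  · rw [abs_of_neg hm]
    have h3 : ((1 + B) * bracket (x + y)) ^ m ≤ bracket x ^ m :=
      Real.rpow_le_rpow_of_nonpos p1 h2 hm.le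
    rw [Real.mul_rpow (by positivity) p2.le] at h3
    rw [Real.rpow_neg (by positivity)]
    have : (0:ℝ) < (1 + B) ^ m := by positivity
    rw [inv_mul_eq_div, le_div_iff₀ this]
    linarith

section

variable {E F G H : Type} [NormedAddCommGroup E] [NormedSpace ℝ E]
  [NormedAddCommGroup F] [NormedSpace ℝ F] [NormedAddCommGroup G] [NormedSpace ℝ G]
  [NormedAddCommGroup H] [NormedSpace ℝ H]

/-- The partial derivative `∂ₓ f` of a function on `ℝ × E`. -/
noncomputable def dx (f : ℝ × E → F) : ℝ × E → F := fun p => fderiv ℝ f p (1, 0)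

/-- The partial derivative `∂_θ f` of a function on `ℝ × E`. -/
noncomputable def dth (f : ℝ × E → F) : ℝ × E → (E →L[ℝ] F) := fun p =>
  (fderiv ℝ f p).comp (ContinuousLinearMap.inr ℝ ℝ E)

/-- All the derivatives of `f` in the second variable are `O(⟨x⟩^m)` on `(M, ∞) × K`, for
all compact `K ⊆ V`. -/
def FiberBound (M : ℝ) (V : Set E) (m : ℝ) (f : ℝ × E → F) : Prop :=
  ∀ K, IsCompact K → K ⊆ V → ∀ k : ℕ, ∃ C, ∀ x, M < x → ∀ θ ∈ K,
    ‖iteratedFDeriv ℝ k (fun u => f (x, u)) θ‖ ≤ C * bracket x ^ m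

/-- The symbol estimates of order `m` for at most `n` derivatives in `x` and arbitrarily many
derivatives in `θ`. -/
def SymN (M : ℝ) (V : Set E) : ℕ → ℝ → (ℝ × E → F) → Prop
  | 0, m, f => ContDiffOn ℝ ∞ f (Ioi M ×ˢ V) ∧ FiberBound M V m f
  | n + 1, m, f => (ContDiffOn ℝ ∞ f (Ioi M ×ˢ V) ∧ FiberBound M V m f) ∧
      SymN M V n (m - 1) (dx f)

/-- Symbols of order `m` on `(M, ∞) × V`, as functions on `ℝ × E`. By `isSymbolOn_iff` these are the
uncurried forms of the functions satisfying `IsSymbolOn`. -/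
def Sym (M : ℝ) (V : Set E) (m : ℝ) (f : ℝ × E → F) : Prop := ∀ n, SymN M V n m f

variable {M M' : ℝ} {V : Set E} {m m' : ℝ} {n : ℕ} {f : ℝ × E → F} {g : ℝ × E → G}

omit [NormedSpace ℝ E] in
theorem isOpen_dom (hV : IsOpen V) : IsOpen (Ioi M ×ˢ V) := isOpen_Ioi.prod hV

theorem SymN.smooth (h : SymN M V n m f) : ContDiffOn ℝ ∞ f (Ioi M ×ˢ V) := by
  cases n with
  | zero => exact h.1
  | succ n => exact h.1.1

theorem SymN.bound (h : SymN M V n m f) : FiberBound M V m f := by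
  cases n with
  | zero => exact h.2
  | succ n => exact h.1.2

theorem SymN.of_succ (h : SymN M V (n + 1) m f) : SymN M V n m f := by
  induction n generalizing m f with
  | zero => exact h.1
  | succ n ih => exact ⟨h.1, ih h.2⟩

theorem Sym.smooth (h : Sym M V m f) : ContDiffOn ℝ ∞ f (Ioi M ×ˢ V) := (h 0).smooth

theorem Sym.bound (h : Sym M V m f) : FiberBound M V m f := (h 0).bound

theorem Sym.deriv_x (h : Sym M V m f) : Sym M V (m - 1) (dx f) := fun n => (h (n + 1)).2

theorem Sym.of_deriv_x (h : ContDiffOn ℝ ∞ f (Ioi M ×ˢ V)) (h0 : FiberBound M V m f)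
    (h1 : Sym M V (m - 1) (dx f)) : Sym M V m f := by
  intro n
  cases n with
  | zero => exact ⟨h, h0⟩
  | succ n => exact ⟨⟨h, h0⟩, h1 n⟩

theorem contDiffOn_dx (hV : IsOpen V) (h : ContDiffOn ℝ ∞ f (Ioi M ×ˢ V)) :
    ContDiffOn ℝ ∞ (dx f) (Ioi M ×ˢ V) :=
  (h.fderiv_of_isOpen (isOpen_dom hV) (m := ∞) le_rfl).clm_apply contDiffOn_const

theorem contDiffOn_dth (hV : IsOpen V) (h : ContDiffOn ℝ ∞ f (Ioi M ×ˢ V)) :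
    ContDiffOn ℝ ∞ (dth f) (Ioi M ×ˢ V) :=
  (h.fderiv_of_isOpen (isOpen_dom hV) (m := ∞) le_rfl).clm_comp contDiffOn_const

theorem contDiffAt_of_mem (hV : IsOpen V) (h : ContDiffOn ℝ ∞ f (Ioi M ×ˢ V)) {x : ℝ} {θ : E}
    (hx : M < x) (hθ : θ ∈ V) : ContDiffAt ℝ ∞ f (x, θ) :=
  h.contDiffAt ((isOpen_dom hV).mem_nhds ⟨hx, hθ⟩)

theorem contDiffOn_slice (h : ContDiffOn ℝ ∞ f (Ioi M ×ˢ V)) {x : ℝ} (hx : M < x) :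
    ContDiffOn ℝ ∞ (fun u => f (x, u)) V :=
  h.comp (contDiff_prodMk_right x).contDiffOn fun _ hu => ⟨hx, hu⟩

theorem hasFDerivAt_slice {x : ℝ} {θ : E} (h : DifferentiableAt ℝ f (x, θ)) :
    HasFDerivAt (fun u => f (x, u)) (dth f (x, θ)) θ :=
  h.hasFDerivAt.comp θ (hasFDerivAt_prodMk_right x θ)

theorem hasDerivAt_slice {x : ℝ} {θ : E} (h : DifferentiableAt ℝ f (x, θ)) :
    HasDerivAt (fun s => f (s, θ)) (dx f (x, θ)) x :=
  h.hasFDerivAt.comp_hasDerivAt x ((hasDerivAt_id x).prodMk (hasDerivAt_const x θ))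

theorem fderiv_eq_dx_dth {p : ℝ × E} (v : ℝ × E) :
    fderiv ℝ f p v = v.1 • dx f p + dth f p v.2 := by
  have : v = v.1 • ((1 : ℝ), (0 : E)) + ContinuousLinearMap.inr ℝ ℝ E v.2 := by
    ext <;> simp
  conv_lhs => rw [this, map_add, map_smul]
  rfl

theorem FiberBound.congr (hV : IsOpen V) {f' : ℝ × E → F} (h : FiberBound M V m f)
    (he : EqOn f' f (Ioi M ×ˢ V)) : FiberBound M V m f' := by
  intro K hK hKV k
  obtain ⟨C, hC⟩ := h K hK hKV k
  refine ⟨C, fun x hx θ hθ => ?_⟩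
  have : (fun u => f' (x, u)) =ᶠ[𝓝 θ] fun u => f (x, u) := by
    filter_upwards [hV.mem_nhds (hKV hθ)] with u hu using he ⟨hx, hu⟩
  rw [(this.iteratedFDeriv ℝ k).self_of_nhds]
  exact hC x hx θ hθ

theorem eqOn_dx (hV : IsOpen V) {f' : ℝ × E → F} (he : EqOn f' f (Ioi M ×ˢ V)) :
    EqOn (dx f') (dx f) (Ioi M ×ˢ V) := by
  intro p hp
  have : f' =ᶠ[𝓝 p] f := he.eventuallyEq_of_mem ((isOpen_dom hV).mem_nhds hp)
  simp only [dx, this.fderiv_eq]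

theorem eqOn_dth (hV : IsOpen V) {f' : ℝ × E → F} (he : EqOn f' f (Ioi M ×ˢ V)) :
    EqOn (dth f') (dth f) (Ioi M ×ˢ V) := by
  intro p hp
  have : f' =ᶠ[𝓝 p] f := he.eventuallyEq_of_mem ((isOpen_dom hV).mem_nhds hp)
  simp only [dth, this.fderiv_eq]

theorem SymN.congr (hV : IsOpen V) {f' : ℝ × E → F} (h : SymN M V n m f)
    (he : EqOn f' f (Ioi M ×ˢ V)) : SymN M V n m f' := by
  induction n generalizing m f f' with
  | zero => exact ⟨h.1.congr he, h.2.congr hV he⟩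
  | succ n ih => exact ⟨⟨h.1.1.congr he, h.1.2.congr hV he⟩, ih h.2 (eqOn_dx hV he)⟩

theorem Sym.congr (hV : IsOpen V) {f' : ℝ × E → F} (h : Sym M V m f)
    (he : EqOn f' f (Ioi M ×ˢ V)) : Sym M V m f' := fun n => (h n).congr hV he

theorem FiberBound.mono_order (h : FiberBound M V m f) (hm : m ≤ m') : FiberBound M V m' f := by
  intro K hK hKV k
  obtain ⟨C, hC⟩ := h K hK hKV k
  refine ⟨|C|, fun x hx θ hθ => (hC x hx θ hθ).trans ?_⟩
  have := Real.rpow_pos_of_pos (bracket_pos x) m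
  exact mul_le_mul (le_abs_self C) (bracket_rpow_mono hm x) this.le (abs_nonneg C)

theorem SymN.mono_order (h : SymN M V n m f) (hm : m ≤ m') : SymN M V n m' f := by
  induction n generalizing m m' f with
  | zero => exact ⟨h.1, h.2.mono_order hm⟩
  | succ n ih => exact ⟨⟨h.1.1, h.1.2.mono_order hm⟩, ih h.2 (by linarith)⟩

theorem Sym.mono_order (h : Sym M V m f) (hm : m ≤ m') : Sym M V m' f :=
  fun n => (h n).mono_order hm

theorem FiberBound.mono_dom {V' : Set E} (h : FiberBound M V m f) (hM : M ≤ M') (hV : V' ⊆ V) :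
    FiberBound M' V' m f := by
  intro K hK hKV k
  obtain ⟨C, hC⟩ := h K hK (hKV.trans hV) k
  exact ⟨C, fun x hx => hC x (hM.trans_lt hx)⟩

theorem SymN.mono_dom {V' : Set E} (h : SymN M V n m f) (hM : M ≤ M') (hV : V' ⊆ V) :
    SymN M' V' n m f := by
  have hs : Ioi M' ×ˢ V' ⊆ Ioi M ×ˢ V := prod_mono (Ioi_subset_Ioi hM) hV
  induction n generalizing m f with
  | zero => exact ⟨h.1.mono hs, h.2.mono_dom hM hV⟩
  | succ n ih => exact ⟨⟨h.1.1.mono hs, h.1.2.mono_dom hM hV⟩, ih h.2⟩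

theorem Sym.mono_dom {V' : Set E} (h : Sym M V m f) (hM : M ≤ M') (hV : V' ⊆ V) :
    Sym M' V' m f := fun n => (h n).mono_dom hM hV

theorem FiberBound.add (hV : IsOpen V) {f' : ℝ × E → F} (h : FiberBound M V m f)
    (h' : FiberBound M V m f') (hf : ContDiffOn ℝ ∞ f (Ioi M ×ˢ V))
    (hf' : ContDiffOn ℝ ∞ f' (Ioi M ×ˢ V)) : FiberBound M V m (fun p => f p + f' p) := by
  intro K hK hKV k
  obtain ⟨C, hC⟩ := h K hK hKV k
  obtain ⟨C', hC'⟩ := h' K hK hKV k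
  refine ⟨C + C', fun x hx θ hθ => ?_⟩
  have a1 : ContDiffAt ℝ k (fun u => f (x, u)) θ :=
    ((contDiffOn_slice hf hx).contDiffAt (hV.mem_nhds (hKV hθ))).of_le (by exact_mod_cast le_top)
  have a2 : ContDiffAt ℝ k (fun u => f' (x, u)) θ :=
    ((contDiffOn_slice hf' hx).contDiffAt (hV.mem_nhds (hKV hθ))).of_le (by exact_mod_cast le_top)
  have := iteratedFDeriv_add_apply a1 a2
  have e : (fun u => f (x, u) + f' (x, u)) = (fun u => f (x, u)) + fun u => f' (x, u) := rfl
  rw [e, this, add_mul]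
  exact (norm_add_le _ _).trans (add_le_add (hC x hx θ hθ) (hC' x hx θ hθ))

theorem SymN.add (hV : IsOpen V) {f' : ℝ × E → F} (h : SymN M V n m f) (h' : SymN M V n m f') :
    SymN M V n m (fun p => f p + f' p) := by
  induction n generalizing m f f' with
  | zero => exact ⟨h.1.add h'.1, h.2.add hV h'.2 h.1 h'.1⟩
  | succ n ih =>
    refine ⟨⟨h.1.1.add h'.1.1, h.1.2.add hV h'.1.2 h.1.1 h'.1.1⟩, (ih h.2 h'.2).congr hV ?_⟩
    rintro ⟨x, θ⟩ ⟨hx, hθ⟩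
    have d1 := (contDiffAt_of_mem hV h.1.1 hx hθ).differentiableAt (by simp)
    have d2 := (contDiffAt_of_mem hV h'.1.1 hx hθ).differentiableAt (by simp)
    simp only [dx]
    rw [fderiv_fun_add d1 d2]
    rfl

theorem Sym.add (hV : IsOpen V) {f' : ℝ × E → F} (h : Sym M V m f) (h' : Sym M V m f') :
    Sym M V m (fun p => f p + f' p) := fun n => (h n).add hV (h' n)

theorem FiberBound.bilin (hV : IsOpen V) (B : F →L[ℝ] G →L[ℝ] H) (h : FiberBound M V m f)
    (h' : FiberBound M V m' g) (hf : ContDiffOn ℝ ∞ f (Ioi M ×ˢ V))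
    (hg : ContDiffOn ℝ ∞ g (Ioi M ×ˢ V)) : FiberBound M V (m + m') (fun p => B (f p) (g p)) := by
  intro K hK hKV k
  choose C hC using h K hK hKV
  choose C' hC' using h' K hK hKV
  refine ⟨‖B‖ * ∑ i ∈ Finset.range (k + 1), (k.choose i : ℝ) * C i * C' (k - i),
    fun x hx θ hθ => ?_⟩
  have a1 := contDiffOn_slice hf hx
  have a2 := contDiffOn_slice hg hx
  have key := B.norm_iteratedFDerivWithin_le_of_bilinear a1 a2 hV.uniqueDiffOn (hKV hθ)
    (n := k) (by exact_mod_cast le_top)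
  rw [iteratedFDerivWithin_of_isOpen _ hV (hKV hθ)] at key
  refine key.trans ?_
  rw [mul_assoc, Finset.sum_mul]
  refine mul_le_mul_of_nonneg_left (Finset.sum_le_sum fun i hi => ?_) (norm_nonneg B)
  rw [iteratedFDerivWithin_of_isOpen _ hV (hKV hθ), iteratedFDerivWithin_of_isOpen _ hV (hKV hθ),
    Real.rpow_add (bracket_pos x)]
  have b1 := hC i x hx θ hθ
  have b2 := hC' (k - i) x hx θ hθ
  calc _ ≤ (k.choose i : ℝ) * (C i * bracket x ^ m) * (C' (k - i) * bracket x ^ m') := by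
        have := (norm_nonneg _).trans b1
        gcongr
    _ = _ := by ring

theorem SymN.bilin (hV : IsOpen V) (B : F →L[ℝ] G →L[ℝ] H) (h : SymN M V n m f)
    (h' : SymN M V n m' g) : SymN M V n (m + m') (fun p => B (f p) (g p)) := by
  have smB : ContDiffOn ℝ ∞ (fun p => B (f p) (g p)) (Ioi M ×ˢ V) :=
    B.isBoundedBilinearMap.contDiff.comp_contDiffOn (h.smooth.prodMk h'.smooth)
  induction n generalizing m m' f g with
  | zero => exact ⟨smB, h.2.bilin hV B h'.2 h.1 h'.1⟩
  | succ n ih =>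
    refine ⟨⟨smB, h.1.2.bilin hV B h'.1.2 h.1.1 h'.1.1⟩, ?_⟩
    have sm (f : ℝ × E → F) (g : ℝ × E → G) (hf : ContDiffOn ℝ ∞ f (Ioi M ×ˢ V))
      (hg : ContDiffOn ℝ ∞ g (Ioi M ×ˢ V)) : ContDiffOn ℝ ∞ (fun p => B (f p) (g p)) (Ioi M ×ˢ V) :=
      B.isBoundedBilinearMap.contDiff.comp_contDiffOn (hf.prodMk hg)
    have i1 := ih h.2 h'.of_succ (sm _ _ h.2.smooth h'.smooth)
    have i2 := ih h.of_succ h'.2 (sm _ _ h.smooth h'.2.smooth)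
    have e1 : m - 1 + m' = m + m' - 1 := by ring
    have e2 : m + (m' - 1) = m + m' - 1 := by ring
    rw [e1] at i1
    rw [e2] at i2
    refine (i1.add hV i2).congr hV ?_
    rintro ⟨x, θ⟩ ⟨hx, hθ⟩
    have d1 := (contDiffAt_of_mem hV h.1.1 hx hθ).differentiableAt (by simp)
    have d2 := (contDiffAt_of_mem hV h'.1.1 hx hθ).differentiableAt (by simp)
    simp only [dx]
    rw [(B.hasFDerivAt_of_bilinear d1.hasFDerivAt d2.hasFDerivAt).fderiv]
    simp [add_comm]

theorem Sym.bilin (hV : IsOpen V) (B : F →L[ℝ] G →L[ℝ] H) (h : Sym M V m f)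
    (h' : Sym M V m' g) : Sym M V (m + m') (fun p => B (f p) (g p)) :=
  fun n => (h n).bilin hV B (h' n)

theorem FiberBound.clm (hV : IsOpen V) (L : F →L[ℝ] G) (h : FiberBound M V m f)
    (hf : ContDiffOn ℝ ∞ f (Ioi M ×ˢ V)) : FiberBound M V m (fun p => L (f p)) := by
  intro K hK hKV k
  obtain ⟨C, hC⟩ := h K hK hKV k
  refine ⟨‖L‖ * C, fun x hx θ hθ => ?_⟩
  have a1 := (contDiffOn_slice hf hx).contDiffAt (hV.mem_nhds (hKV hθ))
  refine (L.norm_iteratedFDeriv_comp_left a1 (n := k) (by exact_mod_cast le_top)).trans ?_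
  rw [mul_assoc]
  gcongr
  exact hC x hx θ hθ

theorem SymN.clm (hV : IsOpen V) (L : F →L[ℝ] G) (h : SymN M V n m f) :
    SymN M V n m (fun p => L (f p)) := by
  induction n generalizing m f with
  | zero => exact ⟨L.contDiff.comp_contDiffOn h.1, h.2.clm hV L h.1⟩
  | succ n ih =>
    refine ⟨⟨L.contDiff.comp_contDiffOn h.1.1, h.1.2.clm hV L h.1.1⟩, (ih h.2).congr hV ?_⟩
    rintro ⟨x, θ⟩ ⟨hx, hθ⟩
    have d1 := (contDiffAt_of_mem hV h.1.1 hx hθ).differentiableAt (by simp)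
    simp only [dx]
    have d2 : HasFDerivAt (fun p => L (f p)) _ _ := L.hasFDerivAt.comp _ d1.hasFDerivAt
    rw [d2.fderiv]
    rfl

theorem Sym.clm (hV : IsOpen V) (L : F →L[ℝ] G) (h : Sym M V m f) :
    Sym M V m (fun p => L (f p)) := fun n => (h n).clm hV L

/-- Partial derivatives commute. -/
theorem dx_dth_comm (hV : IsOpen V) (h : ContDiffOn ℝ ∞ f (Ioi M ×ˢ V)) :
    EqOn (dx (dth f)) (dth (dx f)) (Ioi M ×ˢ V) := by
  rintro ⟨x, θ⟩ ⟨hx, hθ⟩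
  have c := contDiffAt_of_mem hV h hx hθ
  have d : DifferentiableAt ℝ (fderiv ℝ f) (x, θ) :=
    (c.fderiv_right (m := 1) (by norm_num; exact two_le_infty)).differentiableAt (by simp)
  have hsymm := c.isSymmSndFDerivAt (by simp; exact two_le_infty)
  have e1 : HasFDerivAt (dth f) (((ContinuousLinearMap.compL ℝ E (ℝ × E) F).flip
      (ContinuousLinearMap.inr ℝ ℝ E)).comp (fderiv ℝ (fderiv ℝ f) (x, θ))) (x, θ) :=
    ((ContinuousLinearMap.compL ℝ E (ℝ × E) F).flip
      (ContinuousLinearMap.inr ℝ ℝ E)).hasFDerivAt.comp (x, θ) d.hasFDerivAt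
  have e2 : HasFDerivAt (dx f) ((ContinuousLinearMap.apply ℝ F ((1 : ℝ), (0 : E))).comp
      (fderiv ℝ (fderiv ℝ f) (x, θ))) (x, θ) :=
    (ContinuousLinearMap.apply ℝ F ((1 : ℝ), (0 : E))).hasFDerivAt.comp (x, θ) d.hasFDerivAt
  ext v
  rw [dx, e1.fderiv, dth, e2.fderiv]
  exact hsymm.eq _ _

theorem FiberBound.deriv_th (hV : IsOpen V) (h : FiberBound M V m f)
    (hf : ContDiffOn ℝ ∞ f (Ioi M ×ˢ V)) : FiberBound M V m (dth f) := by
  intro K hK hKV k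
  obtain ⟨C, hC⟩ := h K hK hKV (k + 1)
  refine ⟨C, fun x hx θ hθ => ?_⟩
  have : (fun u => dth f (x, u)) =ᶠ[𝓝 θ] fderiv ℝ (fun u => f (x, u)) := by
    filter_upwards [hV.mem_nhds (hKV hθ)] with u hu
    exact (hasFDerivAt_slice ((contDiffAt_of_mem hV hf hx hu).differentiableAt (by simp))).fderiv.symm
  rw [(this.iteratedFDeriv ℝ k).self_of_nhds, norm_iteratedFDeriv_fderiv]
  exact hC x hx θ hθ

theorem SymN.deriv_th (hV : IsOpen V) (h : SymN M V n m f) : SymN M V n m (dth f) := by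
  induction n generalizing m f with
  | zero => exact ⟨contDiffOn_dth hV h.1, h.2.deriv_th hV h.1⟩
  | succ n ih =>
    exact ⟨⟨contDiffOn_dth hV h.1.1, h.1.2.deriv_th hV h.1.1⟩, (ih h.2).congr hV (dx_dth_comm hV h.1.1)⟩

theorem Sym.deriv_th (hV : IsOpen V) (h : Sym M V m f) : Sym M V m (dth f) :=
  fun n => (h n).deriv_th hV

/-- Composition in the second variable. -/
theorem FiberBound.comp {U : Set H} (hV : IsOpen V) (hU : IsOpen U) {ζ : ℝ × H → E}
    (h : FiberBound M V m f) (hf : ContDiffOn ℝ ∞ f (Ioi M ×ˢ V))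
    (hζ : FiberBound M U 0 ζ) (hζ' : ContDiffOn ℝ ∞ ζ (Ioi M ×ˢ U))
    (hmap : ∀ K, IsCompact K → K ⊆ U → ∃ K', IsCompact K' ∧ K' ⊆ V ∧
      ∀ x, M < x → ∀ u ∈ K, ζ (x, u) ∈ K') :
    FiberBound M U m (fun p => f (p.1, ζ p)) := by
  intro K hK hKU k
  obtain ⟨K', hK', hKV', hm⟩ := hmap K hK hKU
  choose C hC using h K' hK' hKV'
  choose D hD using hζ K hK hKU
  set D' : ℝ := 1 + ∑ i ∈ Finset.range (k + 1), |D i| with hD'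
  have hD1 : 1 ≤ D' := le_add_of_nonneg_right (Finset.sum_nonneg fun _ _ => abs_nonneg _)
  refine ⟨k.factorial * (∑ i ∈ Finset.range (k + 1), |C i|) * D' ^ k, fun x hx θ hθ => ?_⟩
  have hb := Real.rpow_pos_of_pos (bracket_pos x) m
  have hmaps : MapsTo (fun u => ζ (x, u)) U V := by
    intro u hu
    obtain ⟨K'', _, h2, h3⟩ := hmap {u} isCompact_singleton (singleton_subset_iff.2 hu)
    exact h2 (h3 x hx u rfl)
  have key := norm_iteratedFDerivWithin_comp_le (contDiffOn_slice hf hx) (contDiffOn_slice hζ' hx)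
    (n := k) (by exact_mod_cast le_top) hV.uniqueDiffOn hU.uniqueDiffOn hmaps (hKU hθ)
    (C := (∑ i ∈ Finset.range (k + 1), |C i|) * bracket x ^ m) (D := D') (fun i hi => ?_)
    (fun i h1 hi => ?_)
  · rw [iteratedFDerivWithin_of_isOpen _ hU (hKU hθ)] at key
    refine key.trans (le_of_eq ?_)
    ring
  · rw [iteratedFDerivWithin_of_isOpen _ hV (hmaps (hKU hθ))]
    refine (hC i x hx _ (hm x hx θ hθ)).trans ?_
    gcongr
    exact (le_abs_self _).trans (Finset.single_le_sum (f := fun i => |C i|)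
      (fun _ _ => abs_nonneg _) (Finset.mem_range.2 (Nat.lt_succ_of_le hi)))
  · rw [iteratedFDerivWithin_of_isOpen _ hU (hKU hθ)]
    refine (hD i x hx _ hθ).trans ?_
    rw [Real.rpow_zero, mul_one]
    have : |D i| ≤ D' := (Finset.single_le_sum (f := fun i => |D i|)
      (fun _ _ => abs_nonneg _) (Finset.mem_range.2 (Nat.lt_succ_of_le hi))).trans (by linarith)
    exact ((le_abs_self _).trans this).trans (le_self_pow₀ hD1 (by omega))

theorem contDiffOn_comp_fiber {U : Set H} {ζ : ℝ × H → E}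
    (hf : ContDiffOn ℝ ∞ f (Ioi M ×ˢ V)) (hζ' : ContDiffOn ℝ ∞ ζ (Ioi M ×ˢ U))
    (hmaps : ∀ x, M < x → ∀ u ∈ U, ζ (x, u) ∈ V) :
    ContDiffOn ℝ ∞ (fun p => f (p.1, ζ p)) (Ioi M ×ˢ U) :=
  hf.comp (contDiff_fst.contDiffOn.prodMk hζ') fun p hp => ⟨hp.1, hmaps p.1 hp.1 p.2 hp.2⟩

/-- Symbols are stable under substitution of a bounded symbol `ζ` for `θ`, provided `ζ` stays in
compact subsets of the domain. -/
theorem Sym.comp {U : Set H} (hV : IsOpen V) (hU : IsOpen U) {ζ : ℝ × H → E}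
    (h : Sym M V m f) (hζ : Sym M U 0 ζ)
    (hmap : ∀ K, IsCompact K → K ⊆ U → ∃ K', IsCompact K' ∧ K' ⊆ V ∧
      ∀ x, M < x → ∀ u ∈ K, ζ (x, u) ∈ K') :
    Sym M U m (fun p => f (p.1, ζ p)) := by
  have hmaps : ∀ x, M < x → ∀ u ∈ U, ζ (x, u) ∈ V := by
    intro x hx u hu
    obtain ⟨K'', _, h2, h3⟩ := hmap {u} isCompact_singleton (singleton_subset_iff.2 hu)
    exact h2 (h3 x hx u rfl)
  suffices ∀ n, ∀ (F : Type) [NormedAddCommGroup F] [NormedSpace ℝ F] (m : ℝ) (f : ℝ × E → F),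
      Sym M V m f → SymN M U n m (fun p => f (p.1, ζ p)) from fun n => this n F m f h
  intro n
  induction n with
  | zero =>
    intro F _ _ m f h
    exact ⟨contDiffOn_comp_fiber h.smooth hζ.smooth hmaps,
      h.bound.comp hV hU h.smooth hζ.bound hζ.smooth hmap⟩
  | succ n ih =>
    intro F _ _ m f h
    refine ⟨⟨contDiffOn_comp_fiber h.smooth hζ.smooth hmaps,
      h.bound.comp hV hU h.smooth hζ.bound hζ.smooth hmap⟩, ?_⟩
    have i1 := ih F _ _ h.deriv_x
    have i2 := (ih (E →L[ℝ] F) _ _ (h.deriv_th hV)).bilin hU (ContinuousLinearMap.id ℝ (E →L[ℝ] F))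
      (hζ.deriv_x n)
    rw [show m + (0 - 1) = m - 1 by ring] at i2
    refine (i1.add hU i2).congr hU ?_
    rintro ⟨x, u⟩ ⟨hx, hu⟩
    have d1 := (contDiffAt_of_mem hV h.smooth hx (hmaps x hx u hu)).differentiableAt (by simp)
    have d2 := (contDiffAt_of_mem hU hζ.smooth hx hu).differentiableAt (by simp)
    have d3 : HasFDerivAt (fun p : ℝ × H => f (p.1, ζ p)) _ (x, u) :=
      HasFDerivAt.comp (x, u) (g := f) d1.hasFDerivAt (hasFDerivAt_fst.prodMk d2.hasFDerivAt)
    have e : dx (fun p : ℝ × H => f (p.1, ζ p)) (x, u) =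
      fderiv ℝ f (x, ζ (x, u)) (1, dx ζ (x, u)) := by
      simp only [dx]
      rw [d3.fderiv]
      rfl
    rw [e, fderiv_eq_dx_dth]
    simp

end

end RadialEnd

namespace RadialEnd

/-! ### Comparison with the symbol classes `IsSymbolOn`, and translations -/

section

variable {E F G H : Type} [NormedAddCommGroup E] [NormedSpace ℝ E]
  [NormedAddCommGroup F] [NormedSpace ℝ F] [NormedAddCommGroup G] [NormedSpace ℝ G]
  [NormedAddCommGroup H] [NormedSpace ℝ H]
variable {M M' : ℝ} {V : Set E} {m m' : ℝ} {n : ℕ} {f : ℝ × E → F} {g : ℝ × E → G}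

theorem Sym.iterate_dx (h : Sym M V m f) (j : ℕ) : Sym M V (m - j) (dx^[j] f) := by
  induction j with
  | zero => simpa using h
  | succ j ih =>
    rw [Function.iterate_succ_apply']
    have := ih.deriv_x
    rwa [show m - ↑(j + 1) = m - j - 1 by push_cast; ring]

theorem contDiffOn_iterate_dx (hV : IsOpen V) (h : ContDiffOn ℝ ∞ f (Ioi M ×ˢ V)) (j : ℕ) :
    ContDiffOn ℝ ∞ (dx^[j] f) (Ioi M ×ˢ V) := by
  induction j with
  | zero => exact h
  | succ j ih =>
    rw [Function.iterate_succ_apply']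
    exact contDiffOn_dx hV ih

theorem sym_iff_iterate (hV : IsOpen V) : Sym M V m f ↔ ContDiffOn ℝ ∞ f (Ioi M ×ˢ V) ∧
    ∀ j : ℕ, FiberBound M V (m - j) (dx^[j] f) := by
  refine ⟨fun h => ⟨h.smooth, fun j => (h.iterate_dx j).bound⟩, ?_⟩
  intro hh n
  obtain ⟨h, hb⟩ : ContDiffOn ℝ ∞ f (Ioi M ×ˢ V) ∧
    ∀ j : ℕ, FiberBound M V (m - j) (dx^[j] f) := hh
  induction n generalizing m f with
  | zero => exact ⟨h, by simpa using hb 0⟩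
  | succ n ih =>
    refine ⟨⟨h, by simpa using hb 0⟩, ih (contDiffOn_dx hV h) fun j => ?_⟩
    have := hb (j + 1)
    rw [Function.iterate_succ_apply] at this
    rwa [show m - ↑(j + 1) = m - 1 - j by push_cast; ring] at this

/-- The iterated derivatives in `θ` are smooth in both variables and commute with `∂ₓ`. -/
theorem iteratedFDeriv_slice (hV : IsOpen V) (h : ContDiffOn ℝ ∞ f (Ioi M ×ˢ V)) (k : ℕ) :
    ContDiffOn ℝ ∞ (fun p : ℝ × E => iteratedFDeriv ℝ k (fun u => f (p.1, u)) p.2) (Ioi M ×ˢ V) ∧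
    EqOn (dx (fun p : ℝ × E => iteratedFDeriv ℝ k (fun u => f (p.1, u)) p.2))
      (fun p : ℝ × E => iteratedFDeriv ℝ k (fun u => dx f (p.1, u)) p.2) (Ioi M ×ˢ V) := by
  have dxL : ∀ {F G : Type} [NormedAddCommGroup F] [NormedSpace ℝ F] [NormedAddCommGroup G]
      [NormedSpace ℝ G] (L : F →L[ℝ] G) (f : ℝ × E → F), ContDiffOn ℝ ∞ f (Ioi M ×ˢ V) →
      EqOn (dx (fun p => L (f p))) (fun p => L (dx f p)) (Ioi M ×ˢ V) := by
    rintro F G _ _ _ _ L f h ⟨x, θ⟩ ⟨hx, hθ⟩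
    have d1 := (contDiffAt_of_mem hV h hx hθ).differentiableAt (by simp)
    have d2 : HasFDerivAt (fun p => L (f p)) _ _ := L.hasFDerivAt.comp _ d1.hasFDerivAt
    rw [dx, d2.fderiv]
    rfl
  induction k generalizing f with
  | zero =>
    simp only [iteratedFDeriv_zero_eq_comp, Function.comp_def]
    refine ⟨?_, ?_⟩
    · exact (continuousMultilinearCurryFin0 ℝ E F).symm.contDiff.comp_contDiffOn h
    · exact dxL (continuousMultilinearCurryFin0 ℝ E
        F).symm.toContinuousLinearEquiv.toContinuousLinearMap f h
  | succ k ih =>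
    set L : (E →L[ℝ] (ContinuousMultilinearMap ℝ (fun _ : Fin k => E) F)) →L[ℝ]
      ContinuousMultilinearMap ℝ (fun _ : Fin (k + 1) => E) F :=
      (continuousMultilinearCurryLeftEquiv ℝ (fun _ : Fin (k + 1) => E)
        F).symm.toContinuousLinearEquiv.toContinuousLinearMap
    have key : ∀ f : ℝ × E → F, ContDiffOn ℝ ∞ f (Ioi M ×ˢ V) → EqOn
        (fun p : ℝ × E => iteratedFDeriv ℝ (k + 1) (fun u => f (p.1, u)) p.2)
        (fun p => L (dth (fun p : ℝ × E => iteratedFDeriv ℝ k (fun u => f (p.1, u)) p.2) p))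
        (Ioi M ×ˢ V) := by
      rintro f h ⟨x, θ⟩ ⟨hx, hθ⟩
      have d1 := (contDiffAt_of_mem hV (ih h).1 hx hθ).differentiableAt (by simp)
      have := (hasFDerivAt_slice d1).fderiv
      simp only [iteratedFDeriv_succ_eq_comp_left, Function.comp_apply]
      rw [← this]
      rfl
    have sm := L.contDiff.comp_contDiffOn (contDiffOn_dth hV (ih h).1)
    refine ⟨sm.congr (key f h), ?_⟩
    intro p hp
    have hh := contDiffOn_dx hV h
    have e := eqOn_dth hV (ih h).2 hp
    have e1 := key (dx f) hh hp
    simp only at e1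
    rw [eqOn_dx hV (key f h) hp, dxL L _ (contDiffOn_dth hV (ih h).1) hp]
    simp only
    rw [e1, dx_dth_comm hV (ih h).1 hp, e]

theorem iteratedDeriv_iteratedFDeriv (hV : IsOpen V) (h : ContDiffOn ℝ ∞ f (Ioi M ×ˢ V))
    (j k : ℕ) {x : ℝ} {θ : E} (hx : M < x) (hθ : θ ∈ V) :
    iteratedDeriv j (fun s => iteratedFDeriv ℝ k (fun u => f (s, u)) θ) x =
      iteratedFDeriv ℝ k (fun u => dx^[j] f (x, u)) θ := by
  induction j generalizing x with
  | zero => simp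
  | succ j ih =>
    rw [iteratedDeriv_succ]
    have e : iteratedDeriv j (fun s => iteratedFDeriv ℝ k (fun u => f (s, u)) θ) =ᶠ[𝓝 x]
        fun s => iteratedFDeriv ℝ k (fun u => dx^[j] f (s, u)) θ := by
      filter_upwards [Ioi_mem_nhds hx] with s hs using ih hs
    have hj := iteratedFDeriv_slice hV (contDiffOn_iterate_dx hV h j) k
    have d1 := (contDiffAt_of_mem hV hj.1 hx hθ).differentiableAt (by simp)
    rw [e.deriv_eq, Function.iterate_succ_apply']
    have := (hasDerivAt_slice d1).deriv
    simp only at this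
    rw [this]
    exact hj.2 ⟨hx, hθ⟩

/-- The inductive symbol classes are those defined by mixed partial derivatives. -/
theorem isSymbolOn_iff (hV : IsOpen V) {f : ℝ → E → F} :
    IsSymbolOn m M V f ↔ Sym M V m (fun p : ℝ × E => f p.1 p.2) := by
  rw [sym_iff_iterate hV, IsSymbolOn]
  refine and_congr_right fun h => ?_
  have key := fun (j k : ℕ) (x : ℝ) (θ : E) (hx : M < x) (hθ : θ ∈ V) =>
    iteratedDeriv_iteratedFDeriv hV h j k hx hθ
  simp only at key
  constructor
  · intro hs j K hK hKV k
    obtain ⟨C, hC⟩ := hs K hK hKV j k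
    refine ⟨C, fun x hx θ hθ => ?_⟩
    rw [← key j k x θ hx (hKV hθ)]
    exact hC x hx θ hθ
  · intro hs K hK hKV j k
    obtain ⟨C, hC⟩ := hs j K hK hKV k
    refine ⟨C, fun x hx θ hθ => ?_⟩
    change ‖iteratedDeriv j (fun s => iteratedFDeriv ℝ k (fun u => f s u) θ) x‖ ≤ _
    rw [key j k x θ hx (hKV hθ)]
    exact hC x hx θ hθ

/-- A symbol on the half-line, seen as a symbol which does not depend on `θ`. -/
theorem IsSymbolOnLine.sym (hV : IsOpen V) {f : ℝ → ℝ} (h : IsSymbolOnLine m M f) :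
    Sym M V m (fun p : ℝ × E => f p.1) := by
  have key : ∀ j : ℕ, ContDiffOn ℝ ∞ (iteratedDeriv j f) (Ioi M) ∧
      EqOn (dx^[j] (fun p : ℝ × E => f p.1)) (fun p => iteratedDeriv j f p.1) (Ioi M ×ˢ V) := by
    intro j
    induction j with
    | zero => exact ⟨by simpa using h.1, fun p _ => by simp⟩
    | succ j ih =>
      refine ⟨?_, ?_⟩
      · rw [iteratedDeriv_succ]
        exact ih.1.deriv_of_isOpen isOpen_Ioi (by simp)
      · intro p hp
        rw [Function.iterate_succ_apply', eqOn_dx hV ih.2 hp, iteratedDeriv_succ]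
        have d1 : DifferentiableAt ℝ (iteratedDeriv j f) p.1 :=
          (ih.1.contDiffAt (Ioi_mem_nhds hp.1)).differentiableAt (by simp)
        have d2 : HasFDerivAt (fun p : ℝ × E => iteratedDeriv j f p.1) _ p :=
          d1.hasFDerivAt.comp p hasFDerivAt_fst
        rw [dx, d2.fderiv]
        simp
  rw [sym_iff_iterate hV]
  refine ⟨h.1.comp contDiffOn_fst fun p hp => hp.1, fun j => ?_⟩
  refine FiberBound.congr hV (f := fun p : ℝ × E => iteratedDeriv j f p.1) ?_ (key j).2
  intro K _ _ k
  obtain ⟨C, hC⟩ := h.2 j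
  cases k with
  | zero => exact ⟨C, fun x hx θ _ => by simpa using hC x hx⟩
  | succ k => exact ⟨0, fun x hx θ _ => by simp [iteratedFDeriv_const_of_ne]⟩

theorem FiberBound.shift (hV : IsOpen V) {P : Set ℝ} (hP : IsOpen P)
    (hM : ∀ s, M' < s → ∀ ψ ∈ P, M < s + ψ) (h : Sym M V m f) :
    FiberBound M' (P ×ˢ V) m (fun q : ℝ × (ℝ × E) => f (q.1 + q.2.1, q.2.2)) := by
  intro K hK hKV k
  obtain ⟨B, hB⟩ := (hK.image continuous_fst).isBounded.exists_norm_le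
  suffices ∀ k, ∀ (F : Type) [NormedAddCommGroup F] [NormedSpace ℝ F] (m : ℝ) (f : ℝ × E → F),
      Sym M V m f → ∃ C, ∀ x, M' < x → ∀ θ ∈ K,
      ‖iteratedFDeriv ℝ k (fun u : ℝ × E => f (x + u.1, u.2)) θ‖ ≤ C * bracket x ^ m from
    this k F m f h
  clear k
  intro k
  induction k with
  | zero =>
    intro F _ _ m f h
    obtain ⟨C, hC⟩ := h.bound (Prod.snd '' K) (hK.image continuous_snd)
      (by rintro _ ⟨u, hu, rfl⟩; exact (hKV hu).2) 0
    obtain ⟨C', hC', hb⟩ := bracket_add_rpow_le m B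
    refine ⟨|C| * C', fun x hx u hu => ?_⟩
    have h1 := hC (x + u.1) (hM x hx _ (hKV hu).1) u.2 (mem_image_of_mem _ hu)
    have h2 := hb x u.1 (hB _ (mem_image_of_mem _ hu))
    simp only [norm_iteratedFDeriv_zero] at h1 ⊢
    have := Real.rpow_pos_of_pos (bracket_pos (x + u.1)) m
    calc _ ≤ _ := h1
      _ ≤ |C| * (C' * bracket x ^ m) := by
        have := le_abs_self C
        gcongr
      _ = _ := by ring
  | succ k ih =>
    intro F _ _ m f h
    obtain ⟨C1, h1⟩ := ih F m (dx f) (h.deriv_x.mono_order (by linarith))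
    obtain ⟨C2, h2⟩ := ih (E →L[ℝ] F) m (dth f) (h.deriv_th hV)
    set A : F →L[ℝ] (ℝ × E →L[ℝ] F) :=
      ContinuousLinearMap.smulRightL ℝ (ℝ × E) F (ContinuousLinearMap.fst ℝ ℝ E)
    set B : (E →L[ℝ] F) →L[ℝ] (ℝ × E →L[ℝ] F) :=
      (ContinuousLinearMap.compL ℝ (ℝ × E) E F).flip (ContinuousLinearMap.snd ℝ ℝ E)
    refine ⟨‖A‖ * C1 + ‖B‖ * C2, fun x hx u hu => ?_⟩
    have hopen : IsOpen (P ×ˢ V) := hP.prod hV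
    have e : fderiv ℝ (fun u : ℝ × E => f (x + u.1, u.2)) =ᶠ[𝓝 u]
        (A ∘ fun u : ℝ × E => dx f (x + u.1, u.2)) + (B ∘ fun u : ℝ × E => dth f (x + u.1, u.2)) := by
      filter_upwards [hopen.mem_nhds (hKV hu)] with v hv
      have d1 := (contDiffAt_of_mem hV h.smooth (hM x hx _ hv.1) hv.2).differentiableAt (by simp)
      have d2 : HasFDerivAt (fun u : ℝ × E => f (x + u.1, u.2)) _ v :=
        HasFDerivAt.comp v (g := f) d1.hasFDerivAt
          ((hasFDerivAt_fst.const_add x).prodMk hasFDerivAt_snd)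
      rw [d2.fderiv]
      ext y
      · simp [A, B, dx, dth]
        exact map_zero (fderiv ℝ f (x + v.1, v.2))
      · simp [A, B, dx, dth]
    have sm : ∀ {F : Type} [NormedAddCommGroup F] [NormedSpace ℝ F] {f : ℝ × E → F},
        ContDiffOn ℝ ∞ f (Ioi M ×ˢ V) →
        ContDiffAt ℝ ∞ (fun u : ℝ × E => f (x + u.1, u.2)) u := by
      intro F _ _ f hf
      exact ContDiffAt.comp u (g := f) (contDiffAt_of_mem hV hf (hM x hx _ (hKV hu).1) (hKV hu).2)
        ((contDiff_const.add contDiff_fst).prodMk contDiff_snd).contDiffAt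
    have s1 := sm (contDiffOn_dx hV h.smooth)
    have s2 := sm (contDiffOn_dth hV h.smooth)
    have hk : (k : ℕ∞ω) ≤ ∞ := by exact_mod_cast le_top
    rw [← norm_iteratedFDeriv_fderiv, (e.iteratedFDeriv ℝ k).self_of_nhds,
      iteratedFDeriv_add_apply ((A.contDiff.contDiffAt.comp u s1).of_le hk)
        ((B.contDiff.contDiffAt.comp u s2).of_le hk)]
    refine (norm_add_le _ _).trans ?_
    have t1 := (A.norm_iteratedFDeriv_comp_left s1 hk).trans
      (mul_le_mul_of_nonneg_left (h1 x hx u hu) (norm_nonneg A))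
    have t2 := (B.norm_iteratedFDeriv_comp_left s2 hk).trans
      (mul_le_mul_of_nonneg_left (h2 x hx u hu) (norm_nonneg B))
    linarith

/-- If `f` is a symbol, so is `f(s + ψ, θ)` in the variables `s` and `(ψ, θ)`, for bounded `ψ`: the
derivatives in `ψ` are even of lower order. -/
theorem Sym.shift (hV : IsOpen V) {P : Set ℝ} (hP : IsOpen P)
    (hM : ∀ s, M' < s → ∀ ψ ∈ P, M < s + ψ) (h : Sym M V m f) :
    Sym M' (P ×ˢ V) m (fun q : ℝ × (ℝ × E) => f (q.1 + q.2.1, q.2.2)) := by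
  have sm : ∀ {f : ℝ × E → F}, ContDiffOn ℝ ∞ f (Ioi M ×ˢ V) →
      ContDiffOn ℝ ∞ (fun q : ℝ × (ℝ × E) => f (q.1 + q.2.1, q.2.2)) (Ioi M' ×ˢ (P ×ˢ V)) :=
    fun hf => hf.comp (by fun_prop) fun q hq => ⟨hM _ hq.1 _ hq.2.1, hq.2.2⟩
  intro n
  induction n generalizing m f with
  | zero => exact ⟨sm h.smooth, .shift hV hP hM h⟩
  | succ n ih =>
    refine ⟨⟨sm h.smooth, .shift hV hP hM h⟩, (ih h.deriv_x).congr (hP.prod hV) ?_⟩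
    rintro ⟨s, ψ, θ⟩ ⟨hs, hψ, hθ⟩
    have d1 := (contDiffAt_of_mem hV h.smooth (hM s hs _ hψ) hθ).differentiableAt (by simp)
    have d2 : HasFDerivAt (fun q : ℝ × (ℝ × E) => f (q.1 + q.2.1, q.2.2)) _ (s, ψ, θ) :=
      HasFDerivAt.comp (s, ψ, θ) (g := f) d1.hasFDerivAt
        ((hasFDerivAt_fst.add (hasFDerivAt_fst.comp (s, ψ, θ) hasFDerivAt_snd)).prodMk
          (hasFDerivAt_snd.comp (s, ψ, θ) hasFDerivAt_snd))
    rw [dx, d2.fderiv]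
    simp [dx]

end

end RadialEnd

namespace RadialEnd

/-! ### Smooth dependence of solutions of differential equations, through a fixed point problem -/

/-- A smooth map which is a contraction away from the identity is a diffeomorphism. -/
theorem exists_homeomorph_id_add {W : Type*} [NormedAddCommGroup W] [NormedSpace ℝ W]
    [CompleteSpace W] {g : W → W} {c : NNReal} (hc : c < 1) (hg : LipschitzWith c g)
    (hs : ContDiff ℝ ∞ g) :
    ∃ Φ : W ≃ₜ W, (∀ x, Φ x = x + g x) ∧ ContDiff ℝ ∞ Φ.symm := by
  have happ : ApproximatesLinearOn (fun x => x + g x)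
      ((ContinuousLinearEquiv.refl ℝ W : W ≃L[ℝ] W) : W →L[ℝ] W) univ c := by
    intro x _ y _
    have := hg.dist_le_mul x y
    rw [dist_eq_norm, dist_eq_norm] at this
    have e : x + g x - (y + g y) - (x - y) = g x - g y := by abel
    rw [← e] at this
    exact this
  have hN : Subsingleton W ∨
      c < ‖((ContinuousLinearEquiv.refl ℝ W).symm : W →L[ℝ] W)‖₊⁻¹ := by
    rcases subsingleton_or_nontrivial W with h | h
    · exact Or.inl h
    · right
      have : ‖((ContinuousLinearEquiv.refl ℝ W).symm : W →L[ℝ] W)‖₊ = 1 := by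
        apply NNReal.eq
        exact ContinuousLinearMap.norm_id
      rw [this]
      simpa using hc
  refine ⟨happ.toHomeomorph _ hN, fun x => rfl, ?_⟩
  set Φ := happ.toHomeomorph _ hN
  rw [contDiff_iff_contDiffAt]
  intro y
  set x := Φ.symm y
  have hd : HasFDerivAt g (fderiv ℝ g x) x := (hs.differentiable (by simp) x).hasFDerivAt
  have hn : ‖-fderiv ℝ g x‖ < 1 := by
    rw [norm_neg]
    exact (norm_fderiv_le_of_lipschitz ℝ hg).trans_lt (by exact_mod_cast hc)
  set A : W ≃L[ℝ] W := ContinuousLinearEquiv.unitsEquiv ℝ W (Units.oneSub _ hn)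
  have hA : (A : W →L[ℝ] W) = ContinuousLinearMap.id ℝ W + fderiv ℝ g x := by
    ext v
    simp [A]
  refine Φ.toOpenPartialHomeomorph.contDiffAt_symm (f₀' := A) (mem_univ y) ?_ ?_
  · rw [hA]
    exact (hasFDerivAt_id x).add hd
  · exact (contDiff_id.add hs).contDiffAt

open BoundedContinuousFunction

section

variable {E F G U : Type} [NormedAddCommGroup E] [NormedSpace ℝ E]
  [NormedAddCommGroup F] [NormedSpace ℝ F] [NormedAddCommGroup G] [NormedSpace ℝ G]
  [NormedAddCommGroup U] [NormedSpace ℝ U]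

/-- Smooth functions on `ℝ × E` whose derivatives in the second variable are bounded. -/
def UnifSmooth (f : ℝ × E → F) : Prop :=
  ContDiff ℝ ∞ f ∧ ∀ k : ℕ, ∃ C, ∀ s z, ‖iteratedFDeriv ℝ k (fun z => f (s, z)) z‖ ≤ C

variable {f : ℝ × E → F}

theorem fderiv_slice (hf : ContDiff ℝ ∞ f) (s : ℝ) :
    fderiv ℝ (fun z => f (s, z)) = fun z => dth f (s, z) := by
  ext1 z
  exact (hasFDerivAt_slice (hf.differentiable (by simp) _)).fderiv

theorem UnifSmooth.deriv_th (hf : UnifSmooth f) : UnifSmooth (dth f) := by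
  refine ⟨?_, fun k => ?_⟩
  · exact (hf.1.fderiv_right (m := ∞) le_rfl).clm_comp contDiff_const
  · obtain ⟨C, hC⟩ := hf.2 (k + 1)
    refine ⟨C, fun s z => ?_⟩
    rw [← fderiv_slice hf.1 s, norm_iteratedFDeriv_fderiv]
    exact hC s z

theorem UnifSmooth.exists_bound (hf : UnifSmooth f) : ∃ C, ∀ s z, ‖f (s, z)‖ ≤ C := by
  obtain ⟨C, hC⟩ := hf.2 0
  exact ⟨C, fun s z => by simpa using hC s z⟩

/-- The superposition (Nemytskii) operator `y ↦ (s ↦ f(s, y(s)))` on bounded curves. -/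
noncomputable def nem (hf : UnifSmooth f) (y : ℝ →ᵇ E) : ℝ →ᵇ F :=
  BoundedContinuousFunction.ofNormedAddCommGroup (fun s => f (s, y s))
    (hf.1.continuous.comp (continuous_id.prodMk y.continuous)) hf.exists_bound.choose
    (fun s => hf.exists_bound.choose_spec s (y s))

@[simp] theorem nem_apply (hf : UnifSmooth f) (y : ℝ →ᵇ E) (s : ℝ) : nem hf y s = f (s, y s) := rfl

/-- Pointwise application of a bounded curve of operators to a bounded curve of vectors. -/
noncomputable def applyBCF : (ℝ →ᵇ (E →L[ℝ] F)) →L[ℝ] (ℝ →ᵇ E) →L[ℝ] (ℝ →ᵇ F) :=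
  LinearMap.mkContinuous₂
    (LinearMap.mk₂ ℝ (fun (A : ℝ →ᵇ (E →L[ℝ] F)) (y : ℝ →ᵇ E) => BoundedContinuousFunction.ofNormedAddCommGroup
        (fun s => A s (y s)) (A.continuous.clm_apply y.continuous) (‖A‖ * ‖y‖)
        (fun s => (A s).le_of_opNorm_le_of_le (A.norm_coe_le_norm s) (y.norm_coe_le_norm s)))
      (fun _ _ _ => by ext; simp) (fun _ _ _ => by ext; simp) (fun _ _ _ => by ext; simp)
      (fun _ _ _ => by ext; simp)) 1
    (fun A y => by
      rw [one_mul]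
      exact (BoundedContinuousFunction.norm_le (by positivity)).2 fun s =>
        (A s).le_of_opNorm_le_of_le (A.norm_coe_le_norm s) (y.norm_coe_le_norm s))

@[simp] theorem applyBCF_apply (A : ℝ →ᵇ (E →L[ℝ] F)) (y : ℝ →ᵇ E) (s : ℝ) :
    applyBCF A y s = A s (y s) := rfl

theorem lipschitz_of_bound {C : ℝ} (hf : ContDiff ℝ ∞ f)
    (h : ∀ s z, ‖dth f (s, z)‖ ≤ C) (s : ℝ) (z z' : E) :
    ‖f (s, z) - f (s, z')‖ ≤ C * ‖z - z'‖ :=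
  convex_univ.norm_image_sub_le_of_norm_hasFDerivWithin_le (f := fun z => f (s, z))
    (fun z _ => (hasFDerivAt_slice (hf.differentiable (by simp) (s, z))).hasFDerivWithinAt)
    (fun z _ => h s z) (mem_univ z') (mem_univ z)

theorem nem_lipschitz (hf : UnifSmooth f) {C : ℝ} (hC : 0 ≤ C) (h : ∀ s z, ‖dth f (s, z)‖ ≤ C)
    (y y' : ℝ →ᵇ E) : ‖nem hf y - nem hf y'‖ ≤ C * ‖y - y'‖ := by
  rw [BoundedContinuousFunction.norm_le (by positivity)]
  intro s
  refine (lipschitz_of_bound hf.1 h s (y s) (y' s)).trans ?_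
  gcongr
  exact (y - y').norm_coe_le_norm s

theorem hasFDerivAt_nem (hf : UnifSmooth f) (y : ℝ →ᵇ E) :
    HasFDerivAt (nem hf) (applyBCF (nem hf.deriv_th y)) y := by
  obtain ⟨C, hC⟩ := hf.deriv_th.deriv_th.exists_bound
  have hC0 : 0 ≤ C := (norm_nonneg _).trans (hC 0 0)
  rw [hasFDerivAt_iff_isLittleO_nhds_zero]
  refine Asymptotics.IsBigO.trans_isLittleO (g := fun h : ℝ →ᵇ E => ‖h‖ ^ 2) ?_ ?_
  · refine Asymptotics.IsBigO.of_bound C (Eventually.of_forall fun h => ?_)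
    rw [Real.norm_of_nonneg (by positivity), BoundedContinuousFunction.norm_le (by positivity)]
    intro s
    have key := (convex_closedBall (y s) ‖h‖).norm_image_sub_le_of_norm_hasFDerivWithin_le'
      (f := fun z => f (s, z)) (f' := fun z => dth f (s, z)) (φ := dth f (s, y s)) (C := C * ‖h‖)
      (x := y s) (y := y s + h s)
      (fun z _ => (hasFDerivAt_slice (hf.1.differentiable (by simp) (s, z))).hasFDerivWithinAt)
      (fun z hz => ?_) (Metric.mem_closedBall_self (norm_nonneg _)) ?_
    · rw [add_sub_cancel_left] at key
      change ‖f (s, y s + h s) - f (s, y s) - (dth f (s, y s)) (h s)‖ ≤ _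
      calc _ ≤ _ := key
        _ ≤ C * ‖h‖ * ‖h‖ := by gcongr; exact h.norm_coe_le_norm s
        _ = _ := by ring
    · refine (lipschitz_of_bound hf.deriv_th.1 hC s z (y s)).trans ?_
      gcongr
      rwa [Metric.mem_closedBall, dist_eq_norm] at hz
    · simpa [dist_eq_norm] using h.norm_coe_le_norm s
  · simp_rw [pow_two]
    have : (fun h : ℝ →ᵇ E => ‖h‖) =o[𝓝 0] fun _ => (1 : ℝ) := by
      rw [Asymptotics.isLittleO_one_iff]
      exact tendsto_norm_zero
    have h2 := this.mul_isBigO (Asymptotics.isBigO_refl (fun h : ℝ →ᵇ E => ‖h‖) (𝓝 0))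
    rw [← Asymptotics.isLittleO_norm_right]
    simpa using h2

theorem contDiff_nem (hf : UnifSmooth f) : ContDiff ℝ ∞ (nem hf) := by
  rw [contDiff_infty]
  intro n
  suffices ∀ (F : Type) [NormedAddCommGroup F] [NormedSpace ℝ F] (f : ℝ × E → F)
      (hf : UnifSmooth f), ContDiff ℝ n (nem hf) from this F f hf
  induction n with
  | zero =>
    intro F _ _ f hf
    rw [Nat.cast_zero, contDiff_zero, continuous_iff_continuousAt]
    exact fun y => (hasFDerivAt_nem hf y).continuousAt
  | succ n ih =>
    intro F _ _ f hf
    rw [Nat.cast_succ, contDiff_succ_iff_fderiv]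
    refine ⟨fun y => (hasFDerivAt_nem hf y).differentiableAt, by simp, ?_⟩
    have : fderiv ℝ (nem hf) = applyBCF ∘ nem hf.deriv_th := by
      ext1 y
      exact (hasFDerivAt_nem hf y).fderiv
    rw [this]
    have hA : ContDiff ℝ n
        (applyBCF : (ℝ →ᵇ (E →L[ℝ] F)) →L[ℝ] (ℝ →ᵇ E) →L[ℝ] (ℝ →ᵇ F)) :=
      ContinuousLinearMap.contDiff _
    exact hA.comp (ih (E →L[ℝ] F) (dth f) hf.deriv_th)

/-- Constant curves. -/
noncomputable def constBCF : E →L[ℝ] (ℝ →ᵇ E) :=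
  LinearMap.mkContinuous
    { toFun := fun u => BoundedContinuousFunction.const ℝ u
      map_add' := fun _ _ => by ext; simp
      map_smul' := fun _ _ => by ext; simp } 1 (fun u => by
        rw [one_mul, BoundedContinuousFunction.norm_le (norm_nonneg u)]
        intro s
        simp)

@[simp] theorem constBCF_apply (u : E) (s : ℝ) : constBCF u s = u := rfl

theorem integrable_smul_bcf {ρ : ℝ → ℝ} (hρ : MeasureTheory.Integrable ρ) (y : ℝ →ᵇ E) :
    MeasureTheory.Integrable (fun s => ρ s • y s) :=
  hρ.smul_bdd (C := ‖y‖) y.continuous.aestronglyMeasurable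
    (Eventually.of_forall fun s => y.norm_coe_le_norm s)

theorem norm_setIntegral_smul_bcf_le {ρ : ℝ → ℝ} (hρ : MeasureTheory.Integrable ρ) (h0 : ∀ s, 0 ≤ ρ s)
    (y : ℝ →ᵇ E) (T : Set ℝ) : ‖∫ s in T, ρ s • y s‖ ≤ (∫ s in T, ρ s) * ‖y‖ := by
  rw [← MeasureTheory.integral_mul_const]
  refine MeasureTheory.norm_integral_le_of_norm_le (hρ.integrableOn.mul_const _)
    (Eventually.of_forall fun s => ?_)
  rw [norm_smul, Real.norm_of_nonneg (h0 s)]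
  gcongr
  · exact h0 s
  · exact y.norm_coe_le_norm s

/-- The functional `y ↦ ∫_T ρ y`. -/
noncomputable def intBCF {ρ : ℝ → ℝ} (hρ : MeasureTheory.Integrable ρ) (h0 : ∀ s, 0 ≤ ρ s)
    (T : Set ℝ) : (ℝ →ᵇ E) →L[ℝ] E :=
  LinearMap.mkContinuous
    { toFun := fun y => ∫ s in T, ρ s • y s
      map_add' := fun y z => by
        simp only [BoundedContinuousFunction.coe_add, Pi.add_apply, smul_add]
        exact MeasureTheory.integral_add (integrable_smul_bcf hρ y).integrableOn
          (integrable_smul_bcf hρ z).integrableOn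
      map_smul' := fun c y => by
        simp only [BoundedContinuousFunction.coe_smul, RingHom.id_apply]
        rw [← MeasureTheory.integral_smul]
        simp_rw [smul_comm c] }
    (∫ s in T, ρ s) (fun y => norm_setIntegral_smul_bcf_le hρ h0 y T)

theorem intBCF_apply {ρ : ℝ → ℝ} (hρ : MeasureTheory.Integrable ρ) (h0 : ∀ s, 0 ≤ ρ s)
    (T : Set ℝ) (y : ℝ →ᵇ E) : intBCF hρ h0 T y = ∫ s in T, ρ s • y s := rfl

theorem norm_intBCF_le {ρ : ℝ → ℝ} (hρ : MeasureTheory.Integrable ρ) (h0 : ∀ s, 0 ≤ ρ s)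
    (T : Set ℝ) : ‖(intBCF hρ h0 T : (ℝ →ᵇ E) →L[ℝ] E)‖ ≤ ∫ s in T, ρ s :=
  LinearMap.mkContinuous_norm_le _ (MeasureTheory.integral_nonneg h0) _

theorem norm_integral_smul_bcf_le {ρ : ℝ → ℝ} (hρ : MeasureTheory.Integrable ρ)
    (h0 : ∀ s, 0 ≤ ρ s) (r : ℝ) (y : ℝ →ᵇ E) (s : ℝ) :
    ‖∫ σ in r..s, ρ σ • y σ‖ ≤ (∫ s, ρ s) * ‖y‖ := by
  rw [intervalIntegral.norm_intervalIntegral_eq]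
  refine (norm_setIntegral_smul_bcf_le hρ h0 y _).trans ?_
  gcongr
  · exact Eventually.of_forall h0
  · exact MeasureTheory.Measure.restrict_le_self

/-- The primitive `s ↦ ∫_r^s ρ y`, as an operator on bounded curves. -/
noncomputable def primBCF {ρ : ℝ → ℝ} (hρ : MeasureTheory.Integrable ρ) (h0 : ∀ s, 0 ≤ ρ s)
    (r : ℝ) : (ℝ →ᵇ E) →L[ℝ] (ℝ →ᵇ E) :=
  LinearMap.mkContinuous
    { toFun := fun y => BoundedContinuousFunction.ofNormedAddCommGroup
        (fun s => ∫ σ in r..s, ρ σ • y σ)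
        (intervalIntegral.continuous_primitive
          (fun _ _ => (integrable_smul_bcf hρ y).intervalIntegrable) r) _
        (norm_integral_smul_bcf_le hρ h0 r y)
      map_add' := fun y z => by
        ext s
        simp only [BoundedContinuousFunction.coe_ofNormedAddCommGroup,
          BoundedContinuousFunction.coe_add, Pi.add_apply, smul_add]
        exact intervalIntegral.integral_add (integrable_smul_bcf hρ y).intervalIntegrable
          (integrable_smul_bcf hρ z).intervalIntegrable
      map_smul' := fun c y => by
        ext s
        simp only [BoundedContinuousFunction.coe_ofNormedAddCommGroup,
          BoundedContinuousFunction.coe_smul, RingHom.id_apply]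
        rw [← intervalIntegral.integral_smul]
        simp_rw [smul_comm c] }
    (∫ s, ρ s) (fun y => (BoundedContinuousFunction.norm_le
      (mul_nonneg (MeasureTheory.integral_nonneg h0) (norm_nonneg y))).2
      (norm_integral_smul_bcf_le hρ h0 r y))

theorem primBCF_apply {ρ : ℝ → ℝ} (hρ : MeasureTheory.Integrable ρ) (h0 : ∀ s, 0 ≤ ρ s)
    (r : ℝ) (y : ℝ →ᵇ E) (s : ℝ) : primBCF hρ h0 r y s = ∫ σ in r..s, ρ σ • y σ := rfl

theorem norm_primBCF_le {ρ : ℝ → ℝ} (hρ : MeasureTheory.Integrable ρ) (h0 : ∀ s, 0 ≤ ρ s)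
    (r : ℝ) (y : ℝ →ᵇ E) : ‖primBCF hρ h0 r y‖ ≤ (∫ s, ρ s) * ‖y‖ :=
  (BoundedContinuousFunction.norm_le
    (mul_nonneg (MeasureTheory.integral_nonneg h0) (norm_nonneg y))).2
    (norm_integral_smul_bcf_le hρ h0 r y)

end

end RadialEnd

namespace RadialEnd
open BoundedContinuousFunction

section

variable {E F G U : Type} [NormedAddCommGroup E] [NormedSpace ℝ E]
  [NormedAddCommGroup F] [NormedSpace ℝ F] [NormedAddCommGroup G] [NormedSpace ℝ G]
  [NormedAddCommGroup U] [NormedSpace ℝ U]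

theorem constBCF_norm_le (u : E) : ‖constBCF u‖ ≤ ‖u‖ := by
  rw [BoundedContinuousFunction.norm_le (norm_nonneg u)]
  intro s
  simp

/-- The solutions of `y' = ρ(s) f(s, y)`, `y(r) = u` on the whole line, as a smooth function of
the initial value `u` with values in the Banach space of bounded curves. -/
theorem exists_solution_map [CompleteSpace E] {ρ : ℝ → ℝ} (hρ : MeasureTheory.Integrable ρ)
    (h0 : ∀ s, 0 ≤ ρ s) {f : ℝ × E → E} (hf : UnifSmooth f) {C c : ℝ} (hC : 0 ≤ C)
    (h : ∀ s z, ‖dth f (s, z)‖ ≤ C) (hc0 : (∫ s, ρ s) * C ≤ c) (hc : c < 1) (r : ℝ) :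
    ∃ Y : E → (ℝ →ᵇ E), ContDiff ℝ ∞ Y ∧
      (∀ u, Y u = constBCF u + primBCF hρ h0 r (nem hf (Y u))) ∧
      ∀ u u' s, ‖Y u s - Y u' s - (u - u')‖ ≤ c / (1 - c) * ‖u - u'‖ := by
  have hA : 0 ≤ ∫ s, ρ s := MeasureTheory.integral_nonneg h0
  have hcn : 0 ≤ c := (mul_nonneg hA hC).trans hc0
  have hlip : ∀ y y' : ℝ →ᵇ E,
      ‖primBCF hρ h0 r (nem hf y) - primBCF hρ h0 r (nem hf y')‖ ≤ c * ‖y - y'‖ := by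
    intro y y'
    rw [← map_sub]
    calc _ ≤ _ := norm_primBCF_le hρ h0 r _
      _ ≤ (∫ s, ρ s) * (C * ‖y - y'‖) := by
        gcongr
        exact nem_lipschitz hf hC h y y'
      _ ≤ _ := by rw [← mul_assoc]; gcongr
  -- The integral equation is `Φ y = u`, where `Φ = id - A` with the contraction
  -- `A y = ∫ ρ f(·, y)`.
  have hL : LipschitzWith ⟨c, hcn⟩ (fun y => -(primBCF hρ h0 r (nem hf y))) := by
    apply LipschitzWith.of_dist_le_mul
    intro y y'
    rw [dist_neg_neg, dist_eq_norm, dist_eq_norm]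
    exact hlip y y'
  obtain ⟨Φ, hΦ, hΦs⟩ := exists_homeomorph_id_add (W := ℝ →ᵇ E) (c := ⟨c, hcn⟩)
    (by exact_mod_cast hc) hL
    (((primBCF hρ h0 r).contDiff.comp (contDiff_nem hf)).neg)
  have heq : ∀ u, Φ.symm (constBCF u) =
      constBCF u + primBCF hρ h0 r (nem hf (Φ.symm (constBCF u))) := by
    intro u
    have := hΦ (Φ.symm (constBCF u))
    rw [Φ.apply_symm_apply] at this
    nth_rewrite 2 [this]
    abel
  refine ⟨fun u => Φ.symm (constBCF u),
    hΦs.comp (ContinuousLinearMap.contDiff (constBCF (E := E))), heq, fun u u' s => ?_⟩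
  set y := Φ.symm (constBCF u) with hy
  set y' := Φ.symm (constBCF u') with hy'
  have e : y - y' - constBCF (u - u') =
      primBCF hρ h0 r (nem hf y) - primBCF hρ h0 r (nem hf y') := by
    have e1 : y = _ := heq u
    have e2 : y' = _ := heq u'
    rw [map_sub]
    nth_rewrite 1 [e1, e2]
    abel
  have h1 := hlip y y'
  rw [← e] at h1
  have h2 : ‖y - y'‖ ≤ ‖u - u'‖ + c * ‖y - y'‖ := by
    calc ‖y - y'‖ = ‖constBCF (u - u') + (y - y' - constBCF (u - u'))‖ := by congr 1; abel
      _ ≤ _ := (norm_add_le _ _).trans (add_le_add (constBCF_norm_le _) h1)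
  have h3 : ‖y - y'‖ ≤ ‖u - u'‖ / (1 - c) := by
    rw [le_div_iff₀ (by linarith)]
    linarith
  calc ‖y s - y' s - (u - u')‖ = ‖(y - y' - constBCF (u - u')) s‖ := by simp
    _ ≤ _ := BoundedContinuousFunction.norm_coe_le_norm _ s
    _ ≤ c * ‖y - y'‖ := h1
    _ ≤ c * (‖u - u'‖ / (1 - c)) := by gcongr
    _ = _ := by ring

/-- The functional `y ↦ ∫_0^s y`. -/
noncomputable def segBCF (s : ℝ) : (ℝ →ᵇ G) →L[ℝ] G :=
  LinearMap.mkContinuous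
    { toFun := fun y => ∫ σ in (0 : ℝ)..s, y σ
      map_add' := fun y z => intervalIntegral.integral_add
        (y.continuous.intervalIntegrable _ _) (z.continuous.intervalIntegrable _ _)
      map_smul' := fun c y => intervalIntegral.integral_smul c _ } |s| (fun y => by
        have := intervalIntegral.norm_integral_le_of_norm_le_const (a := 0) (b := s) (f := y)
          (C := ‖y‖) (fun σ _ => y.norm_coe_le_norm σ)
        rw [sub_zero, mul_comm] at this
        exact this)

theorem segBCF_apply (s : ℝ) (y : ℝ →ᵇ G) : segBCF s y = ∫ σ in (0 : ℝ)..s, y σ := rfl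

/-- The derivatives in `s` and `u` of a family of curves `Y u s` commute. If `K u` is the
derivative of the curve `Y u`, then `Y u s - Y u 0 = ∫_0^s K u` is an identity between continuous
linear functionals of `Y u` and `K u`, and can be differentiated in `u`. -/
theorem hasDerivAt_fderiv_bcf [CompleteSpace G] {Y K : U → (ℝ →ᵇ G)} (hY : Differentiable ℝ Y)
    (hK : Differentiable ℝ K) (hd : ∀ u s, HasDerivAt (Y u) (K u s) s) (u v : U) (s : ℝ) :
    HasDerivAt (fderiv ℝ Y u v) (fderiv ℝ K u v s) s := by
  have h1 : ∀ s u, evalCLM ℝ s (Y u) - evalCLM ℝ 0 (Y u) = segBCF s (K u) := by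
    intro s u
    rw [segBCF_apply]
    exact (intervalIntegral.integral_eq_sub_of_hasDerivAt (fun x _ => hd u x)
      ((K u).continuous.intervalIntegrable _ _)).symm
  have h2 : ∀ s, fderiv ℝ Y u v s = fderiv ℝ Y u v 0 + ∫ σ in (0 : ℝ)..s, fderiv ℝ K u v σ := by
    intro s
    have a1 : HasFDerivAt (fun u => evalCLM ℝ s (Y u) - evalCLM ℝ (0 : ℝ) (Y u))
        ((evalCLM ℝ s).comp (fderiv ℝ Y u) - (evalCLM ℝ (0 : ℝ)).comp (fderiv ℝ Y u)) u :=
      ((evalCLM ℝ s).hasFDerivAt.comp u (hY u).hasFDerivAt).sub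
        ((evalCLM ℝ (0 : ℝ)).hasFDerivAt.comp u (hY u).hasFDerivAt)
    have a2 : HasFDerivAt (fun u => segBCF s (K u)) ((segBCF s).comp (fderiv ℝ K u)) u :=
      (segBCF s).hasFDerivAt.comp u (hK u).hasFDerivAt
    simp_rw [h1] at a1
    have := congrArg (fun L : U →L[ℝ] G => L v) (a1.unique a2)
    simp only [_root_.sub_apply, ContinuousLinearMap.comp_apply, segBCF_apply] at this
    rw [← this]
    simp
  have h3 : HasDerivAt (fun s => fderiv ℝ Y u v 0 + ∫ σ in (0 : ℝ)..s, fderiv ℝ K u v σ)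
      (fderiv ℝ K u v s) s :=
    ((fderiv ℝ K u v).continuous.integral_hasStrictDerivAt 0 s).hasDerivAt.const_add _
  exact h3.congr_of_eventuallyEq (Eventually.of_forall h2)

/-- Joint smoothness in `(s, u)` of `Y u s`, if all the derivatives in `s` are given by curves
depending smoothly on `u`. -/
theorem contDiff_eval_of_hasDerivAt [CompleteSpace G] [FiniteDimensional ℝ U]
    (Y : ℕ → U → (ℝ →ᵇ G)) (hs : ∀ j, ContDiff ℝ ∞ (Y j))
    (hd : ∀ j u s, HasDerivAt (Y j u) (Y (j + 1) u s) s) :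
    ContDiff ℝ ∞ (fun p : ℝ × U => Y 0 p.2 p.1) := by
  rw [contDiff_infty]
  intro n
  have hcont : ∀ {Y : U → (ℝ →ᵇ G)}, Continuous Y → Continuous (fun p : ℝ × U => Y p.2 p.1) :=
    fun h => (h.comp continuous_snd).eval continuous_fst
  induction n generalizing Y with
  | zero =>
    rw [Nat.cast_zero, contDiff_zero]
    exact hcont (hs 0).continuous
  | succ n ih =>
    have hdiff : ∀ j, Differentiable ℝ (Y j) := fun j => (hs j).differentiable (by simp)
    have key : ∀ p : ℝ × U, HasFDerivAt (fun p : ℝ × U => Y 0 p.2 p.1)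
        ((ContinuousLinearMap.toSpanSingleton ℝ (Y 1 p.2 p.1)).coprod
          ((evalCLM ℝ p.1).comp (fderiv ℝ (Y 0) p.2))) p := by
      intro p
      refine (hasStrictFDerivAt_uncurry_coprod (𝕜 := ℝ) (u := p)
        (f := fun s u => Y 0 u s)
        (f₁ := fun s u => ContinuousLinearMap.toSpanSingleton ℝ (Y 1 u s))
        (f₂ := fun s u => (evalCLM ℝ s).comp (fderiv ℝ (Y 0) u)) ?_ ?_ ?_ ?_).hasFDerivAt
      · exact Eventually.of_forall fun q => (hd 0 q.2 q.1).hasFDerivAt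
      · exact Eventually.of_forall fun q =>
          (evalCLM (β := G) ℝ q.1).hasFDerivAt.comp q.2 (hdiff 0 q.2).hasFDerivAt
      · refine Continuous.continuousAt ?_
        have := hcont (hs 1).continuous
        exact (ContinuousLinearMap.toSpanSingletonLIE ℝ G).continuous.comp this
      · refine Continuous.continuousAt ?_
        rw [continuous_clm_apply]
        intro v
        exact hcont (((hs 0).continuous_fderiv (by simp)).clm_apply continuous_const)
    rw [Nat.cast_succ, contDiff_succ_iff_fderiv_apply]
    refine ⟨fun p => (key p).differentiableAt, by simp, ?_⟩
    rintro ⟨σ, v⟩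
    have e : (fun p : ℝ × U => fderiv ℝ (fun p : ℝ × U => Y 0 p.2 p.1) p (σ, v)) =
        fun p => σ • Y 1 p.2 p.1 + fderiv ℝ (Y 0) p.2 v p.1 := by
      ext1 p
      rw [(key p).fderiv]
      simp
    rw [e]
    -- Both terms are values of families of curves which again satisfy the hypotheses.
    refine (contDiff_const.smul (ih (fun j => Y (j + 1)) (fun j => hs _) fun j => hd _)).add ?_
    exact ih (fun j u => fderiv ℝ (Y j) u v)
      (fun j => ((hs j).fderiv_right (m := ∞) le_rfl).clm_apply contDiff_const)
      fun j u s => hasDerivAt_fderiv_bcf (hdiff j) (hdiff (j + 1)) (hd j) u v s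

end

end RadialEnd

namespace RadialEnd

/-! ### Locality and truncation of symbols -/
open BoundedContinuousFunction

section

variable {E F G : Type} [NormedAddCommGroup E] [NormedSpace ℝ E]
  [NormedAddCommGroup F] [NormedSpace ℝ F] [NormedAddCommGroup G] [NormedSpace ℝ G]
variable {M M' : ℝ} {V : Set E} {m m' : ℝ} {n : ℕ} {f : ℝ × E → F}

theorem contDiff_bracket : ContDiff ℝ ∞ bracket := by
  unfold bracket
  exact (contDiff_const.add (contDiff_id.pow 2)).sqrt fun x => by positivity

theorem contDiff_bracket_rpow (m : ℝ) : ContDiff ℝ ∞ (fun x => bracket x ^ m) :=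
  contDiff_bracket.rpow_const_of_ne fun x => (bracket_pos x).ne'

theorem FiberBound.of_local [LocallyCompactSpace E]
    (h : ∀ θ ∈ V, ∃ V', IsOpen V' ∧ θ ∈ V' ∧ FiberBound M V' m f) : FiberBound M V m f := by
  intro K hK hKV k
  refine hK.induction_on (p := fun s => ∃ C, ∀ x, M < x → ∀ θ ∈ s,
    ‖iteratedFDeriv ℝ k (fun u => f (x, u)) θ‖ ≤ C * bracket x ^ m) ⟨0, by simp⟩ ?_ ?_ ?_
  · rintro s t hst ⟨C, hC⟩
    exact ⟨C, fun x hx θ hθ => hC x hx θ (hst hθ)⟩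
  · rintro s t ⟨C, hC⟩ ⟨C', hC'⟩
    refine ⟨max C C', fun x hx θ hθ => ?_⟩
    have := Real.rpow_pos_of_pos (bracket_pos x) m
    rcases hθ with hθ | hθ
    · exact (hC x hx θ hθ).trans (by gcongr; exact le_max_left _ _)
    · exact (hC' x hx θ hθ).trans (by gcongr; exact le_max_right _ _)
  · intro θ hθ
    obtain ⟨V', hV', hθV', hb⟩ := h θ (hKV hθ)
    obtain ⟨K', hK', hKV', hc⟩ := local_compact_nhds (hV'.mem_nhds hθV')
    obtain ⟨C, hC⟩ := hb K' hc hKV' k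
    exact ⟨K', mem_nhdsWithin_of_mem_nhds hK', C, hC⟩

/-- The symbol estimates are local in `θ`. -/
theorem Sym.of_local [LocallyCompactSpace E]
    (h : ∀ θ ∈ V, ∃ V', IsOpen V' ∧ θ ∈ V' ∧ Sym M V' m f) : Sym M V m f := by
  have sm : ∀ {f : ℝ × E → F} {m : ℝ}, (∀ θ ∈ V, ∃ V', IsOpen V' ∧ θ ∈ V' ∧ Sym M V' m f) →
      ContDiffOn ℝ ∞ f (Ioi M ×ˢ V) := by
    rintro f m h ⟨x, θ⟩ ⟨hx, hθ⟩
    obtain ⟨V', hV', hθV', hb⟩ := h θ hθ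
    exact (contDiffAt_of_mem hV' hb.smooth hx hθV').contDiffWithinAt
  intro n
  induction n generalizing m f with
  | zero =>
    refine ⟨sm h, .of_local fun θ hθ => ?_⟩
    obtain ⟨V', h1, h2, h3⟩ := h θ hθ
    exact ⟨V', h1, h2, h3.bound⟩
  | succ n ih =>
    refine ⟨⟨sm h, .of_local fun θ hθ => ?_⟩, ih fun θ hθ => ?_⟩
    · obtain ⟨V', h1, h2, h3⟩ := h θ hθ
      exact ⟨V', h1, h2, h3.bound⟩
    · obtain ⟨V', h1, h2, h3⟩ := h θ hθ
      exact ⟨V', h1, h2, h3.deriv_x⟩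

theorem sym_zero (hV : IsOpen V) : Sym M V m (fun _ : ℝ × E => (0 : F)) := by
  intro n
  induction n generalizing m with
  | zero => exact ⟨contDiffOn_const, fun K _ _ k => ⟨0, fun x _ θ _ => by simp⟩⟩
  | succ n ih =>
    refine ⟨⟨contDiffOn_const, fun K _ _ k => ⟨0, fun x _ θ _ => by simp⟩⟩, ih.congr hV ?_⟩
    intro p _
    simp [dx]

theorem sym_of_independent (hV : IsOpen V) {φ : E → F} (hφ : ContDiffOn ℝ ∞ φ V) :
    Sym M V 0 (fun p : ℝ × E => φ p.2) := by
  have sm : ContDiffOn ℝ ∞ (fun p : ℝ × E => φ p.2) (Ioi M ×ˢ V) :=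
    hφ.comp contDiffOn_snd fun p hp => hp.2
  refine .of_deriv_x sm ?_ ((sym_zero hV).congr hV ?_)
  · intro K hK hKV k
    have hc : ContinuousOn (iteratedFDeriv ℝ k φ) K :=
      ((hφ.continuousOn_iteratedFDerivWithin (m := k) (by exact_mod_cast le_top)
        hV.uniqueDiffOn).congr fun x hx =>
          (iteratedFDerivWithin_of_isOpen k hV hx).symm).mono hKV
    obtain ⟨C, hC⟩ := hK.exists_bound_of_continuousOn hc
    exact ⟨C, fun x _ θ hθ => by simpa using hC θ hθ⟩
  · rintro ⟨x, θ⟩ ⟨hx, hθ⟩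
    have d1 := (contDiffAt_of_mem hV sm hx hθ).differentiableAt (n := ∞) (by simp)
    exact (hasDerivAt_slice d1).unique
      (hasDerivAt_const x (φ θ))

theorem sym_const (hV : IsOpen V) (c : F) : Sym M V 0 (fun _ : ℝ × E => c) :=
  sym_of_independent hV contDiffOn_const

/-- Only the behaviour near infinity matters for a function which is smooth up to the
boundary. -/
theorem Sym.of_tail (hV : IsOpen V) {M₀ : ℝ} (hM : M₀ < M)
    (hf : ContDiffOn ℝ ∞ f (Ioi M₀ ×ˢ V)) (h : Sym M' V m f) : Sym M V m f := by
  rw [sym_iff_iterate hV] at h ⊢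
  refine ⟨hf.mono (prod_mono (Ioi_subset_Ioi hM.le) subset_rfl), fun j K hK hKV k => ?_⟩
  obtain ⟨C, hC⟩ := h.2 j K hK hKV k
  have hc := (iteratedFDeriv_slice hV (contDiffOn_iterate_dx hV hf j) k).1.continuousOn.mono
    (prod_mono (fun x (hx : x ∈ Icc M M') => hM.trans_le hx.1) hKV)
  have hb : Continuous (fun p : ℝ × E => bracket p.1 ^ (-(m - j))) :=
    (contDiff_bracket_rpow _).continuous.comp continuous_fst
  obtain ⟨C', hC'⟩ := (isCompact_Icc.prod hK).exists_bound_of_continuousOn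
    (hb.continuousOn.smul hc)
  refine ⟨max C C', fun x hx θ hθ => ?_⟩
  have hp := Real.rpow_pos_of_pos (bracket_pos x) (m - j)
  rcases lt_or_ge M' x with h1 | h1
  · exact (hC x h1 θ hθ).trans (by gcongr; exact le_max_left _ _)
  · have : ‖bracket x ^ (-(m - j)) • iteratedFDeriv ℝ k (fun u => dx^[j] f (x, u)) θ‖ ≤ C' :=
      hC' (x, θ) ⟨⟨hx.le, h1⟩, hθ⟩
    rw [norm_smul, Real.norm_of_nonneg (Real.rpow_nonneg (bracket_pos x).le _), Real.rpow_neg (bracket_pos x).le,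
      inv_mul_le_iff₀ hp] at this
    rw [mul_comm]
    exact this.trans (by gcongr; exact le_max_right _ _)

/-- Globally defined symbols with support in `[M, ∞) × C`. -/
structure SuppSym (M : ℝ) (C : Set E) (m : ℝ) (f : ℝ × E → F) : Prop where
  smooth : ContDiff ℝ ∞ f
  zero : ∀ p, p ∉ Ici M ×ˢ C → f p = 0
  sym : Sym (M - 1) univ m f

variable {C : Set E}

theorem fderiv_eq_zero_of_support (hC : IsClosed C) (h : ∀ p, p ∉ Ici M ×ˢ C → f p = 0) (p : ℝ × E)
    (hp : p ∉ Ici M ×ˢ C) : fderiv ℝ f p = 0 := by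
  have : f =ᶠ[𝓝 p] fun _ => 0 := by
    filter_upwards [(isClosed_Ici.prod hC).isOpen_compl.mem_nhds hp] with q hq using h q hq
  rw [this.fderiv_eq]
  simp

theorem SuppSym.deriv_x (hC : IsClosed C) (h : SuppSym M C m f) : SuppSym M C (m - 1) (dx f) :=
  ⟨(h.smooth.fderiv_right (m := ∞) le_rfl).clm_apply contDiff_const,
    fun p hp => by simp [dx, fderiv_eq_zero_of_support hC h.zero p hp], h.sym.deriv_x⟩

theorem SuppSym.deriv_th (hC : IsClosed C) (h : SuppSym M C m f) : SuppSym M C m (dth f) :=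
  ⟨(h.smooth.fderiv_right (m := ∞) le_rfl).clm_comp contDiff_const,
    fun p hp => by simp [dth, fderiv_eq_zero_of_support hC h.zero p hp],
    h.sym.deriv_th isOpen_univ⟩

/-- The derivative of `s ↦ f(s, y(s))` when `y' = f₁(s, y)`. -/
theorem SuppSym.material (hC : IsClosed C) {f₁ : ℝ × E → E} (h : SuppSym M C m f)
    (h₁ : SuppSym M C (-1) f₁) : SuppSym M C (m - 1) (fun p => dx f p + dth f p (f₁ p)) := by
  have hx := h.deriv_x hC
  have ht := h.deriv_th hC
  refine ⟨hx.smooth.add (ht.smooth.clm_apply h₁.smooth), fun p hp => ?_, ?_⟩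
  · rw [hx.zero p hp, ht.zero p hp]
    simp
  · exact hx.sym.add isOpen_univ
      (ht.sym.bilin isOpen_univ (ContinuousLinearMap.id ℝ (E →L[ℝ] F)) h₁.sym)

theorem SuppSym.mono_order (h : SuppSym M C m f) (hm : m ≤ m') : SuppSym M C m' f :=
  ⟨h.smooth, h.zero, h.sym.mono_order hm⟩

theorem SuppSym.bound (hC : IsCompact C) (h : SuppSym M C m f) (k : ℕ) :
    ∃ B, 0 ≤ B ∧ ∀ s z, ‖iteratedFDeriv ℝ k (fun z => f (s, z)) z‖ ≤ B * bracket s ^ m := by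
  obtain ⟨B, hB⟩ := h.sym.bound C hC (subset_univ _) k
  refine ⟨|B|, abs_nonneg B, fun s z => ?_⟩
  have hp := Real.rpow_pos_of_pos (bracket_pos s) m
  by_cases hz : s ∈ Ici M ∧ z ∈ C
  · exact (hB s (by have : M ≤ s := hz.1; linarith) z hz.2).trans (by gcongr; exact le_abs_self B)
  · have : (fun z => f (s, z)) =ᶠ[𝓝 z] fun _ => 0 := by
      have hzc : (s, z) ∈ (Ici M ×ˢ C)ᶜ := fun h => hz h
      have := (isClosed_Ici.prod hC.isClosed).isOpen_compl.mem_nhds hzc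
      have hcont : ContinuousAt (fun z : E => (s, z)) z := by fun_prop
      filter_upwards [hcont.preimage_mem_nhds this] with y hy using h.zero _ hy
    rw [(this.iteratedFDeriv ℝ k).self_of_nhds]
    simp only [iteratedFDeriv_fun_zero, Pi.zero_apply, norm_zero]
    positivity

theorem SuppSym.unifSmooth (hC : IsCompact C) (h : SuppSym M C m f) {a : ℝ} (ha : a + m ≤ 0) :
    UnifSmooth (fun p => bracket p.1 ^ a • f p) := by
  refine ⟨((contDiff_bracket_rpow a).comp contDiff_fst).smul h.smooth, fun k => ?_⟩
  obtain ⟨B, hB, hb⟩ := h.bound hC k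
  refine ⟨B, fun s z => ?_⟩
  have hs : ContDiffAt ℝ k (fun z => f (s, z)) z :=
    ((h.smooth.comp (contDiff_prodMk_right s)).contDiffAt).of_le (by exact_mod_cast le_top)
  have := iteratedFDeriv_const_smul_apply (a := bracket s ^ a) hs
  have e : (fun z => bracket s ^ a • f (s, z)) = bracket s ^ a • fun z => f (s, z) := rfl
  simp only [e, this, norm_smul]
  have hp := Real.rpow_pos_of_pos (bracket_pos s) a
  rw [Real.norm_of_nonneg hp.le]
  calc _ ≤ bracket s ^ a * (B * bracket s ^ m) := by gcongr; exact hb s z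
    _ = B * bracket s ^ (a + m) := by rw [Real.rpow_add (bracket_pos s)]; ring
    _ ≤ B * 1 := by
      gcongr
      exact Real.rpow_le_one_of_one_le_of_nonpos (one_le_bracket s) ha
    _ = B := mul_one B

/-- Truncation of a symbol to a globally defined one. -/
theorem suppSym_cutoff [FiniteDimensional ℝ E] {z₀ : E} {R₀ : ℝ} (χ : ContDiffBump z₀)
    (hχ : χ.rOut < R₀) (h : Sym M' (Metric.ball z₀ R₀) m f) (hM : M' ≤ M - 1) :
    SuppSym M (Metric.closedBall z₀ χ.rOut) m
      (fun p => (Real.smoothTransition (p.1 - M) * χ p.2) • f p) := by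
  have hsub : Metric.closedBall z₀ χ.rOut ⊆ Metric.ball z₀ R₀ := Metric.closedBall_subset_ball hχ
  have hzero : ∀ p, p ∉ Ici M ×ˢ Metric.closedBall z₀ χ.rOut →
      (Real.smoothTransition (p.1 - M) * χ p.2) • f p = 0 := by
    intro p hp
    rw [mem_prod, not_and_or] at hp
    rcases hp with hp | hp
    · have : p.1 < M := not_le.1 hp
      rw [Real.smoothTransition.zero_of_nonpos (by linarith)]
      simp
    · have : χ p.2 = 0 := χ.zero_of_le_dist (le_of_lt (by simpa using hp))
      simp [this]
  have hT : ContDiff ℝ ∞ (fun p : ℝ × E => Real.smoothTransition (p.1 - M) * χ p.2) :=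
    (Real.smoothTransition.contDiff.comp (contDiff_fst.sub contDiff_const)).mul
      (χ.contDiff.comp contDiff_snd)
  have hsm : ContDiff ℝ ∞ (fun p => (Real.smoothTransition (p.1 - M) * χ p.2) • f p) := by
    rw [contDiff_iff_contDiffAt]
    intro p
    by_cases hp : p ∈ Ici M ×ˢ Metric.closedBall z₀ χ.rOut
    · have hp1 : M ≤ p.1 := hp.1
      exact hT.contDiffAt.smul (contDiffAt_of_mem Metric.isOpen_ball h.smooth (by linarith)
        (hsub hp.2))
    · have : (fun p => (Real.smoothTransition (p.1 - M) * χ p.2) • f p) =ᶠ[𝓝 p] fun _ => 0 := by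
        filter_upwards [(isClosed_Ici.prod Metric.isClosed_closedBall).isOpen_compl.mem_nhds hp]
          with q hq using hzero q hq
      exact contDiffAt_const.congr_of_eventuallyEq this
  refine ⟨hsm, hzero, ?_⟩
  refine Sym.of_tail (M₀ := M - 2) (M' := M + 1) isOpen_univ (by linarith) hsm.contDiffOn ?_
  refine Sym.of_local fun θ _ => ?_
  by_cases hθ : θ ∈ Metric.ball z₀ R₀
  · refine ⟨_, Metric.isOpen_ball, hθ, ?_⟩
    have h1 := (sym_of_independent (M := M + 1) (Metric.isOpen_ball (x := z₀) (ε := R₀))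
      χ.contDiff.contDiffOn).bilin Metric.isOpen_ball (ContinuousLinearMap.lsmul ℝ ℝ)
      (h.mono_dom (M' := M + 1) (by linarith) subset_rfl)
    rw [zero_add] at h1
    refine h1.congr Metric.isOpen_ball fun p hp => ?_
    have : M + 1 < p.1 := hp.1
    simp only [ContinuousLinearMap.lsmul_apply]
    rw [Real.smoothTransition.one_of_one_le (by linarith), one_mul]
  · refine ⟨_, Metric.isClosed_closedBall.isOpen_compl, fun h => hθ (hsub h), ?_⟩
    refine (sym_zero Metric.isClosed_closedBall.isOpen_compl).congr
      Metric.isClosed_closedBall.isOpen_compl fun p hp => hzero p fun h => hp.2 h.2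

theorem integrable_bracket {τ : ℝ} (hτ : 0 < τ) :
    MeasureTheory.Integrable (fun s => bracket s ^ (-1 - τ)) := by
  have := integrable_rpow_neg_one_add_norm_sq (E := ℝ) (μ := MeasureTheory.volume) (r := 1 + τ)
    (by simpa using hτ)
  refine this.congr (Eventually.of_forall fun s => ?_)
  simp only [bracket, Real.sqrt_eq_rpow, Real.norm_eq_abs, sq_abs]
  rw [← Real.rpow_mul (by positivity)]
  congr 1
  ring

theorem integral_bracket_tail_le {τ : ℝ} (hτ : 0 < τ) {s : ℝ} (hs : 1 ≤ s) :
    ∫ σ in Ioi s, bracket σ ^ (-1 - τ) ≤ 2 ^ τ / τ * bracket s ^ (-τ) := by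
  have h0 : 0 < s := by linarith
  have h1 : ∫ σ in Ioi s, bracket σ ^ (-1 - τ) ≤ ∫ σ in Ioi s, σ ^ (-1 - τ) := by
    refine MeasureTheory.setIntegral_mono_on (integrable_bracket hτ).integrableOn
      (integrableOn_Ioi_rpow_of_lt (by linarith) h0) measurableSet_Ioi fun σ hσ => ?_
    have hσ0 : 0 < σ := h0.trans hσ
    exact Real.rpow_le_rpow_of_nonpos hσ0 ((le_abs_self σ).trans (abs_le_bracket σ)) (by linarith)
  rw [integral_Ioi_rpow_of_lt (by linarith) h0] at h1
  have h2 : s ^ (-τ) ≤ 2 ^ τ * bracket s ^ (-τ) := by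
    have hb : bracket s / 2 ≤ s := by
      rw [div_le_iff₀ two_pos]
      unfold bracket
      rw [Real.sqrt_le_left (by linarith)]
      nlinarith
    have := Real.rpow_le_rpow_of_nonpos (by have := bracket_pos s; positivity) hb
      (z := -τ) (by linarith)
    rw [Real.div_rpow (bracket_pos s).le (by norm_num), Real.rpow_neg (by norm_num : (0:ℝ) ≤ 2)]
      at this
    rw [div_inv_eq_mul] at this
    linarith
  calc _ ≤ _ := h1
    _ = s ^ (-τ) / τ := by
      rw [show -1 - τ + 1 = -τ by ring, neg_div_neg_eq]
    _ ≤ 2 ^ τ * bracket s ^ (-τ) / τ := by gcongr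
    _ = _ := by ring

theorem tendsto_bracket_rpow {τ : ℝ} (hτ : 0 < τ) :
    Tendsto (fun s => bracket s ^ (-τ)) atTop (𝓝 0) := by
  refine squeeze_zero' (Eventually.of_forall fun s => Real.rpow_nonneg (bracket_pos s).le _) ?_
    (tendsto_rpow_neg_atTop hτ)
  filter_upwards [eventually_gt_atTop 0] with s hs
  exact Real.rpow_le_rpow_of_nonpos hs ((le_abs_self s).trans (abs_le_bracket s)) (by linarith)

end

end RadialEnd

namespace RadialEnd

/-! ### The flow of a vector field which is an integrable symbol -/
open BoundedContinuousFunction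

section

variable {E : Type} [NormedAddCommGroup E] [NormedSpace ℝ E] [FiniteDimensional ℝ E]
variable {M M' : ℝ} {m m' τ : ℝ} {f : ℝ × E → E} {C : Set E}

/-- The weight `⟨s⟩^{-1-τ}` cut off at `M`. -/
noncomputable def weight (τ M s : ℝ) : ℝ := (Ici M).indicator (fun s => bracket s ^ (-1 - τ)) s

theorem integrable_weight (hτ : 0 < τ) (M : ℝ) : MeasureTheory.Integrable (weight τ M) :=
  (integrable_bracket hτ).indicator measurableSet_Ici

theorem weight_nonneg (τ M s : ℝ) : 0 ≤ weight τ M s :=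
  indicator_nonneg (fun s _ => Real.rpow_nonneg (bracket_pos s).le _) s

theorem weight_le (τ M s : ℝ) : weight τ M s ≤ bracket s ^ (-1 - τ) :=
  indicator_le_self' (fun s _ => Real.rpow_nonneg (bracket_pos s).le _) s

theorem integral_weight_le (hτ : 0 < τ) (hM : 1 ≤ M) :
    ∫ s, weight τ M s ≤ 2 ^ τ / τ * bracket M ^ (-τ) := by
  have : ∫ s, weight τ M s = ∫ s in Ici M, bracket s ^ (-1 - τ) :=
    MeasureTheory.integral_indicator measurableSet_Ici
  rw [this, MeasureTheory.integral_Ici_eq_integral_Ioi]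
  exact integral_bracket_tail_le hτ hM

omit [FiniteDimensional ℝ E] in
theorem weight_smul (hf : SuppSym M C m f) (p : ℝ × E) :
    weight τ M p.1 • (bracket p.1 ^ (1 + τ) • f p) = f p := by
  by_cases hp : p.1 ∈ Ici M
  · rw [weight, indicator_of_mem hp, smul_smul, ← Real.rpow_add (bracket_pos _)]
    simp
  · rw [hf.zero p fun h => hp h.1]
    simp

/-- The sequence `f₁ = f`, `f_{j+1} = ∂ₛ f_j + ∂_z f_j · f`: along the solutions of `z' = f(s, z)`
the derivative of order `j` is `f_j(s, z)`. -/
noncomputable def material (f : ℝ × E → E) : ℕ → ℝ × E → E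
  | 0 => f
  | j + 1 => fun p => dx (material f j) p + dth (material f j) p (f p)

omit [FiniteDimensional ℝ E] in
theorem suppSym_material (hC : IsCompact C) (hτ : 0 < τ) (hf : SuppSym M C (-1 - τ) f) (j : ℕ) :
    SuppSym M C (-1 - τ - j) (material f j) := by
  induction j with
  | zero => simpa [material] using hf
  | succ j ih =>
    have := ih.material hC.isClosed (hf.mono_order (by linarith))
    rwa [show -1 - τ - ↑(j + 1) = -1 - τ - j - 1 by push_cast; ring]

omit [FiniteDimensional ℝ E] in
theorem suppSym_unifSmooth_material (hC : IsCompact C) (hτ : 0 < τ) (hf : SuppSym M C (-1 - τ) f)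
    (j : ℕ) : UnifSmooth (material f j) := by
  have := (suppSym_material hC hτ hf j).unifSmooth hC (a := 0) (by
    have : (0 : ℝ) ≤ j := Nat.cast_nonneg j
    linarith)
  simpa using this

/-- The flow of an integrable symbol: existence for all times, smooth dependence, symbol estimates
and smooth convergence at infinity. -/
theorem exists_flow_suppSym (hC : IsCompact C) (hτ : 0 < τ) (hf : SuppSym M C (-1 - τ) f)
    {B c : ℝ} (hB : 0 ≤ B) (hM : 1 ≤ M)
    (h0 : ∀ s z, ‖f (s, z)‖ ≤ B * bracket s ^ (-1 - τ))
    (h1 : ∀ s z, ‖dth f (s, z)‖ ≤ B * bracket s ^ (-1 - τ))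
    (hc0 : 2 ^ τ / τ * bracket M ^ (-τ) * B ≤ c) (hc : c < 1) (r : ℝ) :
    ∃ (Z : ℝ × E → E) (Zinf : E → E), ContDiff ℝ ∞ Z ∧ ContDiff ℝ ∞ Zinf ∧ (∀ u, Z (r, u) = u) ∧
      (∀ s u, ‖Z (s, u) - u‖ ≤ c) ∧
      (∀ s u u', ‖Z (s, u) - Z (s, u') - (u - u')‖ ≤ c / (1 - c) * ‖u - u'‖) ∧
      (∀ u, Tendsto (fun s => Z (s, u)) atTop (𝓝 (Zinf u))) ∧
      (∀ s u, HasDerivAt (fun s => Z (s, u)) (f (s, Z (s, u))) s) ∧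
      Sym 1 univ (-τ) (fun p : ℝ × E => Z p - Zinf p.2) := by
  -- `F` has bounded derivatives in `z`; the decay of `f` is moved to the weight of the integrals.
  set F : ℝ × E → E := fun p => bracket p.1 ^ (1 + τ) • f p with hF
  have hFu : UnifSmooth F := hf.unifSmooth hC (by linarith)
  have hbr : ∀ s, bracket s ^ (1 + τ) * (B * bracket s ^ (-1 - τ)) = B := by
    intro s
    rw [mul_left_comm, ← Real.rpow_add (bracket_pos s)]
    simp
  have hF0 : ∀ s z, ‖F (s, z)‖ ≤ B := by
    intro s z
    have hp := Real.rpow_pos_of_pos (bracket_pos s) (1 + τ)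
    rw [hF, norm_smul, Real.norm_of_nonneg hp.le, ← hbr s]
    gcongr
    exact h0 s z
  have hF1 : ∀ s z, ‖dth F (s, z)‖ ≤ B := by
    intro s z
    have hp := Real.rpow_pos_of_pos (bracket_pos s) (1 + τ)
    have e : dth F (s, z) = bracket s ^ (1 + τ) • dth f (s, z) := by
      have d1 := (hasFDerivAt_slice (hf.smooth.differentiable (by simp) (s, z))).const_smul
        (bracket s ^ (1 + τ))
      have d2 := hasFDerivAt_slice (hFu.1.differentiable (by simp) (s, z))
      exact d2.unique d1
    rw [e, norm_smul, Real.norm_of_nonneg hp.le, ← hbr s]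
    gcongr
    exact h1 s z
  have hρ := integrable_weight hτ M
  have hρ0 := weight_nonneg τ M
  have hA : (∫ s, weight τ M s) * B ≤ c :=
    (mul_le_mul_of_nonneg_right (integral_weight_le hτ hM) hB).trans hc0
  obtain ⟨Y, hYs, hY, hYl⟩ := exists_solution_map hρ hρ0 hFu hB hF1 hA hc r
  have hYint : ∀ u s, Y u s = u + ∫ σ in r..s, f (σ, Y u σ) := by
    intro u s
    have := congrArg (fun y : ℝ →ᵇ E => y s) (hY u)
    simp only [BoundedContinuousFunction.coe_add, Pi.add_apply, constBCF_apply, primBCF_apply,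
      nem_apply] at this
    rw [this]
    congr 1
    refine intervalIntegral.integral_congr fun σ _ => ?_
    exact weight_smul hf (σ, Y u σ)
  have hYd : ∀ u s, HasDerivAt (Y u) (f (s, Y u s)) s := by
    intro u s
    have hcont : Continuous fun σ => f (σ, Y u σ) :=
      hf.smooth.continuous.comp (continuous_id.prodMk (Y u).continuous)
    have := (hcont.integral_hasStrictDerivAt r s).hasDerivAt.const_add u
    exact this.congr_of_eventuallyEq (Eventually.of_forall (hYint u))
  -- the curves of all derivatives in `s`
  set D : ℕ → E → (ℝ →ᵇ E) := fun j => Nat.casesOn j Y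
    (fun j u => nem (suppSym_unifSmooth_material hC hτ hf j) (Y u)) with hD
  have hDd : ∀ j u s, HasDerivAt (D j u) (D (j + 1) u s) s := by
    intro j u s
    cases j with
    | zero => exact hYd u s
    | succ j =>
      have d1 := ((suppSym_material hC hτ hf j).smooth.differentiable (by simp)
        (s, Y u s)).hasFDerivAt.comp_hasDerivAt s ((hasDerivAt_id s).prodMk (hYd u s))
      rw [fderiv_eq_dx_dth, one_smul] at d1
      exact d1
  have hDs : ∀ j, ContDiff ℝ ∞ (D j) := by
    intro j
    cases j with
    | zero => exact hYs
    | succ j => exact (contDiff_nem (suppSym_unifSmooth_material hC hτ hf j)).comp hYs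
  set Z : ℝ × E → E := fun p => Y p.2 p.1 with hZ
  have hZs : ContDiff ℝ ∞ Z := contDiff_eval_of_hasDerivAt D hDs hDd
  set Zinf : E → E := fun u => u + intBCF hρ hρ0 (Ioi r) (nem hFu (Y u)) with hZinf
  have hW : ContDiff ℝ ∞ (fun u => nem hFu (Y u)) := (contDiff_nem hFu).comp hYs
  have hZinfs : ContDiff ℝ ∞ Zinf := contDiff_id.add
    ((ContinuousLinearMap.contDiff (intBCF (E := E) hρ hρ0 (Ioi r))).comp hW)
  -- The difference with the limit is minus the tail `∫_s^∞ f(σ, Z(σ, u)) dσ`, a linear functional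
  -- of order `⟨s⟩^{-τ}` of a curve which depends smoothly on `u`.
  have hdiff : ∀ s u, Z (s, u) - Zinf u = -intBCF hρ hρ0 (Ioi s) (nem hFu (Y u)) := by
    intro s u
    have e := congrArg (fun y : ℝ →ᵇ E => y s) (hY u)
    simp only [BoundedContinuousFunction.coe_add, Pi.add_apply, constBCF_apply, primBCF_apply] at e
    have hi := integrable_smul_bcf hρ (nem hFu (Y u))
    simp only [hZ, hZinf, intBCF_apply]
    rw [e, ← intervalIntegral.integral_Ioi_sub_Ioi' hi.integrableOn hi.integrableOn]
    abel
  have hnorm : ∀ s, 1 < s →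
      ‖(intBCF hρ hρ0 (Ioi s) : (ℝ →ᵇ E) →L[ℝ] E)‖ ≤ 2 ^ τ / τ * bracket s ^ (-τ) := by
    intro s hs
    refine (norm_intBCF_le hρ hρ0 _).trans (le_trans ?_ (integral_bracket_tail_le hτ hs.le))
    exact MeasureTheory.setIntegral_mono hρ.integrableOn (integrable_bracket hτ).integrableOn
      (weight_le τ M)
  have hZu : ∀ s u, ‖Z (s, u) - u‖ ≤ c := by
    intro s u
    have e := congrArg (fun y : ℝ →ᵇ E => y s) (hY u)
    simp only [BoundedContinuousFunction.coe_add, Pi.add_apply, constBCF_apply] at e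
    have e2 : Z (s, u) - u = primBCF hρ hρ0 r (nem hFu (Y u)) s := by
      simp only [hZ]
      rw [e]
      abel
    rw [e2]
    refine (BoundedContinuousFunction.norm_coe_le_norm _ s).trans ((norm_primBCF_le _ _ _ _).trans
      (le_trans ?_ hA))
    refine mul_le_mul_of_nonneg_left ?_ (MeasureTheory.integral_nonneg hρ0)
    exact (BoundedContinuousFunction.norm_le hB).2 fun s => hF0 s _
  have hZF : FiberBound 1 univ 0 Z := by
    intro K hK _ k
    obtain ⟨C', hC'⟩ := hK.exists_bound_of_continuousOn
      (hYs.continuous_iteratedFDeriv (m := k) (by exact_mod_cast le_top)).continuousOn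
    refine ⟨‖(1:ℝ)‖ * C', fun s _ u hu => ?_⟩
    have h2 := (evalCLM (β := E) ℝ s).norm_iteratedFDeriv_comp_left (hYs.contDiffAt (x := u))
      (n := k) (by exact_mod_cast le_top)
    have h3 : ‖(evalCLM ℝ s : (ℝ →ᵇ E) →L[ℝ] E)‖ ≤ ‖(1:ℝ)‖ := by
      refine ContinuousLinearMap.opNorm_le_bound _ (norm_nonneg _) fun y => ?_
      rw [norm_one, one_mul]
      exact y.norm_coe_le_norm s
    rw [Real.rpow_zero, mul_one]
    exact h2.trans (mul_le_mul h3 (hC' u hu) (norm_nonneg _) (norm_nonneg _))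
  have hmap : ∀ K : Set E, IsCompact K → K ⊆ univ → ∃ K', IsCompact K' ∧ K' ⊆ univ ∧
      ∀ x, 1 < x → ∀ u ∈ K, Z (x, u) ∈ K' := by
    intro K hK _
    obtain ⟨b, hb⟩ := hK.isBounded.exists_norm_le
    have := FiniteDimensional.proper_real E
    refine ⟨Metric.closedBall 0 (b + c), isCompact_closedBall _ _, subset_univ _, fun x _ u hu => ?_⟩
    rw [mem_closedBall_zero_iff]
    calc ‖Z (x, u)‖ = ‖u + (Z (x, u) - u)‖ := by congr 1; abel
      _ ≤ _ := (norm_add_le _ _).trans (add_le_add (hb u hu) (hZu x u))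
  refine ⟨Z, Zinf, hZs, hZinfs, fun u => ?_, hZu, fun s u u' => hYl u u' s, fun u => ?_,
    fun s u => hYd u s, ?_⟩
  · simp only [hZ]
    rw [hYint u r]
    simp
  · rw [tendsto_iff_norm_sub_tendsto_zero]
    have ht := ((tendsto_bracket_rpow hτ).const_mul (2 ^ τ / τ)).mul_const ‖nem hFu (Y u)‖
    rw [mul_zero, zero_mul] at ht
    refine squeeze_zero' (Eventually.of_forall fun s => norm_nonneg _) ?_ ht
    filter_upwards [eventually_gt_atTop 1] with s hs
    rw [hdiff, norm_neg]
    exact (ContinuousLinearMap.le_opNorm _ _).trans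
      (mul_le_mul_of_nonneg_right (hnorm s hs) (norm_nonneg _))
  · have hsm : ContDiff ℝ ∞ (fun p : ℝ × E => Z p - Zinf p.2) := hZs.sub (hZinfs.comp contDiff_snd)
    -- The derivatives in `s` are the functions `material f j`, evaluated along the flow.
    have hit : ∀ j : ℕ, dx^[j + 1] (fun p : ℝ × E => Z p - Zinf p.2) =
        fun p => material f j (p.1, Z p) := by
      intro j
      induction j with
      | zero =>
        ext1 ⟨s, u⟩
        have := (hasDerivAt_slice (hsm.differentiable (by simp) (s, u)))
        exact this.unique ((hYd u s).sub_const (Zinf u))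
      | succ j ih =>
        rw [Function.iterate_succ_apply', ih]
        ext1 ⟨s, u⟩
        have hsm2 : ContDiff ℝ ∞ (fun p => material f j (p.1, Z p)) :=
          (suppSym_material hC hτ hf j).smooth.comp (contDiff_fst.prodMk hZs)
        have := (hasDerivAt_slice (hsm2.differentiable (by simp) (s, u)))
        exact this.unique (hDd (j + 1) u s)
    rw [sym_iff_iterate isOpen_univ]
    refine ⟨hsm.contDiffOn, fun j => ?_⟩
    cases j with
    | zero =>
      intro K hK _ k
      obtain ⟨C', hC'⟩ := hK.exists_bound_of_continuousOn
        (hW.continuous_iteratedFDeriv (m := k) (by exact_mod_cast le_top)).continuousOn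
      refine ⟨2 ^ τ / τ * C', fun s hs u hu => ?_⟩
      have e : (fun u => dx^[0] (fun p : ℝ × E => Z p - Zinf p.2) (s, u)) =
          (-intBCF hρ hρ0 (Ioi s) : (ℝ →ᵇ E) →L[ℝ] E) ∘ fun u => nem hFu (Y u) := by
        ext1 u
        exact hdiff s u
      rw [e]
      refine (ContinuousLinearMap.norm_iteratedFDeriv_comp_left _ (hW.contDiffAt (x := u))
        (n := k) (by exact_mod_cast le_top)).trans ?_
      rw [norm_neg, Nat.cast_zero, sub_zero, mul_right_comm]
      have := Real.rpow_pos_of_pos (bracket_pos s) (-τ)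
      exact mul_le_mul (hnorm s hs) (hC' u hu) (norm_nonneg _) (by positivity)
    | succ j =>
      rw [hit j]
      have hS := suppSym_material hC hτ hf j
      have hS2 : FiberBound 1 univ (-τ - ↑(j + 1)) (material f j) := by
        intro K hK _ k
        obtain ⟨B', hB', hb⟩ := hS.bound hC k
        exact ⟨B', fun s _ z _ => (hb s z).trans
          (mul_le_mul_of_nonneg_left (bracket_rpow_mono (by push_cast; linarith) s) hB')⟩
      exact hS2.comp isOpen_univ isOpen_univ hS.smooth.contDiffOn hZF hZs.contDiffOn hmap

/-- The flow of a symbol of order `-1-τ` defined near `z₀`, for initial times `r` large enough. -/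
theorem exists_symbol_flow {z₀ : E} {R₀ : ℝ} (hR₀ : 0 < R₀) (hτ : 0 < τ)
    (hf : Sym M (Metric.ball z₀ R₀) (-1 - τ) f) {δ : ℝ} (hδ : 0 < δ) :
    ∃ M₁, M + 1 < M₁ ∧ 2 < M₁ ∧ ∀ r, M₁ ≤ r → ∃ (Z : ℝ × E → E) (Zinf : E → E),
      ContDiff ℝ ∞ Z ∧ ContDiff ℝ ∞ Zinf ∧ (∀ u, Z (r, u) = u) ∧
      (∀ s u, ‖Z (s, u) - u‖ ≤ δ) ∧
      (∀ s u u', ‖Z (s, u) - Z (s, u') - (u - u')‖ ≤ δ * ‖u - u'‖) ∧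
      (∀ s u, ‖dx Z (s, u)‖ ≤ δ) ∧
      (∀ u, Tendsto (fun s => Z (s, u)) atTop (𝓝 (Zinf u))) ∧
      (∀ s, r - 1 < s → ∀ u ∈ Metric.closedBall z₀ (R₀ / 4),
        Z (s, u) ∈ Metric.closedBall z₀ (R₀ / 2) ∧
        HasDerivAt (fun s => Z (s, u)) (f (s, Z (s, u))) s) ∧
      Sym 1 univ (-τ) (fun p : ℝ × E => Z p - Zinf p.2) := by
  set χ : ContDiffBump z₀ := ⟨R₀ / 2, 3 * R₀ / 4, by linarith, by linarith⟩ with hχ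
  have hχ1 : χ.rOut < R₀ := by change 3 * R₀ / 4 < R₀; linarith
  have := FiniteDimensional.proper_real E
  have hC : IsCompact (Metric.closedBall z₀ χ.rOut) := isCompact_closedBall _ _
  -- The bound `B` is taken from a cut-off `f₀` at `M + 1`. It is then valid for the cut-offs `f₁`
  -- at all `L ≥ M + 2`, so that `L` may be chosen in terms of `B`.
  have hS0 := suppSym_cutoff (M := M + 1) χ hχ1 hf (by linarith)
  set f₀ : ℝ × E → E := fun p => (Real.smoothTransition (p.1 - (M + 1)) * χ p.2) • f p
  obtain ⟨B0, hB0, hb0⟩ := hS0.bound hC 0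
  obtain ⟨B1, hB1, hb1⟩ := hS0.bound hC 1
  set B := max B0 B1
  have hB : 0 ≤ B := hB0.trans (le_max_left _ _)
  have hbnd0 : ∀ s z, ‖f₀ (s, z)‖ ≤ B * bracket s ^ (-1 - τ) := by
    intro s z
    have h1 := hb0 s z
    rw [norm_iteratedFDeriv_zero] at h1
    have := Real.rpow_pos_of_pos (bracket_pos s) (-1 - τ)
    exact h1.trans (by gcongr; exact le_max_left _ _)
  have hbnd1 : ∀ s z, ‖dth f₀ (s, z)‖ ≤ B * bracket s ^ (-1 - τ) := by
    intro s z
    have h1 := hb1 s z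
    rw [norm_iteratedFDeriv_one, congrFun (fderiv_slice hS0.smooth s) z] at h1
    have := Real.rpow_pos_of_pos (bracket_pos s) (-1 - τ)
    exact h1.trans (by gcongr; exact le_max_right _ _)
  set c : ℝ := min (1 / 2) (min (δ / 2) (R₀ / 4)) with hc
  have hc0 : 0 < c := by positivity
  have hc1 : c ≤ 1 / 2 := min_le_left _ _
  have hc2 : c ≤ δ / 2 := (min_le_right _ _).trans (min_le_left _ _)
  have hc3 : c ≤ R₀ / 4 := (min_le_right _ _).trans (min_le_right _ _)
  have ht1 : ∀ᶠ s in atTop, 2 ^ τ / τ * bracket s ^ (-τ) * B < c := by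
    have := ((tendsto_bracket_rpow hτ).const_mul (2 ^ τ / τ)).mul_const B
    rw [mul_zero, zero_mul] at this
    exact this.eventually_lt_const hc0
  have ht2 : ∀ᶠ s in atTop, B * bracket s ^ (-τ) < δ := by
    have := (tendsto_bracket_rpow hτ).const_mul B
    rw [mul_zero] at this
    exact this.eventually_lt_const hδ
  obtain ⟨N, hN⟩ := eventually_atTop.1 (ht1.and ht2)
  set L : ℝ := max N (max (M + 2) 1) with hL
  have hL1 : N ≤ L := le_max_left _ _
  have hL2 : M + 2 ≤ L := (le_max_left _ _).trans (le_max_right _ _)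
  have hL3 : 1 ≤ L := (le_max_right _ _).trans (le_max_right _ _)
  have hS := suppSym_cutoff (M := L) χ hχ1 hf (by linarith)
  set f₁ : ℝ × E → E := fun p => (Real.smoothTransition (p.1 - L) * χ p.2) • f p with hf₁
  have he : ∀ p, f₁ p = Real.smoothTransition (p.1 - L) • f₀ p := by
    intro p
    simp only [hf₁, f₀, smul_smul]
    rcases le_or_gt p.1 L with h | h
    · rw [Real.smoothTransition.zero_of_nonpos (by linarith)]
      simp
    · rw [Real.smoothTransition.one_of_one_le (x := p.1 - (M + 1)) (by linarith)]
      simp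
  have hT : ∀ s : ℝ, ‖Real.smoothTransition (s - L)‖ ≤ 1 := fun s => by
    rw [Real.norm_of_nonneg (Real.smoothTransition.nonneg _)]
    exact Real.smoothTransition.le_one _
  have hbd0 : ∀ s z, ‖f₁ (s, z)‖ ≤ B * bracket s ^ (-1 - τ) := by
    intro s z
    rw [he, norm_smul]
    calc _ ≤ 1 * ‖f₀ (s, z)‖ := by gcongr; exact hT s
      _ ≤ _ := by rw [one_mul]; exact hbnd0 s z
  have hbd1 : ∀ s z, ‖dth f₁ (s, z)‖ ≤ B * bracket s ^ (-1 - τ) := by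
    intro s z
    have d1 := (hasFDerivAt_slice (hS0.smooth.differentiable (by simp) (s, z))).const_smul
      (Real.smoothTransition (s - L))
    have d2 := hasFDerivAt_slice (hS.smooth.differentiable (by simp) (s, z))
    have e : dth f₁ (s, z) = Real.smoothTransition (s - L) • dth f₀ (s, z) := by
      refine d2.unique (d1.congr_of_eventuallyEq (Eventually.of_forall fun z => he (s, z)))
    rw [e, norm_smul]
    calc _ ≤ 1 * ‖dth f₀ (s, z)‖ := by gcongr; exact hT s
      _ ≤ _ := by rw [one_mul]; exact hbnd1 s z
  refine ⟨L + 2, by linarith, by linarith, fun r hr => ?_⟩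
  obtain ⟨Z, Zinf, h1, h2, h3, h4, h5, h6, h7, h8⟩ := exists_flow_suppSym hC hτ hS hB hL3 hbd0 hbd1
    (hN L hL1).1.le (by linarith) r
  have hcc : c / (1 - c) ≤ δ := by
    rw [div_le_iff₀ (by linarith)]
    nlinarith
  refine ⟨Z, Zinf, h1, h2, h3, fun s u => (h4 s u).trans (by linarith), fun s u u' =>
    (h5 s u u').trans (by gcongr), fun s u => ?_, h6, fun s hs u hu => ?_, h8⟩
  · have e : dx Z (s, u) = f₁ (s, Z (s, u)) :=
      (hasDerivAt_slice (h1.differentiable (by simp) (s, u))).unique (h7 s u)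
    rw [e]
    rcases lt_or_ge s L with h | h
    · rw [hS.zero (s, Z (s, u)) fun hh => not_le.2 h hh.1]
      simpa using hδ.le
    · refine (hbd0 s _).trans (le_trans ?_ (hN s (hL1.trans h)).2.le)
      gcongr
      · exact one_le_bracket s
      · linarith
  · have hmem : Z (s, u) ∈ Metric.closedBall z₀ (R₀ / 2) := by
      rw [Metric.mem_closedBall] at hu ⊢
      have := h4 s u
      rw [← dist_eq_norm] at this
      linarith [dist_triangle (Z (s, u)) u z₀]
    refine ⟨hmem, ?_⟩
    have e : f₁ (s, Z (s, u)) = f (s, Z (s, u)) := by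
      simp only [hf₁]
      rw [Real.smoothTransition.one_of_one_le (by linarith), χ.one_of_mem_closedBall hmem]
      simp
    rw [← e]
    exact h7 s u

end

end RadialEnd

namespace RadialEnd

/-! ### Products and inverses of symbols -/

section

variable {E F G H : Type} [NormedAddCommGroup E] [NormedSpace ℝ E] [NormedAddCommGroup F]
  [NormedSpace ℝ F] [NormedAddCommGroup G] [NormedSpace ℝ G] [NormedAddCommGroup H]
  [NormedSpace ℝ H]
variable {M M' m m' : ℝ} {V : Set E} {f : ℝ × E → F}

theorem Sym.bilin_le {m'' : ℝ} {g : ℝ × E → G} (hV : IsOpen V) (B : F →L[ℝ] G →L[ℝ] H)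
    (h : Sym M V m f) (h' : Sym M V m' g) (hm : m + m' ≤ m'') :
    Sym M V m'' (fun p => B (f p) (g p)) := (h.bilin hV B h').mono_order hm

theorem Sym.smul_le {m'' : ℝ} {g : ℝ × E → ℝ} (hV : IsOpen V)
    (h' : Sym M V m' g) (h : Sym M V m f) (hm : m' + m ≤ m'') :
    Sym M V m'' (fun p => g p • f p) :=
  (h'.bilin hV (ContinuousLinearMap.lsmul ℝ ℝ) h).mono_order hm

theorem Sym.apply_le {m'' : ℝ} {A : ℝ × E → (F →L[ℝ] G)} (hV : IsOpen V)
    (h' : Sym M V m' A) (h : Sym M V m f) (hm : m' + m ≤ m'') :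
    Sym M V m'' (fun p => A p (f p)) :=
  (h'.bilin hV (ContinuousLinearMap.id ℝ (F →L[ℝ] G)) h).mono_order hm

theorem Sym.flip_apply_le {m'' : ℝ} {A : ℝ × E → (G →L[ℝ] F →L[ℝ] H)} (hV : IsOpen V)
    (h' : Sym M V m' A) (h : Sym M V m f) (hm : m' + m ≤ m'') :
    Sym M V m'' (fun p => (A p).flip (f p)) :=
  (h'.bilin hV ((ContinuousLinearMap.flipₗᵢ ℝ G F H).toContinuousLinearEquiv :
    (G →L[ℝ] F →L[ℝ] H) →L[ℝ] (F →L[ℝ] G →L[ℝ] H)) h).mono_order hm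

theorem Sym.neg (hV : IsOpen V) (h : Sym M V m f) : Sym M V m (fun p => - f p) :=
  h.clm hV (-ContinuousLinearMap.id ℝ F)

theorem Sym.sub (hV : IsOpen V) {g : ℝ × E → F} (h : Sym M V m f) (h' : Sym M V m g) :
    Sym M V m (fun p => f p - g p) := by
  simpa only [sub_eq_add_neg] using h.add hV (h'.neg hV)

theorem Sym.prodMk (hV : IsOpen V) {g : ℝ × E → G} (h : Sym M V m f) (h' : Sym M V m g) :
    Sym M V m (fun p => (f p, g p)) := by
  have := (h.clm hV (ContinuousLinearMap.inl ℝ F G)).add hV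
    (h'.clm hV (ContinuousLinearMap.inr ℝ F G))
  simpa using this

/-- A symbol, seen as a symbol which does not depend on an additional variable. -/
theorem Sym.lift (hV : IsOpen V) {W : Set G} (hW : IsOpen W) (h : Sym M V m f) :
    Sym M (V ×ˢ W) m (fun p : ℝ × (E × G) => f (p.1, p.2.1)) := by
  refine h.comp hV (hV.prod hW) (ζ := fun p : ℝ × (E × G) => p.2.1)
    (sym_of_independent (φ := fun q : E × G => q.1) (hV.prod hW) contDiff_fst.contDiffOn) ?_
  intro K hK hKV
  exact ⟨Prod.fst '' K, hK.image continuous_fst, by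
    rintro _ ⟨q, hq, rfl⟩
    exact (hKV hq).1, fun x _ u hu => mem_image_of_mem _ hu⟩

/-- Symbols of negative order are uniformly small near infinity. -/
theorem Sym.exists_small (h : Sym M V m f) (hm : m < 0) {K : Set E} (hK : IsCompact K)
    (hKV : K ⊆ V) {ε : ℝ} (hε : 0 < ε) : ∃ M', M ≤ M' ∧ ∀ x, M' < x → ∀ u ∈ K, ‖f (x, u)‖ ≤ ε := by
  obtain ⟨C, hC⟩ := h.bound K hK hKV 0
  have ht : Tendsto (fun s => C * bracket s ^ m) atTop (𝓝 0) := by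
    have := (tendsto_bracket_rpow (τ := -m) (by linarith)).const_mul C
    simpa using this
  obtain ⟨N, hN⟩ := eventually_atTop.1 (ht.eventually_le_const hε)
  refine ⟨max M N, le_max_left _ _, fun x hx u hu => ?_⟩
  have := hC x ((le_max_left _ _).trans_lt hx) u hu
  rw [norm_iteratedFDeriv_zero] at this
  exact this.trans (hN x ((le_max_right _ _).trans hx.le))

/-- A smooth function of a bounded symbol with values in a compact subset of its domain. -/
theorem Sym.comp_smooth {U : Set F} (hV : IsOpen V) (hU : IsOpen U) {φ : F → G}
    (hφ : ContDiffOn ℝ ∞ φ U) (h : Sym M V 0 f) {K' : Set F} (hK' : IsCompact K') (hKU : K' ⊆ U)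
    (hmap : ∀ x, M < x → ∀ u ∈ V, f (x, u) ∈ K') : Sym M V 0 (fun p => φ (f p)) :=
  (sym_of_independent hU hφ).comp hU hV h fun _ _ hKV => ⟨K', hK', hKU, fun x hx u hu =>
    hmap x hx u (hKV hu)⟩

theorem isOpen_isInvertible [CompleteSpace E] :
    IsOpen {A : E →L[ℝ] F | A.IsInvertible} :=
  ContinuousLinearEquiv.isOpen

theorem isInvertible_of_pos [FiniteDimensional ℝ E] {B : E →L[ℝ] E →L[ℝ] ℝ}
    (h : ∀ u, u ≠ 0 → 0 < B u u) : B.IsInvertible := by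
  have hinj : Function.Injective (B : E →ₗ[ℝ] (E →L[ℝ] ℝ)) := by
    rw [← LinearMap.ker_eq_bot, LinearMap.ker_eq_bot']
    intro u hu
    by_contra hne
    have := h u hne
    have e : B u = 0 := hu
    simp [e] at this
  have hr : Module.finrank ℝ E = Module.finrank ℝ (E →L[ℝ] ℝ) := by
    rw [← (LinearMap.toContinuousLinearMap (𝕜 := ℝ) (E := E) (F' := ℝ)).finrank_eq]
    exact (Subspace.dual_finrank_eq (K := ℝ) (V := E)).symm
  exact ⟨(LinearEquiv.ofInjectiveOfFinrankEq _ hinj hr).toContinuousLinearEquiv, by ext; rfl⟩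

/-- The inverse of a family of bilinear forms which converges to a nondegenerate one. -/
theorem Sym.exists_inverse [FiniteDimensional ℝ E] {g : ℝ × E → (E →L[ℝ] E →L[ℝ] ℝ)}
    {gb : E → (E →L[ℝ] E →L[ℝ] ℝ)} (hm : m < 0)
    (h : Sym M V m (fun p => g p - gb p.2)) (hb : ContDiffOn ℝ ∞ gb V)
    (hpos : ∀ u ∈ V, ∀ z, z ≠ 0 → 0 < gb u z z) {K : Set E} (hK : IsCompact K) (hKV : K ⊆ V) :
    ∃ M', M ≤ M' ∧ (∀ x, M' < x → ∀ u ∈ K, (g (x, u)).IsInvertible) ∧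
      Sym M' (interior K) 0 (fun p => (g p).inverse) := by
  have hc : IsCompact (gb '' K) := hK.image_of_continuousOn (hb.continuousOn.mono hKV)
  have hsub : gb '' K ⊆ {A | A.IsInvertible} := by
    rintro _ ⟨u, hu, rfl⟩
    exact isInvertible_of_pos (hpos u (hKV hu))
  obtain ⟨ε, hε, hεs⟩ := hc.exists_cthickening_subset_open isOpen_isInvertible hsub
  obtain ⟨M', hM', hs⟩ := h.exists_small hm hK hKV hε
  have hmem : ∀ x, M' < x → ∀ u ∈ K, g (x, u) ∈ Metric.cthickening ε (gb '' K) := by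
    intro x hx u hu
    refine Metric.mem_cthickening_of_dist_le _ (gb u) _ _ (mem_image_of_mem _ hu) ?_
    have e := dist_eq_norm (g (x, u)) (gb u)
    exact e.trans_le (hs x hx u hu)
  refine ⟨M', hM', fun x hx u hu => hεs (hmem x hx u hu), ?_⟩
  have hgs : Sym M' (interior K) 0 g := by
    have h1 := ((h.mono_order hm.le).mono_dom hM' (interior_subset.trans hKV)).add isOpen_interior
      (sym_of_independent isOpen_interior (hb.mono (interior_subset.trans hKV)))
    exact h1.congr isOpen_interior fun p _ => (sub_add_cancel (g p) (gb p.2)).symm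
  refine hgs.comp_smooth (K' := Metric.cthickening ε (gb '' K)) isOpen_interior
    isOpen_isInvertible (φ := ContinuousLinearMap.inverse) ?_ hc.cthickening hεs
    fun x hx u hu => hmem x hx u (interior_subset hu)
  rintro _ ⟨A, rfl⟩
  exact (contDiffAt_map_inverse A).contDiffWithinAt

end

end RadialEnd

namespace RadialEnd

/-! ### The Hamiltonian vector field of unit speed geodesics in a chart -/

section

variable {E : Type} [NormedAddCommGroup E] [NormedSpace ℝ E]

/-- The metric `a dx² + 2 b dx / w + g / w²` on `ℝ × E`, at the point `p`. -/
noncomputable def chartMetric (w : ℝ → ℝ) (a : ℝ × E → ℝ) (b : ℝ × E → (E →L[ℝ] ℝ))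
    (g : ℝ × E → (E →L[ℝ] E →L[ℝ] ℝ)) (p X Y : ℝ × E) : ℝ :=
  a p * (X.1 * Y.1) + (X.1 * b p Y.2 + Y.1 * b p X.2) / w p.1 + g p X.2 Y.2 / w p.1 ^ 2

/-- The coefficients of the metric of the end in one chart: `a`, `b`, `g` on `(R, ∞) × V`, with the
limit metric `gb`. The decay rates are those which matter for the normal flow. -/
structure IsChartEnd (R τ : ℝ) (V : Set E) (w : ℝ → ℝ) (a : ℝ × E → ℝ) (b : ℝ × E → (E →L[ℝ] ℝ))
    (g : ℝ × E → (E →L[ℝ] E →L[ℝ] ℝ)) (gb : E → (E →L[ℝ] E →L[ℝ] ℝ)) : Prop where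
  isOpen : IsOpen V
  w_pos : ∀ x, R < x → 0 < w x
  w_sym : Sym R V (-((1 + τ) / 2)) (fun p : ℝ × E => w p.1)
  a_sym : Sym R V (-1 - τ) (fun p => a p - 1)
  b_sym : Sym R V (-((1 + τ) / 2)) b
  g_sym : Sym R V (-τ) (fun p => g p - gb p.2)
  gb_smooth : ContDiffOn ℝ ∞ gb V
  g_symm : ∀ x, R < x → ∀ u ∈ V, ∀ y z, g (x, u) y z = g (x, u) z y
  gb_pos : ∀ u ∈ V, ∀ z, z ≠ 0 → 0 < gb u z z
  pos : ∀ x, R < x → ∀ u ∈ V, ∀ X, X ≠ 0 → 0 < chartMetric w a b g (x, u) X X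

variable {R τ : ℝ} {V : Set E} {w : ℝ → ℝ} {a : ℝ × E → ℝ} {b : ℝ × E → (E →L[ℝ] ℝ)}
  {g : ℝ × E → (E →L[ℝ] E →L[ℝ] ℝ)} {gb : E → (E →L[ℝ] E →L[ℝ] ℝ)}

/-- The derivative of the momentum `η` along a unit speed geodesic with velocity `(c₀, w v)`:
one half of the derivative of the metric in `θ`. -/
noncomputable def force (a : ℝ × E → ℝ) (b : ℝ × E → (E →L[ℝ] ℝ))
    (g : ℝ × E → (E →L[ℝ] E →L[ℝ] ℝ)) (p : ℝ × E) (c₀ : ℝ) (v : E) : E →L[ℝ] ℝ :=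
  (1 / 2 : ℝ) • ((c₀ * c₀) • dth a p + (2 * c₀) • (dth b p).flip v
    + ((dth g p).flip v).flip v)

theorem IsChartEnd.g_smooth (h : IsChartEnd R τ V w a b g gb) : ContDiffOn ℝ ∞ g (Ioi R ×ˢ V) := by
  have h1 := h.g_sym.smooth.add (h.gb_smooth.comp contDiffOn_snd fun p hp => hp.2)
  exact h1.congr fun p _ => (sub_add_cancel (g p) (gb p.2)).symm

theorem IsChartEnd.g_zero (h : IsChartEnd R τ V w a b g gb) (hτ : 0 < τ) : Sym R V 0 g :=
  ((h.g_sym.mono_order (by linarith)).add h.isOpen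
    (sym_of_independent h.isOpen h.gb_smooth)).congr h.isOpen
      fun p _ => (sub_add_cancel (g p) (gb p.2)).symm

theorem IsChartEnd.a_smooth (h : IsChartEnd R τ V w a b g gb) : ContDiffOn ℝ ∞ a (Ioi R ×ˢ V) := by
  have h1 := h.a_sym.smooth.add (contDiffOn_const (c := (1 : ℝ)))
  exact h1.congr fun p _ => (sub_add_cancel (a p) 1).symm

theorem IsChartEnd.a_zero (h : IsChartEnd R τ V w a b g gb) (hτ : 0 < τ) : Sym R V 0 a :=
  ((h.a_sym.mono_order (by linarith)).add h.isOpen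
    (sym_const h.isOpen (1 : ℝ))).congr h.isOpen
      fun p _ => (sub_add_cancel (a p) 1).symm

/-- Unit speed geodesics in the variables `x`, `θ` and the momentum `η`: the velocity is
`(c₀, w v)`, where `c₀ > 0` and `v` are functions of `(x, (θ, η))` such that
`⟨(c₀, w v), (0, z)⟩ = η z` and `(c₀, w v)` is a unit vector. The differences to the radial motion
are symbols of order `-1-τ`. -/
theorem IsChartEnd.exists_hamiltonian [FiniteDimensional ℝ E]
    (h : IsChartEnd R τ V w a b g gb) (hτ : 0 < τ) {u₀ : E} {ρ : ℝ} (hρ : 0 < ρ)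
    (hρV : Metric.closedBall u₀ ρ ⊆ V) :
    ∃ M, R ≤ M ∧ ∃ (c₀ : ℝ × (E × (E →L[ℝ] ℝ)) → ℝ) (v : ℝ × (E × (E →L[ℝ] ℝ)) → E),
      Sym M (Metric.ball u₀ (ρ / 2) ×ˢ Metric.ball 0 1) (-1 - τ)
        (fun p : ℝ × (E × (E →L[ℝ] ℝ)) =>
          (c₀ p - 1, w p.1 • v p, force a b g (p.1, p.2.1) (c₀ p) (v p))) ∧
      ∀ x, M < x → ∀ u ∈ Metric.ball u₀ (ρ / 2), ∀ η ∈ Metric.ball (0 : E →L[ℝ] ℝ) 1,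
        0 < c₀ (x, (u, η)) ∧
        (∀ z, c₀ (x, (u, η)) * b (x, u) z + g (x, u) (v (x, (u, η))) z = w x * η z) ∧
        a (x, u) * (c₀ (x, (u, η)) * c₀ (x, (u, η)))
          + 2 * (c₀ (x, (u, η)) * b (x, u) (v (x, (u, η))))
          + g (x, u) (v (x, (u, η))) (v (x, (u, η))) = 1 := by
  have hK : IsCompact (Metric.closedBall u₀ ρ) := isCompact_closedBall u₀ ρ
  obtain ⟨M₁, hM₁, hinv, hs0⟩ := h.g_sym.exists_inverse (by linarith) h.gb_smooth h.gb_pos hK hρV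
  set U : Set E := Metric.ball u₀ ρ with hU
  set B : Set (E →L[ℝ] ℝ) := Metric.ball 0 2 with hB
  have oU : IsOpen U := Metric.isOpen_ball
  have oB : IsOpen B := Metric.isOpen_ball
  have oW : IsOpen (U ×ˢ B) := oU.prod oB
  have hUV : U ⊆ V := Metric.ball_subset_closedBall.trans hρV
  have hUK : U ⊆ interior (Metric.closedBall u₀ ρ) := Metric.ball_subset_interior_closedBall
  set sh : ℝ × E → ((E →L[ℝ] ℝ) →L[ℝ] E) := fun p => (g p).inverse with hsh
  have hs : Sym M₁ U 0 sh := hs0.mono_dom le_rfl hUK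
  have hw := h.w_sym.mono_dom hM₁ hUV
  have hb := h.b_sym.mono_dom hM₁ hUV
  have ha := h.a_sym.mono_dom hM₁ hUV
  -- The momentum equation gives `v = g⁻¹ (w η - c₀ b)`. Inserting this in the equation of unit
  -- speed, the terms linear in `c₀` cancel and there remains `α c₀² = 1 - q`, where
  -- `q = w² η g⁻¹ η` and `α = a - b g⁻¹ b`.
  set q : ℝ × (E × (E →L[ℝ] ℝ)) → ℝ := fun p =>
    (w p.1 * w p.1) * p.2.2 (sh (p.1, p.2.1) p.2.2) with hq
  set α : ℝ × E → ℝ := fun p => a p - b p (sh p (b p)) with hα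
  have hη : Sym M₁ (U ×ˢ B) 0 (fun p : ℝ × (E × (E →L[ℝ] ℝ)) => p.2.2) :=
    sym_of_independent (φ := fun q : E × (E →L[ℝ] ℝ) => q.2) oW contDiff_snd.contDiffOn
  have hsl : Sym M₁ (U ×ˢ B) 0 (fun p : ℝ × (E × (E →L[ℝ] ℝ)) => sh (p.1, p.2.1)) :=
    hs.lift oU oB
  have hwl : Sym M₁ (U ×ˢ B) (-((1 + τ) / 2)) (fun p : ℝ × (E × (E →L[ℝ] ℝ)) => w p.1) :=
    hw.lift oU oB
  have hbl : Sym M₁ (U ×ˢ B) (-((1 + τ) / 2)) (fun p : ℝ × (E × (E →L[ℝ] ℝ)) => b (p.1, p.2.1)) :=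
    hb.lift oU oB
  have hsη : Sym M₁ (U ×ˢ B) 0 (fun p : ℝ × (E × (E →L[ℝ] ℝ)) => sh (p.1, p.2.1) p.2.2) :=
    hsl.apply_le oW hη (by norm_num)
  have hq' : Sym M₁ (U ×ˢ B) (-1 - τ) q :=
    (hwl.smul_le (m'' := -1 - τ) oW hwl (by linarith)).smul_le oW
      (hη.apply_le (m'' := 0) oW hsη (by norm_num)) (by linarith)
  have hα' : Sym M₁ U (-1 - τ) (fun p => α p - 1) := by
    have h1 := ha.sub oU (hb.apply_le (m'' := -1 - τ) oU (hs.apply_le oU hb le_rfl) (by linarith))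
    refine h1.congr oU fun p _ => ?_
    simp only [hα]
    ring
  set U' : Set E := Metric.ball u₀ (ρ / 2) with hU'
  set B' : Set (E →L[ℝ] ℝ) := Metric.ball 0 1 with hB'
  have oU' : IsOpen U' := Metric.isOpen_ball
  have oB' : IsOpen B' := Metric.isOpen_ball
  have oW' : IsOpen (U' ×ˢ B') := oU'.prod oB'
  have hUU : U' ⊆ U := Metric.ball_subset_ball (by linarith)
  have hWW : U' ×ˢ B' ⊆ U ×ˢ B := prod_mono hUU (Metric.ball_subset_ball (by norm_num))
  -- restrict to large `x`, where `q` and `α - 1` are small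
  have hcl : ∃ M₂, M₁ ≤ M₂ ∧ ∀ x, M₂ < x → ∀ u ∈ U', ∀ η ∈ B',
      ‖q (x, (u, η))‖ ≤ 1 / 2 ∧ ‖α (x, u) - 1‖ ≤ 1 / 2 := by
    have hK₁ : Metric.closedBall u₀ (ρ / 2) ⊆ U := Metric.closedBall_subset_ball (by linarith)
    have hK₂ : Metric.closedBall (0 : E →L[ℝ] ℝ) 1 ⊆ B :=
      Metric.closedBall_subset_ball (by norm_num)
    obtain ⟨N₁, hN₁, h1⟩ := hq'.exists_small (by linarith)
      ((isCompact_closedBall u₀ (ρ / 2)).prod (isCompact_closedBall (0 : E →L[ℝ] ℝ) 1))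
      (prod_mono hK₁ hK₂) (ε := 1 / 2) (by norm_num)
    obtain ⟨N₂, hN₂, h2⟩ := hα'.exists_small (by linarith)
      (isCompact_closedBall u₀ (ρ / 2)) hK₁ (ε := 1 / 2) (by norm_num)
    exact ⟨max N₁ N₂, hN₁.trans (le_max_left _ _), fun x hx u hu η hη =>
      ⟨h1 x ((le_max_left _ _).trans_lt hx) (u, η) ⟨Metric.ball_subset_closedBall hu,
        Metric.ball_subset_closedBall hη⟩, h2 x ((le_max_right _ _).trans_lt hx) u
        (Metric.ball_subset_closedBall hu)⟩⟩
  obtain ⟨M₂, hM₂, hsmall⟩ := hcl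
  set c : ℝ × (E × (E →L[ℝ] ℝ)) → ℝ := fun p => Real.sqrt ((1 - q p) / α (p.1, p.2.1)) with hc
  set v : ℝ × (E × (E →L[ℝ] ℝ)) → E := fun p =>
    w p.1 • sh (p.1, p.2.1) p.2.2 - c p • sh (p.1, p.2.1) (b (p.1, p.2.1)) with hv
  have hU2 : Sym M₂ (U' ×ˢ B') (-1 - τ) q := hq'.mono_dom hM₂ hWW
  have hα2 : Sym M₂ (U' ×ˢ B') (-1 - τ) (fun p : ℝ × (E × (E →L[ℝ] ℝ)) => α (p.1, p.2.1) - 1) :=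
    (hα'.mono_dom hM₂ hUU).lift oU' oB'
  have hc1 : Sym M₂ (U' ×ˢ B') (-1 - τ) (fun p => c p - 1) := by
    set D : Set (ℝ × ℝ) := {y | y.1 < 1 ∧ -1 < y.2} with hD
    have oD : IsOpen D := (isOpen_lt continuous_fst continuous_const).inter
      (isOpen_lt continuous_const continuous_snd)
    -- `√z - 1 = (z - 1) / (√z + 1)` for `z = (1 - q) / α`, so `c₀ - 1` is the product of the symbol
    -- `-(q + (α - 1))` and a smooth function of `(q, α - 1)`.
    set Φ : ℝ × ℝ → ℝ := fun y =>
      ((1 + y.2) * (Real.sqrt ((1 - y.1) / (1 + y.2)) + 1))⁻¹ with hΦ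
    have hΦs : ContDiffOn ℝ ∞ Φ D := by
      intro y hy
      have y1 : 0 < 1 - y.1 := by linarith [hy.1]
      have y2 : 0 < 1 + y.2 := by linarith [hy.2]
      refine ContDiffAt.contDiffWithinAt ?_
      refine ContDiffAt.inv ((contDiffAt_const.add contDiffAt_snd).mul ((ContDiffAt.sqrt
        ((contDiffAt_const.sub contDiffAt_fst).div (contDiffAt_const.add contDiffAt_snd) y2.ne')
        (div_pos y1 y2).ne').add contDiffAt_const))
        (mul_pos y2 (add_pos_of_nonneg_of_pos (Real.sqrt_nonneg _) one_pos)).ne'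
    have hqα : Sym M₂ (U' ×ˢ B') (-1 - τ)
        (fun p : ℝ × (E × (E →L[ℝ] ℝ)) => (q p, α (p.1, p.2.1) - 1)) := hU2.prodMk oW' hα2
    have hsym := (hqα.mono_order (m' := 0) (by linarith)).comp_smooth
      (K' := Metric.closedBall 0 (1 / 2)) oW' oD hΦs (isCompact_closedBall _ _) ?_ ?_
    · have h2 := hsym.smul_le oW' ((hU2.add oW' hα2).neg oW') (m'' := -1 - τ) (by linarith)
      refine h2.congr oW' ?_
      rintro ⟨x, u, η⟩ ⟨hx, hu, hη⟩
      obtain ⟨e1, e2⟩ := hsmall x hx u hu η hη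
      rw [Real.norm_eq_abs, abs_le] at e1 e2
      have p1 : 0 < 1 - q (x, (u, η)) := by linarith
      have p2 : 0 < α (x, u) := by linarith
      simp only [hc, hΦ, smul_eq_mul, add_sub_cancel]
      set y := Real.sqrt ((1 - q (x, (u, η))) / α (x, u)) with hy
      have hy0 : 0 ≤ y := Real.sqrt_nonneg _
      have hy2 : α (x, u) * y ^ 2 = 1 - q (x, (u, η)) := by
        rw [hy, Real.sq_sqrt (by positivity)]
        field_simp
      have : 0 < α (x, u) * (y + 1) := by positivity
      field_simp
      linear_combination hy2
    · intro y hy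
      rw [mem_closedBall_zero_iff, Prod.norm_def, sup_le_iff] at hy
      simp only [Real.norm_eq_abs, abs_le] at hy
      exact ⟨by linarith [hy.1.2], by linarith [hy.2.1]⟩
    · rintro x hx ⟨u, η⟩ ⟨hu, hη⟩
      rw [mem_closedBall_zero_iff, Prod.norm_def, sup_le_iff]
      exact hsmall x hx u hu η hη
  have hc0 : Sym M₂ (U' ×ˢ B') 0 c := ((hc1.mono_order (by linarith)).add oW'
    (sym_const oW' (1 : ℝ))).congr oW' fun p _ => (sub_add_cancel (c p) 1).symm
  have hv1 : Sym M₂ (U' ×ˢ B') (-((1 + τ) / 2)) v :=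
    ((hwl.smul_le oW hsη (m'' := -((1 + τ) / 2)) (by linarith)).mono_dom hM₂ hWW).sub oW'
      (hc0.smul_le oW' ((hsl.apply_le oW hbl (m'' := -((1 + τ) / 2)) (by linarith)).mono_dom
        hM₂ hWW) (by linarith))
  refine ⟨M₂, hM₁.trans hM₂, c, v, ?_, ?_⟩
  · have da : Sym M₂ (U' ×ˢ B') (-1 - τ)
        (fun p : ℝ × (E × (E →L[ℝ] ℝ)) => dth a (p.1, p.2.1)) := by
      have h1 := ((ha.deriv_th oU).mono_dom hM₂ hUU).lift oU' oB'
      refine h1.congr oW' fun p _ => ?_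
      simp only [dth, fderiv_sub_const]
    have db : Sym M₂ (U' ×ˢ B') (-((1 + τ) / 2))
        (fun p : ℝ × (E × (E →L[ℝ] ℝ)) => dth b (p.1, p.2.1)) :=
      ((hb.deriv_th oU).mono_dom hM₂ hUU).lift oU' oB'
    have dg : Sym M₂ (U' ×ˢ B') 0
        (fun p : ℝ × (E × (E →L[ℝ] ℝ)) => dth g (p.1, p.2.1)) :=
      ((((h.g_zero hτ).mono_dom hM₁ hUV).deriv_th oU).mono_dom hM₂ hUU).lift oU' oB'
    refine hc1.prodMk oW' (((hwl.mono_dom hM₂ hWW).smul_le oW' hv1 (by linarith)).prodMk oW' ?_)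
    have f1 := (hc0.smul_le (m'' := 0) oW' hc0 (by norm_num)).smul_le (m'' := -1 - τ) oW' da
      (by linarith)
    have f2 := ((sym_const oW' (2 : ℝ)).smul_le (m'' := 0) oW' hc0 (by norm_num)).smul_le
      (m'' := -1 - τ) oW' (db.flip_apply_le oW' hv1 le_rfl) (by linarith)
    have f3 := (dg.flip_apply_le (m'' := -((1 + τ) / 2)) oW' hv1 (by linarith)).flip_apply_le
      (m'' := -1 - τ) oW' hv1 (by linarith)
    exact (sym_const oW' (1 / 2 : ℝ)).smul_le oW' ((f1.add oW' f2).add oW' f3) (by linarith)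
  · intro x hx u hu η hη
    obtain ⟨e1, e2⟩ := hsmall x hx u hu η hη
    rw [Real.norm_eq_abs, abs_le] at e1 e2
    have p1 : 0 < 1 - q (x, (u, η)) := by linarith
    have p2 : 0 < α (x, u) := by linarith
    have hgs : ∀ ζ, g (x, u) (sh (x, u) ζ) = ζ := by
      intro ζ
      obtain ⟨A, hA⟩ := hinv x (hM₂.trans_lt hx) u (Metric.ball_subset_closedBall (hUU hu))
      simp only [hsh, ← hA, ContinuousLinearMap.inverse_equiv]
      exact A.apply_symm_apply ζ
    have hsym := h.g_symm x (hM₁.trans_lt (hM₂.trans_lt hx)) u (hUV (hUU hu))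
    have hgv : ∀ z, g (x, u) (v (x, (u, η))) z = w x * η z - c (x, (u, η)) * b (x, u) z := by
      intro z
      simp [hv, hgs]
    have hc2 : α (x, u) * (c (x, (u, η)) * c (x, (u, η))) = 1 - q (x, (u, η)) := by
      simp only [hc]
      rw [Real.mul_self_sqrt (by positivity)]
      field_simp
    refine ⟨Real.sqrt_pos.2 (by positivity), fun z => by rw [hgv]; ring, ?_⟩
    rw [hgv]
    have sy : η (sh (x, u) (b (x, u))) = b (x, u) (sh (x, u) η) := by
      have := hsym (sh (x, u) η) (sh (x, u) (b (x, u)))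
      rwa [hgs, hgs] at this
    simp only [hα, hq] at hc2
    simp only [hv, map_sub, map_smul, smul_eq_mul, sy]
    linear_combination hc2

end

end RadialEnd

namespace RadialEnd

/-! ### The geodesic equation -/

section

variable {P Q : Type} [NormedAddCommGroup P] [NormedSpace ℝ P] [NormedAddCommGroup Q]
  [NormedSpace ℝ Q]

/-- The left-hand side `m(A, Z) + Γ(X, X; Z)` of the geodesic equation for the metric `m`, where
`X` is the velocity and `A` the second derivative of the curve. -/
noncomputable def geodesicForm (m : P → (P →L[ℝ] P →L[ℝ] ℝ)) (p X A Z : P) : ℝ :=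
  m p A Z + fderiv ℝ m p X X Z - fderiv ℝ m p Z X X / 2

variable {m : P → (P →L[ℝ] P →L[ℝ] ℝ)}

theorem fderiv_bilin_apply {p : P} (hm : DifferentiableAt ℝ m p) (X Y Z : P) :
    fderiv ℝ (fun q => m q Y Z) p X = fderiv ℝ m p X Y Z := by
  have h1 := hm.hasFDerivAt.clm_apply (hasFDerivAt_const Y p)
  have h2 := h1.clm_apply (hasFDerivAt_const Z p)
  rw [h2.fderiv]
  simp

theorem hasDerivAt_bilin {c X Y : ℝ → P} {X₀ A B : P} {t : ℝ} (hm : DifferentiableAt ℝ m (c t))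
    (hc : HasDerivAt c X₀ t) (hX : HasDerivAt X A t) (hY : HasDerivAt Y B t) :
    HasDerivAt (fun s => m (c s) (X s) (Y s))
      (fderiv ℝ m (c t) X₀ (X t) (Y t) + m (c t) A (Y t) + m (c t) (X t) B) t := by
  have h1 : HasDerivAt (fun s => m (c s)) (fderiv ℝ m (c t) X₀) t := by
    have h0 := hm.hasFDerivAt
    exact HasFDerivAt.comp_hasDerivAt (E := P →L[ℝ] P →L[ℝ] ℝ) t h0 hc
  exact (h1.clm_apply hX).clm_apply hY

theorem geodesicForm_add (p X A Z Z' : P) :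
    geodesicForm m p X A (Z + Z') = geodesicForm m p X A Z + geodesicForm m p X A Z' := by
  simp only [geodesicForm, map_add, add_apply]
  ring

theorem geodesicForm_smul (p X A Z : P) (r : ℝ) :
    geodesicForm m p X A (r • Z) = r * geodesicForm m p X A Z := by
  simp only [geodesicForm, map_smul, smul_apply, smul_eq_mul]
  ring

/-- The derivative of the momentum in a constant direction. -/
theorem geodesicForm_eq_of_hasDerivAt {c X : ℝ → P} {A Z : P} {t ζ : ℝ}
    (hm : DifferentiableAt ℝ m (c t))
    (hc : HasDerivAt c (X t) t) (hX : HasDerivAt X A t)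
    (hζ : HasDerivAt (fun s => m (c s) (X s) Z) ζ t) :
    geodesicForm m (c t) (X t) A Z = ζ - fderiv ℝ m (c t) Z (X t) (X t) / 2 := by
  have := (hasDerivAt_bilin hm hc hX (hasDerivAt_const t Z)).unique hζ
  simp only [map_zero, add_zero] at this
  rw [geodesicForm, ← this]
  ring

/-- The component of the geodesic equation along a unit speed curve is automatic. -/
theorem geodesicForm_self {c X : ℝ → P} {A : P} {t : ℝ} (hm : DifferentiableAt ℝ m (c t))
    (hsymm : ∀ Y Z, m (c t) Y Z = m (c t) Z Y)
    (hc : HasDerivAt c (X t) t) (hX : HasDerivAt X A t)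
    (h1 : ∀ᶠ s in 𝓝 t, m (c s) (X s) (X s) = 1) : geodesicForm m (c t) (X t) A (X t) = 0 := by
  have := (hasDerivAt_bilin hm hc hX hX).unique
    ((hasDerivAt_const t (1 : ℝ)).congr_of_eventuallyEq h1)
  rw [hsymm (X t) A] at this
  rw [geodesicForm]
  linarith

/-- The Gauss lemma: the derivative of `⟨∂ₜc, ∂ᵤc⟩` along a family of unit speed geodesics
vanishes. Here `W = ∂ᵤc`, and `W'` is the mixed second derivative of the family. -/
theorem gauss_lemma {c X W : ℝ → P} {A W' : P} {t : ℝ} (hm : DifferentiableAt ℝ m (c t))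
    (hc : HasDerivAt c (X t) t) (hX : HasDerivAt X A t) (hW : HasDerivAt W W' t)
    (hgeo : geodesicForm m (c t) (X t) A (W t) = 0)
    (hunit : fderiv ℝ m (c t) (W t) (X t) (X t) + 2 * m (c t) (X t) W' = 0) :
    HasDerivAt (fun s => m (c s) (X s) (W s)) 0 t := by
  convert hasDerivAt_bilin hm hc hX hW using 1
  rw [geodesicForm] at hgeo
  linarith

/-- The geodesic equation is invariant under changes of coordinates `Φ`. -/
theorem geodesicForm_comp {m' : Q → (Q →L[ℝ] Q →L[ℝ] ℝ)} {Φ : P → Q} {p : P}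
    (hm : DifferentiableAt ℝ m p) (hm' : DifferentiableAt ℝ m' (Φ p)) (hΦ : ContDiffAt ℝ 2 Φ p)
    (hsymm : ∀ Y Z, m' (Φ p) Y Z = m' (Φ p) Z Y)
    (h : ∀ᶠ q in 𝓝 p, ∀ Y Z, m' (Φ q) (fderiv ℝ Φ q Y) (fderiv ℝ Φ q Z) = m q Y Z) (X A Z : P) :
    geodesicForm m' (Φ p) (fderiv ℝ Φ p X) (fderiv ℝ (fderiv ℝ Φ) p X X + fderiv ℝ Φ p A)
      (fderiv ℝ Φ p Z) = geodesicForm m p X A Z := by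
  have dΦ : HasFDerivAt Φ (fderiv ℝ Φ p) p := (hΦ.differentiableAt (by simp)).hasFDerivAt
  have ddΦ : HasFDerivAt (fderiv ℝ Φ) (fderiv ℝ (fderiv ℝ Φ) p) p :=
    ((hΦ.fderiv_right (m := 1) (by norm_num)).differentiableAt (by simp)).hasFDerivAt
  have key : ∀ X Y Z, fderiv ℝ m p X Y Z = fderiv ℝ m' (Φ p) (fderiv ℝ Φ p X) (fderiv ℝ Φ p Y)
      (fderiv ℝ Φ p Z) + m' (Φ p) (fderiv ℝ (fderiv ℝ Φ) p X Y) (fderiv ℝ Φ p Z)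
      + m' (Φ p) (fderiv ℝ Φ p Y) (fderiv ℝ (fderiv ℝ Φ) p X Z) := by
    intro X Y Z
    have e0 : HasFDerivAt (fun q => m' (Φ q)) ((fderiv ℝ m' (Φ p)).comp (fderiv ℝ Φ p)) p := by
      have h0 := hm'.hasFDerivAt
      exact HasFDerivAt.comp (G := Q →L[ℝ] Q →L[ℝ] ℝ) p h0 dΦ
    have e1 := (e0.clm_apply (ddΦ.clm_apply (hasFDerivAt_const Y p))
      ).clm_apply (ddΦ.clm_apply (hasFDerivAt_const Z p))
    have e2 : (fun q => m q Y Z) =ᶠ[𝓝 p] fun q =>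
        m' (Φ q) (fderiv ℝ Φ q Y) (fderiv ℝ Φ q Z) := h.mono fun q hq => (hq Y Z).symm
    rw [← fderiv_bilin_apply hm, (e1.congr_of_eventuallyEq e2).fderiv]
    simp
    ring
  have sΦ : IsSymmSndFDerivAt ℝ Φ p := hΦ.isSymmSndFDerivAt (by simp)
  rw [geodesicForm, geodesicForm, ← h.self_of_nhds A Z, key X X Z, key Z X X, sΦ.eq Z X, map_add,
    add_apply, hsymm _ (fderiv ℝ Φ p X)]
  ring

end

section

variable {E : Type} [NormedAddCommGroup E] [NormedSpace ℝ E]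

/-- The metric `chartMetric` as a field of continuous bilinear forms. -/
noncomputable def metricForm (w : ℝ → ℝ) (a : ℝ × E → ℝ) (b : ℝ × E → (E →L[ℝ] ℝ))
    (g : ℝ × E → (E →L[ℝ] E →L[ℝ] ℝ)) (p : ℝ × E) : (ℝ × E) →L[ℝ] (ℝ × E) →L[ℝ] ℝ :=
  a p • (ContinuousLinearMap.fst ℝ ℝ E).smulRight (ContinuousLinearMap.fst ℝ ℝ E)
    + (w p.1)⁻¹ • ((ContinuousLinearMap.fst ℝ ℝ E).smulRight
        ((b p).comp (ContinuousLinearMap.snd ℝ ℝ E))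
      + ((b p).comp (ContinuousLinearMap.snd ℝ ℝ E)).smulRight (ContinuousLinearMap.fst ℝ ℝ E))
    + (w p.1 ^ 2)⁻¹ • (g p).bilinearComp (ContinuousLinearMap.snd ℝ ℝ E)
        (ContinuousLinearMap.snd ℝ ℝ E)

variable {R τ : ℝ} {V : Set E} {w : ℝ → ℝ} {a : ℝ × E → ℝ} {b : ℝ × E → (E →L[ℝ] ℝ)}
  {g : ℝ × E → (E →L[ℝ] E →L[ℝ] ℝ)} {gb : E → (E →L[ℝ] E →L[ℝ] ℝ)}

theorem metricForm_apply (p X Y : ℝ × E) :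
    metricForm w a b g p X Y = chartMetric w a b g p X Y := by
  change a p * (X.1 * Y.1) + (w p.1)⁻¹ * (X.1 * b p Y.2 + b p X.2 * Y.1)
    + (w p.1 ^ 2)⁻¹ * g p X.2 Y.2 = _
  rw [chartMetric]
  ring

theorem IsChartEnd.metric_symm (h : IsChartEnd R τ V w a b g gb) {p : ℝ × E}
    (hp : p ∈ Ioi R ×ˢ V) (X Y : ℝ × E) :
    metricForm w a b g p X Y = metricForm w a b g p Y X := by
  simp only [metricForm_apply, chartMetric, h.g_symm p.1 hp.1 p.2 hp.2 X.2 Y.2]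
  ring

theorem IsChartEnd.w_smooth (h : IsChartEnd R τ V w a b g gb) :
    ContDiffOn ℝ ∞ (fun p : ℝ × E => w p.1) (Ioi R ×ˢ V) := h.w_sym.smooth

theorem IsChartEnd.contDiffOn_metricForm [FiniteDimensional ℝ E]
    (h : IsChartEnd R τ V w a b g gb) : ContDiffOn ℝ ∞ (metricForm w a b g) (Ioi R ×ˢ V) := by
  rw [contDiffOn_clm_apply]
  intro X
  rw [contDiffOn_clm_apply]
  intro Y
  simp only [metricForm_apply, chartMetric]
  have hw : ∀ p ∈ Ioi R ×ˢ V, w p.1 ≠ 0 := fun p hp => (h.w_pos p.1 hp.1).ne'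
  refine ((h.a_smooth.mul contDiffOn_const).add (ContDiffOn.div ?_ h.w_smooth hw)).add
    (ContDiffOn.div ?_ (h.w_smooth.pow 2) fun p hp => pow_ne_zero 2 (hw p hp))
  · have hb := h.b_sym.smooth
    exact (contDiffOn_const.mul (hb.clm_apply contDiffOn_const)).add
      (contDiffOn_const.mul (hb.clm_apply contDiffOn_const))
  · exact (h.g_smooth.clm_apply contDiffOn_const).clm_apply contDiffOn_const

theorem IsChartEnd.differentiableAt_metricForm [FiniteDimensional ℝ E]
    (h : IsChartEnd R τ V w a b g gb) {p : ℝ × E} (hp : p ∈ Ioi R ×ˢ V) :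
    DifferentiableAt ℝ (metricForm w a b g) p :=
  ((h.contDiffOn_metricForm).contDiffAt ((isOpen_dom h.isOpen).mem_nhds hp)).differentiableAt
    (by simp)

/-- The derivative of the metric in the direction `z` tangent to the cross-section. -/
theorem IsChartEnd.fderiv_metricForm_th [FiniteDimensional ℝ E]
    (h : IsChartEnd R τ V w a b g gb) {p : ℝ × E} (hp : p ∈ Ioi R ×ˢ V) (c₀ : ℝ) (v z : E) :
    fderiv ℝ (metricForm w a b g) p (0, z) (c₀, w p.1 • v) (c₀, w p.1 • v)
      = 2 * force a b g p c₀ v z := by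
  obtain ⟨x, u⟩ := p
  have hw : w x ≠ 0 := (h.w_pos x hp.1).ne'
  have hm := h.differentiableAt_metricForm hp
  rw [← fderiv_bilin_apply hm]
  have h0 : DifferentiableAt ℝ (fun q => metricForm w a b g q (c₀, w x • v) (c₀, w x • v)) (x, u) :=
    ((hm.hasFDerivAt.clm_apply (hasFDerivAt_const _ _)).clm_apply
      (hasFDerivAt_const _ _)).differentiableAt
  have nh := (isOpen_dom h.isOpen).mem_nhds hp
  have da := hasFDerivAt_slice ((h.a_smooth.contDiffAt nh).differentiableAt (by simp))
  have db := hasFDerivAt_slice ((h.b_sym.smooth.contDiffAt nh).differentiableAt (by simp))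
  have dg := hasFDerivAt_slice ((h.g_smooth.contDiffAt nh).differentiableAt (by simp))
  have e1 := hasFDerivAt_slice h0
  have e2 := ((da.mul_const (c₀ * c₀)).add ((((db.clm_apply (hasFDerivAt_const (w x • v) u)).const_mul
    c₀).const_mul 2).mul_const (w x)⁻¹)).add (((dg.clm_apply (hasFDerivAt_const (w x • v) u)).clm_apply
      (hasFDerivAt_const (w x • v) u)).mul_const ((w x) ^ 2)⁻¹)
  have e3 := e2.congr_of_eventuallyEq (f₁ := fun u =>
      metricForm w a b g (x, u) (c₀, w x • v) (c₀, w x • v)) (Eventually.of_forall fun u => by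
    simp only [metricForm_apply, chartMetric, Pi.add_apply]
    field_simp
    ring)
  have e4 := congrArg (fun L : E →L[ℝ] ℝ => L z) (e1.unique e3)
  simp only [dth, ContinuousLinearMap.comp_apply, ContinuousLinearMap.inr_apply] at e4
  rw [e4]
  simp [force, dth]
  field_simp

/-- The solutions of the Hamiltonian system are geodesics. -/
theorem IsChartEnd.geodesicForm_eq_zero [FiniteDimensional ℝ E]
    (h : IsChartEnd R τ V w a b g gb) {c : ℝ → ℝ × E} {c₀ : ℝ → ℝ} {v : ℝ → E}
    {η : ℝ → (E →L[ℝ] ℝ)} {A : ℝ × E} {t : ℝ} (hp : c t ∈ Ioi R ×ˢ V)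
    (hc : HasDerivAt c (c₀ t, w (c t).1 • v t) t)
    (hc' : HasDerivAt (fun s => (c₀ s, w (c s).1 • v s)) A t)
    (hη : HasDerivAt η (force a b g (c t) (c₀ t) (v t)) t)
    (hpos : 0 < c₀ t)
    (hmom : ∀ᶠ s in 𝓝 t, ∀ z, c₀ s * b (c s) z + g (c s) (v s) z = w (c s).1 * η s z)
    (hunit : ∀ᶠ s in 𝓝 t, a (c s) * (c₀ s * c₀ s) + 2 * (c₀ s * b (c s) (v s))
      + g (c s) (v s) (v s) = 1) (Z : ℝ × E) :
    geodesicForm (metricForm w a b g) (c t) (c₀ t, w (c t).1 • v t) A Z = 0 := by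
  have hm := h.differentiableAt_metricForm hp
  have hev : ∀ᶠ s in 𝓝 t, R < (c s).1 :=
    (continuous_fst.continuousAt.comp hc.continuousAt).eventually (lt_mem_nhds hp.1)
  have h1 : geodesicForm (metricForm w a b g) (c t) (c₀ t, w (c t).1 • v t) A
      (c₀ t, w (c t).1 • v t) = 0 := by
    refine geodesicForm_self (X := fun s => (c₀ s, w (c s).1 • v s)) hm
      (h.metric_symm hp) hc hc' ?_
    filter_upwards [hev, hunit] with s hs hu
    have := (h.w_pos _ hs).ne'
    rw [← hu, metricForm_apply, chartMetric]
    simp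
    field_simp
    ring
  have h2 : ∀ z, geodesicForm (metricForm w a b g) (c t) (c₀ t, w (c t).1 • v t) A (0, z) = 0 := by
    intro z
    have hd : HasDerivAt (fun s => metricForm w a b g (c s) (c₀ s, w (c s).1 • v s) (0, z))
        (force a b g (c t) (c₀ t) (v t) z) t := by
      have := hη.clm_apply (hasDerivAt_const t z)
      simp only [map_zero, add_zero] at this
      refine this.congr_of_eventuallyEq ?_
      filter_upwards [hev, hmom] with s hs hu
      have := (h.w_pos _ hs).ne'
      have hu := hu z
      rw [metricForm_apply, chartMetric]
      simp
      field_simp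
      linear_combination hu
    rw [geodesicForm_eq_of_hasDerivAt (X := fun s => (c₀ s, w (c s).1 • v s)) hm hc hc' hd,
      h.fderiv_metricForm_th hp]
    ring
  have hZ : Z = (Z.1 / c₀ t) • (c₀ t, w (c t).1 • v t)
      + (0, Z.2 - (Z.1 / c₀ t) • (w (c t).1 • v t)) := by
    ext
    · simp
      field_simp
    · simp
  rw [hZ, geodesicForm_add, geodesicForm_smul, h1, h2]
  ring

end

end RadialEnd

namespace RadialEnd

/-! ### The normal geodesic flow in a chart -/

section

variable {E : Type} [NormedAddCommGroup E] [NormedSpace ℝ E]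

/-- `N` is a family of unit speed geodesics of the metric `m`, close to the radial motion and
parametrized by `u ∈ E`, starting orthogonally to the hypersurface `x = r`. The geometric
properties hold for `t > -1` and `u ∈ U`. -/
structure IsChartFlow (m : ℝ × E → ((ℝ × E) →L[ℝ] (ℝ × E) →L[ℝ] ℝ)) (R r δ : ℝ) (V U : Set E)
    (N : ℝ × E → ℝ × E) : Prop where
  smooth : ContDiff ℝ ∞ N
  zero : ∀ u, N (0, u) = (r, u)
  close : ∀ t u, ‖N (t, u) - (r + t, u)‖ ≤ δ
  lip : ∀ t u u', ‖N (t, u) - N (t, u') - (0, u - u')‖ ≤ δ * ‖u - u'‖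
  speed : ∀ t u, ‖dx N (t, u) - (1, 0)‖ ≤ δ
  mem : ∀ t, -1 < t → ∀ u ∈ U, N (t, u) ∈ Ioi R ×ˢ V
  unit : ∀ t, -1 < t → ∀ u ∈ U, m (N (t, u)) (dx N (t, u)) (dx N (t, u)) = 1
  geodesic : ∀ t, -1 < t → ∀ u ∈ U, ∀ Z,
    geodesicForm m (N (t, u)) (dx N (t, u)) (dx (dx N) (t, u)) Z = 0
  normal : ∀ u ∈ U, ∀ z, m (r, u) (dx N (0, u)) (0, z) = 0

variable {R τ : ℝ} {V : Set E} {w : ℝ → ℝ} {a : ℝ × E → ℝ} {b : ℝ × E → (E →L[ℝ] ℝ)}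
  {g : ℝ × E → (E →L[ℝ] E →L[ℝ] ℝ)} {gb : E → (E →L[ℝ] E →L[ℝ] ℝ)}

/-- Existence of the normal flow in a chart, for all `r` large enough. In terms of `s = r + t`, the
flow of the Hamiltonian vector field is written in the variables `ψ = x - s`, `θ` and `η`, which
makes it a small perturbation of the identity; it starts at `ψ = 0`, `η = 0`. -/
theorem IsChartEnd.exists_chartFlow [FiniteDimensional ℝ E]
    (h : IsChartEnd R τ V w a b g gb) (hτ : 0 < τ) {u₀ : E} {ρ : ℝ} (hρ : 0 < ρ) (hρ1 : ρ ≤ 1)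
    (hρV : Metric.closedBall u₀ (2 * ρ) ⊆ V) {δ : ℝ} (hδ : 0 < δ) :
    ∃ M₁, 2 < M₁ ∧ ∀ r, M₁ ≤ r → ∃ (N : ℝ × E → ℝ × E) (Ninf : E → ℝ × E),
      IsChartFlow (metricForm w a b g) R r δ V (Metric.closedBall u₀ (ρ / 4)) N ∧
      ContDiff ℝ ∞ Ninf ∧
      Sym 1 univ (-τ) (fun p : ℝ × E => N (p.1 - r, p.2) - (p.1, 0) - Ninf p.2) := by
  obtain ⟨M, hM, c₀, v, hX, hc⟩ := h.exists_hamiltonian hτ (by positivity) hρV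
  rw [mul_div_cancel_left₀ ρ two_ne_zero] at hX hc
  set X : ℝ × (E × (E →L[ℝ] ℝ)) → ℝ × (E × (E →L[ℝ] ℝ)) := fun p =>
    (c₀ p - 1, w p.1 • v p, force a b g (p.1, p.2.1) (c₀ p) (v p)) with hXdef
  set F : ℝ × (ℝ × (E × (E →L[ℝ] ℝ))) → ℝ × (E × (E →L[ℝ] ℝ)) :=
    fun q => X (q.1 + q.2.1, q.2.2) with hF
  set z₀ : ℝ × (E × (E →L[ℝ] ℝ)) := (0, (u₀, 0)) with hz₀
  have hball : Metric.ball z₀ ρ ⊆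
      Metric.ball (0 : ℝ) 1 ×ˢ (Metric.ball u₀ ρ ×ˢ Metric.ball (0 : E →L[ℝ] ℝ) 1) := by
    rw [hz₀, ← ball_prod_same, ← ball_prod_same]
    exact prod_mono (Metric.ball_subset_ball hρ1) (prod_mono subset_rfl
      (Metric.ball_subset_ball hρ1))
  have hFs : Sym (M + 1) (Metric.ball z₀ ρ) (-1 - τ) F := by
    refine (hX.shift (M' := M + 1) (Metric.isOpen_ball.prod Metric.isOpen_ball)
      (P := Metric.ball 0 1) Metric.isOpen_ball ?_).mono_dom le_rfl hball
    intro s hs ψ hψ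
    rw [mem_ball_zero_iff, Real.norm_eq_abs, abs_lt] at hψ
    linarith [hψ.1]
  obtain ⟨M₁, hM₁, hM₁2, H⟩ := exists_symbol_flow hρ hτ hFs hδ
  refine ⟨M₁, hM₁2, fun r hr => ?_⟩
  obtain ⟨Z, Zinf, z1, z2, z3, z4, z5, z6, -, z8, z9⟩ := H r hr
  set L : ℝ × (E × (E →L[ℝ] ℝ)) →L[ℝ] ℝ × E :=
    (ContinuousLinearMap.fst ℝ ℝ (E × (E →L[ℝ] ℝ))).prod
      ((ContinuousLinearMap.fst ℝ E (E →L[ℝ] ℝ)).comp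
        (ContinuousLinearMap.snd ℝ ℝ (E × (E →L[ℝ] ℝ)))) with hL
  have hLa : ∀ z, L z = (z.1, z.2.1) := fun z => rfl
  have hLn : ∀ z, ‖L z‖ ≤ ‖z‖ := by
    intro z
    rw [hLa, Prod.norm_def, Prod.norm_def z, Prod.norm_def z.2]
    exact max_le_max le_rfl (le_max_left _ _)
  set ι : E → ℝ × (E × (E →L[ℝ] ℝ)) := fun u => (0, (u, 0)) with hι
  have hιs : ContDiff ℝ ∞ ι := contDiff_const.prodMk (contDiff_id.prodMk contDiff_const)
  have hιn : ∀ u u', ‖ι u - ι u'‖ = ‖u - u'‖ := by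
    intro u u'
    simp [hι, Prod.norm_def]
  set N : ℝ × E → ℝ × E := fun p => (r + p.1, 0) + L (Z (r + p.1, ι p.2)) with hN
  have hNs : ContDiff ℝ ∞ N := by
    refine ((contDiff_const.add contDiff_fst).prodMk contDiff_const).add
      (L.contDiff.comp (z1.comp ((contDiff_const.add contDiff_fst).prodMk
        (hιs.comp contDiff_snd))))
  have hNd : ∀ t u, dx N (t, u) = (1, 0) + L (dx Z (r + t, ι u)) := by
    intro t u
    have e1 := hasDerivAt_slice (hNs.differentiable (by simp) (t, u))
    have e2 := hasDerivAt_slice (z1.differentiable (by simp) (r + t, ι u))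
    have e3 : HasDerivAt (fun t => r + t) 1 t := (hasDerivAt_id t).const_add r
    have e4 := HasDerivAt.scomp t e2 e3
    rw [one_smul] at e4
    have e5 : HasDerivAt (fun t => N (t, u)) ((1, 0) + L (dx Z (r + t, ι u))) t :=
      (e3.prodMk (hasDerivAt_const t (0 : E))).add (L.hasFDerivAt.comp_hasDerivAt t e4)
    exact e1.unique e5
  have hιball : ∀ u ∈ Metric.closedBall u₀ (ρ / 4), ι u ∈ Metric.closedBall z₀ (ρ / 4) := by
    intro u hu
    rw [mem_closedBall_iff_norm] at hu ⊢
    rwa [show z₀ = ι u₀ from rfl, hιn]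
  have hsol : ∀ s, r - 1 < s → ∀ u ∈ Metric.closedBall u₀ (ρ / 4),
      M < s + (Z (s, ι u)).1 ∧ (Z (s, ι u)).2.1 ∈ Metric.ball u₀ ρ ∧
      (Z (s, ι u)).2.2 ∈ Metric.ball (0 : E →L[ℝ] ℝ) 1 ∧
      HasDerivAt (fun s => Z (s, ι u)) (F (s, Z (s, ι u))) s := by
    intro s hs u hu
    obtain ⟨q1, q2⟩ := z8 s hs (ι u) (hιball u hu)
    obtain ⟨q3, q4, q5⟩ := hball (Metric.closedBall_subset_ball (by linarith) q1)
    rw [mem_ball_zero_iff, Real.norm_eq_abs, abs_lt] at q3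
    exact ⟨by linarith [q3.1], q4, q5, q2⟩
  have hvel : ∀ t, -1 < t → ∀ u ∈ Metric.closedBall u₀ (ρ / 4),
      dx N (t, u) = (c₀ ((N (t, u)).1, ((N (t, u)).2, (Z (r + t, ι u)).2.2)),
        w (N (t, u)).1 • v ((N (t, u)).1, ((N (t, u)).2, (Z (r + t, ι u)).2.2))) := by
    intro t ht u hu
    obtain ⟨q1, q2, q3, q4⟩ := hsol (r + t) (by linarith) u hu
    rw [hNd, (hasDerivAt_slice (z1.differentiable (by simp) (r + t, ι u))).unique q4]
    simp [hLa, hF, hXdef, hN]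
  have hmem : ∀ t, -1 < t → ∀ u ∈ Metric.closedBall u₀ (ρ / 4), M < (N (t, u)).1 ∧
      (N (t, u)).2 ∈ Metric.ball u₀ ρ := by
    intro t ht u hu
    obtain ⟨q1, q2, q3, q4⟩ := hsol (r + t) (by linarith) u hu
    exact ⟨by simpa [hLa, hN] using q1, by simpa [hLa, hN] using q2⟩
  have hVmem : ∀ t, -1 < t → ∀ u ∈ Metric.closedBall u₀ (ρ / 4), N (t, u) ∈ Ioi R ×ˢ V :=
    fun t ht u hu => ⟨hM.trans_lt (hmem t ht u hu).1, hρV (Metric.closedBall_subset_closedBall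
      (by linarith) (Metric.ball_subset_closedBall (hmem t ht u hu).2))⟩
  have hNz : ∀ u, N (0, u) = (r, u) := fun u => by simp [hN, hLa, z3, hι]
  refine ⟨N, fun u => L (Zinf (ι u)), ⟨hNs, hNz, ?_, ?_, ?_, hVmem, ?_, ?_, ?_⟩,
    L.contDiff.comp (z2.comp hιs), ?_⟩
  · intro t u
    have : N (t, u) - (r + t, u) = L (Z (r + t, ι u) - ι u) := by
      rw [map_sub]
      simp [hN, hLa, hι]
    rw [this]
    exact (hLn _).trans (z4 _ _)
  · intro t u u'
    have : N (t, u) - N (t, u') - (0, u - u') =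
        L (Z (r + t, ι u) - Z (r + t, ι u') - (ι u - ι u')) := by
      simp only [map_sub]
      simp [hN, hLa, hι]
    rw [this, ← hιn]
    exact (hLn _).trans (z5 _ _ _)
  · intro t u
    rw [hNd, add_sub_cancel_left]
    exact (hLn _).trans (z6 _ _)
  · intro t ht u hu
    obtain ⟨p1, p2⟩ := hmem t ht u hu
    obtain ⟨-, -, q3, -⟩ := hsol (r + t) (by linarith) u hu
    obtain ⟨-, -, k3⟩ := hc _ p1 _ p2 _ q3
    have hw := (h.w_pos _ (hM.trans_lt p1)).ne'
    rw [hvel t ht u hu, metricForm_apply, chartMetric, ← k3]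
    simp
    field_simp
    ring
  · intro t ht u hu Z'
    have hI : Ioi (-1 : ℝ) ∈ 𝓝 t := Ioi_mem_nhds ht
    have hcd : ∀ t, HasDerivAt (fun t => N (t, u)) (dx N (t, u)) t := fun t =>
      hasDerivAt_slice (hNs.differentiable (by simp) (t, u))
    have hNd2 : ContDiff ℝ ∞ (dx N) := (hNs.fderiv_right (m := ∞) le_rfl).clm_apply contDiff_const
    have hcdd : HasDerivAt (fun t => dx N (t, u)) (dx (dx N) (t, u)) t :=
      hasDerivAt_slice (hNd2.differentiable (by simp) (t, u))
    obtain ⟨q1, q2, q3, q4⟩ := hsol (r + t) (by linarith) u hu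
    have hη : HasDerivAt (fun t => (Z (r + t, ι u)).2.2) (force a b g (N (t, u))
        (c₀ ((N (t, u)).1, ((N (t, u)).2, (Z (r + t, ι u)).2.2)))
        (v ((N (t, u)).1, ((N (t, u)).2, (Z (r + t, ι u)).2.2)))) t := by
      have e3 : HasDerivAt (fun t => r + t) 1 t := (hasDerivAt_id t).const_add r
      have e4 := HasDerivAt.scomp t q4 e3
      rw [one_smul] at e4
      have e5 := ((ContinuousLinearMap.snd ℝ E (E →L[ℝ] ℝ)).comp
        (ContinuousLinearMap.snd ℝ ℝ (E × (E →L[ℝ] ℝ)))).hasFDerivAt.comp_hasDerivAt t e4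
      have e6 : N (t, u) = (r + t + (Z (r + t, ι u)).1, (Z (r + t, ι u)).2.1) := by
        simp [hN, hLa]
      rw [e6]
      exact e5
    have hall : ∀ᶠ t in 𝓝 t, -1 < t := hI
    rw [hvel t ht u hu]
    refine h.geodesicForm_eq_zero (c := fun t => N (t, u)) (η := fun t => (Z (r + t, ι u)).2.2)
      (c₀ := fun t => c₀ ((N (t, u)).1, ((N (t, u)).2, (Z (r + t, ι u)).2.2)))
      (v := fun t => v ((N (t, u)).1, ((N (t, u)).2, (Z (r + t, ι u)).2.2)))
      (hVmem t ht u hu) ?_ ?_ hη ?_ ?_ ?_ Z'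
    · rw [← hvel t ht u hu]
      exact hcd t
    · exact hcdd.congr_of_eventuallyEq (hall.mono fun s hs => (hvel s hs u hu).symm)
    · exact (hc _ (hmem t ht u hu).1 _ (hmem t ht u hu).2 _ q3).1
    · refine hall.mono fun s hs => ?_
      exact (hc _ (hmem s hs u hu).1 _ (hmem s hs u hu).2 _
        (hsol (r + s) (by linarith) u hu).2.2.1).2.1
    · refine hall.mono fun s hs => ?_
      exact (hc _ (hmem s hs u hu).1 _ (hmem s hs u hu).2 _
        (hsol (r + s) (by linarith) u hu).2.2.1).2.2
  · intro u hu z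
    have h0 : (-1 : ℝ) < 0 := by norm_num
    obtain ⟨p1, p2⟩ := hmem 0 h0 u hu
    obtain ⟨-, -, q3, -⟩ := hsol (r + 0) (by linarith) u hu
    obtain ⟨-, k2, -⟩ := hc _ p1 _ p2 _ q3
    have hw := (h.w_pos _ (hM.trans_lt p1)).ne'
    have k2 := k2 z
    rw [hvel 0 h0 u hu, metricForm_apply, chartMetric]
    rw [hNz] at k2 hw ⊢
    simp only [add_zero, z3, hι] at k2 hw ⊢
    simp
    field_simp
    simpa using k2
  · have hs := (z9.comp isOpen_univ isOpen_univ (ζ := fun p : ℝ × E => ι p.2) (M := 1) (U := univ)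
      (sym_of_independent isOpen_univ hιs.contDiffOn) fun K hK _ =>
        ⟨ι '' K, hK.image hιs.continuous, subset_univ _, fun x _ u hu => mem_image_of_mem _ hu⟩).clm
      isOpen_univ L
    refine hs.congr isOpen_univ fun p _ => ?_
    simp only [hN, map_sub, add_sub_cancel, add_sub_cancel_left]

/-- The Gauss lemma for the normal flow. -/
theorem IsChartFlow.gauss [FiniteDimensional ℝ E]
    (h : IsChartEnd R τ V w a b g gb) {r δ : ℝ} {U : Set E} {N : ℝ × E → ℝ × E}
    (hN : IsChartFlow (metricForm w a b g) R r δ V U N) {t : ℝ} (ht : -1 < t) {u : E}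
    (hu : u ∈ interior U) (z : E) :
    metricForm w a b g (N (t, u)) (dx N (t, u)) (dth N (t, u) z) = 0 := by
  have hiU : ∀ u ∈ interior U, u ∈ U := fun u hu => interior_subset hu
  have sN1 : ContDiff ℝ ∞ (dx N) := (hN.smooth.fderiv_right (m := ∞) le_rfl).clm_apply contDiff_const
  have sN2 : ContDiff ℝ ∞ (dth N) := (hN.smooth.fderiv_right (m := ∞) le_rfl).clm_comp contDiff_const
  have hder : ∀ t, -1 < t → HasDerivAt (fun s =>
      metricForm w a b g (N (s, u)) (dx N (s, u)) (dth N (s, u) z)) 0 t := by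
    intro t ht
    have hm := h.differentiableAt_metricForm (hN.mem t ht u (hiU u hu))
    have hW := (hasDerivAt_slice (sN2.differentiable (by simp) (t, u))).clm_apply
      (hasDerivAt_const t z)
    rw [map_zero, add_zero, dx_dth_comm (M := t - 1) isOpen_univ hN.smooth.contDiffOn
      ⟨by simp, mem_univ u⟩] at hW
    refine gauss_lemma (c := fun s => N (s, u)) (X := fun s => dx N (s, u))
      (W := fun s => dth N (s, u) z) hm
      (hasDerivAt_slice (hN.smooth.differentiable (by simp) (t, u)))
      (hasDerivAt_slice (sN1.differentiable (by simp) (t, u))) hW (hN.geodesic t ht u (hiU u hu) _) ?_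
    -- differentiate the unit speed condition in the direction `z`
    have d1 : HasFDerivAt (fun u => metricForm w a b g (N (t, u)))
        ((fderiv ℝ (metricForm w a b g) (N (t, u))).comp (dth N (t, u))) u := by
      have h0 := hm.hasFDerivAt
      exact HasFDerivAt.comp (G := (ℝ × E) →L[ℝ] (ℝ × E) →L[ℝ] ℝ) u h0
        (hasFDerivAt_slice (hN.smooth.differentiable (by simp) (t, u)))
    have d2 := hasFDerivAt_slice (sN1.differentiable (by simp) (t, u))
    have d3 := (d1.clm_apply d2).clm_apply d2
    have d4 : HasFDerivAt (fun u => metricForm w a b g (N (t, u)) (dx N (t, u)) (dx N (t, u)))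
        (0 : E →L[ℝ] ℝ) u := by
      refine (hasFDerivAt_const (1 : ℝ) u).congr_of_eventuallyEq ?_
      filter_upwards [isOpen_interior.mem_nhds hu] with u' hu'
      exact hN.unit t ht u' (hiU u' hu')
    have d5 := congrArg (fun A : E →L[ℝ] ℝ => A z) (d3.unique d4)
    have hs := h.metric_symm (hN.mem t ht u (hiU u hu)) (dth (dx N) (t, u) z) (dx N (t, u))
    simp at d5
    linarith
  have hconst : ∀ t, -1 < t → metricForm w a b g (N (t, u)) (dx N (t, u)) (dth N (t, u) z) =
      metricForm w a b g (N (0, u)) (dx N (0, u)) (dth N (0, u) z) := by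
    intro t ht
    exact (convex_Ioi (-1 : ℝ)).is_const_of_fderivWithin_eq_zero (𝕜 := ℝ)
      (fun s hs => (hder s hs).differentiableAt.differentiableWithinAt)
      (fun s hs => by
        rw [fderivWithin_of_isOpen isOpen_Ioi hs]
        have := (hder s hs).hasFDerivAt.fderiv
        rw [this]
        ext
        simp) ht (by simp)
  rw [hconst t ht, hN.zero]
  have : dth N (0, u) z = (0, z) := by
    have e1 := hasFDerivAt_slice (hN.smooth.differentiable (by simp) (0, u))
    have e2 : HasFDerivAt (fun u => N (0, u)) (ContinuousLinearMap.inr ℝ ℝ E) u := by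
      simp only [hN.zero]
      exact hasFDerivAt_prodMk_right r u
    rw [e1.unique e2]
    simp
  rw [this]
  exact hN.normal u (hiU u hu) z

end

end RadialEnd

namespace RadialEnd

/-! ### Changes of charts -/

section

/-- The model space. -/
abbrev Eu (d : ℕ) := EuclideanSpace ℝ (Fin d)

variable {d : ℕ} {S : Type*} [TopologicalSpace S] [ChartedSpace (EuclideanSpace ℝ (Fin d)) S]

/-- The part of the target of the chart `e` which is covered by the chart `e'`. -/
def overlap (e e' : Chart d S) : Set (Eu d) := e.target ∩ e.symm ⁻¹' e'.source

/-- The transition map between two charts. -/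
def transition (e e' : Chart d S) (u : Eu d) : Eu d := e' (e.symm u)

variable {e e' : Chart d S}

omit [ChartedSpace (EuclideanSpace ℝ (Fin d)) S] in
theorem isOpen_overlap : IsOpen (overlap e e') := e.symm.isOpen_inter_preimage e'.open_source

omit [ChartedSpace (EuclideanSpace ℝ (Fin d)) S] in
theorem transition_mem_target {u : Eu d} (hu : u ∈ overlap e e') :
    transition e e' u ∈ e'.target := e'.map_source hu.2

omit [ChartedSpace (EuclideanSpace ℝ (Fin d)) S] in
theorem symm_transition {u : Eu d} (hu : u ∈ overlap e e') :
    e'.symm (transition e e' u) = e.symm u := e'.left_inv hu.2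

variable [IsManifold (𝓡 d) ∞ S]

theorem contMDiffOn_chart (he : e ∈ atlas (EuclideanSpace ℝ (Fin d)) S) :
    ContMDiffOn (𝓡 d) (𝓡 d) ∞ e e.source :=
  contMDiffOn_of_mem_maximalAtlas (IsManifold.subset_maximalAtlas he)

theorem contMDiffOn_chart_symm (he : e ∈ atlas (EuclideanSpace ℝ (Fin d)) S) :
    ContMDiffOn (𝓡 d) (𝓡 d) ∞ e.symm e.target :=
  contMDiffOn_symm_of_mem_maximalAtlas (IsManifold.subset_maximalAtlas he)

theorem contDiffOn_transition (he : e ∈ atlas (EuclideanSpace ℝ (Fin d)) S)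
    (he' : e' ∈ atlas (EuclideanSpace ℝ (Fin d)) S) :
    ContDiffOn ℝ ∞ (transition e e') (overlap e e') := by
  rw [← contMDiffOn_iff_contDiffOn]
  exact (contMDiffOn_chart he').comp ((contMDiffOn_chart_symm he).mono inter_subset_left)
    fun u hu => hu.2

theorem mdifferentiableAt_chart_symm (he : e ∈ atlas (EuclideanSpace ℝ (Fin d)) S) {u : Eu d}
    (hu : u ∈ e.target) : MDifferentiableAt (𝓡 d) (𝓡 d) e.symm u :=
  ((contMDiffOn_chart_symm he).contMDiffAt (e.open_target.mem_nhds hu)).mdifferentiableAt (by simp)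

/-- The chain rule for `e⁻¹ = e'⁻¹ ∘ (e' ∘ e⁻¹)`. -/
theorem dInv_transition (he : e ∈ atlas (EuclideanSpace ℝ (Fin d)) S)
    (he' : e' ∈ atlas (EuclideanSpace ℝ (Fin d)) S) {u : Eu d} (hu : u ∈ overlap e e') :
    (dInv e u : Eu d →L[ℝ] Eu d) =
      (dInv e' (transition e e' u) : Eu d →L[ℝ] Eu d).comp (fderiv ℝ (transition e e') u) := by
  have hn := isOpen_overlap.mem_nhds hu
  have h1 : e.symm =ᶠ[𝓝 u] e'.symm ∘ transition e e' := by
    filter_upwards [hn] with v hv using (symm_transition hv).symm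
  have h2 : MDifferentiableAt (𝓡 d) (𝓡 d) (transition e e') u :=
    mdifferentiableAt_iff_differentiableAt.2
      (((contDiffOn_transition he he').contDiffAt hn).differentiableAt (by simp))
  have h3 := mfderiv_comp u (mdifferentiableAt_chart_symm he' (transition_mem_target hu)) h2
  rw [mfderiv_eq_fderiv] at h3
  exact (Filter.EventuallyEq.mfderiv_eq h1).trans h3

theorem dInv_injective (he : e ∈ atlas (EuclideanSpace ℝ (Fin d)) S) {u : Eu d}
    (hu : u ∈ e.target) : Function.Injective (dInv e u : Eu d →L[ℝ] Eu d) := by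
  have : IsManifold (𝓡 d) 1 S := IsManifold.of_le (n := ∞) (by exact_mod_cast le_top)
  have h := (mdifferentiable_of_mem_atlas (I := 𝓡 d) he).comp_symm_deriv hu
  intro z z' hz
  have h1 := DFunLike.congr_fun h z
  have h2 := DFunLike.congr_fun h z'
  have h3 : (mfderiv (𝓡 d) (𝓡 d) e (e.symm u)) (dInv e u z) =
    (mfderiv (𝓡 d) (𝓡 d) e (e.symm u)) (dInv e u z') := congrArg _ hz
  exact h1.symm.trans (h3.trans h2)

omit [ChartedSpace (EuclideanSpace ℝ (Fin d)) S] [IsManifold (𝓡 d) ∞ S] in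
theorem funInChart_transition (f : FunFamily S) (x : ℝ) {u : Eu d} (hu : u ∈ overlap e e') :
    funInChart e f x u = funInChart e' f x (transition e e' u) := by
  simp only [funInChart, symm_transition hu]

theorem formInChart_transition (he : e ∈ atlas (EuclideanSpace ℝ (Fin d)) S)
    (he' : e' ∈ atlas (EuclideanSpace ℝ (Fin d)) S) (b : FormFamily d S) (x : ℝ) {u : Eu d}
    (hu : u ∈ overlap e e') : formInChart e b x u =
      (formInChart e' b x (transition e e' u)).comp (fderiv ℝ (transition e e') u) := by
  have key : ∀ y y' : S, y = y' → (b x y : Eu d →L[ℝ] ℝ) = b x y' := by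
    rintro y _ rfl
    rfl
  ext z
  have h1 := DFunLike.congr_fun (dInv_transition he he' hu) z
  change (b x (e.symm u) : Eu d →L[ℝ] ℝ) (dInv e u z) =
    (b x (e'.symm (transition e e' u)) : Eu d →L[ℝ] ℝ) (dInv e' (transition e e' u)
      (fderiv ℝ (transition e e') u z))
  rw [key _ _ (symm_transition hu)]
  exact congrArg (b x (e.symm u) : Eu d →L[ℝ] ℝ) h1

theorem bilinInChart_transition (he : e ∈ atlas (EuclideanSpace ℝ (Fin d)) S)
    (he' : e' ∈ atlas (EuclideanSpace ℝ (Fin d)) S) (g : BilinFamily d S) (x : ℝ) {u : Eu d}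
    (hu : u ∈ overlap e e') : bilinInChart e g x u =
      pullBilin (bilinInChart e' g x (transition e e' u)) (fderiv ℝ (transition e e') u) := by
  have key : ∀ y y' : S, y = y' → (g x y : Eu d →L[ℝ] Eu d →L[ℝ] ℝ) = g x y' := by
    rintro y _ rfl
    rfl
  ext z z'
  have h1 := DFunLike.congr_fun (dInv_transition he he' hu) z
  have h2 := DFunLike.congr_fun (dInv_transition he he' hu) z'
  change (g x (e.symm u) : Eu d →L[ℝ] Eu d →L[ℝ] ℝ) (dInv e u z) (dInv e u z') =
    (g x (e'.symm (transition e e' u)) : Eu d →L[ℝ] Eu d →L[ℝ] ℝ) (dInv e' (transition e e' u)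
      (fderiv ℝ (transition e e') u z)) (dInv e' (transition e e' u)
      (fderiv ℝ (transition e e') u z'))
  rw [key _ _ (symm_transition hu)]
  exact congrArg₂ (fun A B => (g x (e.symm u) : Eu d →L[ℝ] Eu d →L[ℝ] ℝ) A B) h1 h2

/-- The metric of the end in a chart, as a field of continuous bilinear forms. -/
noncomputable def endForm (w : ℝ → ℝ) (a : FunFamily S) (b : FormFamily d S) (g : BilinFamily d S)
    (e : Chart d S) : ℝ × Eu d → ((ℝ × Eu d) →L[ℝ] (ℝ × Eu d) →L[ℝ] ℝ) :=
  metricForm w (fun p => funInChart e a p.1 p.2) (fun p => formInChart e b p.1 p.2)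
    (fun p => bilinInChart e g p.1 p.2)

variable {w : ℝ → ℝ} {a : FunFamily S} {b : FormFamily d S} {g : BilinFamily d S}

omit [IsManifold (𝓡 d) ∞ S] in
theorem metricInChart_eq (p X Y : ℝ × Eu d) :
    metricInChart w a b g e p X Y = endForm w a b g e p X Y := by
  rw [endForm, metricForm_apply]
  rfl

omit [IsManifold (𝓡 d) ∞ S] in
/-- The left-hand side of the geodesic equation, written with the Christoffel symbols. -/
theorem geodesic_expr_eq {p : ℝ × Eu d} (h : DifferentiableAt ℝ (endForm w a b g e) p)
    (X A Z : ℝ × Eu d) : metricInChart w a b g e p A Z + christoffel w a b g e p X X Z =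
      geodesicForm (endForm w a b g e) p X A Z := by
  simp only [christoffel, metricInChart_eq, fderiv_bilin_apply h, geodesicForm]
  ring

/-- The transition map on `ℝ × S`. -/
def transitionProd (e e' : Chart d S) (p : ℝ × Eu d) : ℝ × Eu d := (p.1, transition e e' p.2)

theorem contDiffAt_transitionProd (he : e ∈ atlas (EuclideanSpace ℝ (Fin d)) S)
    (he' : e' ∈ atlas (EuclideanSpace ℝ (Fin d)) S) {p : ℝ × Eu d} (hp : p.2 ∈ overlap e e') :
    ContDiffAt ℝ ∞ (transitionProd e e') p :=
  contDiffAt_fst.prodMk (((contDiffOn_transition he he').contDiffAt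
    (isOpen_overlap.mem_nhds hp)).comp p contDiffAt_snd)

theorem fderiv_transitionProd (he : e ∈ atlas (EuclideanSpace ℝ (Fin d)) S)
    (he' : e' ∈ atlas (EuclideanSpace ℝ (Fin d)) S) {p : ℝ × Eu d} (hp : p.2 ∈ overlap e e')
    (X : ℝ × Eu d) : fderiv ℝ (transitionProd e e') p X =
      (X.1, fderiv ℝ (transition e e') p.2 X.2) := by
  have h1 : HasFDerivAt (transition e e') (fderiv ℝ (transition e e') p.2) p.2 :=
    (((contDiffOn_transition he he').contDiffAt
      (isOpen_overlap.mem_nhds hp)).differentiableAt (by simp)).hasFDerivAt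
  have h2 : HasFDerivAt (transitionProd e e') _ p :=
    hasFDerivAt_fst.prodMk (h1.comp p hasFDerivAt_snd)
  rw [h2.fderiv]
  rfl

theorem endForm_transition (he : e ∈ atlas (EuclideanSpace ℝ (Fin d)) S)
    (he' : e' ∈ atlas (EuclideanSpace ℝ (Fin d)) S) {p : ℝ × Eu d} (hp : p.2 ∈ overlap e e')
    (X Y : ℝ × Eu d) : endForm w a b g e' (transitionProd e e' p)
      (fderiv ℝ (transitionProd e e') p X) (fderiv ℝ (transitionProd e e') p Y) =
      endForm w a b g e p X Y := by
  simp only [endForm, metricForm_apply, chartMetric, fderiv_transitionProd he he' hp,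
    funInChart_transition a p.1 hp, formInChart_transition he he' b p.1 hp,
    bilinInChart_transition he he' g p.1 hp]
  rfl

end

end RadialEnd

namespace RadialEnd

/-! ### Uniqueness of geodesics -/

section

variable {P : Type} [NormedAddCommGroup P] [NormedSpace ℝ P]

/-- The second derivative of a geodesic, as a function of its position and its velocity. -/
noncomputable def geodesicAcc (m : P → (P →L[ℝ] P →L[ℝ] ℝ)) (y : P × P) : P :=
  (m y.1).inverse ((1 / 2 : ℝ) • ((fderiv ℝ m y.1).flip y.2).flip y.2 - fderiv ℝ m y.1 y.2 y.2)

variable {m : P → (P →L[ℝ] P →L[ℝ] ℝ)}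

theorem eq_geodesicAcc {p X A : P} (hm : (m p).IsInvertible)
    (h : ∀ Z, geodesicForm m p X A Z = 0) : A = geodesicAcc m (p, X) := by
  obtain ⟨L, hL⟩ := hm
  have h1 : m p A = (1 / 2 : ℝ) • ((fderiv ℝ m p).flip X).flip X - fderiv ℝ m p X X := by
    ext Z
    have := h Z
    rw [geodesicForm] at this
    change m p A Z = (1 / 2 : ℝ) * fderiv ℝ m p Z X X - fderiv ℝ m p X X Z
    linarith
  rw [geodesicAcc, ← h1, ← hL, ContinuousLinearMap.inverse_equiv]
  exact (L.symm_apply_apply A).symm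

set_option maxSynthPendingDepth 3 in
theorem contDiffAt_geodesicAcc [FiniteDimensional ℝ P] {y : P × P} (hm : (m y.1).IsInvertible)
    (h : ContDiffAt ℝ ∞ m y.1) : ContDiffAt ℝ 1 (geodesicAcc m) y := by
  have h0 : ContDiffAt ℝ ∞ (fderiv ℝ m) y.1 := h.fderiv_right (m := ∞) le_rfl
  have h1 : ContDiffAt ℝ ∞ (fun y : P × P => fderiv ℝ m y.1) y := h0.comp y contDiffAt_fst
  have h2 : ContDiffAt ℝ ∞ (fun y : P × P => m y.1) y := h.comp y contDiffAt_fst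
  have h3 : ContDiffAt ℝ ∞ (fun y : P × P => (m y.1).inverse) y := by
    obtain ⟨L, hL⟩ := hm
    have := contDiffAt_map_inverse (n := ∞) L
    rw [hL] at this
    exact ContDiffAt.comp (f := fun y : P × P => m y.1) y this h2
  have h4 : ContDiffAt ℝ ∞ (fun y : P × P => (fderiv ℝ m y.1).flip y.2) y :=
    (((ContinuousLinearMap.flipₗᵢ ℝ P P (P →L[ℝ] ℝ)).contDiff.contDiffAt).comp y h1).clm_apply
      contDiffAt_snd
  have h5 : ContDiffAt ℝ ∞ (fun y : P × P => ((fderiv ℝ m y.1).flip y.2).flip y.2) y :=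
    (((ContinuousLinearMap.flipₗᵢ ℝ P P ℝ).contDiff.contDiffAt).comp y h4).clm_apply
      contDiffAt_snd
  have h6 := h3.clm_apply ((contDiffAt_const (c := (1 / 2 : ℝ)).smul h5).sub
    ((h1.clm_apply contDiffAt_snd).clm_apply contDiffAt_snd))
  exact h6.of_le (by exact_mod_cast le_top)

/-- Local uniqueness of geodesics. -/
theorem geodesic_unique_right [FiniteDimensional ℝ P] {c c' X X' : ℝ → P} {A A' : ℝ → P} {t : ℝ}
    (hm : (m (c t)).IsInvertible) (hms : ContDiffAt ℝ ∞ m (c t))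
    (hcX : ContinuousWithinAt X (Ici t) t) (hcX' : ContinuousWithinAt X' (Ici t) t)
    (h1 : ∀ᶠ s in 𝓝[≥] t, HasDerivWithinAt c (X s) (Ici s) s ∧ ContinuousWithinAt c (Ici t) s ∧
      HasDerivWithinAt X (A s) (Ici s) s ∧ ContinuousWithinAt X (Ici t) s ∧
      ∀ Z, geodesicForm m (c s) (X s) (A s) Z = 0)
    (h2 : ∀ᶠ s in 𝓝[≥] t, HasDerivWithinAt c' (X' s) (Ici s) s ∧ ContinuousWithinAt c' (Ici t) s ∧
      HasDerivWithinAt X' (A' s) (Ici s) s ∧ ContinuousWithinAt X' (Ici t) s ∧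
      ∀ Z, geodesicForm m (c' s) (X' s) (A' s) Z = 0)
    (e : c t = c' t) (eX : X t = X' t) : ∀ᶠ s in 𝓝[≥] t, c s = c' s := by
  set v : P × P → P × P := fun y => (y.2, geodesicAcc m y) with hv
  have hvs : ContDiffAt ℝ 1 v (c t, X t) :=
    contDiffAt_snd.prodMk (contDiffAt_geodesicAcc hm hms)
  obtain ⟨K, B, hB, hL⟩ := hvs.exists_lipschitzOnWith
  have hinv : ∀ᶠ p in 𝓝 (c t), (m p).IsInvertible :=
    hms.continuousAt.eventually (isOpen_isInvertible.mem_nhds hm)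
  have hc0 : ContinuousWithinAt c (Ici t) t := (h1.self_of_nhdsWithin self_mem_Ici).2.1
  have hc0' : ContinuousWithinAt c' (Ici t) t := (h2.self_of_nhdsWithin self_mem_Ici).2.1
  have k1 : ∀ᶠ s in 𝓝[≥] t, (c s, X s) ∈ B ∧ (m (c s)).IsInvertible :=
    ((hc0.prodMk hcX).eventually hB).and (hc0.eventually hinv)
  have k2 : ∀ᶠ s in 𝓝[≥] t, (c' s, X' s) ∈ B ∧ (m (c' s)).IsInvertible := by
    rw [e, eX] at hB
    rw [e] at hinv
    exact ((hc0'.prodMk hcX').eventually hB).and (hc0'.eventually hinv)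
  obtain ⟨ε, hε, hball⟩ := Metric.mem_nhdsWithin_iff.1 ((h1.and h2).and (k1.and k2))
  have hsub : ∀ s ∈ Icc t (t + ε / 2), s ∈ Metric.ball t ε ∩ Ici t := by
    intro s hs
    refine ⟨?_, hs.1⟩
    rw [Metric.mem_ball, Real.dist_eq, abs_of_nonneg (by linarith [hs.1])]
    linarith [hs.2]
  have hu := ODE_solution_unique_of_mem_Icc_right (v := fun _ => v) (s := fun _ => B) (K := K)
    (f := fun s => (c s, X s)) (g := fun s => (c' s, X' s)) (a := t) (b := t + ε / 2)
    (fun _ _ => hL) ?_ ?_ ?_ ?_ ?_ ?_ (Prod.ext e eX)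
  · filter_upwards [Icc_mem_nhdsGE (show t < t + ε / 2 by linarith)] with s hs
    exact congrArg Prod.fst (hu hs)
  · intro s hs
    obtain ⟨⟨q1, q2⟩, q3, q4⟩ := hball (hsub s hs)
    exact (q1.2.1.prodMk q1.2.2.2.1).mono Icc_subset_Ici_self
  · intro s hs
    obtain ⟨⟨q1, q2⟩, q3, q4⟩ := hball (hsub s (Ico_subset_Icc_self hs))
    rw [hv]
    simp only
    rw [← eq_geodesicAcc q3.2 q1.2.2.2.2]
    exact q1.1.prodMk q1.2.2.1
  · intro s hs
    exact (hball (hsub s (Ico_subset_Icc_self hs))).2.1.1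
  · intro s hs
    obtain ⟨⟨q1, q2⟩, q3, q4⟩ := hball (hsub s hs)
    exact (q2.2.1.prodMk q2.2.2.2.1).mono Icc_subset_Ici_self
  · intro s hs
    obtain ⟨⟨q1, q2⟩, q3, q4⟩ := hball (hsub s (Ico_subset_Icc_self hs))
    rw [hv]
    simp only
    rw [← eq_geodesicAcc q4.2 q2.2.2.2.2]
    exact q2.1.prodMk q2.2.2.1
  · intro s hs
    exact (hball (hsub s (Ico_subset_Icc_self hs))).2.2.1

end

section

variable {d : ℕ} {S : Type*} [TopologicalSpace S] [ChartedSpace (EuclideanSpace ℝ (Fin d)) S]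
  {e e' : Chart d S} {R τ : ℝ} {w : ℝ → ℝ} {a : FunFamily S} {b : FormFamily d S}
  {g : BilinFamily d S} {gb : Eu d → (Eu d →L[ℝ] Eu d →L[ℝ] ℝ)}

/-- The coefficients of the metric of the end in the chart `e` satisfy `IsChartEnd`. -/
def IsEndInChart (R τ : ℝ) (w : ℝ → ℝ) (a : FunFamily S) (b : FormFamily d S)
    (g : BilinFamily d S) (e : Chart d S) (gb : Eu d → (Eu d →L[ℝ] Eu d →L[ℝ] ℝ)) : Prop :=
  IsChartEnd R τ e.target w (fun p => funInChart e a p.1 p.2) (fun p => formInChart e b p.1 p.2)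
    (fun p => bilinInChart e g p.1 p.2) gb

theorem IsEndInChart.contDiffAt (h : IsEndInChart R τ w a b g e gb) {p : ℝ × Eu d}
    (hp : p ∈ Ioi R ×ˢ e.target) : ContDiffAt ℝ ∞ (endForm w a b g e) p :=
  (IsChartEnd.contDiffOn_metricForm h).contDiffAt ((isOpen_dom e.open_target).mem_nhds hp)

theorem IsEndInChart.differentiableAt (h : IsEndInChart R τ w a b g e gb) {p : ℝ × Eu d}
    (hp : p ∈ Ioi R ×ˢ e.target) : DifferentiableAt ℝ (endForm w a b g e) p :=
  (h.contDiffAt hp).differentiableAt (by simp)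

theorem IsEndInChart.pos (h : IsEndInChart R τ w a b g e gb) {p : ℝ × Eu d}
    (hp : p ∈ Ioi R ×ˢ e.target) {X : ℝ × Eu d} (hX : X ≠ 0) : 0 < endForm w a b g e p X X := by
  rw [endForm, metricForm_apply]
  exact IsChartEnd.pos h p.1 hp.1 p.2 hp.2 X hX

theorem IsEndInChart.symm (h : IsEndInChart R τ w a b g e gb) {p : ℝ × Eu d}
    (hp : p ∈ Ioi R ×ˢ e.target) (X Y : ℝ × Eu d) :
    endForm w a b g e p X Y = endForm w a b g e p Y X := IsChartEnd.metric_symm h hp X Y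

theorem IsEndInChart.isInvertible (h : IsEndInChart R τ w a b g e gb) {p : ℝ × Eu d}
    (hp : p ∈ Ioi R ×ˢ e.target) : (endForm w a b g e p).IsInvertible :=
  isInvertible_of_pos fun _ hX => h.pos hp hX

/-- The outgoing unit normal vector is unique. -/
theorem IsEndInChart.normal_unique (h : IsEndInChart R τ w a b g e gb) {p X Y : ℝ × Eu d}
    (hp : p ∈ Ioi R ×ˢ e.target) (hX : IsOutgoingUnitNormal w a b g e p X)
    (hY : IsOutgoingUnitNormal w a b g e p Y) : X = Y := by
  obtain ⟨x1, x2, x3⟩ := hX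
  obtain ⟨y1, y2, y3⟩ := hY
  simp only [metricInChart_eq] at x1 x2 y1 y2
  set m := endForm w a b g e p
  set k := Y.1 / X.1 with hk
  have hk0 : 0 < k := by positivity
  have hz : Y - k • X = (0, Y.2 - k • X.2) := by
    ext
    · simp [hk]
      field_simp
      ring
    · rfl
  have hz0 : ∀ z, m (Y - k • X) (0, z) = 0 := by
    intro z
    rw [map_sub, map_smul]
    change m Y (0, z) - k * m X (0, z) = 0
    rw [x2, y2]
    ring
  have h0 : Y - k • X = 0 := by
    by_contra hne
    have := h.pos hp hne
    have e1 : m (Y - k • X) (Y - k • X) = 0 := by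
      nth_rewrite 2 [hz]
      exact hz0 _
    exact this.ne' e1
  have hY : Y = k • X := sub_eq_zero.1 h0
  rw [hY] at y1
  simp only [map_smul, smul_apply, x1, smul_eq_mul] at y1
  have : k = 1 := by nlinarith
  rw [hY, this, one_smul]

variable [T2Space S]

omit [T2Space S] in
/-- Two geodesics with the same initial position and velocity coincide locally. -/
theorem IsGeodesicOn.eventuallyEq (h : IsEndInChart R τ w a b g e gb)
    (he : e ∈ atlas (EuclideanSpace ℝ (Fin d)) S) {γ γ' : ℝ → ℝ × S}
    (hγ : IsGeodesicOn R w a b g (Ici 0) γ) (hγ' : IsGeodesicOn R w a b g (Ici 0) γ') {t : ℝ}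
    (ht : 0 ≤ t) (hte : (γ t).2 ∈ e.source) (h0 : γ t = γ' t)
    (h1 : derivWithin (curveInChart e γ) (Ici 0) t = derivWithin (curveInChart e γ') (Ici 0) t) :
    ∀ᶠ s in 𝓝[≥] t, γ s = γ' s := by
  have hsub : Ici t ⊆ Ici 0 := Ici_subset_Ici.2 ht
  have key : ∀ γ : ℝ → ℝ × S, IsGeodesicOn R w a b g (Ici 0) γ → (γ t).2 ∈ e.source →
      ContinuousWithinAt (derivWithin (curveInChart e γ) (Ici 0)) (Ici t) t ∧
      (∀ᶠ s in 𝓝[≥] t, (γ s).2 ∈ e.source) ∧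
      ∀ᶠ s in 𝓝[≥] t, HasDerivWithinAt (curveInChart e γ)
          (derivWithin (curveInChart e γ) (Ici 0) s) (Ici s) s ∧
        ContinuousWithinAt (curveInChart e γ) (Ici t) s ∧
        HasDerivWithinAt (derivWithin (curveInChart e γ) (Ici 0))
          (derivWithin (derivWithin (curveInChart e γ) (Ici 0)) (Ici 0) s) (Ici s) s ∧
        ContinuousWithinAt (derivWithin (curveInChart e γ) (Ici 0)) (Ici t) s ∧
        ∀ Z, geodesicForm (endForm w a b g e) (curveInChart e γ s)
          (derivWithin (curveInChart e γ) (Ici 0) s)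
          (derivWithin (derivWithin (curveInChart e γ) (Ici 0)) (Ici 0) s) Z = 0 := by
    rintro γ ⟨k1, k2, k3⟩ hte
    have hsrc : ∀ᶠ s in 𝓝[≥] t, (γ s).2 ∈ e.source :=
      ((continuous_snd.continuousAt.comp_continuousWithinAt (k2 t ht)).mono hsub).eventually
        (e.open_source.mem_nhds hte)
    have hD : ∀ s, 0 ≤ s → (γ s).2 ∈ e.source →
        ContDiffWithinAt ℝ 1 (derivWithin (curveInChart e γ) (Ici 0)) (Ici 0) s :=
      fun s hs hse => (k3 e he s hs hse).1.derivWithin (uniqueDiffOn_Ici 0) (by norm_num) hs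
    refine ⟨(hD t ht hte).continuousWithinAt.mono hsub, hsrc, ?_⟩
    filter_upwards [hsrc, self_mem_nhdsWithin] with s hse hts
    have hs : 0 ≤ s := ht.trans hts
    have hss : Ici s ⊆ Ici 0 := Ici_subset_Ici.2 hs
    obtain ⟨c1, c2⟩ := k3 e he s hs hse
    refine ⟨((c1.differentiableWithinAt (by simp)).hasDerivWithinAt).mono hss,
      c1.continuousWithinAt.mono hsub,
      (((hD s hs hse).differentiableWithinAt (by simp)).hasDerivWithinAt).mono hss,
      (hD s hs hse).continuousWithinAt.mono hsub, fun Z => ?_⟩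
    rw [← geodesic_expr_eq (h.differentiableAt
      (p := curveInChart e γ s) ⟨k1 s hs, e.map_source hse⟩), c2]
  obtain ⟨a1, a2, a3⟩ := key γ hγ hte
  obtain ⟨b1, b2, b3⟩ := key γ' hγ' (h0 ▸ hte)
  have hp : curveInChart e γ t ∈ Ioi R ×ˢ e.target := ⟨hγ.1 t ht, e.map_source hte⟩
  have := geodesic_unique_right (h.isInvertible hp) (h.contDiffAt hp) a1 b1 a3 b3
    (by simp only [curveInChart, h0]) h1
  filter_upwards [this, a2, b2] with s hs h1 h2
  have e1 : (γ s).1 = (γ' s).1 := congrArg (fun q : ℝ × Eu d => q.1) hs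
  have e2 : e (γ s).2 = e (γ' s).2 := congrArg (fun q : ℝ × Eu d => q.2) hs
  exact Prod.ext e1 (e.injOn h1 h2 e2)

/-- Two geodesics with the same initial position and velocity coincide. -/
theorem IsGeodesicOn.eqOn
    (h : ∀ e ∈ atlas (EuclideanSpace ℝ (Fin d)) S, ∃ gb, IsEndInChart R τ w a b g e gb)
    (he : e ∈ atlas (EuclideanSpace ℝ (Fin d)) S) {γ γ' : ℝ → ℝ × S}
    (hγ : IsGeodesicOn R w a b g (Ici 0) γ) (hγ' : IsGeodesicOn R w a b g (Ici 0) γ')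
    (hte : (γ 0).2 ∈ e.source) (h0 : γ 0 = γ' 0)
    (h1 : derivWithin (curveInChart e γ) (Ici 0) 0 = derivWithin (curveInChart e γ') (Ici 0) 0)
    {t : ℝ} (ht : 0 ≤ t) : γ t = γ' t := by
  set D : Set ℝ := {s | s ∈ Icc 0 t ∧ γ s = γ' s} with hD
  have hDc : IsClosed D := by
    have c1 : ContinuousOn (fun s => (γ s, γ' s)) (Icc 0 t) :=
      (hγ.2.1.prodMk hγ'.2.1).mono Icc_subset_Ici_self
    exact c1.preimage_isClosed_of_isClosed isClosed_Icc isClosed_diagonal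
  set A : Set ℝ := {s | Icc 0 s ⊆ D} with hA
  have hAc : IsClosed (A ∩ Icc 0 t) := by
    refine isClosed_of_closure_subset fun s hs => ?_
    have hs1 : s ∈ Icc 0 t := closure_minimal inter_subset_right isClosed_Icc hs
    refine ⟨fun σ hσ => ?_, hs1⟩
    rcases hσ.2.lt_or_eq with hlt | rfl
    · obtain ⟨s', hs', hs''⟩ := mem_closure_iff.1 hs (Ioi σ) isOpen_Ioi hlt
      exact hs''.1 ⟨hσ.1, le_of_lt hs'⟩
    · refine closure_minimal (fun s' hs' => ?_) hDc hs
      exact hs'.1 ⟨hs'.2.1, le_rfl⟩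
  have hA0 : (0 : ℝ) ∈ A := by
    intro s hs
    rw [Icc_self, mem_singleton_iff] at hs
    subst hs
    exact ⟨⟨le_rfl, ht⟩, h0⟩
  have hsub := hAc.Icc_subset_of_forall_exists_gt hA0 ?_
  · exact (hsub ⟨ht, le_rfl⟩ ⟨ht, le_rfl⟩).2
  rintro s ⟨hsA, hs0, hst⟩ y hy
  have hss : γ s = γ' s := (hsA ⟨hs0, le_rfl⟩).2
  have hev : ∀ᶠ σ in 𝓝[≥] s, γ σ = γ' σ := by
    rcases hs0.eq_or_lt with rfl | hpos
    · obtain ⟨gb, hgb⟩ := h e he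
      exact hγ.eventuallyEq hgb he hγ' le_rfl hte h0 h1
    · set f := chartAt (EuclideanSpace ℝ (Fin d)) (γ s).2 with hf
      have hfa : f ∈ atlas (EuclideanSpace ℝ (Fin d)) S := chart_mem_atlas _ _
      have hfs : (γ s).2 ∈ f.source := mem_chart_source _ _
      obtain ⟨gb, hgb⟩ := h f hfa
      refine hγ.eventuallyEq hgb hfa hγ' hs0 hfs hss ?_
      have hu : UniqueDiffWithinAt ℝ (Icc 0 s) s := uniqueDiffOn_Icc hpos s ⟨hs0, le_rfl⟩
      have e1 : ∀ γ : ℝ → ℝ × S, IsGeodesicOn R w a b g (Ici 0) γ → (γ s).2 ∈ f.source →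
          derivWithin (curveInChart f γ) (Icc 0 s) s = derivWithin (curveInChart f γ) (Ici 0) s :=
        fun γ hγ hse => ((((hγ.2.2 f hfa s hs0 hse).1.differentiableWithinAt
          (by simp)).hasDerivWithinAt).mono Icc_subset_Ici_self).derivWithin hu
      rw [← e1 γ hγ hfs, ← e1 γ' hγ' (hss ▸ hfs)]
      refine derivWithin_congr (fun σ hσ => ?_) ?_
      · simp only [curveInChart, (hsA hσ).2]
      · simp only [curveInChart, hss]
  obtain ⟨ε, hε, hball⟩ := Metric.mem_nhdsWithin_iff.1 hev
  set s' := min (min y t) (s + ε / 2) with hs'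
  have hss' : s < s' := lt_min (lt_min hy hst) (by linarith)
  have hs'y : s' ≤ y := (min_le_left _ _).trans (min_le_left _ _)
  have hs't : s' ≤ t := (min_le_left _ _).trans (min_le_right _ _)
  have hs'ε : s' ≤ s + ε / 2 := min_le_right _ _
  refine ⟨s', fun σ hσ => ?_, hss', hs'y⟩
  rcases le_or_gt σ s with hσs | hσs
  · exact hsA ⟨hσ.1, hσs⟩
  · refine ⟨⟨hσ.1, hσ.2.trans hs't⟩, hball ⟨?_, hσs.le⟩⟩
    rw [Metric.mem_ball, Real.dist_eq, abs_of_nonneg (by linarith)]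
    linarith [hσ.2]

end

end RadialEnd

namespace RadialEnd

/-! ### The normal flow on the end, expressed in charts -/

section

variable {d : ℕ} {S : Type*} [TopologicalSpace S] [ChartedSpace (EuclideanSpace ℝ (Fin d)) S]
  [IsManifold (𝓡 d) ∞ S]
  {e e' : Chart d S} {R τ : ℝ} {w : ℝ → ℝ} {a : FunFamily S} {b : FormFamily d S}
  {g : BilinFamily d S} {gb : Eu d → (Eu d →L[ℝ] Eu d →L[ℝ] ℝ)}

/-- The decay assumptions, expressed in a chart. Only the rates `1 + τ`, `(1 + τ) / 2` and `τ` are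
kept, to which the orders `μ`, `ν` and `lam` are lowered. -/
theorem isEndInChart (hG : IsEndMetric R w a b g)
    (gbar : Bundle.ContMDiffRiemannianMetric (𝓡 d) ∞ (EuclideanSpace ℝ (Fin d))
      (TangentSpace (𝓡 d) : S → Type)) {lam μ ν : ℝ}
    (hw : IsSymbolOnLine (-lam) R w)
    (ha : FunIsSymbol (d := d) (-μ) R (fun x y => a x y - 1))
    (hb : FormIsSymbol (-ν) R b)
    (hg : BilinIsSymbol (-τ) R (fun x y => g x y - gbar.inner y))
    (hμ : 1 + τ ≤ μ) (hν : (1 + τ) / 2 ≤ ν) (hlam : (1 + τ) / 2 ≤ lam)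
    (he : e ∈ atlas (EuclideanSpace ℝ (Fin d)) S) :
    IsEndInChart R τ w a b g e (fun u => bilinInChart e (fun _ y => gbar.inner y) 0 u) := by
  have hsub : ∀ x u, bilinInChart e (fun x y => g x y - gbar.inner y) x u =
      bilinInChart e g x u - bilinInChart e (fun _ y => gbar.inner y) 0 u := by
    intro x u
    ext z z'
    rfl
  have hinj : ∀ u ∈ e.target, ∀ z : Eu d, z ≠ 0 → (dInv e u : Eu d →L[ℝ] Eu d) z ≠ 0 := by
    intro u hu z hz h0
    exact hz (dInv_injective he hu (h0.trans (map_zero (dInv e u : Eu d →L[ℝ] Eu d)).symm))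
  have hg' : Sym R e.target (-τ) (fun p => bilinInChart e g p.1 p.2 -
      bilinInChart e (fun _ y => gbar.inner y) 0 p.2) := by
    have := (isSymbolOn_iff e.open_target).1 (hg e he)
    simpa only [hsub] using this
  have hgpos : ∀ (y : S) (v : TangentSpace (𝓡 d) y), v ≠ 0 → 0 < gbar.inner y v v := gbar.pos
  refine ⟨e.open_target, hG.w_pos, (hw.sym e.open_target).mono_order (by linarith),
    ((isSymbolOn_iff e.open_target).1 (ha e he)).mono_order (by linarith),
    ((isSymbolOn_iff e.open_target).1 (hb e he)).mono_order (by linarith), hg', ?_, ?_, ?_, ?_⟩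
  · have h1 := contDiffOn_slice (hG.g_smooth e he) (x := R + 1) (by simp)
    have h2 := contDiffOn_slice hg'.smooth (x := R + 1) (by simp)
    refine (h1.sub h2).congr fun u _ => ?_
    exact (sub_sub_cancel (bilinInChart e g (R + 1) u) _).symm
  · intro x hx u _ y z
    exact hG.g_symm x hx _ _ _
  · intro u hu z hz
    exact hgpos (e.symm u) (dInv e u z) (hinj u hu z hz)
  · intro x hx u hu X hX
    refine hG.pos x hx (e.symm u) (X.1, dInv e u X.2) fun h0 => hX ?_
    have h1 : X.1 = 0 := congrArg (fun q : ℝ × Eu d => q.1) h0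
    have h2 : (dInv e u : Eu d →L[ℝ] Eu d) X.2 = 0 := congrArg (fun q : ℝ × Eu d => q.2) h0
    refine Prod.ext h1 ?_
    by_contra hne
    exact hinj u hu _ hne h2

theorem exists_fderiv_transitionProd_eq (he : e ∈ atlas (EuclideanSpace ℝ (Fin d)) S)
    (he' : e' ∈ atlas (EuclideanSpace ℝ (Fin d)) S) {p : ℝ × Eu d} (hp : p.2 ∈ overlap e e')
    (Z : ℝ × Eu d) : ∃ Z', fderiv ℝ (transitionProd e e') p Z' = Z := by
  have hinj : Function.Injective (fderiv ℝ (transition e e') p.2 : Eu d →ₗ[ℝ] Eu d) := by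
    intro z z' hz
    refine dInv_injective he hp.1 ?_
    rw [dInv_transition he he' hp]
    exact congrArg (dInv e' (transition e e' p.2) : Eu d →L[ℝ] Eu d) hz
  obtain ⟨z, hz⟩ := LinearMap.injective_iff_surjective.1 hinj Z.2
  refine ⟨(Z.1, z), ?_⟩
  rw [fderiv_transitionProd he he' hp]
  exact Prod.ext rfl hz

/-- The curves of a chart flow are geodesics of the end. -/
theorem IsChartFlow.isGeodesicOn
    (h : ∀ e ∈ atlas (EuclideanSpace ℝ (Fin d)) S, ∃ gb, IsEndInChart R τ w a b g e gb)
    (he : e ∈ atlas (EuclideanSpace ℝ (Fin d)) S) {r δ : ℝ} {U : Set (Eu d)}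
    {N : ℝ × Eu d → ℝ × Eu d} (hN : IsChartFlow (endForm w a b g e) R r δ e.target U N) (hδ : δ < 1)
    {u : Eu d} (hu : u ∈ U) :
    IsGeodesicOn R w a b g (Ici 0) (fun t => ((N (t, u)).1, e.symm (N (t, u)).2)) ∧
      ∀ e' ∈ atlas (EuclideanSpace ℝ (Fin d)) S, e.symm u ∈ e'.source → u ∈ e.target →
        IsOutgoingUnitNormal w a b g e' (r, e' (e.symm u))
          (derivWithin (curveInChart e' fun t => ((N (t, u)).1, e.symm (N (t, u)).2)) (Ici 0) 0) := by
  have sN1 : ContDiff ℝ ∞ (dx N) := (hN.smooth.fderiv_right (m := ∞) le_rfl).clm_apply contDiff_const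
  have hd1 : ∀ t, HasDerivAt (fun t => N (t, u)) (dx N (t, u)) t := fun t =>
    hasDerivAt_slice (hN.smooth.differentiable (by simp) (t, u))
  have hd2 : ∀ t, HasDerivAt (fun t => dx N (t, u)) (dx (dx N) (t, u)) t := fun t =>
    hasDerivAt_slice (sN1.differentiable (by simp) (t, u))
  have hcont : Continuous fun t => N (t, u) :=
    hN.smooth.continuous.comp (continuous_id.prodMk continuous_const)
  have hlt : ∀ t : ℝ, 0 ≤ t → -1 < t := fun t ht => by linarith
  set γ : ℝ → ℝ × S := fun t => ((N (t, u)).1, e.symm (N (t, u)).2) with hγ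
  -- the derivatives of the curve in another chart
  have hder : ∀ e' ∈ atlas (EuclideanSpace ℝ (Fin d)) S, ∀ t, (N (t, u)).2 ∈ overlap e e' →
      HasDerivAt (curveInChart e' γ) (fderiv ℝ (transitionProd e e') (N (t, u)) (dx N (t, u))) t := by
    intro e' he' t ht
    exact ((contDiffAt_transitionProd he he' ht).differentiableAt
      (by simp)).hasFDerivAt.comp_hasDerivAt t (hd1 t)
  have hdw : ∀ e' ∈ atlas (EuclideanSpace ℝ (Fin d)) S, ∀ t, 0 ≤ t → (N (t, u)).2 ∈ overlap e e' →
      derivWithin (curveInChart e' γ) (Ici 0) t =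
        fderiv ℝ (transitionProd e e') (N (t, u)) (dx N (t, u)) :=
    fun e' he' t ht0 ht => (hder e' he' t ht).hasDerivWithinAt.derivWithin
      (uniqueDiffOn_Ici 0 t ht0)
  refine ⟨⟨fun t ht => (hN.mem t (hlt t ht) u hu).1, ?_, ?_⟩, ?_⟩
  · refine (continuous_fst.comp hcont).continuousOn.prodMk ?_
    exact e.continuousOn_symm.comp (continuous_snd.comp hcont).continuousOn
      fun t ht => (hN.mem t (hlt t ht) u hu).2
  · intro e' he' t ht hte
    have hov : (N (t, u)).2 ∈ overlap e e' := ⟨(hN.mem t (hlt t ht) u hu).2, hte⟩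
    have hcd : ContDiffAt ℝ ∞ (curveInChart e' γ) t :=
      ContDiffAt.comp (f := fun t => N (t, u)) t (contDiffAt_transitionProd he he' hov)
        (hN.smooth.contDiffAt.comp t (contDiffAt_id.prodMk contDiffAt_const))
    refine ⟨(hcd.of_le two_le_infty).contDiffWithinAt, fun Z => ?_⟩
    have hev : ∀ᶠ s in 𝓝 t, (N (s, u)).2 ∈ overlap e e' :=
      (continuous_snd.comp hcont).continuousAt.eventually (isOpen_overlap.mem_nhds hov)
    have hΦ := contDiffAt_transitionProd he he' hov
    have hΦ1 : HasFDerivAt (fderiv ℝ (transitionProd e e'))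
        (fderiv ℝ (fderiv ℝ (transitionProd e e')) (N (t, u))) (N (t, u)) :=
      ((hΦ.fderiv_right (m := 1) (by norm_num; exact two_le_infty)).differentiableAt
        (by simp)).hasFDerivAt
    have h2 : HasDerivAt (fun s => fderiv ℝ (transitionProd e e') (N (s, u)) (dx N (s, u)))
        (fderiv ℝ (fderiv ℝ (transitionProd e e')) (N (t, u)) (dx N (t, u)) (dx N (t, u))
          + fderiv ℝ (transitionProd e e') (N (t, u)) (dx (dx N) (t, u))) t := by
      have h0 : HasDerivAt (fun s => fderiv ℝ (transitionProd e e') (N (s, u)))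
          (fderiv ℝ (fderiv ℝ (transitionProd e e')) (N (t, u)) (dx N (t, u))) t :=
        hΦ1.comp_hasDerivAt t (hd1 t)
      exact h0.clm_apply (hd2 t)
    have h3 : derivWithin (derivWithin (curveInChart e' γ) (Ici 0)) (Ici 0) t =
        fderiv ℝ (fderiv ℝ (transitionProd e e')) (N (t, u)) (dx N (t, u)) (dx N (t, u))
          + fderiv ℝ (transitionProd e e') (N (t, u)) (dx (dx N) (t, u)) := by
      refine (HasDerivWithinAt.congr_of_eventuallyEq h2.hasDerivWithinAt ?_
        (hdw e' he' t ht hov)).derivWithin (uniqueDiffOn_Ici 0 t ht)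
      filter_upwards [self_mem_nhdsWithin, mem_nhdsWithin_of_mem_nhds hev] with s hs hs'
      exact hdw e' he' s hs hs'
    obtain ⟨gb, hgb⟩ := h e he
    obtain ⟨gb', hgb'⟩ := h e' he'
    have hmem := hN.mem t (hlt t ht) u hu
    have hmem' : transitionProd e e' (N (t, u)) ∈ Ioi R ×ˢ e'.target :=
      ⟨hmem.1, transition_mem_target hov⟩
    have hc : curveInChart e' γ t = transitionProd e e' (N (t, u)) := rfl
    obtain ⟨Z', rfl⟩ := exists_fderiv_transitionProd_eq he he' hov Z
    rw [h3, hdw e' he' t ht hov, hc, geodesic_expr_eq (hgb'.differentiableAt hmem'),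
      geodesicForm_comp (hgb.differentiableAt hmem) (hgb'.differentiableAt hmem')
        (hΦ.of_le two_le_infty) (hgb'.symm hmem')]
    · exact hN.geodesic t (hlt t ht) u hu Z'
    · filter_upwards [continuous_snd.continuousAt.eventually (isOpen_overlap.mem_nhds hov)]
        with q hq
      exact endForm_transition he he' hq
  · intro e' he' hs hut
    have hov : u ∈ overlap e e' := ⟨hut, hs⟩
    have hov0 : (N (0, u)).2 ∈ overlap e e' := by rw [hN.zero]; exact hov
    have hp : (r, e' (e.symm u)) = transitionProd e e' (r, u) := rfl
    rw [hdw e' he' 0 le_rfl hov0, hN.zero, hp]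
    have hu1 := hN.unit 0 (by norm_num) u hu
    rw [hN.zero] at hu1
    have hov1 : ((r, u) : ℝ × Eu d).2 ∈ overlap e e' := hov
    refine ⟨?_, fun z => ?_, ?_⟩
    · rw [metricInChart_eq, endForm_transition he he' hov1, hu1]
    · obtain ⟨Z', hZ'⟩ := exists_fderiv_transitionProd_eq he he' hov1 (0, z)
      have hZ1 : Z'.1 = 0 := by
        rw [fderiv_transitionProd he he' hov1] at hZ'
        exact congrArg Prod.fst hZ'
      rw [← hZ', metricInChart_eq, endForm_transition he he' hov1]
      have : Z' = (0, Z'.2) := Prod.ext hZ1 rfl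
      rw [this]
      exact hN.normal u hu _
    · rw [fderiv_transitionProd he he' hov1]
      have h1 : ‖(dx N (0, u)).1 - 1‖ ≤ δ := (norm_fst_le _).trans (hN.speed 0 u)
      rw [Real.norm_eq_abs, abs_le] at h1
      have h2 := h1.1
      change 0 < (dx N (0, u)).1
      linarith

end

end RadialEnd

namespace RadialEnd
open BoundedContinuousFunction

/-! ### Differences of symbols -/

section

variable {E F G H : Type} [NormedAddCommGroup E] [NormedSpace ℝ E] [NormedAddCommGroup F]
  [NormedSpace ℝ F] [NormedAddCommGroup G] [NormedSpace ℝ G]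
variable {M M' m m' : ℝ} {V : Set E} {f : ℝ × E → F}

/-- The bounds for all derivatives in `θ` follow from those for the function and for its first
derivative. -/
theorem FiberBound.of_zero_dth (hV : IsOpen V) (hf : ContDiffOn ℝ ∞ f (Ioi M ×ˢ V))
    (h0 : ∃ C, ∀ x, M < x → ∀ θ ∈ V, ‖f (x, θ)‖ ≤ C * bracket x ^ m)
    (h1 : FiberBound M V m (dth f)) : FiberBound M V m f := by
  intro K hK hKV k
  cases k with
  | zero =>
    obtain ⟨C, hC⟩ := h0
    exact ⟨C, fun x hx θ hθ => by simpa using hC x hx θ (hKV hθ)⟩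
  | succ k =>
    obtain ⟨C, hC⟩ := h1 K hK hKV k
    refine ⟨C, fun x hx θ hθ => ?_⟩
    have : (fun u => dth f (x, u)) =ᶠ[𝓝 θ] fderiv ℝ (fun u => f (x, u)) := by
      filter_upwards [hV.mem_nhds (hKV hθ)] with u hu
      exact ((hasFDerivAt_slice ((contDiffAt_of_mem hV hf hx hu).differentiableAt
        (by simp))).fderiv).symm
    rw [← norm_iteratedFDeriv_fderiv, ← (EventuallyEq.iteratedFDeriv ℝ this k).self_of_nhds]
    exact hC x hx θ hθ

theorem IsSymbolOnLine.mono {p : ℝ → ℝ} (h : IsSymbolOnLine m M p) (hM : M ≤ M') :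
    IsSymbolOnLine m M' p :=
  ⟨h.1.mono (Ioi_subset_Ioi hM), fun j => (h.2 j).imp fun _ hC x hx => hC x (hM.trans_lt hx)⟩

theorem IsSymbolOnLine.deriv {p : ℝ → ℝ} (h : IsSymbolOnLine m M p) :
    IsSymbolOnLine (m - 1) M (deriv p) := by
  refine ⟨?_, fun j => ?_⟩
  · exact (contDiffOn_infty_iff_deriv_of_isOpen isOpen_Ioi).1 h.1 |>.2
  · obtain ⟨C, hC⟩ := h.2 (j + 1)
    refine ⟨C, fun x hx => ?_⟩
    rw [← iteratedDeriv_succ']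
    have := hC x hx
    rwa [show m - ↑(j + 1) = m - 1 - j by push_cast; ring] at this

/-- If `p'` is a symbol of order `m`, so is `p(x + ψ) - p(x)`, for `ψ` in a bounded interval. -/
theorem sym_shift_sub (hV : IsOpen V) {p : ℝ → ℝ} (hp : ContDiffOn ℝ ∞ p (Ioi M))
    (h : IsSymbolOnLine m M (deriv p)) {B : ℝ} (hB : 0 ≤ B) :
    Sym (M + B) (Ioo (-B) B ×ˢ V) m
      (fun q : ℝ × (ℝ × E) => p (q.1 + q.2.1) - p q.1) := by
  have oP : IsOpen (Ioo (-B) B) := isOpen_Ioo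
  have oW : IsOpen (Ioo (-B) B ×ˢ V) := oP.prod hV
  have hMs : ∀ s, M + B < s → ∀ ψ ∈ Ioo (-B) B, M < s + ψ := fun s hs ψ hψ => by linarith [hψ.1]
  have base : ∀ {m : ℝ} {p : ℝ → ℝ}, ContDiffOn ℝ ∞ p (Ioi M) → IsSymbolOnLine m M (_root_.deriv p) →
      ContDiffOn ℝ ∞ (fun q : ℝ × (ℝ × E) => p (q.1 + q.2.1) - p q.1)
        (Ioi (M + B) ×ˢ (Ioo (-B) B ×ˢ V)) ∧
      FiberBound (M + B) (Ioo (-B) B ×ˢ V) m (fun q : ℝ × (ℝ × E) => p (q.1 + q.2.1) - p q.1) := by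
    intro m p hp h
    have sm : ContDiffOn ℝ ∞ (fun q : ℝ × (ℝ × E) => p (q.1 + q.2.1) - p q.1)
        (Ioi (M + B) ×ˢ (Ioo (-B) B ×ˢ V)) :=
      (hp.comp (by fun_prop) fun q hq => hMs _ hq.1 _ hq.2.1).sub
        (hp.comp contDiffOn_fst fun q hq => (show M < q.1 by linarith [show M + B < q.1 from hq.1]))
    refine ⟨sm, ?_⟩
    refine FiberBound.of_zero_dth oW sm ?_ ?_
    · obtain ⟨C, hC⟩ := h.2 0
      obtain ⟨C', hC', hb⟩ := bracket_add_rpow_le m B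
      refine ⟨|C| * C' * B, fun x hx θ hθ => ?_⟩
      have hconv : Convex ℝ (Icc (x - B) (x + B) ∩ Ioi M) := (convex_Icc _ _).inter (convex_Ioi _)
      have hpd : ∀ y ∈ Icc (x - B) (x + B) ∩ Ioi M, HasDerivWithinAt p (_root_.deriv p y)
          (Icc (x - B) (x + B) ∩ Ioi M) y := fun y hy =>
        ((hp.contDiffAt (Ioi_mem_nhds hy.2)).differentiableAt
          (by simp)).hasDerivAt.hasDerivWithinAt
      have := hconv.norm_image_sub_le_of_norm_hasDerivWithin_le (C := |C| * (C' * bracket x ^ m))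
        hpd (fun y hy => ?_) (x := x) (y := x + θ.1) ?_ ?_
      · refine this.trans ?_
        rw [add_sub_cancel_left]
        have e1 : ‖θ.1‖ ≤ B := by
          rw [Real.norm_eq_abs, abs_le]
          exact ⟨hθ.1.1.le, hθ.1.2.le⟩
        have := Real.rpow_pos_of_pos (bracket_pos x) m
        calc _ ≤ |C| * (C' * bracket x ^ m) * B := by gcongr
          _ = _ := by ring
      · have e1 := hC y hy.2
        rw [iteratedDeriv_zero, Nat.cast_zero, sub_zero] at e1
        have e2 := hb x (y - x) (by rw [abs_le]; exact ⟨by linarith [hy.1.1], by linarith [hy.1.2]⟩)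
        rw [add_sub_cancel] at e2
        have := Real.rpow_pos_of_pos (bracket_pos y) m
        calc _ ≤ _ := e1
          _ ≤ |C| * bracket y ^ m := by gcongr; exact le_abs_self C
          _ ≤ _ := by gcongr
      · exact ⟨⟨by linarith, by linarith⟩, show M < x by linarith⟩
      · exact ⟨⟨by linarith [hθ.1.1], by linarith [hθ.1.2]⟩, hMs x hx θ.1 hθ.1⟩
    · have h1 := (((h.sym (E := E) hV).shift hV oP hMs).clm oW (ContinuousLinearMap.toSpanSingleton ℝ
          (ContinuousLinearMap.fst ℝ ℝ E))).bound
      refine h1.congr oW fun q hq => ?_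
      have d1 := (hp.contDiffAt (Ioi_mem_nhds (hMs _ hq.1 _ hq.2.1))).differentiableAt (by simp)
      have d2 := hasFDerivAt_slice ((contDiffAt_of_mem oW sm hq.1 hq.2).differentiableAt (by simp))
      have d3 : HasFDerivAt (fun y : ℝ × E => p (q.1 + y.1) - p q.1)
          (_root_.deriv p (q.1 + q.2.1) • ContinuousLinearMap.fst ℝ ℝ E) q.2 :=
        (HasDerivAt.comp_hasFDerivAt q.2 d1.hasDerivAt
          (hasFDerivAt_fst.const_add q.1)).sub_const (p q.1)
      exact d2.unique d3
  intro n
  induction n generalizing m p with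
  | zero => exact base hp h
  | succ n ih =>
    refine ⟨base hp h, (ih ((contDiffOn_infty_iff_deriv_of_isOpen isOpen_Ioi).1 hp).2
      h.deriv).congr oW fun q hq => ?_⟩
    have sm := (base hp h).1
    have d1 := (hp.contDiffAt (Ioi_mem_nhds (hMs _ hq.1 _ hq.2.1))).differentiableAt (by simp)
    have d1' := (hp.contDiffAt (Ioi_mem_nhds (show M < q.1 by
      linarith [show M + B < q.1 from hq.1]))).differentiableAt (by simp)
    have d2 := hasDerivAt_slice ((contDiffAt_of_mem oW sm hq.1 hq.2).differentiableAt (by simp))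
    have d3 : HasDerivAt (fun x => p (x + q.2.1) - p x)
        (_root_.deriv p (q.1 + q.2.1) - _root_.deriv p q.1) q.1 :=
      (HasDerivAt.comp_add_const q.1 q.2.1 d1.hasDerivAt).sub d1'.hasDerivAt
    exact d2.unique d3


end

end RadialEnd

namespace RadialEnd
open BoundedContinuousFunction

section

variable {E F G H : Type} [NormedAddCommGroup E] [NormedSpace ℝ E] [NormedAddCommGroup F]
  [NormedSpace ℝ F] [NormedAddCommGroup G] [NormedSpace ℝ G]
variable {M M' m m' : ℝ} {V : Set E}

/-- The Hadamard lemma `φ(y) - φ(y') = Ψ(y, y') (y - y')`, with `Ψ(y, y')` the mean of the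
derivative of `φ` over the segment `[y', y]`. -/
theorem exists_hadamard [FiniteDimensional ℝ E] [CompleteSpace F] {φ : E → F}
    (hφ : ContDiff ℝ ∞ φ) (hc : HasCompactSupport φ) :
    ∃ Ψ : E × E → (E →L[ℝ] F), ContDiff ℝ ∞ Ψ ∧ ∀ y y', φ y - φ y' = Ψ (y, y') (y - y') := by
  have hd : ContDiff ℝ ∞ (fderiv ℝ φ) := hφ.fderiv_right (m := ∞) le_rfl
  have hf : UnifSmooth (fun p : ℝ × E => fderiv ℝ φ p.2) := by
    refine ⟨hd.comp contDiff_snd, fun k => ?_⟩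
    obtain ⟨C, hC⟩ := ((hc.fderiv (𝕜 := ℝ)).iteratedFDeriv (𝕜 := ℝ) k).exists_bound_of_continuous
      (hd.continuous_iteratedFDeriv (m := k) (by exact_mod_cast le_top))
    exact ⟨C, fun _ z => hC z⟩
  set A : ℝ →ᵇ (E →L[ℝ] E) := BoundedContinuousFunction.ofNormedAddCommGroup
    (fun s => (max 0 (min s 1) : ℝ) • ContinuousLinearMap.id ℝ E)
    (by fun_prop) 1 (fun s => by
      rw [norm_smul, Real.norm_of_nonneg (le_max_left _ _)]
      exact mul_le_one₀ (max_le zero_le_one (min_le_right _ _)) (norm_nonneg _)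
        ContinuousLinearMap.norm_id_le) with hA
  -- The mean `∫_0^1 φ'(y' + s (y - y')) ds` is smooth, as a composition of continuous linear maps
  -- and of the superposition operator of `φ'` on bounded curves.
  refine ⟨fun p => segBCF 1 (nem hf (constBCF p.2 + applyBCF A (constBCF (p.1 - p.2)))), ?_, ?_⟩
  · refine (ContinuousLinearMap.contDiff (segBCF (G := E →L[ℝ] F) 1)).comp
      ((contDiff_nem hf).comp ?_)
    have hc1 : ContDiff ℝ ∞ (fun y : E => (constBCF y : ℝ →ᵇ E)) :=
      ContinuousLinearMap.contDiff (constBCF (E := E))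
    exact (hc1.comp contDiff_snd).add ((ContinuousLinearMap.contDiff (applyBCF A)).comp
      (hc1.comp (contDiff_fst.sub contDiff_snd)))
  · intro y y'
    simp only [segBCF_apply]
    have hcont : Continuous (fun s : ℝ => fderiv ℝ φ (y' + s • (y - y'))) :=
      hd.continuous.comp (by fun_prop)
    have e1 : ∫ s in (0 : ℝ)..1, nem hf (constBCF y' + applyBCF A (constBCF (y - y'))) s =
        ∫ s in (0 : ℝ)..1, fderiv ℝ φ (y' + s • (y - y')) := by
      refine intervalIntegral.integral_congr fun s hs => ?_
      rw [uIcc_of_le zero_le_one] at hs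
      simp [hA, min_eq_left hs.2, max_eq_right hs.1]
      rw [smul_sub]
    rw [e1, ContinuousLinearMap.intervalIntegral_apply (hcont.intervalIntegrable _ _)]
    have e2 := intervalIntegral.integral_eq_sub_of_hasDerivAt (a := 0) (b := 1)
      (f := fun s : ℝ => φ (y' + s • (y - y'))) (f' := fun s => fderiv ℝ φ (y' + s • (y - y')) (y - y'))
      (fun s _ => by
        have h1 : HasDerivAt (fun s : ℝ => y' + s • (y - y')) (y - y') s := by
          simpa using ((hasDerivAt_id s).smul_const (y - y')).const_add y'
        exact ((hφ.differentiable (by simp) _).hasFDerivAt).comp_hasDerivAt s h1)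
      ((hcont.clm_apply continuous_const).intervalIntegrable _ _)
    rw [e2]
    simp

theorem contDiff_bump_smul [FiniteDimensional ℝ E] {c : E} (χ : ContDiffBump c) {U : Set E} (hU : IsOpen U)
    (hsub : Metric.closedBall c χ.rOut ⊆ U) {φ : E → F} (hφ : ContDiffOn ℝ ∞ φ U) :
    ContDiff ℝ ∞ (fun y => χ y • φ y) := by
  rw [contDiff_iff_contDiffAt]
  intro y
  by_cases hy : y ∈ Metric.closedBall c χ.rOut
  · exact χ.contDiff.contDiffAt.smul (hφ.contDiffAt (hU.mem_nhds (hsub hy)))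
  · have : (fun y => χ y • φ y) =ᶠ[𝓝 y] fun _ => 0 := by
      filter_upwards [Metric.isClosed_closedBall.isOpen_compl.mem_nhds hy] with z hz
      rw [χ.zero_of_le_dist (not_le.1 (fun h => hz (Metric.mem_closedBall.2 h))).le, zero_smul]
    exact contDiffAt_const.congr_of_eventuallyEq this

/-- Smooth functions preserve the order of the difference of two bounded symbols. -/
theorem Sym.comp_sub [FiniteDimensional ℝ F] [CompleteSpace G] {U : Set F} (hV : IsOpen V)
    (hU : IsOpen U) {φ : F → G} (hφ : ContDiffOn ℝ ∞ φ U) {y y' : ℝ × E → F} (h : Sym M V 0 y)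
    (h' : Sym M V 0 y') (hd : Sym M V m (fun p => y p - y' p)) {c : F} {ρ : ℝ} (hρ : 0 < ρ)
    (hρU : Metric.closedBall c (2 * ρ) ⊆ U)
    (hy : ∀ x, M < x → ∀ u ∈ V, y (x, u) ∈ Metric.closedBall c ρ)
    (hy' : ∀ x, M < x → ∀ u ∈ V, y' (x, u) ∈ Metric.closedBall c ρ) :
    Sym M V m (fun p => φ (y p) - φ (y' p)) := by
  set χ : ContDiffBump c := ⟨ρ, 2 * ρ, hρ, by linarith⟩ with hχ
  obtain ⟨Ψ, hΨ, he⟩ := exists_hadamard (contDiff_bump_smul χ hU hρU hφ)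
    (χ.hasCompactSupport.smul_right)
  have h1 : Sym M V 0 (fun p => Ψ (y p, y' p)) := (h.prodMk hV h').comp_smooth hV isOpen_univ
    hΨ.contDiffOn ((isCompact_closedBall c ρ).prod (isCompact_closedBall c ρ)) (subset_univ _)
    fun x hx u hu => ⟨hy x hx u hu, hy' x hx u hu⟩
  refine (h1.apply_le hV hd (by linarith)).congr hV ?_
  rintro ⟨x, u⟩ ⟨hx, hu⟩
  have e := he (y (x, u)) (y' (x, u))
  rw [χ.one_of_mem_closedBall (hy x hx u hu), χ.one_of_mem_closedBall (hy' x hx u hu), one_smul,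
    one_smul] at e
  exact e

end

/-! ### The logarithmic derivative of the warping function -/

section

variable {ε R : ℝ} {q : ℝ → ℝ}

/-- A function on the half-line whose derivative is a symbol of order `-1 - ε` has a limit, and its
difference with the limit is a symbol of order `-ε`. -/
theorem exists_limit_of_deriv_symbol (hε : 0 < ε) (hq : ContDiffOn ℝ ∞ q (Ioi R))
    (h : IsSymbolOnLine (-1 - ε) R (deriv q)) : ∃ κ, Tendsto q atTop (𝓝 κ) ∧
      IsSymbolOnLine (-ε) (max R 1) (fun x => q x - κ) := by
  obtain ⟨C, hC⟩ := h.2 0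
  have hd : ∀ x, R < x → HasDerivAt q (deriv q x) x := fun x hx =>
    ((hq.contDiffAt (Ioi_mem_nhds hx)).differentiableAt (by simp)).hasDerivAt
  have hb : ∀ x, R < x → ‖deriv q x‖ ≤ |C| * bracket x ^ (-1 - ε) := by
    intro x hx
    have := hC x hx
    simp only [iteratedDeriv_zero, Nat.cast_zero, sub_zero] at this
    have hp := Real.rpow_pos_of_pos (bracket_pos x) (-1 - ε)
    exact this.trans (by gcongr; exact le_abs_self C)
  have hcd : ContinuousOn (deriv q) (Ioi R) := h.1.continuousOn
  have hint : ∀ x, R < x → MeasureTheory.IntegrableOn (deriv q) (Ioi x) := by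
    intro x hx
    refine MeasureTheory.Integrable.mono' (((integrable_bracket hε).const_mul |C|).integrableOn)
      ((hcd.mono (Ioi_subset_Ioi hx.le)).aestronglyMeasurable measurableSet_Ioi) ?_
    exact (MeasureTheory.ae_restrict_iff' measurableSet_Ioi).2
      (Eventually.of_forall fun y hy => hb y (hx.trans hy))
  have hlim := MeasureTheory.tendsto_limUnder_of_hasDerivAt_of_integrableOn_Ioi (a := R + 1)
    (f := q) (f' := deriv q) (fun x hx => hd x (by linarith [show R + 1 < x from hx]))
    (hint _ (by linarith))
  set κ := limUnder atTop q
  refine ⟨κ, hlim, ?_⟩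
  have hR : R ≤ max R 1 := le_max_left _ _
  refine ⟨(hq.mono (Ioi_subset_Ioi hR)).sub contDiffOn_const, fun j => ?_⟩
  cases j with
  | zero =>
    refine ⟨|C| * (2 ^ ε / ε), fun x hx => ?_⟩
    have hRx := hR.trans_lt hx
    have e := MeasureTheory.integral_Ioi_of_hasDerivAt_of_tendsto
      (hd x hRx).continuousAt.continuousWithinAt (fun y hy => hd y (hRx.trans hy)) (hint x hRx) hlim
    rw [iteratedDeriv_zero, abs_sub_comm, ← e, Nat.cast_zero, sub_zero, ← Real.norm_eq_abs]
    refine (MeasureTheory.norm_integral_le_of_norm_le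
      (((integrable_bracket hε).const_mul |C|).integrableOn)
      ((MeasureTheory.ae_restrict_iff' measurableSet_Ioi).2
        (Eventually.of_forall fun y hy => hb y (hRx.trans hy)))).trans ?_
    rw [MeasureTheory.integral_const_mul, mul_assoc]
    gcongr
    exact integral_bracket_tail_le hε ((le_max_right R 1).trans hx.le)
  | succ j =>
    obtain ⟨C', hC'⟩ := h.2 j
    refine ⟨C', fun x hx => ?_⟩
    have e : deriv (fun x => q x - κ) = deriv q := by
      ext x
      exact deriv_sub_const κ
    rw [iteratedDeriv_succ', e]
    have := hC' x (hR.trans_lt hx)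
    rwa [show -ε - ↑(j + 1) = -1 - ε - j by push_cast; ring]

/-- A positive function tending to zero cannot have a positive limit logarithmic derivative. -/
theorem nonpos_of_tendsto_logDeriv {w : ℝ → ℝ} {κ : ℝ} (hw : ∀ x, R < x → 0 < w x)
    (hd : DifferentiableOn ℝ w (Ioi R)) (h0 : Tendsto w atTop (𝓝 0))
    (h : Tendsto (fun x => deriv w x / w x) atTop (𝓝 κ)) : κ ≤ 0 := by
  by_contra! hκ
  obtain ⟨X, hX⟩ := eventually_atTop.1 (h.eventually_const_lt hκ)
  set Y := max X (R + 1)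
  have hY : R < Y := by linarith [le_max_right X (R + 1)]
  have hmono : MonotoneOn w (Ici Y) := by
    refine monotoneOn_of_deriv_nonneg (convex_Ici Y) ?_ ?_ ?_
    · exact hd.continuousOn.mono fun x hx => hY.trans_le hx
    · rw [interior_Ici]
      exact hd.mono fun x hx => hY.trans hx
    · intro x hx
      rw [interior_Ici] at hx
      have h1 := hX x ((le_max_left _ _).trans (le_of_lt hx))
      have h2 := hw x (hY.trans hx)
      by_contra! hneg
      exact absurd h1 (not_lt.2 (div_nonpos_of_nonpos_of_nonneg hneg.le h2.le))
  have h1 : w Y ≤ 0 := ge_of_tendsto h0 (by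
    filter_upwards [eventually_ge_atTop Y] with x hx using hmono self_mem_Ici hx hx)
  exact absurd (hw Y hY) (not_lt.2 h1)

end

end RadialEnd

namespace RadialEnd

/-! ### Asymptotics of the metric along the normal flow -/

section

variable {E F G H : Type} [NormedAddCommGroup E] [NormedSpace ℝ E] [NormedAddCommGroup F]
  [NormedSpace ℝ F] [NormedAddCommGroup G] [NormedSpace ℝ G] [NormedAddCommGroup H]
  [NormedSpace ℝ H]
variable {M M' m m' : ℝ} {V : Set E} {f : ℝ × E → F}

theorem Sym.comp_le {m'' : ℝ} {A : ℝ × E → (G →L[ℝ] H)} {T : ℝ × E → (F →L[ℝ] G)} (hV : IsOpen V)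
    (h : Sym M V m A) (h' : Sym M V m' T) (hm : m + m' ≤ m'') :
    Sym M V m'' (fun p => (A p).comp (T p)) :=
  h.bilin_le hV (ContinuousLinearMap.compL ℝ F G H) h' hm

theorem Sym.smulRight_le {m'' : ℝ} {A : ℝ × E → (F →L[ℝ] ℝ)} {y : ℝ × E → G} (hV : IsOpen V)
    (h : Sym M V m A) (h' : Sym M V m' y) (hm : m + m' ≤ m'') :
    Sym M V m'' (fun p => (A p).smulRight (y p)) :=
  h.bilin_le hV (ContinuousLinearMap.smulRightL ℝ F G) h' hm

theorem Sym.flip {A : ℝ × E → (F →L[ℝ] G →L[ℝ] H)} (hV : IsOpen V) (h : Sym M V m A) :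
    Sym M V m (fun p => (A p).flip) :=
  (h.clm hV ((ContinuousLinearMap.flipₗᵢ ℝ F G H).toContinuousLinearEquiv.toContinuousLinearMap :
    (F →L[ℝ] G →L[ℝ] H) →L[ℝ] (G →L[ℝ] F →L[ℝ] H))).congr hV fun _ _ => rfl

theorem Sym.bilinearComp_le {m₁ m₂ m'' : ℝ} {A : ℝ × E → (G →L[ℝ] G →L[ℝ] ℝ)}
    {T T' : ℝ × E → (F →L[ℝ] G)} (hV : IsOpen V)
    (h : Sym M V m A) (h₁ : Sym M V m₁ T) (h₂ : Sym M V m₂ T') (hm : m + m₁ + m₂ ≤ m'') :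
    Sym M V m'' (fun p => (A p).bilinearComp (T p) (T' p)) :=
  ((((h.comp_le hV h₁ le_rfl).flip hV).comp_le hV h₂ hm).flip hV)

/-- Translation of a symbol by the constant `c`; the domain shrinks by `1`, as `c` is replaced by a
variable near `c`. -/
theorem Sym.translate (hV : IsOpen V) (h : Sym M V m f) (c : ℝ) :
    Sym (M - c + 1) V m (fun p => f (p.1 + c, p.2)) := by
  have h1 := h.shift (M' := M - c + 1) hV (P := Metric.ball c 1) Metric.isOpen_ball (by
    intro s hs ψ hψ
    rw [Metric.mem_ball, Real.dist_eq, abs_lt] at hψ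
    linarith [hψ.1])
  refine h1.comp (Metric.isOpen_ball.prod hV) hV (ζ := fun p => (c, p.2))
    (sym_of_independent (φ := fun u => (c, u)) hV (by fun_prop)) fun K hK hKV => ?_
  exact ⟨{c} ×ˢ K, isCompact_singleton.prod hK, prod_mono
    (singleton_subset_iff.2 (Metric.mem_ball_self one_pos)) hKV, fun x _ u hu => ⟨rfl, hu⟩⟩

/-- A function `q • k + l`, with `k` and `l` smooth up to the boundary `x = M`, is a symbol
as soon as it is one near infinity and `q` is a symbol. -/
theorem Sym.smul_add_of_tail (hV : IsOpen V) {q : ℝ × E → ℝ} {k l : ℝ × E → F} {M₀ m₁ : ℝ}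
    (hM : M₀ < M) (hq : Sym M V m₁ q) (hk : ContDiffOn ℝ ∞ k (Ioi M₀ ×ˢ V))
    (hl : ContDiffOn ℝ ∞ l (Ioi M₀ ×ˢ V)) (h : Sym M' V m (fun p => q p • k p + l p)) :
    Sym M V m (fun p => q p • k p + l p) := by
  set N := max M M' + 1 with hN
  have hMN : M < N := by linarith [le_max_left M M']
  have hMN' : M' < N := by linarith [le_max_right M M']
  set χ : ℝ → ℝ := fun t => Real.smoothTransition (t - N) with hχ
  have hχs : ContDiff ℝ ∞ (fun p : ℝ × E => χ p.1) :=
    Real.smoothTransition.contDiff.comp (contDiff_fst.sub contDiff_const)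
  have hχ1 : ∀ t, N + 1 < t → χ t = 1 := fun t ht =>
    Real.smoothTransition.one_of_one_le (by linarith)
  have hχ0 : ∀ t, t ≤ N → χ t = 0 := fun t ht =>
    Real.smoothTransition.zero_of_nonpos (by linarith)
  have hcut : ∀ {k : ℝ × E → F} (n : ℝ), ContDiffOn ℝ ∞ k (Ioi M₀ ×ˢ V) →
      Sym M V n (fun p => (1 - χ p.1) • k p) := by
    intro k n hk
    refine Sym.of_tail (M' := N + 1) hV hM ((contDiffOn_const.sub hχs.contDiffOn).smul hk)
      ((sym_zero hV).congr hV fun p hp => ?_)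
    simp only [hχ1 p.1 hp.1, sub_self, zero_smul]
  have hs : ContDiffOn ℝ ∞ (fun p => q p • k p + l p) (Ioi M ×ˢ V) :=
    (hq.smooth.smul (hk.mono (prod_mono (Ioi_subset_Ioi hM.le) subset_rfl))).add
      (hl.mono (prod_mono (Ioi_subset_Ioi hM.le) subset_rfl))
  have h3 : Sym M V m (fun p => χ p.1 • (q p • k p + l p)) := by
    refine Sym.of_tail (M' := N + 1) (M₀ := M₀) hV hM ?_ ((h.mono_dom (by linarith)
      subset_rfl).congr hV fun p hp => ?_)
    · rintro ⟨t, u⟩ ⟨ht, hu⟩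
      refine ContDiffAt.contDiffWithinAt ?_
      rcases lt_or_ge t N with h1 | h1
      · have : (fun p : ℝ × E => χ p.1 • (q p • k p + l p)) =ᶠ[𝓝 (t, u)] fun _ => 0 := by
          filter_upwards [continuous_fst.continuousAt.eventually (gt_mem_nhds h1)] with p hp
          rw [hχ0 p.1 hp.le, zero_smul]
        exact contDiffAt_const.congr_of_eventuallyEq this
      · exact hχs.contDiffAt.smul (contDiffAt_of_mem hV hs (hMN.trans_le h1) hu)
    · simp only [hχ1 p.1 hp.1, one_smul]
  have h1 := hq.smul_le (m'' := m) hV (hcut (m - m₁) hk) (by linarith)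
  have h2 := hcut m hl
  refine ((h1.add hV h2).add hV h3).congr hV fun p _ => ?_
  simp only [smul_add, sub_smul, one_smul, smul_sub, smul_comm (χ p.1) (q p) (k p)]
  abel

theorem IsSymbolOnLine.congr {p p' : ℝ → ℝ} (h : IsSymbolOnLine m M p)
    (he : EqOn p' p (Ioi M)) : IsSymbolOnLine m M p' := by
  refine ⟨h.1.congr he, fun j => ?_⟩
  obtain ⟨C, hC⟩ := h.2 j
  refine ⟨C, fun x hx => ?_⟩
  have : p' =ᶠ[𝓝 x] p := he.eventuallyEq_of_mem (Ioi_mem_nhds hx)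
  rw [this.iteratedDeriv_eq j]
  exact hC x hx

end

section

variable {E : Type} [NormedAddCommGroup E] [NormedSpace ℝ E]

/-- The metric induced on the cross-section by a family `N` of curves. -/
noncomputable def inducedForm (m : ℝ × E → ((ℝ × E) →L[ℝ] (ℝ × E) →L[ℝ] ℝ)) (N : ℝ × E → ℝ × E)
    (p : ℝ × E) : E →L[ℝ] E →L[ℝ] ℝ :=
  (m (N p)).bilinearComp (dth N p) (dth N p)

/-- The limit metric: the form `e^{-2κφ} θ^* gb`, where `Ninf = (φ, θ)`. -/
noncomputable def limitForm (κ : ℝ) (gb : E → (E →L[ℝ] E →L[ℝ] ℝ)) (Ninf : E → ℝ × E) (u : E) :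
    E →L[ℝ] E →L[ℝ] ℝ :=
  Real.exp (-2 * κ * (Ninf u).1) • (gb (Ninf u).2).bilinearComp
    ((ContinuousLinearMap.snd ℝ ℝ E).comp (fderiv ℝ Ninf u))
    ((ContinuousLinearMap.snd ℝ ℝ E).comp (fderiv ℝ Ninf u))

variable {R τ ε κ lam r δ M : ℝ} {V U : Set E} {w : ℝ → ℝ} {a : ℝ × E → ℝ} {b : ℝ × E → (E →L[ℝ] ℝ)}
  {g : ℝ × E → (E →L[ℝ] E →L[ℝ] ℝ)} {gb : E → (E →L[ℝ] E →L[ℝ] ℝ)}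
  {m : ℝ × E → ((ℝ × E) →L[ℝ] (ℝ × E) →L[ℝ] ℝ)} {N : ℝ × E → ℝ × E} {Ninf : E → ℝ × E}

theorem tendsto_of_sym {F : Type} [NormedAddCommGroup F] [NormedSpace ℝ F] (hτ : 0 < τ)
    {f : ℝ × E → F} (hs : Sym M univ (-τ) f) (u : E) :
    Tendsto (fun t => f (t, u)) atTop (𝓝 0) := by
  rw [Metric.tendsto_atTop]
  intro ε hε
  obtain ⟨M', hM', h⟩ := hs.exists_small (by linarith) (isCompact_singleton (x := u))
    (subset_univ _) (half_pos hε)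
  refine ⟨M' + 1, fun t ht => ?_⟩
  rw [dist_zero_right]
  exact (h t (by linarith) u rfl).trans_lt (half_lt_self hε)

/-- The limit of the flow inherits the bound on the displacement. -/
theorem IsChartFlow.norm_limit_sub_le (hN : IsChartFlow m R r δ V U N) (hτ : 0 < τ)
    (hs : Sym M univ (-τ) (fun p : ℝ × E => N p - (p.1, 0) - Ninf p.2)) (u : E) :
    ‖Ninf u - (r, u)‖ ≤ δ := by
  have h1 := (tendsto_of_sym hτ hs u).norm
  rw [norm_zero] at h1
  have h2 : ∀ t, ‖Ninf u - (r, u)‖ ≤ ‖N (t, u) - (t, 0) - Ninf u‖ + δ := by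
    intro t
    have e : Ninf u - (r, u) = -(N (t, u) - (t, 0) - Ninf u) + (N (t, u) - (r + t, u)) := by
      ext
      · simp
        ring
      · simp
    rw [e]
    refine (norm_add_le _ _).trans ?_
    rw [norm_neg]
    gcongr
    exact hN.close t u
  have h3 := h1.add_const δ
  rw [zero_add] at h3
  exact ge_of_tendsto' h3 h2

/-- The rescaled metric `w(t)² N^* G` on the cross-section converges to the limit metric. -/
theorem IsChartFlow.sym_inducedForm [FiniteDimensional ℝ E]
    (h : IsChartEnd R τ V w a b g gb) (hτ : 0 < τ) (hε : 0 < ε)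
    (hN : IsChartFlow (metricForm w a b g) R r δ V U N) {u₀ : E} {σ : ℝ} (hσ : 0 < σ)
    (hσV : Metric.closedBall u₀ (4 * σ) ⊆ V) (hδσ : δ ≤ σ) (hδ1 : δ ≤ 1)
    (hNinf : ContDiff ℝ ∞ Ninf)
    (hs : Sym M univ (-τ) (fun p : ℝ × E => N p - (p.1, 0) - Ninf p.2))
    (hκ : IsSymbolOnLine (-ε) (max R 1) (fun x => deriv w x / w x - κ))
    (hws : ContDiffOn ℝ ∞ w (Ioi R)) :
    ∃ M', Sym M' (Metric.ball u₀ σ) (-(min τ ε)) (fun p =>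
      w p.1 ^ 2 • inducedForm (metricForm w a b g) N p - limitForm κ gb Ninf p.2) := by
  set U₀ : Set E := Metric.ball u₀ σ with hU₀
  have oU : IsOpen U₀ := Metric.isOpen_ball
  set B : ℝ := |r| + 2 with hB
  have hB0 : 0 ≤ B := by positivity
  -- `ζ = (x - t, θ)` is a bounded symbol with values in a compact set, with limit
  -- `Ninf = (φ, θ_∞)`.
  set ζ : ℝ × E → ℝ × E := fun p => N p - (p.1, 0) with hζ
  have hζr : ∀ t u, ‖ζ (t, u) - (r, u)‖ ≤ δ := by
    intro t u
    have : ζ (t, u) - (r, u) = N (t, u) - (r + t, u) := by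
      ext
      · simp [hζ]
        ring
      · simp [hζ]
    rw [this]
    exact hN.close t u
  have hinfr := hN.norm_limit_sub_le hτ hs
  have hmemK : ∀ {z : ℝ × E} {u : E}, u ∈ U₀ → ‖z - (r, u)‖ ≤ δ →
      z ∈ Icc (-(|r| + 1)) (|r| + 1) ×ˢ Metric.closedBall u₀ (2 * σ) := by
    intro z u hu hz
    have h1 := (norm_fst_le _).trans hz
    have h2 := (norm_snd_le _).trans hz
    rw [Prod.fst_sub, Real.norm_eq_abs, abs_le] at h1
    refine ⟨⟨by linarith [neg_abs_le r, h1.1], by linarith [le_abs_self r, h1.2]⟩, ?_⟩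
    rw [mem_closedBall_iff_norm]
    rw [hU₀, mem_ball_iff_norm] at hu
    have e : z.2 - u₀ = (z.2 - u) + (u - u₀) := by abel
    rw [e]
    refine (norm_add_le _ _).trans ?_
    rw [Prod.snd_sub] at h2
    linarith
  have hK : IsCompact (Icc (-(|r| + 1)) (|r| + 1) ×ˢ Metric.closedBall u₀ (2 * σ)) :=
    isCompact_Icc.prod (isCompact_closedBall u₀ (2 * σ))
  have hKV : Icc (-(|r| + 1)) (|r| + 1) ×ˢ Metric.closedBall u₀ (2 * σ) ⊆ Ioo (-B) B ×ˢ V :=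
    prod_mono (fun x hx => ⟨by linarith [hx.1], by linarith [hx.2]⟩)
      ((Metric.closedBall_subset_closedBall (by linarith)).trans hσV)
  have oW : IsOpen (Ioo (-B) B ×ˢ V) := isOpen_Ioo.prod h.isOpen
  -- the logarithm of the ratio of the warping functions
  set L : ℝ → ℝ := fun x => Real.log (w x) - κ * x with hL
  have hLs : ContDiffOn ℝ ∞ L (Ioi (max R 1)) :=
    ((hws.mono (Ioi_subset_Ioi (le_max_left _ _))).log fun x hx =>
      (h.w_pos x ((le_max_left _ _).trans_lt hx)).ne').sub (contDiffOn_const.mul contDiffOn_id)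
  have hLd : IsSymbolOnLine (-ε) (max R 1) (deriv L) := by
    refine hκ.congr fun x hx => ?_
    have hxR : R < x := (le_max_left _ _).trans_lt hx
    have d1 : HasDerivAt w (deriv w x) x :=
      ((hws.contDiffAt (Ioi_mem_nhds hxR)).differentiableAt (by simp)).hasDerivAt
    have d2 := (d1.log (h.w_pos x hxR).ne').sub ((hasDerivAt_id x).const_mul κ)
    rw [mul_one] at d2
    exact d2.deriv
  have hLsh := sym_shift_sub h.isOpen hLs hLd hB0
  obtain ⟨M₂, hM₂, hsmall⟩ := hLsh.exists_small (by linarith) hK hKV one_pos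
  set M' : ℝ := max M (max M₂ (R + B)) with hM'
  have hMM : M ≤ M' := le_max_left _ _
  have hM₂M : M₂ ≤ M' := (le_max_left _ _).trans (le_max_right _ _)
  have hRM : R + B ≤ M' := (le_max_right _ _).trans (le_max_right _ _)
  have hd : Sym M' U₀ (-τ) (fun p => ζ p - Ninf p.2) := hs.mono_dom hMM (subset_univ _)
  have hinf : Sym M' U₀ 0 (fun p : ℝ × E => Ninf p.2) :=
    sym_of_independent oU hNinf.contDiffOn
  have hζs : Sym M' U₀ 0 ζ := ((hd.mono_order (by linarith)).add oU hinf).congr oU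
    fun p _ => (sub_add_cancel (ζ p) (Ninf p.2)).symm
  have hmap : ∀ K, IsCompact K → K ⊆ U₀ → ∃ K', IsCompact K' ∧ K' ⊆ Ioo (-B) B ×ˢ V ∧
      ∀ x, M' < x → ∀ u ∈ K, ζ (x, u) ∈ K' := fun K _ hKU =>
    ⟨_, hK, hKV, fun x _ u hu => hmemK (hKU hu) (hζr x u)⟩
  have hcomp : ∀ {F : Type} [NormedAddCommGroup F] [NormedSpace ℝ F] {f : ℝ × E → F} {n : ℝ},
      Sym R V n f → Sym M' U₀ n (fun p => f (N p)) := by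
    intro F _ _ f n hf
    have h1 := ((hf.shift (M' := R + B) h.isOpen isOpen_Ioo (P := Ioo (-B) B) fun s hs ψ hψ => by
      linarith [hψ.1]).mono_dom hRM subset_rfl).comp oW oU hζs hmap
    refine h1.congr oU fun p _ => ?_
    simp [hζ]
  have hMpos : ∀ t, M' < t → ∀ u ∈ U₀, R < t ∧ R < (N (t, u)).1 := by
    intro t ht u hu
    have h1 : R + B < t := hRM.trans_lt ht
    have h2 := (hKV (hmemK hu (hζr t u))).1
    have e : (ζ (t, u)).1 = (N (t, u)).1 - t := by simp [hζ]
    rw [e] at h2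
    exact ⟨by linarith, by linarith [h2.1]⟩
  -- the ratio of the warping functions
  have hratio : Sym M' U₀ (-(min τ ε)) (fun p =>
      (w p.1 / w (N p).1) ^ 2 - Real.exp (-2 * κ * (Ninf p.2).1)) := by
    have hH : Sym M' U₀ (-ε) (fun p => L (N p).1 - L p.1) := by
      refine ((hLsh.mono_dom (hM₂.trans hM₂M) subset_rfl).comp oW oU hζs hmap).congr oU
        fun p _ => ?_
      simp [hζ]
    have hζ1 : Sym M' U₀ 0 (fun p => (ζ p).1) := hζs.clm oU (ContinuousLinearMap.fst ℝ ℝ E)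
    have hinf1 : Sym M' U₀ 0 (fun p : ℝ × E => (Ninf p.2).1) :=
      hinf.clm oU (ContinuousLinearMap.fst ℝ ℝ E)
    have hd1 : Sym M' U₀ (-τ) (fun p => (ζ p).1 - (Ninf p.2).1) :=
      hd.clm oU (ContinuousLinearMap.fst ℝ ℝ E)
    -- `(w(t) / w(x))² = exp y`, where `y` tends to `y' = -2κφ`.
    set y : ℝ × E → ℝ := fun p => -2 * (L (N p).1 - L p.1) + -2 * κ * (ζ p).1 with hy
    set y' : ℝ × E → ℝ := fun p => -2 * κ * (Ninf p.2).1 with hy'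
    have c1 := (sym_const (M := M') oU (-2 : ℝ)).smul_le (m'' := -ε) oU hH (by linarith)
    have c2 := (sym_const (M := M') oU (-2 * κ : ℝ)).smul_le (m'' := 0) oU hζ1 (by linarith)
    have c3 := (sym_const (M := M') oU (-2 * κ : ℝ)).smul_le (m'' := 0) oU hinf1 (by linarith)
    have c4 := (sym_const (M := M') oU (-2 * κ : ℝ)).smul_le (m'' := -τ) oU hd1 (by linarith)
    have hyy : Sym M' U₀ (-(min τ ε)) (fun p => y p - y' p) := by
      refine ((c1.mono_order (m' := -(min τ ε)) (neg_le_neg (min_le_right _ _))).add oU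
        (c4.mono_order (neg_le_neg (min_le_left _ _)))).congr oU fun p _ => ?_
      simp only [hy, hy', smul_eq_mul]
      ring
    have hfst : ∀ {z : ℝ × E} {u : E}, u ∈ U₀ → ‖z - (r, u)‖ ≤ δ → |z.1| ≤ B := by
      intro z u hu hz
      have := (hmemK hu hz).1
      rw [abs_le]
      exact ⟨by linarith [this.1], by linarith [this.2]⟩
    have hexp := Sym.comp_sub (U := univ) (φ := Real.exp) (c := 0) (ρ := 2 + 2 * |κ| * B) oU
      isOpen_univ Real.contDiff_exp.contDiffOn ((c1.mono_order (by linarith)).add oU c2) c3 hyy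
      (by positivity) (subset_univ _) ?_ ?_
    · refine hexp.congr oU ?_
      rintro ⟨t, u⟩ ⟨ht, hu⟩
      obtain ⟨q1, q2⟩ := hMpos t ht u hu
      have w1 := h.w_pos _ q1
      have w2 := h.w_pos _ q2
      have e1 : y (t, u) = 2 * (Real.log (w t) - Real.log (w (N (t, u)).1)) := by
        simp only [hy, hL, hζ, Prod.fst_sub]
        ring
      change (w t / w (N (t, u)).1) ^ 2 - Real.exp (y' (t, u)) =
        Real.exp (y (t, u)) - Real.exp (y' (t, u))
      rw [e1, ← Real.log_div w1.ne' w2.ne', two_mul, Real.exp_add, Real.exp_log (by positivity), sq]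
    · intro t ht u hu
      rw [mem_closedBall_zero_iff]
      have e1 : ‖L (N (t, u)).1 - L t‖ ≤ 1 := by
        have := hsmall t (hM₂M.trans_lt ht) _ (hmemK hu (hζr t u))
        simpa [hζ] using this
      rw [Real.norm_eq_abs] at e1
      have e2 := hfst hu (hζr t u)
      refine (norm_add_le _ _).trans ?_
      simp only [smul_eq_mul, norm_mul, Real.norm_eq_abs, norm_neg, Nat.abs_ofNat]
      have : |κ| * |(ζ (t, u)).1| ≤ |κ| * B := by gcongr
      linarith
    · intro t ht u hu
      rw [mem_closedBall_zero_iff]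
      have e2 := hfst hu (hinfr u)
      simp only [smul_eq_mul, norm_mul, Real.norm_eq_abs, norm_neg, Nat.abs_ofNat]
      have : |κ| * |(Ninf u).1| ≤ |κ| * B := by gcongr
      linarith
  -- the derivative of the flow
  have hDd : Sym M' U₀ (-τ) (fun p => dth N p - fderiv ℝ Ninf p.2) := by
    refine (hd.deriv_th oU).congr oU fun p hp => ?_
    have e1 : HasFDerivAt (fun u => N (p.1, u) - (p.1, 0) - Ninf u)
        (dth N p - fderiv ℝ Ninf p.2) p.2 :=
      ((hasFDerivAt_slice (x := p.1) (θ := p.2) (hN.smooth.differentiable (by simp) _)).sub_const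
        _).sub (hNinf.differentiable (by simp) p.2).hasFDerivAt
    have e2 := hasFDerivAt_slice ((contDiffAt_of_mem oU hd.smooth hp.1 hp.2).differentiableAt
      (by simp))
    exact e1.unique e2
  have hDinf : Sym M' U₀ 0 (fun p : ℝ × E => fderiv ℝ Ninf p.2) :=
    sym_of_independent oU (hNinf.fderiv_right (m := ∞) le_rfl).contDiffOn
  have hD : Sym M' U₀ 0 (dth N) := ((hDd.mono_order (by linarith)).add oU hDinf).congr oU
    fun p _ => (sub_add_cancel (dth N p) (fderiv ℝ Ninf p.2)).symm
  set A : ℝ × E → (E →L[ℝ] ℝ) := fun p => (ContinuousLinearMap.fst ℝ ℝ E).comp (dth N p) with hA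
  set T : ℝ × E → (E →L[ℝ] E) := fun p => (ContinuousLinearMap.snd ℝ ℝ E).comp (dth N p) with hT
  set T' : ℝ × E → (E →L[ℝ] E) := fun p =>
    (ContinuousLinearMap.snd ℝ ℝ E).comp (fderiv ℝ Ninf p.2) with hT'
  have hAs : Sym M' U₀ 0 A := (sym_const oU _).comp_le oU hD (by norm_num)
  have hTs : Sym M' U₀ 0 T := (sym_const oU _).comp_le oU hD (by norm_num)
  have hTs' : Sym M' U₀ 0 T' := (sym_const oU _).comp_le oU hDinf (by norm_num)
  have hTd : Sym M' U₀ (-τ) (fun p => T p - T' p) := by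
    refine ((sym_const oU (ContinuousLinearMap.snd ℝ ℝ E)).comp_le oU hDd (m'' := -τ)
      (by linarith)).congr oU fun p _ => ?_
    simp only [hT, hT', ContinuousLinearMap.comp_sub]
  -- the limit of the cross-sectional part
  have hgd : Sym M' U₀ (-τ) (fun p => g (N p) - gb (Ninf p.2).2) := by
    have k1 := hcomp h.g_sym
    have k2 := Sym.comp_sub (U := V) oU h.isOpen h.gb_smooth
      (hζs.clm oU (ContinuousLinearMap.snd ℝ ℝ E)) (hinf.clm oU (ContinuousLinearMap.snd ℝ ℝ E))
      (hd.clm oU (ContinuousLinearMap.snd ℝ ℝ E)) (c := u₀) (ρ := 2 * σ) (by positivity)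
      (by rwa [← mul_assoc, show (2 : ℝ) * 2 = 4 by norm_num])
      (fun x _ u hu => (hmemK hu (hζr x u)).2) (fun x _ u hu => (hmemK hu (hinfr u)).2)
    refine (k1.add oU k2).congr oU fun p _ => ?_
    have e : (ζ p).2 = (N p).2 := by simp [hζ]
    change _ = (g (N p) - gb (N p).2) + (gb (ζ p).2 - gb (Ninf p.2).2)
    rw [e]
    exact (sub_add_sub_cancel (g (N p)) (gb (N p).2) (gb (Ninf p.2).2)).symm
  have hgs : Sym M' U₀ 0 (fun p => g (N p)) := hcomp (h.g_zero hτ)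
  have hgbs : Sym M' U₀ 0 (fun p : ℝ × E => gb (Ninf p.2).2) := by
    exact (hgs.sub oU (hgd.mono_order (by linarith))).congr oU fun p _ =>
      (sub_sub_cancel (g (N p)) (gb (Ninf p.2).2)).symm
  have hws' : Sym M' U₀ (-((1 + τ) / 2)) (fun p => w (N p).1) := hcomp h.w_sym
  have hbs : Sym M' U₀ (-((1 + τ) / 2)) (fun p => (b (N p)).comp (T p)) :=
    (hcomp h.b_sym).comp_le oU hTs (by linarith)
  have has : Sym M' U₀ 0 (fun p => a (N p)) := hcomp (h.a_zero hτ)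
  set Q : ℝ × E → (E →L[ℝ] E →L[ℝ] ℝ) := fun p =>
    (g (N p)).bilinearComp (T p) (T p)
      + w (N p).1 • ((A p).smulRight ((b (N p)).comp (T p)) + ((b (N p)).comp (T p)).smulRight (A p))
      + (w (N p).1 * (w (N p).1 * a (N p))) • (A p).smulRight (A p) with hQ
  have hQd : Sym M' U₀ (-τ) (fun p => Q p - (gb (Ninf p.2).2).bilinearComp (T' p) (T' p)) := by
    have k1 := hgd.bilinearComp_le (m'' := -τ) oU hTs hTs (by linarith)
    have k2 := hgbs.bilinearComp_le (m'' := -τ) oU hTd hTs (by linarith)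
    have k3 := hgbs.bilinearComp_le (m'' := -τ) oU hTs' hTd (by linarith)
    have k4 := hws'.smul_le (m'' := -τ) oU ((hAs.smulRight_le oU hbs
      (m'' := -((1 + τ) / 2)) (by linarith)).add oU (hbs.smulRight_le oU hAs (by linarith)))
      (by linarith)
    have k5 := (hws'.smul_le (m'' := -1 - τ) oU (hws'.smul_le (m'' := -((1 + τ) / 2)) oU has
      (by linarith)) (by linarith)).smul_le (m'' := -τ) oU (hAs.smulRight_le (m'' := 0) oU hAs
      (by norm_num)) (by linarith)
    refine ((((k1.add oU k2).add oU k3).add oU k4).add oU k5).congr oU fun p _ => ?_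
    ext z z'
    simp [hQ]
    ring
  have hQs : Sym M' U₀ 0 (fun p : ℝ × E => (gb (Ninf p.2).2).bilinearComp (T' p) (T' p)) :=
    hgbs.bilinearComp_le oU hTs' hTs' (by norm_num)
  have hexps : Sym M' U₀ 0 (fun p : ℝ × E => Real.exp (-2 * κ * (Ninf p.2).1)) :=
    sym_of_independent (φ := fun u => Real.exp (-2 * κ * (Ninf u).1)) oU
      (Real.contDiff_exp.comp (contDiff_const.mul (contDiff_fst.comp hNinf))).contDiffOn
  have hrs : Sym M' U₀ 0 (fun p => (w p.1 / w (N p).1) ^ 2) := by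
    have hmin : 0 < min τ ε := lt_min hτ hε
    refine ((hratio.mono_order (by linarith)).add oU hexps).congr oU fun p _ => ?_
    simp
  refine ⟨M', ?_⟩
  have j1 := hrs.smul_le (m'' := -(min τ ε)) oU hQd (by linarith [min_le_left τ ε])
  have j2 := hratio.smul_le (m'' := -(min τ ε)) oU hQs (by linarith)
  refine (j1.add oU j2).congr oU ?_
  rintro ⟨t, u⟩ ⟨ht, hu⟩
  obtain ⟨q1, q2⟩ := hMpos t ht u hu
  have w2 := (h.w_pos _ q2).ne'
  ext z z'
  have e : inducedForm (metricForm w a b g) N (t, u) z z' =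
      chartMetric w a b g (N (t, u)) (dth N (t, u) z) (dth N (t, u) z') :=
    metricForm_apply _ _ _
  have e1 : (w t ^ 2 • inducedForm (metricForm w a b g) N (t, u) - limitForm κ gb Ninf u) z z' =
      w t ^ 2 * inducedForm (metricForm w a b g) N (t, u) z z' - Real.exp (-2 * κ * (Ninf u).1) *
        gb (Ninf u).2 (T' (t, u) z) (T' (t, u) z') := rfl
  change (w t ^ 2 • inducedForm (metricForm w a b g) N (t, u) - limitForm κ gb Ninf u) z z' = _
  rw [e1, e, chartMetric]
  simp [hQ, hA, hT]
  field_simp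
  ring

end

end RadialEnd

namespace RadialEnd

/-! ### Gluing almost isometric diffeomorphisms of charts -/

section

variable {d : ℕ} {S : Type*} [TopologicalSpace S] [ChartedSpace (EuclideanSpace ℝ (Fin d)) S]

/-- The inverse of the chart `(x, y) ↦ (x, e y)` of `ℝ × S`. -/
def symmProd (e : Chart d S) (p : ℝ × Eu d) : ℝ × S := (p.1, e.symm p.2)

/-- The chart `(x, y) ↦ (x, e y)` of `ℝ × S`. -/
def chartProd (e : Chart d S) (q : ℝ × S) : ℝ × Eu d := (q.1, e q.2)

section

variable [IsManifold (𝓡 d) ∞ S] {e : Chart d S}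

theorem contMDiffAt_symmProd (he : e ∈ atlas (EuclideanSpace ℝ (Fin d)) S) {p : ℝ × Eu d}
    (hp : p.2 ∈ e.target) :
    ContMDiffAt 𝓘(ℝ, ℝ × Eu d) (𝓘(ℝ, ℝ).prod (𝓡 d)) ∞ (symmProd e) p :=
  contDiffAt_fst.contMDiffAt.prodMk (((contMDiffOn_chart_symm he).contMDiffAt
    (e.open_target.mem_nhds hp)).comp p contDiffAt_snd.contMDiffAt)

theorem contMDiffAt_chartProd (he : e ∈ atlas (EuclideanSpace ℝ (Fin d)) S) {q : ℝ × S}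
    (hq : q.2 ∈ e.source) :
    ContMDiffAt (𝓘(ℝ, ℝ).prod (𝓡 d)) 𝓘(ℝ, ℝ × Eu d) ∞ (chartProd e) q :=
  contMDiffAt_fst.prodMk_space (((contMDiffOn_chart he).contMDiffAt
    (e.open_source.mem_nhds hq)).comp q contMDiffAt_snd)

theorem mfderiv_symmProd (he : e ∈ atlas (EuclideanSpace ℝ (Fin d)) S) {p : ℝ × Eu d}
    (hp : p.2 ∈ e.target) (X : ℝ × Eu d) :
    (mfderiv 𝓘(ℝ, ℝ × Eu d) (𝓘(ℝ, ℝ).prod (𝓡 d)) (symmProd e) p : ℝ × Eu d →L[ℝ] ℝ × Eu d) X =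
      (X.1, (dInv e p.2 : Eu d →L[ℝ] Eu d) X.2) := by
  have h1 : MDifferentiableAt 𝓘(ℝ, ℝ × Eu d) 𝓘(ℝ, ℝ) (Prod.fst : ℝ × Eu d → ℝ) p :=
    differentiableAt_fst.mdifferentiableAt
  have h2 : MDifferentiableAt 𝓘(ℝ, ℝ × Eu d) (𝓡 d) (Prod.snd : ℝ × Eu d → Eu d) p :=
    differentiableAt_snd.mdifferentiableAt
  have h3 := mdifferentiableAt_chart_symm he hp
  have e1 := mfderiv_comp p h3 h2
  have e2 := mfderiv_prodMk h1 (h3.comp p h2)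
  have e3 : mfderiv 𝓘(ℝ, ℝ × Eu d) 𝓘(ℝ, ℝ) (Prod.fst : ℝ × Eu d → ℝ) p =
      ContinuousLinearMap.fst ℝ ℝ (Eu d) := by
    rw [mfderiv_eq_fderiv]
    exact fderiv_fst
  have e4 : mfderiv 𝓘(ℝ, ℝ × Eu d) (𝓡 d) (Prod.snd : ℝ × Eu d → Eu d) p =
      ContinuousLinearMap.snd ℝ ℝ (Eu d) := by
    rw [mfderiv_eq_fderiv]
    exact fderiv_snd
  rw [e3, e1, e4] at e2
  exact DFunLike.congr_fun e2 X

end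

/-- A family of coordinate balls `B(u₀, σ / 4)` of charts `e` which covers `S`, such that a
displacement of a point by at most `δ` in one of the charts does not leave the coordinate ball
`B(u₀, σ)` of another chart, if it ends in its ball `B(u₀, σ / 4)`. -/
structure IsChartCover {ι : Type*} (e : ι → Chart d S) (u₀ : ι → Eu d) (σ : ι → ℝ) (δ : ℝ) :
    Prop where
  mem i : e i ∈ atlas (EuclideanSpace ℝ (Fin d)) S
  pos i : 0 < σ i
  le i : σ i ≤ 1 / 4
  target i : Metric.closedBall (u₀ i) (8 * σ i) ⊆ (e i).target
  cover y : ∃ i, y ∈ (e i).source ∧ e i y ∈ Metric.ball (u₀ i) (σ i / 4)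
  delta_le i : δ ≤ σ i / 4
  near i j u θ : u ∈ Metric.closedBall (u₀ j) (σ j / 4) → ‖θ - u‖ ≤ δ →
    (e j).symm θ ∈ (e i).source → e i ((e j).symm θ) ∈ Metric.ball (u₀ i) (σ i / 4) →
    (e j).symm u ∈ (e i).source ∧ e i ((e j).symm u) ∈ Metric.ball (u₀ i) (σ i)

/-- On a compact manifold there are finite covers by coordinate balls. Points of the chart `e j`
which `e i` maps to the ball `B(u₀ i, σ i / 4)` form a relatively compact subset of the points
mapped to `B(u₀ i, σ i)`; so a `δ`-neighbourhood of the former set is contained in the latter, and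
`δ` can be taken the same for all pairs of charts. -/
theorem exists_isChartCover [CompactSpace S] [T2Space S] :
    ∃ (T : Finset S) (e : T → Chart d S) (u₀ : T → Eu d) (σ : T → ℝ) (δ : ℝ),
      0 < δ ∧ δ ≤ 1 / 4 ∧ IsChartCover e u₀ σ δ := by
  have h1 : ∀ y : S, ∃ σ, 0 < σ ∧ σ ≤ 1 / 4 ∧
      Metric.closedBall (chartAt (Eu d) y y) (8 * σ) ⊆ (chartAt (Eu d) y).target := by
    intro y
    obtain ⟨s, hs, h⟩ := Metric.nhds_basis_closedBall.mem_iff.1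
      ((chartAt (Eu d) y).open_target.mem_nhds (mem_chart_target (Eu d) y))
    exact ⟨min (s / 8) (1 / 4), by positivity, min_le_right _ _,
      (Metric.closedBall_subset_closedBall (by linarith [min_le_left (s / 8) (1 / 4)])).trans h⟩
  choose s hs0 hs1 hs using h1
  set A : S → Set S := fun y => (chartAt (Eu d) y).source ∩
    chartAt (Eu d) y ⁻¹' Metric.ball (chartAt (Eu d) y y) (s y / 4) with hA
  obtain ⟨T, hT⟩ := isCompact_univ.elim_finite_subcover A
    (fun y => (chartAt (Eu d) y).isOpen_inter_preimage Metric.isOpen_ball)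
    (fun y _ => mem_iUnion.2 ⟨y, mem_chart_source _ y, Metric.mem_ball_self (by
      have := hs0 y
      positivity)⟩)
  have hball : ∀ (y : S) {c : ℝ}, c ≤ 8 →
      Metric.closedBall (chartAt (Eu d) y y) (c * s y) ⊆ (chartAt (Eu d) y).target := fun y c hc =>
    (Metric.closedBall_subset_closedBall (mul_le_mul_of_nonneg_right hc (hs0 y).le)).trans (hs y)
  have h2 : ∀ p : T × T, ∃ δ, 0 < δ ∧ ∀ u θ : Eu d,
      u ∈ Metric.closedBall (chartAt (Eu d) p.2.1 p.2.1) (s p.2 / 4) → ‖θ - u‖ ≤ δ →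
      θ ∈ Metric.closedBall (chartAt (Eu d) p.2.1 p.2.1) (s p.2 / 2) →
      (chartAt (Eu d) p.2.1).symm θ ∈ A p.1 →
      (chartAt (Eu d) p.2.1).symm u ∈ (chartAt (Eu d) p.1.1).source ∧
        chartAt (Eu d) p.1.1 ((chartAt (Eu d) p.2.1).symm u) ∈
          Metric.ball (chartAt (Eu d) p.1.1 p.1.1) (s p.1) := by
    rintro ⟨i, j⟩
    simp only
    set ei := chartAt (Eu d) i.1
    set ej := chartAt (Eu d) j.1
    have hbi : Metric.closedBall (ei i.1) (s i / 4) ⊆ ei.target := by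
      have := hball i.1 (c := 1 / 4) (by norm_num)
      rwa [one_div_mul_eq_div] at this
    have hbj : Metric.closedBall (ej j.1) (s j / 2) ⊆ ej.target := by
      have := hball j.1 (c := 1 / 2) (by norm_num)
      rwa [one_div_mul_eq_div] at this
    have hcl : IsClosed (ei.symm '' Metric.closedBall (ei i.1) (s i / 4)) :=
      ((isCompact_closedBall _ _).image_of_continuousOn (ei.continuousOn_symm.mono hbi)).isClosed
    have hC : IsCompact (Metric.closedBall (ej j.1) (s j / 2) ∩
        ej.symm ⁻¹' (ei.symm '' Metric.closedBall (ei i.1) (s i / 4))) := by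
      refine (isCompact_closedBall _ _).of_isClosed_subset ?_ inter_subset_left
      exact (ej.continuousOn_symm.mono hbj).preimage_isClosed_of_isClosed
        Metric.isClosed_closedBall hcl
    have hO : IsOpen (ej.target ∩ ej.symm ⁻¹' (ei.source ∩ ei ⁻¹' Metric.ball (ei i.1) (s i))) :=
      ej.symm.isOpen_inter_preimage (ei.isOpen_inter_preimage Metric.isOpen_ball)
    obtain ⟨δ, hδ, h⟩ := hC.exists_cthickening_subset_open hO (by
      rintro θ ⟨h1, v, hv, h2⟩
      refine ⟨hbj h1, ?_⟩
      rw [mem_preimage, ← h2]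
      refine ⟨ei.map_target (hbi hv), ?_⟩
      rw [mem_preimage, ei.right_inv (hbi hv)]
      exact Metric.closedBall_subset_ball (by linarith [hs0 i.1]) hv)
    refine ⟨δ, hδ, fun u θ hu hθu hθ hm => ?_⟩
    refine (h (Metric.mem_cthickening_of_dist_le u θ δ _ ⟨hθ, ?_⟩ ?_)).2
    · exact ⟨ei (ej.symm θ), Metric.ball_subset_closedBall hm.2, ei.left_inv hm.1⟩
    · rw [dist_comm, dist_eq_norm]
      exact hθu
  choose D hD0 hD using h2
  obtain ⟨δ, hδ, h⟩ : ∃ δ : ℝ, 0 < δ ∧ ∀ p, δ ≤ D p ∧ δ ≤ s p.1 / 4 ∧ δ ≤ 1 / 4 := by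
    have : ∀ᶠ δ in 𝓝[>] (0 : ℝ), ∀ p, δ ≤ D p ∧ δ ≤ s p.1 / 4 ∧ δ ≤ 1 / 4 := by
      refine eventually_all.2 fun p => ?_
      have hp : 0 < s p.1 / 4 := div_pos (hs0 _) (by norm_num)
      refine nhdsWithin_le_nhds ?_
      filter_upwards [Iic_mem_nhds (hD0 p), Iic_mem_nhds hp,
        Iic_mem_nhds (show (0 : ℝ) < 1 / 4 by norm_num)] with x h1 h2 h3 using ⟨h1, h2, h3⟩
    obtain ⟨δ, h1, h2⟩ := (this.and self_mem_nhdsWithin).exists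
    exact ⟨δ, h2, h1⟩
  have hcov : ∀ y, ∃ i : T, y ∈ A i := by
    intro y
    obtain ⟨i, hi, hy⟩ := mem_iUnion₂.1 (hT (mem_univ y))
    exact ⟨⟨i, hi⟩, hy⟩
  refine ⟨T, fun i => chartAt (Eu d) i.1, fun i => chartAt (Eu d) i.1 i.1,
    fun i => s i, min δ (1 / 4), by positivity, min_le_right _ _, fun i => chart_mem_atlas _ _,
    fun i => hs0 i, fun i => hs1 i, fun i => hs i, hcov,
    fun i => (min_le_left _ _).trans (h (i, i)).2.1, fun i j u θ hu hθ h1 h2 => ?_⟩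
  have hθ' := hθ.trans (min_le_left _ _)
  refine hD (i, j) u θ hu (hθ'.trans (h (i, j)).1) ?_ ⟨h1, h2⟩
  have h3 := (h (j, i)).2.1
  rw [mem_closedBall_iff_norm] at hu ⊢
  calc ‖θ - chartAt (Eu d) j.1 j.1‖ ≤ ‖θ - u‖ + ‖u - chartAt (Eu d) j.1 j.1‖ :=
        norm_sub_le_norm_sub_add_norm_sub _ _ _
    _ ≤ s j / 2 := by
      simp only at h3 hu
      linarith

variable {ι : Type*} {e : ι → Chart d S} {u₀ : ι → Eu d} {σ : ι → ℝ} {δ : ℝ}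

theorem IsChartCover.ball_subset (hc : IsChartCover e u₀ σ δ) (i : ι) :
    Metric.closedBall (u₀ i) (2 * σ i) ⊆ (e i).target :=
  (Metric.closedBall_subset_closedBall (by linarith [hc.pos i])).trans (hc.target i)

theorem IsChartCover.mem_target (hc : IsChartCover e u₀ σ δ) {i : ι} {u : Eu d}
    (hu : u ∈ Metric.ball (u₀ i) (σ i)) : u ∈ (e i).target :=
  hc.ball_subset i (Metric.ball_subset_closedBall (Metric.ball_subset_ball
    (by linarith [hc.pos i]) hu))

theorem IsChartCover.mem_target_of_near (hc : IsChartCover e u₀ σ δ) {i : ι} {u v : Eu d}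
    (hu : u ∈ Metric.ball (u₀ i) (σ i)) (hv : ‖v - u‖ ≤ δ) : v ∈ (e i).target := by
  refine hc.ball_subset i ?_
  rw [mem_ball_iff_norm] at hu
  rw [mem_closedBall_iff_norm]
  linarith [norm_sub_le_norm_sub_add_norm_sub v u (u₀ i), hc.delta_le i, hc.pos i]

theorem IsChartCover.mem_ball_of_quarter (hc : IsChartCover e u₀ σ δ) {i : ι} {u : Eu d}
    (hu : u ∈ Metric.ball (u₀ i) (σ i / 4)) : u ∈ Metric.ball (u₀ i) (σ i) :=
  Metric.ball_subset_ball (by linarith [hc.pos i]) hu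

variable [IsManifold (𝓡 d) ∞ S]

/-- A map of `ℝ × S` which is given in the charts of a cover by small Lipschitz perturbations
`Φ i` of the identity is a diffeomorphism. -/
theorem IsChartCover.exists_inverse (hc : IsChartCover e u₀ σ δ)
    {Φ : ι → ℝ × Eu d → ℝ × Eu d} (hs : ∀ i, ContDiff ℝ ∞ (Φ i))
    (hlip : ∀ i p q, ‖Φ i p - p - (Φ i q - q)‖ ≤ 1 / 2 * ‖p - q‖)
    (hclose : ∀ i p, ‖(Φ i p).2 - p.2‖ ≤ δ) {J J' : Set ℝ}
    (hJ : ∀ i p, (Φ i p).1 ∈ J' ↔ p.1 ∈ J) {F : ℝ × S → ℝ × S}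
    (hF : ∀ i, ∀ t ∈ J, ∀ u ∈ Metric.ball (u₀ i) (σ i),
      F (t, (e i).symm u) = symmProd (e i) (Φ i (t, u))) :
    ∃ F' : ℝ × S → ℝ × S, MapsTo F (J ×ˢ univ) (J' ×ˢ univ) ∧
      MapsTo F' (J' ×ˢ univ) (J ×ˢ univ) ∧ InvOn F' F (J ×ˢ univ) (J' ×ˢ univ) ∧
      ContMDiffOn (𝓘(ℝ, ℝ).prod (𝓡 d)) (𝓘(ℝ, ℝ).prod (𝓡 d)) ∞ F (J ×ˢ univ) ∧
      ContMDiffOn (𝓘(ℝ, ℝ).prod (𝓡 d)) (𝓘(ℝ, ℝ).prod (𝓡 d)) ∞ F' (J' ×ˢ univ) := by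
  have hΨ : ∀ i, ∃ Ψ : ℝ × Eu d → ℝ × Eu d, Function.LeftInverse Ψ (Φ i) ∧
      Function.RightInverse Ψ (Φ i) ∧ ContDiff ℝ ∞ Ψ := by
    intro i
    -- Each `Φ i` is a diffeomorphism of `ℝ × ℝᵈ`. The inverse of `F` is given by these inverses.
    obtain ⟨Ψ, h1, h2⟩ := exists_homeomorph_id_add (g := fun p => Φ i p - p) (c := 1 / 2)
      (by rw [← NNReal.coe_lt_coe]; norm_num) (LipschitzWith.of_dist_le_mul fun p q => by
        rw [dist_eq_norm, dist_eq_norm]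
        simpa using hlip i p q) ((hs i).sub contDiff_id)
    have h3 : ∀ p, Ψ p = Φ i p := fun p => by rw [h1, add_sub_cancel]
    exact ⟨Ψ.symm, fun p => by rw [← h3, Ψ.symm_apply_apply],
      fun p => by rw [← h3, Ψ.apply_symm_apply], h2⟩
  choose Ψ hΨl hΨr hΨs using hΨ
  choose c hcs hcb using hc.cover
  have hcF : ∀ i, ∀ t ∈ J, ∀ y ∈ (e i).source, e i y ∈ Metric.ball (u₀ i) (σ i) →
      F (t, y) = symmProd (e i) (Φ i (t, e i y)) := by
    intro i t ht y hy hb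
    rw [← hF i t ht _ hb, (e i).left_inv hy]
  have hmaps : MapsTo F (J ×ˢ univ) (J' ×ˢ univ) := by
    rintro ⟨t, y⟩ ⟨ht, -⟩
    rw [hcF _ t ht y (hcs y) (hc.mem_ball_of_quarter (hcb y))]
    exact ⟨(hJ _ _).2 ht, mem_univ _⟩
  have hΨball : ∀ i (q : ℝ × Eu d), q.2 ∈ Metric.ball (u₀ i) (σ i / 4) →
      (Ψ i q).2 ∈ Metric.ball (u₀ i) (σ i) := by
    intro i q hq
    have h1 := hclose i (Ψ i q)
    rw [hΨr i q, norm_sub_rev] at h1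
    rw [mem_ball_iff_norm] at hq ⊢
    linarith [norm_sub_le_norm_sub_add_norm_sub (Ψ i q).2 q.2 (u₀ i), hc.delta_le i, hc.pos i]
  -- every point of the image has its preimage in the corresponding chart
  have hpre : ∀ i, ∀ t ∈ J, ∀ y, (F (t, y)).2 ∈ (e i).source →
      e i (F (t, y)).2 ∈ Metric.ball (u₀ i) (σ i / 4) →
      y ∈ (e i).source ∧ (t, e i y) = Ψ i (chartProd (e i) (F (t, y))) := by
    intro i t ht y h1 h2
    have h0 := hcF _ t ht y (hcs y) (hc.mem_ball_of_quarter (hcb y))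
    have h3 : y ∈ (e i).source ∧ e i y ∈ Metric.ball (u₀ i) (σ i) := by
      have := hc.near i (c y) (e (c y) y) (Φ (c y) (t, e (c y) y)).2
        (Metric.ball_subset_closedBall (hcb y)) (hclose (c y) (t, e (c y) y))
      rw [(e (c y)).left_inv (hcs y)] at this
      rw [h0] at h1 h2
      exact this h1 h2
    refine ⟨h3.1, ?_⟩
    rw [hcF i t ht y h3.1 h3.2, chartProd, symmProd]
    simp only
    rw [(e i).right_inv (hc.mem_target_of_near h3.2 (hclose i (t, e i y))), Prod.mk.eta, hΨl i]
  have hloc : ∀ i, ∀ x ∈ J', ∀ z ∈ (e i).source, e i z ∈ Metric.ball (u₀ i) (σ i / 4) →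
      (Ψ i (x, e i z)).1 ∈ J ∧ F (symmProd (e i) (Ψ i (x, e i z))) = (x, z) := by
    intro i x hx z hz hb
    have h1 : (Ψ i (x, e i z)).1 ∈ J := by
      rw [← hJ i, hΨr i]
      exact hx
    refine ⟨h1, ?_⟩
    rw [symmProd, hF i _ h1 _ (hΨball i (x, e i z) hb), Prod.mk.eta, hΨr i, symmProd]
    simp only [(e i).left_inv hz]
  have huniq : ∀ i, ∀ t ∈ J, ∀ y, (F (t, y)).2 ∈ (e i).source →
      e i (F (t, y)).2 ∈ Metric.ball (u₀ i) (σ i / 4) →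
      (t, y) = symmProd (e i) (Ψ i (chartProd (e i) (F (t, y)))) := by
    intro i t ht y h1 h2
    obtain ⟨h3, h4⟩ := hpre i t ht y h1 h2
    rw [← h4, symmProd]
    simp only [(e i).left_inv h3]
  obtain ⟨F', hF'⟩ : ∃ F' : ℝ × S → ℝ × S, ∀ x z, F' (x, z) =
      symmProd (e (c z)) (Ψ (c z) (x, e (c z) z)) :=
    ⟨fun q => symmProd (e (c q.2)) (Ψ (c q.2) (q.1, e (c q.2) q.2)), fun _ _ => rfl⟩
  have hF'loc : ∀ i, ∀ x ∈ J', ∀ z ∈ (e i).source, e i z ∈ Metric.ball (u₀ i) (σ i / 4) →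
      F' (x, z) = symmProd (e i) (Ψ i (chartProd (e i) (x, z))) := by
    intro i x hx z hz hb
    obtain ⟨h1, h2⟩ := hloc (c z) x hx z (hcs z) (hcb z)
    have h3 := huniq i _ h1 ((e (c z)).symm (Ψ (c z) (x, e (c z) z)).2)
    rw [hF']
    rw [symmProd] at h2 ⊢
    rw [h2] at h3
    exact h3 hz hb
  refine ⟨F', hmaps, ?_, ⟨?_, ?_⟩, ?_, ?_⟩
  · rintro ⟨x, z⟩ ⟨hx, -⟩
    rw [hF']
    exact ⟨(hloc (c z) x hx z (hcs z) (hcb z)).1, mem_univ _⟩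
  · rintro ⟨t, y⟩ ⟨ht, -⟩
    refine (hF' (F (t, y)).1 (F (t, y)).2).trans ?_
    exact (huniq _ t ht y (hcs _) (hcb _)).symm
  · rintro ⟨x, z⟩ ⟨hx, -⟩
    rw [hF']
    exact (hloc (c z) x hx z (hcs z) (hcb z)).2
  · rintro ⟨t, y⟩ ⟨ht, -⟩
    have hb := hc.mem_ball_of_quarter (hcb y)
    have h1 : ContMDiffAt (𝓘(ℝ, ℝ).prod (𝓡 d)) (𝓘(ℝ, ℝ).prod (𝓡 d)) ∞
        (fun q => symmProd (e (c y)) (Φ (c y) (chartProd (e (c y)) q))) (t, y) :=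
      (contMDiffAt_symmProd (hc.mem _)
        (hc.mem_target_of_near hb (hclose (c y) (t, e (c y) y)))).comp (t, y)
        ((hs _).contDiffAt.contMDiffAt.comp (t, y) (contMDiffAt_chartProd (hc.mem _) (hcs y)))
    refine h1.contMDiffWithinAt.congr_of_eventuallyEq ?_ (hcF _ t ht y (hcs y) hb)
    have hn : ∀ᶠ q : ℝ × S in 𝓝 (t, y), q.2 ∈ (e (c y)).source ∩
        e (c y) ⁻¹' Metric.ball (u₀ (c y)) (σ (c y)) :=
      continuous_snd.continuousAt.eventually
        (((e (c y)).isOpen_inter_preimage Metric.isOpen_ball).mem_nhds ⟨hcs y, hb⟩)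
    filter_upwards [hn.filter_mono nhdsWithin_le_nhds, self_mem_nhdsWithin] with q h2 h3
    exact hcF _ q.1 h3.1 q.2 h2.1 h2.2
  · rintro ⟨x, z⟩ ⟨hx, -⟩
    have hb := hcb z
    have h1 : ContMDiffAt (𝓘(ℝ, ℝ).prod (𝓡 d)) (𝓘(ℝ, ℝ).prod (𝓡 d)) ∞
        (fun q => symmProd (e (c z)) (Ψ (c z) (chartProd (e (c z)) q))) (x, z) :=
      (contMDiffAt_symmProd (hc.mem _) (hc.mem_target (hΨball (c z) (x, e (c z) z) hb))).comp (x, z)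
        ((hΨs _).contDiffAt.contMDiffAt.comp (x, z) (contMDiffAt_chartProd (hc.mem _) (hcs z)))
    refine h1.contMDiffWithinAt.congr_of_eventuallyEq ?_ (hF'loc _ x hx z (hcs z) hb)
    have hn : ∀ᶠ q : ℝ × S in 𝓝 (x, z), q.2 ∈ (e (c z)).source ∩
        e (c z) ⁻¹' Metric.ball (u₀ (c z)) (σ (c z) / 4) :=
      continuous_snd.continuousAt.eventually
        (((e (c z)).isOpen_inter_preimage Metric.isOpen_ball).mem_nhds ⟨hcs z, hb⟩)
    filter_upwards [hn.filter_mono nhdsWithin_le_nhds, self_mem_nhdsWithin] with q h2 h3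
    exact hF'loc _ q.1 h3.1 q.2 h2.1 h2.2

end

end RadialEnd

namespace RadialEnd

/-! ### The normal flow is a diffeomorphism -/

section

variable {E : Type} [NormedAddCommGroup E] [NormedSpace ℝ E]
  {m : ℝ × E → ((ℝ × E) →L[ℝ] (ℝ × E) →L[ℝ] ℝ)} {R r δ τ M : ℝ} {V U : Set E}
  {N : ℝ × E → ℝ × E} {Ninf : E → ℝ × E}

theorem IsChartFlow.norm_sub_le_time (hN : IsChartFlow m R r δ V U N) (t t' : ℝ) (u : E) :
    ‖N (t, u) - (t, u) - (N (t', u) - (t', u))‖ ≤ δ * |t - t'| := by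
  have hd : ∀ s ∈ (univ : Set ℝ), HasDerivWithinAt (fun s => N (s, u) - (s, u))
      (dx N (s, u) - (1, 0)) univ s := fun s _ =>
    ((hasDerivAt_slice (hN.smooth.differentiable (by simp) (s, u))).sub
      ((hasDerivAt_id s).prodMk (hasDerivAt_const s u))).hasDerivWithinAt
  exact convex_univ.norm_image_sub_le_of_norm_hasDerivWithin_le hd (fun s _ => hN.speed s u)
    (mem_univ t') (mem_univ t)

theorem IsChartFlow.norm_sub_le (hN : IsChartFlow m R r δ V U N) (hδ : δ ≤ 1 / 4)
    (p q : ℝ × E) : ‖N p - p - (N q - q)‖ ≤ 1 / 2 * ‖p - q‖ := by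
  obtain ⟨t, u⟩ := p
  obtain ⟨t', u'⟩ := q
  have h1 := hN.norm_sub_le_time t t' u
  have h2 := hN.lip t' u u'
  have h3 : |t - t'| ≤ ‖(t, u) - (t', u')‖ := norm_fst_le ((t, u) - (t', u') : ℝ × E)
  have h4 : ‖u - u'‖ ≤ ‖(t, u) - (t', u')‖ := norm_snd_le ((t, u) - (t', u') : ℝ × E)
  have e : N (t, u) - (t, u) - (N (t', u') - (t', u')) =
      (N (t, u) - (t, u) - (N (t', u) - (t', u))) +
        (N (t', u) - N (t', u') - (0, u - u')) := by
    have : ((0, u - u') : ℝ × E) = (t', u) - (t', u') := by simp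
    rw [this]
    abel
  rw [e]
  refine (norm_add_le _ _).trans ?_
  have h5 : δ * |t - t'| ≤ 1 / 4 * ‖(t, u) - (t', u')‖ := by gcongr
  have h6 : δ * ‖u - u'‖ ≤ 1 / 4 * ‖(t, u) - (t', u')‖ := by gcongr
  linarith

theorem IsChartFlow.abs_fst_le (hN : IsChartFlow m R r δ V U N) (t : ℝ) (u : E) :
    |(N (t, u)).1 - r - t| ≤ δ * |t| := by
  have h := (norm_fst_le _).trans (hN.norm_sub_le_time t 0 u)
  rw [hN.zero] at h
  simp only [Prod.fst_sub, sub_zero, Real.norm_eq_abs] at h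
  rwa [sub_right_comm]

theorem IsChartFlow.le_fst_iff (hN : IsChartFlow m R r δ V U N) (hδ : δ < 1) (p : ℝ × E) :
    r ≤ (N p).1 ↔ 0 ≤ p.1 := by
  obtain ⟨t, u⟩ := p
  have h := abs_le.1 (hN.abs_fst_le t u)
  constructor
  · intro h1
    by_contra! h2
    simp only at h2
    rw [abs_of_neg h2] at h
    nlinarith [h.2]
  · intro h2
    simp only at h2
    rw [abs_of_nonneg h2] at h
    nlinarith [h.1]

theorem IsChartFlow.lt_fst_iff (hN : IsChartFlow m R r δ V U N) (hδ : δ < 1) (p : ℝ × E) :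
    r < (N p).1 ↔ 0 < p.1 := by
  obtain ⟨t, u⟩ := p
  have h := abs_le.1 (hN.abs_fst_le t u)
  constructor
  · intro h1
    by_contra! h2
    simp only at h2
    rw [abs_of_nonpos h2] at h
    nlinarith [h.2]
  · intro h2
    simp only at h2
    rw [abs_of_pos h2] at h
    nlinarith [h.1]

theorem IsChartFlow.norm_snd_sub_le (hN : IsChartFlow m R r δ V U N) (p : ℝ × E) :
    ‖(N p).2 - p.2‖ ≤ δ := (norm_snd_le _).trans (hN.close p.1 p.2)

theorem IsChartFlow.norm_dth_sub_le (hN : IsChartFlow m R r δ V U N) (hδ0 : 0 ≤ δ) (p : ℝ × E)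
    (z : E) : ‖dth N p z - (0, z)‖ ≤ δ * ‖z‖ := by
  have h1 : HasFDerivAt (fun u => N (p.1, u) - (0, u))
      (dth N p - ContinuousLinearMap.inr ℝ ℝ E) p.2 :=
    (hasFDerivAt_slice (hN.smooth.differentiable (by simp) _)).sub
      (hasFDerivAt_prodMk_right 0 p.2)
  have h2 := h1.le_of_lip' hδ0 (Eventually.of_forall fun u => by
    have := hN.lip p.1 u p.2
    have e : N (p.1, u) - (0, u) - (N (p.1, p.2) - (0, p.2)) =
      N (p.1, u) - N (p.1, p.2) - (0, u - p.2) := by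
      have : ((0, u - p.2) : ℝ × E) = (0, u) - (0, p.2) := by simp
      rw [this]
      abel
    rw [e]
    exact this)
  exact (ContinuousLinearMap.le_opNorm _ z).trans
    (mul_le_mul_of_nonneg_right h2 (norm_nonneg z))

theorem IsChartFlow.norm_limit_sub_limit_le (hN : IsChartFlow m R r δ V U N) (hτ : 0 < τ)
    (hs : Sym M univ (-τ) (fun p : ℝ × E => N p - (p.1, 0) - Ninf p.2)) (u u' : E) :
    ‖(Ninf u).2 - u - ((Ninf u').2 - u')‖ ≤ δ * ‖u - u'‖ := by
  have h1 := ((tendsto_of_sym hτ hs u').sub (tendsto_of_sym hτ hs u)).norm.add_const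
    (δ * ‖u - u'‖)
  rw [sub_zero, norm_zero, zero_add] at h1
  refine ge_of_tendsto' h1 fun t => ?_
  have e : Ninf u - Ninf u' - (0, u - u') =
      (N (t, u') - (t, 0) - Ninf u' - (N (t, u) - (t, 0) - Ninf u)) +
        (N (t, u) - N (t, u') - (0, u - u')) := by abel
  have h2 : ‖Ninf u - Ninf u' - (0, u - u')‖ ≤
      ‖N (t, u') - (t, 0) - Ninf u' - (N (t, u) - (t, 0) - Ninf u)‖ + δ * ‖u - u'‖ := by
    rw [e]
    exact (norm_add_le _ _).trans (add_le_add_right (hN.lip t u u') _)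
  have e2 : (Ninf u).2 - u - ((Ninf u').2 - u') = (Ninf u - Ninf u' - (0, u - u')).2 := by
    simp only [Prod.snd_sub]
    abel
  rw [e2]
  exact (norm_snd_le _).trans h2

end

section

variable {d : ℕ} {S : Type*} [TopologicalSpace S] [ChartedSpace (EuclideanSpace ℝ (Fin d)) S]
  [IsManifold (𝓡 d) ∞ S]
  {R τ r δ : ℝ} {w : ℝ → ℝ} {a : FunFamily S} {b : FormFamily d S} {g : BilinFamily d S}

/-- Every outgoing normal flow is given by the flows in the charts, by the uniqueness of geodesics
and of the outgoing unit normal. -/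
theorem IsOutgoingNormalFlow.eq_chartFlow [T2Space S]
    (h : ∀ e ∈ atlas (EuclideanSpace ℝ (Fin d)) S, ∃ gb, IsEndInChart R τ w a b g e gb)
    {N : ℝ × S → ℝ × S} (hN : IsOutgoingNormalFlow R w a b g r N) {e : Chart d S}
    (he : e ∈ atlas (EuclideanSpace ℝ (Fin d)) S) {U : Set (Eu d)} {Ne : ℝ × Eu d → ℝ × Eu d}
    (hNe : IsChartFlow (endForm w a b g e) R r δ e.target U Ne) (hδ : δ < 1) {u : Eu d}
    (hu : u ∈ U) (hue : u ∈ e.target) {t : ℝ} (ht : 0 ≤ t) :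
    N (t, e.symm u) = symmProd e (Ne (t, u)) := by
  obtain ⟨g1, z1, n1⟩ := hN (e.symm u)
  obtain ⟨g2, n2⟩ := hNe.isGeodesicOn h he hδ hu
  have hs := e.map_target hue
  obtain ⟨gb, hgb⟩ := h e he
  have hR : R < r := by
    have := (hNe.mem 0 (by norm_num) u hu).1
    rwa [hNe.zero] at this
  refine g1.eqOn h he g2 (t := t) ?_ ?_ ?_ ht
  · rw [z1]
    exact hs
  · rw [z1, hNe.zero]
  · exact hgb.normal_unique (p := (r, e (e.symm u))) ⟨hR, e.map_source hs⟩ (n1 e he hs) (n2 e he hs hue)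

variable {ι : Type*} {e : ι → Chart d S} {u₀ : ι → Eu d} {σ : ι → ℝ}
  {Ne : ι → ℝ × Eu d → ℝ × Eu d}

/-- The flows in the charts of a cover yield an outgoing normal flow. It does not matter which chart
is chosen at a point, since being a geodesic starting at the outgoing unit normal does not depend on
the chart. -/
theorem IsChartCover.exists_normalFlow (hc : IsChartCover e u₀ σ δ)
    (h : ∀ e ∈ atlas (EuclideanSpace ℝ (Fin d)) S, ∃ gb, IsEndInChart R τ w a b g e gb)
    (hNe : ∀ i, IsChartFlow (endForm w a b g (e i)) R r δ (e i).target
      (Metric.closedBall (u₀ i) (σ i)) (Ne i)) (hδ : δ < 1) :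
    ∃ N, IsOutgoingNormalFlow R w a b g r N := by
  choose c hcs hcb using hc.cover
  refine ⟨fun q => symmProd (e (c q.2)) (Ne (c q.2) (q.1, e (c q.2) q.2)), fun y => ?_⟩
  have hu := Metric.ball_subset_closedBall (hc.mem_ball_of_quarter (hcb y))
  have ht := (e (c y)).map_source (hcs y)
  obtain ⟨h1, h2⟩ := (hNe (c y)).isGeodesicOn h (hc.mem _) hδ hu
  rw [(e (c y)).left_inv (hcs y)] at h2
  refine ⟨h1, ?_, fun e' he' hy => h2 e' he' hy ht⟩
  simp only [symmProd, (hNe (c y)).zero, (e (c y)).left_inv (hcs y)]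

variable {N : ℝ × S → ℝ × S}

theorem IsChartCover.isHomeoBetween (hc : IsChartCover e u₀ σ δ)
    (hNe : ∀ i, IsChartFlow (endForm w a b g (e i)) R r δ (e i).target
      (Metric.closedBall (u₀ i) (σ i)) (Ne i)) (hδ : δ ≤ 1 / 4)
    (hF : ∀ i t, 0 ≤ t → ∀ u ∈ Metric.ball (u₀ i) (σ i),
      N (t, (e i).symm u) = symmProd (e i) (Ne i (t, u))) :
    IsHomeoBetween N (Ici 0 ×ˢ univ) (Ici r ×ˢ univ) := by
  obtain ⟨F', h1, h2, h3, h4, h5⟩ := hc.exists_inverse (fun i => (hNe i).smooth)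
    (fun i => (hNe i).norm_sub_le hδ) (fun i => (hNe i).norm_snd_sub_le)
    (J := Ici 0) (J' := Ici r) (fun i p => (hNe i).le_fst_iff (by linarith) p)
    (fun i t ht => hF i t ht)
  exact ⟨F', h1, h2, h3, h4.continuousOn, h5.continuousOn⟩

theorem IsChartCover.isDiffeoBetween (hc : IsChartCover e u₀ σ δ)
    (hNe : ∀ i, IsChartFlow (endForm w a b g (e i)) R r δ (e i).target
      (Metric.closedBall (u₀ i) (σ i)) (Ne i)) (hδ : δ ≤ 1 / 4)
    (hF : ∀ i t, 0 ≤ t → ∀ u ∈ Metric.ball (u₀ i) (σ i),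
      N (t, (e i).symm u) = symmProd (e i) (Ne i (t, u))) :
    IsDiffeoBetween d N (Ioi 0 ×ˢ univ) (Ioi r ×ˢ univ) :=
  hc.exists_inverse (fun i => (hNe i).smooth)
    (fun i => (hNe i).norm_sub_le hδ) (fun i => (hNe i).norm_snd_sub_le)
    (J := Ioi 0) (J' := Ioi r) (fun i p => (hNe i).lt_fst_iff (by linarith) p)
    (fun i t ht => hF i t (le_of_lt ht))

/-- The limit of the normal flow: there are a diffeomorphism `Ω` and a function `φ` which in the
charts of the cover are given by the limits of the flows in these charts. -/
theorem IsChartCover.exists_limit [T2Space S] (hc : IsChartCover e u₀ σ δ)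
    (hNe : ∀ i, IsChartFlow (endForm w a b g (e i)) R r δ (e i).target
      (Metric.closedBall (u₀ i) (σ i)) (Ne i)) (hδ : δ ≤ 1 / 4) (hτ : 0 < τ)
    (hF : ∀ i t, 0 ≤ t → ∀ u ∈ Metric.ball (u₀ i) (σ i),
      N (t, (e i).symm u) = symmProd (e i) (Ne i (t, u)))
    {Ninf : ι → Eu d → ℝ × Eu d} (hsm : ∀ i, ContDiff ℝ ∞ (Ninf i)) {M : ℝ}
    (hs : ∀ i, Sym M univ (-τ) (fun p : ℝ × Eu d => Ne i p - (p.1, 0) - Ninf i p.2)) :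
    ∃ (Ω : S ≃ₘ^∞⟮𝓡 d, 𝓡 d⟯ S) (φ : S → ℝ), ContMDiff (𝓡 d) 𝓘(ℝ, ℝ) ∞ φ ∧
      ∀ i, ∀ u ∈ Metric.ball (u₀ i) (σ i), Ω ((e i).symm u) = (e i).symm (Ninf i u).2 ∧
        φ ((e i).symm u) = (Ninf i u).1 := by
  choose c hcs hcb using hc.cover
  have hclose : ∀ i u, ‖(Ninf i u).2 - u‖ ≤ δ := fun i u =>
    (norm_snd_le _).trans ((hNe i).norm_limit_sub_le hτ (hs i) u)
  -- the limits are independent of the chart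
  have hlim : ∀ i, ∀ u ∈ Metric.ball (u₀ i) (σ i),
      Tendsto (fun t => (N (t, (e i).symm u)).1 - t) atTop (𝓝 (Ninf i u).1) ∧
      Tendsto (fun t => (N (t, (e i).symm u)).2) atTop (𝓝 ((e i).symm (Ninf i u).2)) := by
    intro i u hu
    have h1 : Tendsto (fun t => Ne i (t, u) - (t, 0)) atTop (𝓝 (Ninf i u)) := by
      have := (tendsto_of_sym hτ (hs i) u).add_const (Ninf i u)
      simpa using this
    have h2 : Tendsto (fun t => (Ne i (t, u)).1 - t) atTop (𝓝 (Ninf i u).1) :=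
      (continuous_fst.tendsto _).comp h1
    have h3 : Tendsto (fun t => (Ne i (t, u)).2) atTop (𝓝 (Ninf i u).2) := by
      have := (continuous_snd.tendsto _).comp h1
      refine this.congr fun t => ?_
      simp
    have h4 : ContinuousAt (e i).symm (Ninf i u).2 :=
      (e i).symm.continuousAt (hc.mem_target_of_near hu (hclose i u))
    constructor
    · refine h2.congr' ?_
      filter_upwards [eventually_ge_atTop 0] with t ht
      rw [hF i t ht u hu, symmProd]
    · refine (h4.tendsto.comp h3).congr' ?_
      filter_upwards [eventually_ge_atTop 0] with t ht
      rw [hF i t ht u hu, symmProd]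
      rfl
  obtain ⟨Ω, hΩ⟩ : ∃ Ω : S → S, ∀ y, Ω y = (e (c y)).symm (Ninf (c y) (e (c y) y)).2 :=
    ⟨_, fun _ => rfl⟩
  obtain ⟨φ, hφ⟩ : ∃ φ : S → ℝ, ∀ y, φ y = (Ninf (c y) (e (c y) y)).1 := ⟨_, fun _ => rfl⟩
  have hloc : ∀ i, ∀ u ∈ Metric.ball (u₀ i) (σ i), Ω ((e i).symm u) = (e i).symm (Ninf i u).2 ∧
        φ ((e i).symm u) = (Ninf i u).1 := by
    intro i u hu
    set y := (e i).symm u with hy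
    obtain ⟨l1, l2⟩ := hlim i u hu
    obtain ⟨k1, k2⟩ := hlim (c y) (e (c y) y) (hc.mem_ball_of_quarter (hcb y))
    rw [(e (c y)).left_inv (hcs y)] at k1 k2
    rw [hΩ, hφ]
    exact ⟨tendsto_nhds_unique k2 l2, tendsto_nhds_unique k1 l1⟩
  obtain ⟨F', h1, h2, h3, h4, h5⟩ := hc.exists_inverse
    -- `id × Ω` is a perturbation of the identity of the kind considered in `exists_inverse`.
    (Φ := fun i p => (p.1, (Ninf i p.2).2)) (J := univ) (J' := univ)
    (F := fun q => (q.1, Ω q.2))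
    (fun i => contDiff_fst.prodMk (contDiff_snd.comp ((hsm i).comp contDiff_snd)))
    (fun i p q => by
      have h1 := (hNe i).norm_limit_sub_limit_le hτ (hs i) p.2 q.2
      have h2 : ‖p.2 - q.2‖ ≤ ‖p - q‖ := norm_snd_le (p - q)
      have e : (p.1, (Ninf i p.2).2) - p - ((q.1, (Ninf i q.2).2) - q) =
          (0, (Ninf i p.2).2 - p.2 - ((Ninf i q.2).2 - q.2)) := by
        ext <;> simp
      rw [e, Prod.norm_mk, norm_zero, max_eq_right (norm_nonneg _)]
      refine h1.trans ?_
      gcongr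
      linarith)
    (fun i p => hclose i p.2) (fun _ _ => by simp)
    (fun i t _ u hu => by
      simp only [symmProd, (hloc i u hu).1])
  have hr := h3.1
  have hl := h3.2
  rw [univ_prod_univ, contMDiffOn_univ] at h4 h5
  have hinv : ∀ z, ((F' (0, z)).1, Ω (F' (0, z)).2) = (0, z) := fun z => hl (by simp)
  have hΩs : ContMDiff (𝓡 d) (𝓡 d) ∞ Ω :=
    contMDiff_snd.comp (h4.comp (contMDiff_const (c := (0 : ℝ)).prodMk contMDiff_id))
  have hΩs' : ContMDiff (𝓡 d) (𝓡 d) ∞ fun z => (F' (0, z)).2 :=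
    contMDiff_snd.comp (h5.comp (contMDiff_const (c := (0 : ℝ)).prodMk contMDiff_id))
  refine ⟨⟨⟨Ω, fun z => (F' (0, z)).2, fun y => ?_, fun z => (Prod.ext_iff.1 (hinv z)).2⟩, hΩs,
    hΩs'⟩, φ, fun y => ?_, hloc⟩
  · have : F' (0, Ω y) = (0, y) := hr (x := (0, y)) (by simp)
    change (F' (0, Ω y)).2 = y
    rw [this]
  · have hb := hc.mem_ball_of_quarter (hcb y)
    have k1 : ContMDiffAt (𝓡 d) 𝓘(ℝ, ℝ) ∞ (fun y' => (Ninf (c y) (e (c y) y')).1) y :=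
      (contDiff_fst.comp (hsm (c y))).contMDiff.contMDiffAt.comp y
        ((contMDiffOn_chart (hc.mem _)).contMDiffAt ((e (c y)).open_source.mem_nhds (hcs y)))
    refine k1.congr_of_eventuallyEq ?_
    filter_upwards [((e (c y)).isOpen_inter_preimage Metric.isOpen_ball).mem_nhds ⟨hcs y, hb⟩]
      with y' hy'
    rw [← (hloc (c y) _ hy'.2).2, (e (c y)).left_inv hy'.1]

end

end RadialEnd

namespace RadialEnd

/-! ### The metric in normal coordinates -/

section

variable {d : ℕ} {S : Type*} [TopologicalSpace S] [ChartedSpace (EuclideanSpace ℝ (Fin d)) S]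
  {R τ r δ : ℝ} {w : ℝ → ℝ} {a : FunFamily S} {b : FormFamily d S} {g : BilinFamily d S}

/-- The differential `dInv` of the inverse of a chart, as an endomorphism of the model space, of
which all the tangent spaces are copies by definition. -/
noncomputable def modelDInv (e : Chart d S) (u : Eu d) : Eu d →L[ℝ] Eu d := dInv e u

/-- The differential of a map of `ℝ × S`, as an endomorphism of the model space. -/
noncomputable def modelDeriv (N : ℝ × S → ℝ × S) (q : ℝ × S) : ℝ × Eu d →L[ℝ] ℝ × Eu d :=
  mfderiv (𝓘(ℝ, ℝ).prod (𝓡 d)) (𝓘(ℝ, ℝ).prod (𝓡 d)) N q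

/-- The metric of the end at the point `q` of `ℝ × S`, as a continuous bilinear form on the model
space. -/
noncomputable def endBilin (w : ℝ → ℝ) (a : FunFamily S) (b : FormFamily d S) (g : BilinFamily d S)
    (q : ℝ × S) : (ℝ × Eu d) →L[ℝ] (ℝ × Eu d) →L[ℝ] ℝ :=
  metricForm w (fun _ => a q.1 q.2) (fun _ => b q.1 q.2) (fun _ => g q.1 q.2) (q.1, (0 : Eu d))

theorem endBilin_apply (q : ℝ × S) (X Y : ℝ × Eu d) :
    endBilin w a b g q X Y = endMetric w a b g q.1 q.2 X Y :=
  metricForm_apply _ _ _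

theorem endForm_eq_endBilin (e : Chart d S) (p X Y : ℝ × Eu d) :
    endForm w a b g e p X Y = endBilin w a b g (symmProd e p)
      (X.1, modelDInv e p.2 X.2) (Y.1, modelDInv e p.2 Y.2) := by
  rw [endBilin_apply]
  exact metricForm_apply _ _ _

/-- The metrics on `S` induced by a family `N t : S → ℝ × S` of maps to the end. -/
noncomputable def inducedMetric (w : ℝ → ℝ) (a : FunFamily S) (b : FormFamily d S)
    (g : BilinFamily d S) (N : ℝ × S → ℝ × S) : BilinFamily d S := fun t y =>
  (endBilin w a b g (N (t, y))).bilinearComp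
    ((modelDeriv N (t, y)).comp (ContinuousLinearMap.inr ℝ ℝ (Eu d)))
    ((modelDeriv N (t, y)).comp (ContinuousLinearMap.inr ℝ ℝ (Eu d)))

variable [IsManifold (𝓡 d) ∞ S]

theorem exists_modelDInv_eq {e : Chart d S} (he : e ∈ atlas (EuclideanSpace ℝ (Fin d)) S) {u : Eu d}
    (hu : u ∈ e.target) (z : Eu d) : ∃ z', modelDInv e u z' = z :=
  LinearMap.surjective_of_injective (f := (modelDInv e u : Eu d →ₗ[ℝ] Eu d))
    (dInv_injective he hu) z

variable {N : ℝ × S → ℝ × S} {e : Chart d S} {Ne : ℝ × Eu d → ℝ × Eu d} {U : Set (Eu d)}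

/-- The differential of a map of `ℝ × S` in a chart. -/
theorem modelDeriv_apply (he : e ∈ atlas (EuclideanSpace ℝ (Fin d)) S) {p : ℝ × Eu d}
    (hp : p.2 ∈ e.target) (hNp : (Ne p).2 ∈ e.target) (hNe : DifferentiableAt ℝ Ne p)
    (hN : MDifferentiableAt (𝓘(ℝ, ℝ).prod (𝓡 d)) (𝓘(ℝ, ℝ).prod (𝓡 d)) N (symmProd e p))
    (hloc : ∀ᶠ q in 𝓝 p, N (symmProd e q) = symmProd e (Ne q)) (X : ℝ × Eu d) :
    modelDeriv N (symmProd e p) (X.1, modelDInv e p.2 X.2) =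
      ((fderiv ℝ Ne p X).1, modelDInv e (Ne p).2 (fderiv ℝ Ne p X).2) := by
  have d1 := (contMDiffAt_symmProd he hp).mdifferentiableAt (by simp)
  have d2 := (contMDiffAt_symmProd he hNp).mdifferentiableAt (by simp)
  have d3 : MDifferentiableAt 𝓘(ℝ, ℝ × Eu d) 𝓘(ℝ, ℝ × Eu d) Ne p := hNe.mdifferentiableAt
  have e1 := mfderiv_comp p hN d1
  have e2 := mfderiv_comp p d2 d3
  rw [mfderiv_eq_fderiv] at e2
  have e3 : mfderiv 𝓘(ℝ, ℝ × Eu d) (𝓘(ℝ, ℝ).prod (𝓡 d)) (N ∘ symmProd e) p =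
      mfderiv 𝓘(ℝ, ℝ × Eu d) (𝓘(ℝ, ℝ).prod (𝓡 d)) (symmProd e ∘ Ne) p :=
    Filter.EventuallyEq.mfderiv_eq hloc
  have k1 : modelDeriv N (symmProd e p) (X.1, modelDInv e p.2 X.2) = _ :=
    congrArg (modelDeriv N (symmProd e p)) (mfderiv_symmProd he hp X).symm
  refine k1.trans (Eq.trans ?_ (mfderiv_symmProd he hNp _))
  exact (DFunLike.congr_fun e1 X).symm.trans ((DFunLike.congr_fun e3 X).trans
    (DFunLike.congr_fun e2 X))

/-- `N` is given by `Ne` in the chart `e`, over the open set `U`. -/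
structure IsRepresentedBy (N : ℝ × S → ℝ × S) (e : Chart d S) (U : Set (Eu d))
    (Ne : ℝ × Eu d → ℝ × Eu d) : Prop where
  mem : e ∈ atlas (EuclideanSpace ℝ (Fin d)) S
  isOpen : IsOpen U
  subset : U ⊆ e.target
  eq : ∀ t, 0 ≤ t → ∀ u ∈ U, N (t, e.symm u) = symmProd e (Ne (t, u))
  mdiff : ContMDiffOn (𝓘(ℝ, ℝ).prod (𝓡 d)) (𝓘(ℝ, ℝ).prod (𝓡 d)) ∞ N (Ioi 0 ×ˢ univ)

theorem IsRepresentedBy.endBilin_mfderiv (h : IsRepresentedBy N e U Ne) {t : ℝ} (ht : 0 < t)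
    {u : Eu d} (hu : u ∈ U) (hNe : ContDiff ℝ ∞ Ne) (hNp : (Ne (t, u)).2 ∈ e.target)
    (X Y : ℝ × Eu d) :
    endBilin w a b g (N (t, e.symm u)) (modelDeriv N (t, e.symm u) (X.1, modelDInv e u X.2))
      (modelDeriv N (t, e.symm u) (Y.1, modelDInv e u Y.2)) =
      endForm w a b g e (Ne (t, u)) (fderiv ℝ Ne (t, u) X) (fderiv ℝ Ne (t, u) Y) := by
  have hN : MDifferentiableAt (𝓘(ℝ, ℝ).prod (𝓡 d)) (𝓘(ℝ, ℝ).prod (𝓡 d)) N (symmProd e (t, u)) :=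
    (h.mdiff.contMDiffAt ((isOpen_Ioi.prod isOpen_univ).mem_nhds
      (show symmProd e (t, u) ∈ Ioi (0 : ℝ) ×ˢ univ from ⟨ht, mem_univ _⟩))).mdifferentiableAt
      (by simp)
  have hloc : ∀ᶠ q : ℝ × Eu d in 𝓝 (t, u), N (symmProd e q) = symmProd e (Ne q) := by
    filter_upwards [(isOpen_Ioi.prod h.isOpen).mem_nhds (show (t, u) ∈ Ioi (0 : ℝ) ×ˢ U from
      ⟨ht, hu⟩)] with q hq
    exact h.eq q.1 (le_of_lt hq.1) q.2 hq.2
  have key := modelDeriv_apply h.mem (p := (t, u)) (h.subset hu) hNp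
    (hNe.differentiable (by simp) _) hN hloc
  rw [h.eq t ht.le u hu, endForm_eq_endBilin, ← key X, ← key Y]
  rfl

theorem IsRepresentedBy.inducedMetric_inChart (h : IsRepresentedBy N e U Ne) {t : ℝ} (ht : 0 < t)
    {u : Eu d} (hu : u ∈ U) (hNe : ContDiff ℝ ∞ Ne) (hNp : (Ne (t, u)).2 ∈ e.target) :
    bilinInChart e (inducedMetric w a b g N) t u =
      inducedForm (endForm w a b g e) Ne (t, u) := by
  ext z z'
  have := h.endBilin_mfderiv (w := w) (a := a) (b := b) (g := g) ht hu hNe hNp (0, z) (0, z')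
  exact this

/-- In normal coordinates the metric splits, by the unit speed of the geodesics and by Gauss's
lemma. -/
theorem IsRepresentedBy.pullbackEndMetric_eq {gb : Eu d → (Eu d →L[ℝ] Eu d →L[ℝ] ℝ)}
    (h : IsRepresentedBy N e U Ne) (hE : IsEndInChart R τ w a b g e gb) {V : Set (Eu d)}
    (hNe : IsChartFlow (endForm w a b g e) R r δ e.target V Ne) (hUV : U ⊆ V) {t : ℝ}
    (ht : 0 < t) {u : Eu d} (hu : u ∈ U) (X Y : ℝ × TangentSpace (𝓡 d) (e.symm u)) :
    pullbackEndMetric w a b g N t (e.symm u) X Y =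
      X.1 * Y.1 + inducedMetric w a b g N t (e.symm u) X.2 Y.2 := by
  have ht1 : -1 < t := by linarith
  have hmem := hNe.mem t ht1 u (hUV hu)
  have hi : u ∈ interior V := interior_maximal hUV h.isOpen hu
  obtain ⟨x, X₂⟩ := X
  obtain ⟨y, Y₂⟩ := Y
  obtain ⟨z, rfl⟩ := exists_modelDInv_eq h.mem (h.subset hu) X₂
  obtain ⟨z', rfl⟩ := exists_modelDInv_eq h.mem (h.subset hu) Y₂
  have k1 := h.endBilin_mfderiv (w := w) (a := a) (b := b) (g := g) ht hu hNe.smooth hmem.2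
    (x, z) (y, z')
  have k2 := h.endBilin_mfderiv (w := w) (a := a) (b := b) (g := g) ht hu hNe.smooth hmem.2
    (0, z) (0, z')
  have k3 : pullbackEndMetric w a b g N t (e.symm u) (x, modelDInv e u z)
      (y, modelDInv e u z') = _ := (endBilin_apply _ _ _).symm.trans k1
  have k4 : inducedMetric w a b g N t (e.symm u) (modelDInv e u z)
      (modelDInv e u z') = _ := k2
  refine k3.trans ?_
  change _ = x * y + inducedMetric w a b g N t (e.symm u) (modelDInv e u z)
      (modelDInv e u z')
  rw [k4]
  have g1 := IsChartFlow.gauss hE hNe ht1 hi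
  have g2 := hNe.unit t ht1 u (hUV hu)
  have g3 : ∀ z, endForm w a b g e (Ne (t, u)) (dth Ne (t, u) z) (dx Ne (t, u)) = 0 := fun z => by
    rw [hE.symm hmem]
    exact g1 z
  have g1' : ∀ z, endForm w a b g e (Ne (t, u)) (dx Ne (t, u)) (dth Ne (t, u) z) = 0 := g1
  simp only [fderiv_eq_dx_dth, map_add, map_smul, zero_smul, zero_add,
    add_apply, smul_apply, g1', g2, g3, smul_eq_mul]
  ring

end

end RadialEnd

namespace RadialEnd

/-! ### Families of bilinear forms in overlapping charts -/

section

variable {E F G : Type} [NormedAddCommGroup E] [NormedSpace ℝ E] [NormedAddCommGroup F]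
  [NormedSpace ℝ F] [NormedAddCommGroup G] [NormedSpace ℝ G]

set_option maxSynthPendingDepth 3 in
theorem contDiff_flip : ContDiff ℝ ∞ (fun B : E →L[ℝ] F →L[ℝ] G => B.flip) := by
  obtain ⟨L, hL⟩ : ∃ L : (E →L[ℝ] F →L[ℝ] G) →L[ℝ] (F →L[ℝ] E →L[ℝ] G), ∀ B, L B = B.flip :=
    ⟨(ContinuousLinearMap.flipₗᵢ ℝ E F G).toContinuousLinearEquiv.toContinuousLinearMap,
      fun _ => rfl⟩
  simp only [← hL]
  exact ContinuousLinearMap.contDiff (𝕜 := ℝ) (E := E →L[ℝ] F →L[ℝ] G)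
    (F := F →L[ℝ] E →L[ℝ] G) L

theorem contDiffOn_bilinearComp {s : Set E} {A : E → (F →L[ℝ] F →L[ℝ] ℝ)} {T : E → (G →L[ℝ] F)}
    (hA : ContDiffOn ℝ ∞ A s) (hT : ContDiffOn ℝ ∞ T s) :
    ContDiffOn ℝ ∞ (fun p => (A p).bilinearComp (T p) (T p)) s := by
  exact contDiff_flip.comp_contDiffOn ((contDiff_flip.comp_contDiffOn (hA.clm_comp hT)).clm_comp hT)

end

section

variable {d : ℕ} {S : Type*} [TopologicalSpace S] [ChartedSpace (EuclideanSpace ℝ (Fin d)) S]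
  [IsManifold (𝓡 d) ∞ S] {e e' : Chart d S} {U : Set (Eu d)} {k : BilinFamily d S} {M m : ℝ}

/-- The part of the chart `e'` which the chart `e` maps to `U`. -/
def overlapOn (e' e : Chart d S) (U : Set (Eu d)) : Set (Eu d) :=
  overlap e' e ∩ transition e' e ⁻¹' U

theorem isOpen_overlapOn (he' : e' ∈ atlas (EuclideanSpace ℝ (Fin d)) S)
    (he : e ∈ atlas (EuclideanSpace ℝ (Fin d)) S) (hU : IsOpen U) : IsOpen (overlapOn e' e U) :=
  (contDiffOn_transition he' he).continuousOn.isOpen_inter_preimage isOpen_overlap hU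

theorem contDiffOn_fderiv_transition (he' : e' ∈ atlas (EuclideanSpace ℝ (Fin d)) S)
    (he : e ∈ atlas (EuclideanSpace ℝ (Fin d)) S) :
    ContDiffOn ℝ ∞ (fderiv ℝ (transition e' e)) (overlap e' e) :=
  (contDiffOn_transition he' he).fderiv_of_isOpen isOpen_overlap le_rfl

theorem contDiffOn_bilinInChart_transition (he' : e' ∈ atlas (EuclideanSpace ℝ (Fin d)) S)
    (he : e ∈ atlas (EuclideanSpace ℝ (Fin d)) S)
    (hk : ContDiffOn ℝ ∞ (fun p : ℝ × Eu d => bilinInChart e k p.1 p.2) (Ioi M ×ˢ U)) :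
    ContDiffOn ℝ ∞ (fun p : ℝ × Eu d => bilinInChart e' k p.1 p.2)
      (Ioi M ×ˢ overlapOn e' e U) := by
  have hsnd : MapsTo (Prod.snd : ℝ × Eu d → Eu d) (Ioi M ×ˢ overlapOn e' e U) (overlap e' e) :=
    fun p hp => hp.2.1
  have h1 : ContDiffOn ℝ ∞ (fun p : ℝ × Eu d => (p.1, transition e' e p.2))
      (Ioi M ×ˢ overlapOn e' e U) :=
    contDiffOn_fst.prodMk ((contDiffOn_transition he' he).comp contDiffOn_snd hsnd)
  refine (contDiffOn_bilinearComp (hk.comp h1 fun p hp => ⟨hp.1, hp.2.2⟩)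
    ((contDiffOn_fderiv_transition he' he).comp contDiffOn_snd hsnd)).congr fun p hp => ?_
  exact bilinInChart_transition he' he k p.1 hp.2.1

theorem sym_bilinInChart_transition (he' : e' ∈ atlas (EuclideanSpace ℝ (Fin d)) S)
    (he : e ∈ atlas (EuclideanSpace ℝ (Fin d)) S) (hU : IsOpen U)
    (hk : Sym M U m (fun p : ℝ × Eu d => bilinInChart e k p.1 p.2)) :
    Sym M (overlapOn e' e U) m (fun p : ℝ × Eu d => bilinInChart e' k p.1 p.2) := by
  have hO := isOpen_overlapOn he' he hU
  have h1 : Sym M (overlapOn e' e U) m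
      (fun p : ℝ × Eu d => bilinInChart e k p.1 (transition e' e p.2)) := by
    refine hk.comp hU hO (ζ := fun p : ℝ × Eu d => transition e' e p.2)
      (sym_of_independent hO ((contDiffOn_transition he' he).mono inter_subset_left))
      fun K hK hKV => ?_
    exact ⟨transition e' e '' K, hK.image_of_continuousOn
      ((contDiffOn_transition he' he).continuousOn.mono (hKV.trans inter_subset_left)),
      image_subset_iff.2 fun u hu => (hKV hu).2, fun x _ u hu => mem_image_of_mem _ hu⟩
  have h2 : Sym M (overlapOn e' e U) 0 (fun p : ℝ × Eu d => fderiv ℝ (transition e' e) p.2) :=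
    sym_of_independent hO ((contDiffOn_fderiv_transition he' he).mono inter_subset_left)
  refine (h1.bilinearComp_le hO h2 h2 (m'' := m) (by linarith)).congr hO fun p hp => ?_
  exact bilinInChart_transition he' he k p.1 hp.2.1

/-- A family of forms is smooth in all charts if it is so in some chart near each point. -/
theorem contDiffOn_bilinInChart_of_local
    (h : ∀ y : S, ∃ e ∈ atlas (EuclideanSpace ℝ (Fin d)) S, ∃ U, IsOpen U ∧ y ∈ e.source ∧
      e y ∈ U ∧ ContDiffOn ℝ ∞ (fun p : ℝ × Eu d => bilinInChart e k p.1 p.2) (Ioi M ×ˢ U))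
    (he' : e' ∈ atlas (EuclideanSpace ℝ (Fin d)) S) :
    ContDiffOn ℝ ∞ (fun p : ℝ × Eu d => bilinInChart e' k p.1 p.2) (Ioi M ×ˢ e'.target) := by
  rintro ⟨t, u⟩ ⟨ht, hu⟩
  obtain ⟨e, he, U, hU, hy, hyU, hs⟩ := h (e'.symm u)
  exact (contDiffAt_of_mem (isOpen_overlapOn he' he hU)
    (contDiffOn_bilinInChart_transition he' he hs) ht ⟨⟨hu, hy⟩, hyU⟩).contDiffWithinAt

/-- A family of forms is a symbol if it is one in some chart near each point. -/
theorem bilinIsSymbol_of_local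
    (h : ∀ y : S, ∃ e ∈ atlas (EuclideanSpace ℝ (Fin d)) S, ∃ U, IsOpen U ∧ y ∈ e.source ∧
      e y ∈ U ∧ Sym M U m (fun p : ℝ × Eu d => bilinInChart e k p.1 p.2)) :
    BilinIsSymbol m M k := by
  intro e' he'
  rw [isSymbolOn_iff e'.open_target]
  refine Sym.of_local fun u hu => ?_
  obtain ⟨e, he, U, hU, hy, hyU, hs⟩ := h (e'.symm u)
  exact ⟨_, isOpen_overlapOn he' he hU, ⟨⟨hu, hy⟩, hyU⟩, sym_bilinInChart_transition he' he hU hs⟩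

/-- The limit metric in a chart. -/
theorem conformalPullback_inChart (he : e ∈ atlas (EuclideanSpace ℝ (Fin d)) S)
    (gbar : ∀ y : S, TangentSpace (𝓡 d) y →L[ℝ] TangentSpace (𝓡 d) y →L[ℝ] ℝ) {κ t : ℝ}
    {φ : S → ℝ} {Ω : S → S} (hΩ : ContMDiff (𝓡 d) (𝓡 d) ∞ Ω) {Ninf : Eu d → ℝ × Eu d}
    (hs : ContDiff ℝ ∞ Ninf) (hU : IsOpen U) (hUe : U ⊆ e.target)
    (hloc : ∀ u ∈ U, Ω (e.symm u) = e.symm (Ninf u).2 ∧ φ (e.symm u) = (Ninf u).1)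
    {u : Eu d} (hu : u ∈ U) (hNu : (Ninf u).2 ∈ e.target) :
    bilinInChart e (fun _ y => conformalPullback κ φ Ω gbar y) t u =
      limitForm κ (fun v => bilinInChart e (fun _ y => gbar y) 0 v) Ninf u := by
  obtain ⟨G, hG⟩ : ∃ G : S → (Eu d →L[ℝ] Eu d →L[ℝ] ℝ), ∀ y, G y = gbar y := ⟨_, fun _ => rfl⟩
  obtain ⟨D, hD⟩ : ∃ D : Eu d →L[ℝ] Eu d, D = mfderiv (𝓡 d) (𝓡 d) Ω (e.symm u) := ⟨_, rfl⟩
  set T : Eu d →L[ℝ] Eu d := (ContinuousLinearMap.snd ℝ ℝ (Eu d)).comp (fderiv ℝ Ninf u) with hT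
  have hT' : HasFDerivAt (fun v => (Ninf v).2) T u :=
    (ContinuousLinearMap.snd ℝ ℝ (Eu d)).hasFDerivAt.comp u
      (hs.differentiable (by simp) u).hasFDerivAt
  have d1 : MDifferentiableAt (𝓡 d) (𝓡 d) (fun v => (Ninf v).2) u :=
    hT'.differentiableAt.mdifferentiableAt
  have e1 := mfderiv_comp u (hΩ.mdifferentiable (by simp) (e.symm u))
    (mdifferentiableAt_chart_symm he (hUe hu))
  have e2 := mfderiv_comp u (mdifferentiableAt_chart_symm he hNu) d1
  rw [mfderiv_eq_fderiv, hT'.fderiv] at e2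
  have e3 : mfderiv (𝓡 d) (𝓡 d) (Ω ∘ e.symm) u =
      mfderiv (𝓡 d) (𝓡 d) (e.symm ∘ fun v => (Ninf v).2) u := by
    refine Filter.EventuallyEq.mfderiv_eq ?_
    filter_upwards [hU.mem_nhds hu] with v hv using (hloc v hv).1
  have key : ∀ z, D (modelDInv e u z) = modelDInv e (Ninf u).2 (T z) := fun z => by
    rw [hD]
    exact (DFunLike.congr_fun e1 z).symm.trans ((DFunLike.congr_fun e3 z).trans
      (DFunLike.congr_fun e2 z))
  ext z z'
  have k1 : bilinInChart e (fun _ y => conformalPullback κ φ Ω gbar y) t u z z' =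
      Real.exp (-2 * κ * φ (e.symm u)) *
        G (Ω (e.symm u)) (D (modelDInv e u z)) (D (modelDInv e u z')) := by
    rw [hG, hD]
    rfl
  have k2 : limitForm κ (fun v => bilinInChart e (fun _ y => gbar y) 0 v) Ninf u z z' =
      Real.exp (-2 * κ * (Ninf u).1) *
        G (e.symm (Ninf u).2) (modelDInv e (Ninf u).2 (T z)) (modelDInv e (Ninf u).2 (T z')) := by
    rw [hG]
    rfl
  rw [k1, k2, key, key, (hloc u hu).1, (hloc u hu).2]

end

section

variable {E : Type} [NormedAddCommGroup E] [NormedSpace ℝ E] [FiniteDimensional ℝ E]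
  {R τ κ r δ : ℝ} {V U U' : Set E} {w : ℝ → ℝ} {a : ℝ × E → ℝ} {b : ℝ × E → (E →L[ℝ] ℝ)}
  {g : ℝ × E → (E →L[ℝ] E →L[ℝ] ℝ)} {gb : E → (E →L[ℝ] E →L[ℝ] ℝ)}
  {N : ℝ × E → ℝ × E} {Ninf : E → ℝ × E}

theorem IsChartFlow.contDiffOn_inducedForm (h : IsChartEnd R τ V w a b g gb)
    (hN : IsChartFlow (metricForm w a b g) R r δ V U N) (hU : U' ⊆ U) :
    ContDiffOn ℝ ∞ (inducedForm (metricForm w a b g) N) (Ioi (-1) ×ˢ U') :=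
  contDiffOn_bilinearComp (h.contDiffOn_metricForm.comp hN.smooth.contDiffOn
    fun p hp => hN.mem p.1 hp.1 p.2 (hU hp.2))
    ((hN.smooth.fderiv_right (m := ∞) le_rfl).clm_comp contDiff_const).contDiffOn

set_option maxSynthPendingDepth 3 in
omit [FiniteDimensional ℝ E] in
theorem contDiffOn_limitForm (h : ContDiffOn ℝ ∞ gb V) (hN : ContDiff ℝ ∞ Ninf)
    (hU : ∀ u ∈ U, (Ninf u).2 ∈ V) : ContDiffOn ℝ ∞ (limitForm κ gb Ninf) U := by
  have h1 : ContDiffOn ℝ ∞ (fun u => Real.exp (-2 * κ * (Ninf u).1)) U :=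
    (Real.contDiff_exp.comp (contDiff_const.mul (contDiff_fst.comp hN))).contDiffOn
  exact ContDiffOn.smul h1 (contDiffOn_bilinearComp
    (h.comp (contDiff_snd.comp hN).contDiffOn hU)
    (contDiff_const.clm_comp (hN.fderiv_right (m := ∞) le_rfl)).contDiffOn)

omit [FiniteDimensional ℝ E] in
/-- The induced metrics are positive definite. -/
theorem IsChartFlow.inducedForm_pos (h : IsChartEnd R τ V w a b g gb)
    (hN : IsChartFlow (metricForm w a b g) R r δ V U N) (hδ0 : 0 ≤ δ) (hδ : δ < 1) {t : ℝ}
    (ht : -1 < t) {u : E} (hu : u ∈ U) {z : E} (hz : z ≠ 0) :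
    0 < inducedForm (metricForm w a b g) N (t, u) z z := by
  have hm := hN.mem t ht u hu
  have h1 : dth N (t, u) z ≠ 0 := by
    intro h0
    have h2 := hN.norm_dth_sub_le hδ0 (t, u) z
    rw [h0, zero_sub, norm_neg, Prod.norm_mk, norm_zero, max_eq_right (norm_nonneg _)] at h2
    have h3 := norm_pos_iff.2 hz
    nlinarith
  have h4 : inducedForm (metricForm w a b g) N (t, u) z z =
      chartMetric w a b g (N (t, u)) (dth N (t, u) z) (dth N (t, u) z) := metricForm_apply _ _ _
  rw [h4]
  exact h.pos _ hm.1 _ hm.2 _ h1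

end

end RadialEnd

namespace RadialEnd

/-! ### The normal form of the metric -/

section

variable {d : ℕ} {S : Type*} [TopologicalSpace S] [ChartedSpace (EuclideanSpace ℝ (Fin d)) S]
  [IsManifold (𝓡 d) ∞ S]
  {R τ ε κ r δ M : ℝ} {w : ℝ → ℝ} {a : FunFamily S} {b : FormFamily d S} {g : BilinFamily d S}
  {N : ℝ × S → ℝ × S} {ι : Type*} {e : ι → Chart d S} {u₀ : ι → Eu d} {σ : ι → ℝ}
  {Ne : ι → ℝ × Eu d → ℝ × Eu d} {Ninf : ι → Eu d → ℝ × Eu d}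
  {gb : ι → Eu d → (Eu d →L[ℝ] Eu d →L[ℝ] ℝ)}

set_option maxSynthPendingDepth 3 in
omit [IsManifold (𝓡 d) ∞ S] in
theorem IsSmoothMetricFamily.smul {k : BilinFamily d S} (hk : IsSmoothMetricFamily M k) {M' : ℝ}
    (hM : M ≤ M') {f : ℝ → ℝ} (hf : ContDiffOn ℝ ∞ f (Ioi M')) (hpos : ∀ t, M' < t → 0 < f t) :
    IsSmoothMetricFamily M' (fun t y => f t • k t y) := by
  refine ⟨fun e he => ?_, fun t ht y u v => ?_, fun t ht y u hu => ?_⟩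
  · have h1 : ContDiffOn ℝ ∞ (fun p : ℝ × Eu d => f p.1) (Ioi M' ×ˢ e.target) :=
      hf.comp contDiffOn_fst fun p hp => hp.1
    exact ContDiffOn.smul h1 ((hk.smooth e he).mono (prod_mono (Ioi_subset_Ioi hM) subset_rfl))
  · exact congrArg (f t * ·) (hk.symm t (hM.trans_lt ht) y u v)
  · exact mul_pos (hpos t ht) (hk.pos t (hM.trans_lt ht) y u hu)

/-- The hypotheses under which the metric in normal coordinates is studied: in the charts of a
cover, the flow `N` is given by the flows `Ne i`. -/
structure IsCoveredFlow (R r δ : ℝ) (w : ℝ → ℝ) (a : FunFamily S) (b : FormFamily d S)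
    (g : BilinFamily d S) (e : ι → Chart d S) (u₀ : ι → Eu d) (σ : ι → ℝ)
    (Ne : ι → ℝ × Eu d → ℝ × Eu d) (N : ℝ × S → ℝ × S) : Prop where
  cover : IsChartCover e u₀ σ δ
  nonneg : 0 ≤ δ
  le : δ ≤ 1 / 4
  flow i : IsChartFlow (endForm w a b g (e i)) R r δ (e i).target
    (Metric.closedBall (u₀ i) (σ i)) (Ne i)
  repr i : IsRepresentedBy N (e i) (Metric.ball (u₀ i) (σ i)) (Ne i)

theorem IsCoveredFlow.inChart (h : IsCoveredFlow R r δ w a b g e u₀ σ Ne N) {i : ι} {t : ℝ}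
    (ht : 0 < t) {u : Eu d} (hu : u ∈ Metric.ball (u₀ i) (σ i)) :
    bilinInChart (e i) (inducedMetric w a b g N) t u =
      inducedForm (endForm w a b g (e i)) (Ne i) (t, u) :=
  (h.repr i).inducedMetric_inChart ht hu (h.flow i).smooth
    ((h.flow i).mem t (by linarith) u (Metric.ball_subset_closedBall hu)).2

omit [IsManifold (𝓡 d) ∞ S] in
theorem IsCoveredFlow.exists_eq (h : IsCoveredFlow R r δ w a b g e u₀ σ Ne N) (y : S) :
    ∃ i, ∃ u ∈ Metric.ball (u₀ i) (σ i), y = (e i).symm u := by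
  obtain ⟨i, h1, h2⟩ := h.cover.cover y
  exact ⟨i, e i y, h.cover.mem_ball_of_quarter h2, ((e i).left_inv h1).symm⟩

theorem IsCoveredFlow.pullbackEndMetric_eq (h : IsCoveredFlow R r δ w a b g e u₀ σ Ne N)
    (hE : ∀ i, IsEndInChart R τ w a b g (e i) (gb i)) {t : ℝ} (ht : 0 < t) (y : S)
    (X Y : ℝ × TangentSpace (𝓡 d) y) :
    pullbackEndMetric w a b g N t y X Y = X.1 * Y.1 + inducedMetric w a b g N t y X.2 Y.2 := by
  obtain ⟨i, u, hu, rfl⟩ := h.exists_eq y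
  exact (h.repr i).pullbackEndMetric_eq (hE i) (h.flow i) Metric.ball_subset_closedBall ht hu X Y

theorem IsCoveredFlow.isSmoothMetricFamily (h : IsCoveredFlow R r δ w a b g e u₀ σ Ne N)
    (hE : ∀ i, IsEndInChart R τ w a b g (e i) (gb i)) :
    IsSmoothMetricFamily 0 (inducedMetric w a b g N) := by
  have hval : ∀ i, ∀ t, 0 < t → ∀ u ∈ Metric.ball (u₀ i) (σ i), ∀ z z' : Eu d,
      inducedMetric w a b g N t ((e i).symm u) (modelDInv (e i) u z) (modelDInv (e i) u z') =
        inducedForm (endForm w a b g (e i)) (Ne i) (t, u) z z' := by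
    intro i t ht u hu z z'
    rw [← h.inChart ht hu]
    rfl
  refine ⟨fun e' he' => ?_, fun t ht y X Y => ?_, fun t ht y X hX => ?_⟩
  · refine contDiffOn_bilinInChart_of_local (fun y => ?_) he'
    obtain ⟨i, h1, h2⟩ := h.cover.cover y
    refine ⟨e i, h.cover.mem i, _, Metric.isOpen_ball, h1, h.cover.mem_ball_of_quarter h2, ?_⟩
    refine ((IsChartFlow.contDiffOn_inducedForm (hE i) (h.flow i)
      Metric.ball_subset_closedBall).mono (prod_mono (Ioi_subset_Ioi (by norm_num))
      subset_rfl)).congr fun p hp => ?_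
    exact h.inChart hp.1 hp.2
  · obtain ⟨i, u, hu, rfl⟩ := h.exists_eq y
    have hue := h.cover.mem_target hu
    obtain ⟨z, rfl⟩ := exists_modelDInv_eq (h.cover.mem i) hue X
    obtain ⟨z', rfl⟩ := exists_modelDInv_eq (h.cover.mem i) hue Y
    refine (hval i t ht u hu z z').trans (Eq.trans ?_ (hval i t ht u hu z' z).symm)
    exact (hE i).symm ((h.flow i).mem t (by linarith) u (Metric.ball_subset_closedBall hu)) _ _
  · obtain ⟨i, u, hu, rfl⟩ := h.exists_eq y
    have hue := h.cover.mem_target hu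
    obtain ⟨z, rfl⟩ := exists_modelDInv_eq (h.cover.mem i) hue X
    have hz : z ≠ 0 := by
      rintro rfl
      exact hX (map_zero (modelDInv (e i) u))
    refine lt_of_lt_of_eq ?_ (hval i t ht u hu z z).symm
    exact IsChartFlow.inducedForm_pos (hE i) (h.flow i) h.nonneg (by linarith [h.le])
      (by linarith) (Metric.ball_subset_closedBall hu) hz

/-- The rescaled metrics converge to the limit metric as symbols. The asymptotics hold for large
`t`; down to `max R 0`, it is used that the flow and the induced metrics are smooth up to `t = -1`
in the charts, and that `w²` is a symbol on `(max R 0, ∞)`. -/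
theorem IsCoveredFlow.bilinIsSymbol (h : IsCoveredFlow R r δ w a b g e u₀ σ Ne N)
    (gbar : ∀ y : S, TangentSpace (𝓡 d) y →L[ℝ] TangentSpace (𝓡 d) y →L[ℝ] ℝ)
    (hE : ∀ i, IsEndInChart R τ w a b g (e i) (fun u => bilinInChart (e i) (fun _ y => gbar y) 0 u))
    (hτ : 0 < τ) (hε : 0 < ε) {lam : ℝ} (hw : IsSymbolOnLine (-lam) R w)
    (hκ : IsSymbolOnLine (-ε) (max R 1) (fun x => deriv w x / w x - κ))
    (hsm : ∀ i, ContDiff ℝ ∞ (Ninf i))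
    (hs : ∀ i, Sym M univ (-τ) (fun p : ℝ × Eu d => Ne i p - (p.1, 0) - Ninf i p.2))
    {Ω : S → S} (hΩ : ContMDiff (𝓡 d) (𝓡 d) ∞ Ω) {φ : S → ℝ}
    (hloc : ∀ i, ∀ u ∈ Metric.ball (u₀ i) (σ i), Ω ((e i).symm u) = (e i).symm (Ninf i u).2 ∧
        φ ((e i).symm u) = (Ninf i u).1) :
    BilinIsSymbol (-(min τ ε)) (max R 0) (fun t y => w t ^ 2 • inducedMetric w a b g N t y -
      conformalPullback κ φ Ω gbar y) := by
  refine bilinIsSymbol_of_local fun y => ?_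
  obtain ⟨i, h1, h2⟩ := h.cover.cover y
  refine ⟨e i, h.cover.mem i, _, Metric.isOpen_ball, h1, h.cover.mem_ball_of_quarter h2, ?_⟩
  have hU : Metric.ball (u₀ i) (σ i) ⊆ (e i).target := fun u hu => h.cover.mem_target hu
  have hNu : ∀ u ∈ Metric.ball (u₀ i) (σ i), (Ninf i u).2 ∈ (e i).target := fun u hu =>
    h.cover.mem_target_of_near hu
      ((norm_snd_le (Ninf i u - (r, u))).trans ((h.flow i).norm_limit_sub_le hτ (hs i) u))
  obtain ⟨M', hM'⟩ := IsChartFlow.sym_inducedForm (hE i) hτ hε (h.flow i) (h.cover.pos i)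
    ((Metric.closedBall_subset_closedBall (by linarith [h.cover.pos i])).trans (h.cover.target i))
    (by linarith [h.cover.delta_le i, h.cover.pos i]) (by linarith [h.le]) (hsm i) (hs i) hκ hw.1
  set l : ℝ × Eu d → (Eu d →L[ℝ] Eu d →L[ℝ] ℝ) := fun p =>
    limitForm κ (fun u => bilinInChart (e i) (fun _ y => gbar y) 0 u) (Ninf i) p.2 with hl
  have hls : ContDiffOn ℝ ∞ l (Ioi (-1) ×ˢ Metric.ball (u₀ i) (σ i)) :=
    (contDiffOn_limitForm (IsChartEnd.gb_smooth (hE i)) (hsm i) hNu).comp contDiffOn_snd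
      fun p hp => hp.2
  have hws : Sym (max R 0) (Metric.ball (u₀ i) (σ i)) (-lam + -lam)
      (fun p : ℝ × Eu d => w p.1 * w p.1) :=
    ((hw.mono (le_max_left R 0)).sym Metric.isOpen_ball).smul_le Metric.isOpen_ball
      ((hw.mono (le_max_left R 0)).sym Metric.isOpen_ball) le_rfl
  have hsum : Sym M' (Metric.ball (u₀ i) (σ i)) (-(min τ ε)) (fun p : ℝ × Eu d =>
      (w p.1 * w p.1) • inducedForm (endForm w a b g (e i)) (Ne i) p + -l p) :=
    hM'.congr Metric.isOpen_ball fun p _ => by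
      change _ = w p.1 ^ 2 • inducedForm (endForm w a b g (e i)) (Ne i) p - l p
      rw [sq]
      exact (sub_eq_add_neg _ (l p)).symm
  refine (Sym.smul_add_of_tail Metric.isOpen_ball (M₀ := -1)
    (by linarith [le_max_right R 0]) hws
    (IsChartFlow.contDiffOn_inducedForm (hE i) (h.flow i) Metric.ball_subset_closedBall)
    hls.neg hsum).congr Metric.isOpen_ball ?_
  rintro ⟨t, u⟩ ⟨ht, hu⟩
  have ht0 : 0 < t := (le_max_right R 0).trans_lt ht
  have k1 := h.inChart ht0 hu
  have k2 := conformalPullback_inChart (κ := κ) (t := t) (h.cover.mem i) gbar hΩ (hsm i)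
    Metric.isOpen_ball hU (hloc i) hu (hNu u hu)
  ext z z'
  have k3 : bilinInChart (e i) (fun t y => w t ^ 2 • inducedMetric w a b g N t y -
      conformalPullback κ φ Ω gbar y) t u z z' =
      w t ^ 2 * bilinInChart (e i) (inducedMetric w a b g N) t u z z' -
        bilinInChart (e i) (fun _ y => conformalPullback κ φ Ω gbar y) t u z z' := rfl
  have k4 : ((w t * w t) • inducedForm (endForm w a b g (e i)) (Ne i) (t, u) + -l (t, u)) z z' =
      w t * w t * inducedForm (endForm w a b g (e i)) (Ne i) (t, u) z z' + - l (t, u) z z' := rfl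
  refine k3.trans (Eq.trans ?_ k4.symm)
  rw [k1, k2, sq, sub_eq_add_neg]

end

end RadialEnd

theorem theorem1 (d : ℕ) (hd : 1 ≤ d) {S : Type*} [TopologicalSpace S] [T2Space S]
    [CompactSpace S] [ChartedSpace (EuclideanSpace ℝ (Fin d)) S] [IsManifold (𝓡 d) ∞ S]
    (R : ℝ) (w : ℝ → ℝ) (a : FunFamily S) (b : FormFamily d S) (g : BilinFamily d S)
    (hG : IsEndMetric R w a b g)
    (gbar : Bundle.ContMDiffRiemannianMetric (𝓡 d) ∞ (EuclideanSpace ℝ (Fin d))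
      (TangentSpace (𝓡 d) : S → Type))
    (lam ε μ ν τ : ℝ) (hlam_pos : 0 < lam) (hε : 0 < ε) (hτ : 0 < τ)
    (hw : IsSymbolOnLine (-lam) R w)
    (hw' : IsSymbolOnLine (-1 - ε) R (deriv (fun x => deriv w x / w x)))
    (ha : FunIsSymbol (d := d) (-μ) R (fun x y => a x y - 1))
    (hb : FormIsSymbol (-ν) R b)
    (hg : BilinIsSymbol (-τ) R (fun x y => g x y - gbar.inner y))
    (hμ : 1 + τ ≤ μ) (hν : (1 + τ) / 2 ≤ ν) (hlam : (1 + τ) / 2 ≤ lam) :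
    ∃ κ : ℝ, κ ≤ 0 ∧ Tendsto (fun x => deriv w x / w x) atTop (𝓝 κ) ∧
      ∃ r₀ : ℝ, R < r₀ ∧ ∀ r, r₀ ≤ r →
        (∃ N : ℝ × S → ℝ × S, IsOutgoingNormalFlow R w a b g r N) ∧
        ∀ N : ℝ × S → ℝ × S, IsOutgoingNormalFlow R w a b g r N →
          IsHomeoBetween N (Ici 0 ×ˢ univ) (Ici r ×ˢ univ) ∧
          IsDiffeoBetween d N (Ioi 0 ×ˢ univ) (Ioi r ×ˢ univ) ∧
          ∃ (Ω : S ≃ₘ^∞⟮𝓡 d, 𝓡 d⟯ S) (φ : S → ℝ) (k h : BilinFamily d S),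
            ContMDiff (𝓡 d) 𝓘(ℝ, ℝ) ∞ φ ∧
            IsSmoothMetricFamily 0 k ∧
            (∀ t, 0 < t → ∀ (y : S) (X Y : ℝ × TangentSpace (𝓡 d) y),
              pullbackEndMetric w a b g N t y X Y = X.1 * Y.1 + k t y X.2 Y.2) ∧
            IsSmoothMetricFamily (max R 0) h ∧
            (∀ t, max R 0 < t → ∀ y : S, k t y = (w t ^ 2)⁻¹ • h t y) ∧
            BilinIsSymbol (-(min τ ε)) (max R 0)
              (fun t y => h t y - conformalPullback κ φ Ω gbar.inner y) := by
  obtain ⟨κ, hlim, hκ⟩ := exists_limit_of_deriv_symbol hε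
    (((contDiffOn_infty_iff_deriv_of_isOpen isOpen_Ioi).1 hG.w_smooth).2.div hG.w_smooth
      fun x hx => (hG.w_pos x hx).ne') hw'
  refine ⟨κ, ?_, hlim, ?_⟩
  · exact nonpos_of_tendsto_logDeriv hG.w_pos (hG.w_smooth.differentiableOn (by simp))
      (tendsto_of_sym hlam_pos (hw.sym (E := ℝ) isOpen_univ) 0) hlim
  have hE := fun (e : Chart d S) (he : e ∈ atlas (EuclideanSpace ℝ (Fin d)) S) =>
    isEndInChart hG gbar hw ha hb hg hμ hν hlam he
  have hE' : ∀ e ∈ atlas (EuclideanSpace ℝ (Fin d)) S, ∃ gb, IsEndInChart R τ w a b g e gb :=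
    fun e he => ⟨_, hE e he⟩
  obtain ⟨T, e, u₀, σ, δ, hδ0, hδ, hc⟩ := exists_isChartCover (d := d) (S := S)
  have hflow := fun i => IsChartEnd.exists_chartFlow (hE (e i) (hc.mem i)) hτ (u₀ := u₀ i)
    (ρ := 4 * σ i) (by linarith [hc.pos i]) (by linarith [hc.le i])
    (by rw [← mul_assoc]; norm_num; exact hc.target i) hδ0
  choose M₁ hM₁ hflow using hflow
  obtain ⟨B, hB⟩ := (finite_range M₁).bddAbove
  refine ⟨max B (R + 1), by linarith [le_max_right B (R + 1)], fun r hr => ?_⟩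
  have hMr : ∀ i, M₁ i ≤ r := fun i => (hB (mem_range_self i)).trans ((le_max_left _ _).trans hr)
  choose Ne Ninf₀ hNe hsm₀ hs₀ using fun i => hflow i r (hMr i)
  simp only [mul_div_cancel_left₀ _ (four_ne_zero (α := ℝ))] at hNe
  have hδ1 : δ < 1 := by linarith
  refine ⟨hc.exists_normalFlow hE' hNe hδ1, fun N hN => ?_⟩
  have hF : ∀ i t, 0 ≤ t → ∀ u ∈ Metric.ball (u₀ i) (σ i),
      N (t, (e i).symm u) = symmProd (e i) (Ne i (t, u)) := fun i t ht u hu =>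
    hN.eq_chartFlow hE' (hc.mem i) (hNe i) hδ1 (Metric.ball_subset_closedBall hu)
      (hc.mem_target hu) ht
  have hD := hc.isDiffeoBetween hNe hδ hF
  -- the limit of the flow in terms of the time `t = x - r`
  set Ninf : T → Eu d → ℝ × Eu d := fun i u => Ninf₀ i u + (r, 0) with hNinf
  have hsm : ∀ i, ContDiff ℝ ∞ (Ninf i) := fun i => (hsm₀ i).add contDiff_const
  have hs : ∀ i, Sym (1 - r + 1) univ (-τ)
      (fun p : ℝ × Eu d => Ne i p - (p.1, 0) - Ninf i p.2) := by
    intro i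
    refine ((hs₀ i).translate isOpen_univ r).congr isOpen_univ fun p _ => ?_
    have h1 : ((p.1 + r, 0) : ℝ × Eu d) = (p.1, 0) + (r, 0) := by simp
    simp only [hNinf, add_sub_cancel_right, Prod.mk.eta, h1]
    abel
  obtain ⟨Ω, φ, hφ, hloc⟩ := hc.exists_limit hNe hδ hτ hF hsm hs
  have hcov : IsCoveredFlow R r δ w a b g e u₀ σ Ne N :=
    { cover := hc, nonneg := hδ0.le, le := hδ, flow := hNe
      repr := fun i =>
        { mem := hc.mem i, isOpen := Metric.isOpen_ball, subset := fun u hu => hc.mem_target hu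
          eq := hF i, mdiff := by
            obtain ⟨-, -, -, -, h, -⟩ := hD
            exact h } }
  have hEi := fun i => hE (e i) (hc.mem i)
  have hk := hcov.isSmoothMetricFamily hEi
  have hw0 : ∀ t, max R 0 < t → 0 < w t := fun t ht => hG.w_pos t ((le_max_left R 0).trans_lt ht)
  refine ⟨hc.isHomeoBetween hNe hδ hF, hD, Ω, φ, inducedMetric w a b g N,
    fun t y => w t ^ 2 • inducedMetric w a b g N t y, hφ, hk,
    fun t ht y X Y => hcov.pullbackEndMetric_eq hEi ht y X Y,
    hk.smul (le_max_right R 0) ((hG.w_smooth.mono (Ioi_subset_Ioi (le_max_left R 0))).pow 2)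
      fun t ht => pow_pos (hw0 t ht) 2, fun t ht y => ?_,
    hcov.bilinIsSymbol (fun y => gbar.inner y) hEi hτ hε hw hκ hsm hs Ω.contMDiff hloc⟩
  exact (inv_smul_smul₀ (pow_pos (hw0 t ht) 2).ne' _).symm
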